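/- Let $s>2$ and let $\mu,\nu\ge 0$ satisfy either $\mu>0,\ \nu=0$ or $\mu=0,\ \nu>0$. Consider on $\mathbb R^2$ the $2\frac12$D electron MHD system for real-valued $a(x,y,t)$, $b(x,y,t)$, $$\partial_t a+a_yb_x-a_xb_y=\mu\Delta a,\qquad \partial_t b-a_y\Delta a_x+a_x\Delta a_y=\nu\Delta b .$$ By a solution on $[0,T)$ with initial data $(a_0,b_0)$ we mean a pair with $(a(t),b(t))\in H^{s+1}(\mathbb R^2)\times H^s(\mathbb R^2)$ for every $t\in[0,T)$, with $\|a(t)\|_{H^{s+1}}$ and $\|b(t)\|_{H^s}$ bounded on every compact subinterval of $[0,T)$, such that $a,b:[0,T)\to L^2(\mathbb R^2)$ are differentiable (one-sidedly at $t=0$), the two equations hold in $L^2(\mathbb R^2)$ for every $t\in[0,T)$, with weak spatial derivatives, and $(a(0),b(0))=(a_0,b_0)$. For all $A,B\ge 0$ there is $T>0$, depending only on $s,\mu,\nu,A,B$, such that for all $(a_0,b_0)\in H^{s+1}(\mathbb R^2)\times H^s(\mathbb R^2)$ with $\|a_0\|_{H^{s+1}}\le A$ and $\|b_0\|_{H^s}\le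 B$ there is exactly one solution $(a,b)$ on $[0,T)$ with initial data $(a_0,b_0)$. Moreover $a\in C([0,T);H^{s+1}(\mathbb R^2))$ and $b\in C([0,T);H^s(\mathbb R^2))$. -/

import Mathlib

open MeasureTheory TemperedDistribution
open scoped FourierTransform LineDeriv NNReal ENNReal SchwartzMap Topology

noncomputable section

namespace EMHD

/-- The plane `ℝ²` with its Euclidean norm; the coordinate `0` is `x`, the coordinate `1` is `y`. -/
abbrev Plane : Type := EuclideanSpace ℝ (Fin 2)

/-- Real-valued square integrable functions on the plane (modulo equality a.e.). -/
abbrev L2 : Type := Lp ℝ 2 (volume : Measure Plane)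

/-- A real-valued `L²` function regarded as a complex-valued one. -/
def toComplex (f : L2) : Lp ℂ 2 (volume : Measure Plane) :=
  Complex.ofRealCLM.compLp f

/-- The norm of the Sobolev space `H^σ(ℝ²)`, for `σ ≥ 0`, of a real-valued `L²` function:
the `L²` norm of `(1 + |ξ|²)^(σ/2) f̂(ξ)`, where `f̂` is the (Plancherel) Fourier transform.
It is `∞` when `f` is not in `H^σ`. (The Fourier kernel is `exp (-2πi x·ξ)`, so this is one of the
usual equivalent norms of `H^σ`.) -/
def sobolevNorm (σ : ℝ) (f : L2) : ℝ≥0∞ :=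
  eLpNorm (fun ξ : Plane => (((1 + ‖ξ‖ ^ 2) ^ (σ / 2) : ℝ) : ℂ) * (𝓕 (toComplex f)) ξ) 2 volume

/-- `f` belongs to `H^σ(ℝ²)`. -/
def MemH (σ : ℝ) (f : L2) : Prop := sobolevNorm σ f < ⊤

/-- `g ∈ L²` is the weak (distributional) partial derivative of `f ∈ L²` in the direction of the
`i`-th coordinate. -/
def IsWeakDeriv (i : Fin 2) (f g : L2) : Prop :=
  ∂_{(EuclideanSpace.single i (1 : ℝ) : Plane)} ((toComplex f : 𝓢'(Plane, ℂ))) =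
    (toComplex g : 𝓢'(Plane, ℂ))

open Classical in
/-- The weak partial derivative of `f` if it exists in `L²` (and `0` otherwise). -/
def weakDeriv (i : Fin 2) (f : L2) : L2 :=
  if h : ∃ g, IsWeakDeriv i f g then h.choose else 0

/-- `∂ₓ f` -/
abbrev dx (f : L2) : L2 := weakDeriv 0 f

/-- `∂_y f` -/
abbrev dy (f : L2) : L2 := weakDeriv 1 f

/-- `Δ f = f_xx + f_yy` -/
def lap (f : L2) : L2 := dx (dx f) + dy (dy f)

/-- `(a, b)` solves the `2½`D electron MHD system
`a_t + a_y b_x - a_x b_y = μ Δ a`, `b_t - a_y (Δ a)_x + a_x (Δ a)_y = ν Δ b`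
on `[0, T)` with initial data `(a₀, b₀)`, and `(a(t), b(t)) ∈ H^{s+1} × H^s`. For `s > 2` every
term of the system is then in `L²`, and the time derivative is the derivative of a curve in `L²`
(one-sided at `t = 0`). -/
structure IsSolution (s μ ν T : ℝ) (a₀ b₀ : L2) (a b : ℝ → L2) : Prop where
  memH : ∀ t ∈ Set.Ico 0 T, MemH (s + 1) (a t) ∧ MemH s (b t)
  /-- the Sobolev norms are bounded on compact subintervals of `[0, T)` -/
  locallyBounded : ∀ T' ∈ Set.Ico 0 T, ∃ M : ℝ≥0, ∀ t ∈ Set.Icc 0 T',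
    sobolevNorm (s + 1) (a t) ≤ M ∧ sobolevNorm s (b t) ≤ M
  initial : a 0 = a₀ ∧ b 0 = b₀
  eq_a : ∀ t ∈ Set.Ico 0 T, ∃ a' : L2, HasDerivWithinAt a a' (Set.Ico 0 T) t ∧
    ∀ᵐ p : Plane, a' p + dy (a t) p * dx (b t) p - dx (a t) p * dy (b t) p = μ * lap (a t) p
  eq_b : ∀ t ∈ Set.Ico 0 T, ∃ b' : L2, HasDerivWithinAt b b' (Set.Ico 0 T) t ∧
    ∀ᵐ p : Plane, b' p - dy (a t) p * dx (lap (a t)) p + dx (a t) p * dy (lap (a t)) p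
      = ν * lap (b t) p

/-- The curve `u` is continuous on `[0, T)` with respect to the `H^σ` norm. -/
def ContinuousInH (σ T : ℝ) (u : ℝ → L2) : Prop :=
  ∀ t₀ ∈ Set.Ico 0 T,
    Filter.Tendsto (fun t => sobolevNorm σ (u t - u t₀)) (𝓝[Set.Ico 0 T] t₀) (𝓝 0)


theorem toComplex_injective {f g : L2} (h : toComplex f = toComplex g) : f = g := by
  ext1
  have h1 := Complex.ofRealCLM.coeFn_compLp f
  have h2 := Complex.ofRealCLM.coeFn_compLp g
  have h3 : (toComplex f : Plane → ℂ) =ᵐ[volume] toComplex g := by rw [h]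
  filter_upwards [h1, h2, h3] with x h1 h2 h3
  have : Complex.ofRealCLM (f x) = Complex.ofRealCLM (g x) := by
    rw [← h1, ← h2]; exact h3
  simpa using this

theorem toDistribution_injective {f g : Lp ℂ 2 (volume : Measure Plane)}
    (h : (f : 𝓢'(Plane, ℂ)) = (g : 𝓢'(Plane, ℂ))) : f = g :=
  LinearMap.ker_eq_bot.mp
    (Lp.ker_toTemperedDistributionCLM_eq_bot (F := ℂ) (μ := (volume : Measure Plane)) (p := 2)) h

theorem IsWeakDeriv.weakDeriv_eq {i : Fin 2} {f g : L2} (h : IsWeakDeriv i f g) :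
    weakDeriv i f = g := by
  have hex : ∃ g, IsWeakDeriv i f g := ⟨g, h⟩
  rw [weakDeriv, dif_pos hex]
  exact toComplex_injective (toDistribution_injective (hex.choose_spec.symm.trans h))

/-- Membership agrees with Mathlib's Bessel potential spaces. -/
theorem memH_iff_memSobolev {σ : ℝ} (hσ : 0 ≤ σ) (f : L2) :
    MemH σ f ↔ MemSobolev σ 2 (toComplex f : 𝓢'(Plane, ℂ)) := by
  rw [memSobolev_iff_exists_smulLeftCLM_fourier, Lp.fourier_toTemperedDistribution_eq]
  set g := 𝓕 (toComplex f) with hg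
  have hw : MemLp (fun x : Plane => (((1 + ‖x‖ ^ 2) ^ (-σ / 2) : ℝ) : ℂ)) ⊤ := by
    refine memLp_top_of_bound (C := 1) ?_ ?_
    · have : (fun x : Plane ↦ (1 + ‖x‖ ^ 2) ^ (-σ / 2)).HasTemperateGrowth := by fun_prop
      exact (Complex.continuous_ofReal.comp this.1.continuous).aestronglyMeasurable
    · refine Filter.Eventually.of_forall fun x => ?_
      rw [Complex.norm_real, Real.norm_eq_abs, abs_eq_self.mpr (by positivity)]
      exact Real.rpow_le_one_of_one_le_of_nonpos (by simp) (by linarith)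
  have key : ∀ f' : Lp ℂ 2 (volume : Measure Plane),
      smulLeftCLM ℂ (fun x ↦ (((1 + ‖x‖ ^ 2) ^ (σ / 2) : ℝ) : ℂ)) (g : 𝓢'(Plane, ℂ)) = f' ↔
      g = hw.toLp • f' := by
    intro f'
    have e : ((hw.toLp • f' : Lp ℂ 2 (volume : Measure Plane)) : 𝓢'(Plane, ℂ)) =
        smulLeftCLM ℂ (fun x ↦ (((1 + ‖x‖ ^ 2) ^ (-σ / 2) : ℝ) : ℂ)) (f' : 𝓢'(Plane, ℂ)) :=
      Lp.toTemperedDistribution_smul_eq (by fun_prop) hw f'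
    have c : ∀ u : 𝓢'(Plane, ℂ), ∀ r t : ℝ, r + t = 0 →
        smulLeftCLM ℂ (fun x ↦ (((1 + ‖x‖ ^ 2) ^ r : ℝ) : ℂ))
          (smulLeftCLM ℂ (fun x ↦ (((1 + ‖x‖ ^ 2) ^ t : ℝ) : ℂ)) u) = u := by
      intro u r t hrt
      rw [smulLeftCLM_smulLeftCLM_apply (by fun_prop) (by fun_prop)]
      convert! (smulLeftCLM_const 1 u) using 1
      · congr
        ext x
        rw [Pi.mul_apply]
        norm_cast
        rw [← Real.rpow_add (by positivity), (by linarith : t + r = 0)]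
        simp
      · simp
    constructor
    · intro h
      apply toDistribution_injective
      rw [e, ← h, c _ _ _ (by ring)]
    · intro h
      rw [h, e, c _ _ _ (by ring)]
  have key2 : ∀ f' : Lp ℂ 2 (volume : Measure Plane), g = hw.toLp • f' ↔
      (fun ξ : Plane => (((1 + ‖ξ‖ ^ 2) ^ (σ / 2) : ℝ) : ℂ) * g ξ) =ᵐ[volume] f' := by
    intro f'
    have h1 : (hw.toLp • f' : Lp ℂ 2 (volume : Measure Plane)) =ᵐ[volume]
        fun x => (((1 + ‖x‖ ^ 2) ^ (-σ / 2) : ℝ) : ℂ) * f' x := by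
      filter_upwards [Lp.coeFn_lpSMul (r := 2) hw.toLp f', hw.coeFn_toLp] with x h1 h2
      rw [h1, Pi.smul_apply', h2, smul_eq_mul]
    have inv : ∀ x : Plane, (((1 + ‖x‖ ^ 2) ^ (σ / 2) : ℝ) : ℂ) *
        (((1 + ‖x‖ ^ 2) ^ (-σ / 2) : ℝ) : ℂ) = 1 := by
      intro x
      norm_cast
      rw [← Real.rpow_add (by positivity)]
      ring_nf
      simp
    constructor
    · intro h
      have h2 : g =ᵐ[volume] (hw.toLp • f' : Lp ℂ 2 (volume : Measure Plane)) := by rw [← h]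
      filter_upwards [h1, h2] with x h1 h2
      rw [h2, h1, ← mul_assoc, inv, one_mul]
    · intro h
      ext1
      filter_upwards [h1, h] with x h1 h
      rw [h1, ← h, ← mul_assoc, mul_comm (_ : ℂ) (((1 + ‖x‖ ^ 2) ^ (σ / 2) : ℝ) : ℂ), inv, one_mul]
  simp_rw [key, key2]
  have hm : AEStronglyMeasurable
      (fun ξ : Plane => (((1 + ‖ξ‖ ^ 2) ^ (σ / 2) : ℝ) : ℂ) * g ξ) volume := by
    have : (fun x : Plane ↦ (1 + ‖x‖ ^ 2) ^ (σ / 2)).HasTemperateGrowth := by fun_prop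
    exact (Complex.continuous_ofReal.comp this.1.continuous).aestronglyMeasurable.mul
      (Lp.aestronglyMeasurable g)
  constructor
  · intro h
    exact ⟨MemLp.toLp _ ⟨hm, h⟩, (MemLp.coeFn_toLp _).symm⟩
  · rintro ⟨f', h⟩
    rw [MemH, sobolevNorm, ← hg, eLpNorm_congr_ae h]
    exact Lp.eLpNorm_lt_top f'

end EMHD

end

/-! The proof is an energy method on the Fourier side, where both nonlinearities are Jacobians with
kernel `cross`. The energy `en w` weighs a by ⟨ξ⟩w(⟨ξ⟩) and b by w(⟨ξ⟩); its factor `kap` gives the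
two nonlinear terms the same coefficient `kap ^ 2`, so that they combine into one trilinear integral
over p + q + r = 0 with a in the slots p, q and b in the slot r. Antisymmetrization in p and q
(`two_mul_nlForm`) leaves the symbol cross(p,q) · (⟨p⟩²(w(p)² − w(r)²) − ⟨q⟩²(w(q)² − w(r)²)), which
vanishes for w = 1. For slowly varying w (`IsWt`) it is bounded by two powers of the lowest
frequency times ⟨·⟩w at the other two (`symbol_cases`). The lowest frequency is then estimated in
L¹, which H^{s+1} controls because s > 2.

What is lost is one derivative on b beyond the energy. If ν > 0, the dissipation of b absorbs it. If
μ > 0, the triangle inequality for p + q + r = 0 moves that derivative to a, where the dissipation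
of a absorbs it. See `norm_nlForm_le_b`, `norm_nlForm_le_a` and `absorb`. The outcome,
`energy_estimate`, bounds the derivative of `en w` by −`ds w` + K(1 + √ds + en)·`en w`, where the
unweighted-looking `ds` and `en` are those of the weight x^s.

With w = x^s this gives Galerkin solutions (Fourier truncations of the system) a common lifespan and
bound (`exists_galerkin`). With the weights `tailW` it shows that their high-frequency parts are
small uniformly in time and in the truncation (`Galerkin.tight`); the factor √ds is not bounded in
time, but the integrating factor exp(en) pays for it (`gronwall_weighted`).

Two solutions are compared in H¹ × L², that is, with w = 1. In `difference_estimate` the dissipation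
of only one of them occurs, and for that one a Galerkin solution is always taken; the other need
only be bounded in H^{s+1} × H^s. Comparing two Galerkin solutions shows that the scheme is Cauchy
in L² with rate n^{-(s-2)}. Comparing a Galerkin solution with an arbitrary solution shows that
every solution is the limit of the same sequence, which is uniqueness. Convergence in L² together
with uniformly small tails is convergence in H^{s+1} × H^s, uniformly in time, so the limit solves
the system and is continuous in the strong norm. -/

noncomputable section

namespace EMHD

/-! ### Brackets, weighted norms and Young's inequality. -/

/-- The Japanese bracket `⟨ξ⟩ = (1 + |ξ|²)^(1/2)`. -/
def jb (ξ : Plane) : ℝ := √(1 + ‖ξ‖ ^ 2)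

theorem jb_sq (ξ : Plane) : jb ξ ^ 2 = 1 + ‖ξ‖ ^ 2 := Real.sq_sqrt (by positivity)

theorem one_le_jb (ξ : Plane) : 1 ≤ jb ξ := by
  rw [jb, Real.one_le_sqrt]; nlinarith [sq_nonneg ‖ξ‖]

theorem jb_pos (ξ : Plane) : 0 < jb ξ := lt_of_lt_of_le one_pos (one_le_jb ξ)

theorem norm_le_jb (ξ : Plane) : ‖ξ‖ ≤ jb ξ := by
  have h := jb_sq ξ
  have := jb_pos ξ
  nlinarith [norm_nonneg ξ]

@[simp] theorem jb_neg (ξ : Plane) : jb (-ξ) = jb ξ := by simp [jb]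

theorem continuous_jb : Continuous jb := by unfold jb; fun_prop

theorem jb_rpow (σ : ℝ) (ξ : Plane) : jb ξ ^ σ = (1 + ‖ξ‖ ^ 2) ^ (σ / 2) := by
  rw [jb, Real.sqrt_eq_rpow, ← Real.rpow_mul (by positivity)]
  congr 1; ring

/-- `|⟨ξ⟩ - ⟨η⟩| ≤ |ξ + η|`. -/
theorem jb_le_add (ξ η : Plane) : jb ξ ≤ jb η + ‖ξ + η‖ := by
  have h1 : ‖ξ‖ ≤ ‖ξ + η‖ + ‖η‖ := by
    simpa using norm_sub_le (ξ + η) η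
  have h2 := jb_sq ξ
  have h3 := jb_sq η
  have h4 := jb_pos η
  have h5 := norm_le_jb η
  have h6 := norm_nonneg (ξ + η)
  have h7 := norm_nonneg ξ
  have h8 := jb_pos ξ
  nlinarith [mul_le_mul_of_nonneg_left h5 h6]

/-- The product `w(⟨ξ⟩) f(ξ)`. -/
def wt (w : ℝ → ℝ) (f : Plane → ℂ) (ξ : Plane) : ℂ := (w (jb ξ) : ℂ) * f ξ

theorem measurable_comp_jb {w : ℝ → ℝ} (hw : Measurable w) : Measurable fun ξ => w (jb ξ) :=
  hw.comp continuous_jb.measurable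

theorem aesm_wt {w : ℝ → ℝ} (hw : Measurable w) {f : Plane → ℂ}
    (hf : AEStronglyMeasurable f volume) : AEStronglyMeasurable (wt w f) volume :=
  (Complex.measurable_ofReal.comp (measurable_comp_jb hw)).aestronglyMeasurable.mul hf

/-- The weighted `L²` norm of `w(⟨ξ⟩) f(ξ)`. -/
def N2 (w : ℝ → ℝ) (f : Plane → ℂ) : ℝ≥0∞ := eLpNorm (wt w f) 2 volume

/-- The weighted `L¹` norm of `w(⟨ξ⟩) f(ξ)`. -/
def N1 (w : ℝ → ℝ) (f : Plane → ℂ) : ℝ≥0∞ := ∫⁻ ξ, ‖wt w f ξ‖ₑ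

theorem eLpNorm_two_sq {f : Plane → ℂ} : eLpNorm f 2 volume ^ 2 = ∫⁻ ξ, ‖f ξ‖ₑ ^ 2 := by
  have := eLpNorm_nnreal_pow_eq_lintegral (f := f) (μ := volume) (p := 2) (by norm_num)
  simpa using this

theorem lintegral_mul_le_sqrt {F G : Plane → ℝ≥0∞} (hF : AEMeasurable F) (hG : AEMeasurable G) :
    (∫⁻ ξ, F ξ * G ξ) ^ 2 ≤ (∫⁻ ξ, F ξ ^ 2) * ∫⁻ ξ, G ξ ^ 2 := by
  have h := ENNReal.lintegral_mul_le_Lp_mul_Lq volume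
    (Real.HolderConjugate.two_two) hF hG
  have h2 := pow_le_pow_left' h 2
  refine h2.trans (le_of_eq ?_)
  rw [mul_pow, ← ENNReal.rpow_natCast, ← ENNReal.rpow_natCast, ← ENNReal.rpow_mul,
    ← ENNReal.rpow_mul]
  simp

theorem lintegral_young {F G : Plane → ℝ≥0∞} (hF : AEMeasurable F) (hG : AEMeasurable G) :
    ∫⁻ ξ, (∫⁻ η, F η * G (ξ - η)) ^ 2 ≤ (∫⁻ η, F η) ^ 2 * ∫⁻ ξ, G ξ ^ 2 := by
  have hG' : ∀ ξ, AEMeasurable fun η => G (ξ - η) := fun ξ =>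
    hG.comp_quasiMeasurePreserving (quasiMeasurePreserving_sub_left volume ξ)
  have h1 : ∀ ξ, (∫⁻ η, F η * G (ξ - η)) ^ 2 ≤
      (∫⁻ η, F η) * ∫⁻ η, F η * G (ξ - η) ^ 2 := by
    intro ξ
    -- Cauchy–Schwarz for the measure F dη: one factor √F goes with 1, the other with G.
    have hs : AEMeasurable fun η => F η ^ (1 / 2 : ℝ) := hF.pow_const _
    have e : ∀ x : ℝ≥0∞, x ^ (1 / 2 : ℝ) * x ^ (1 / 2 : ℝ) = x := by
      intro x
      rw [← ENNReal.rpow_add_of_nonneg _ _ (by norm_num) (by norm_num)]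
      norm_num
    have := lintegral_mul_le_sqrt hs (hs.mul (hG' ξ))
    simpa only [Pi.mul_apply, mul_pow, ← mul_assoc, e, pow_two (_ ^ (1 / 2 : ℝ))] using this
  have hjoint : AEMeasurable (fun z : Plane × Plane => F z.2 * G (z.1 - z.2) ^ 2)
      (volume.prod volume) := by
    have a1 : AEMeasurable (fun z : Plane × Plane => F z.2) (volume.prod volume) := hF.comp_snd
    have a2 : AEMeasurable (fun z : Plane × Plane => G (z.1 - z.2)) (volume.prod volume) :=
      hG.comp_quasiMeasurePreserving (quasiMeasurePreserving_sub volume volume)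
    exact a1.mul (a2.pow_const 2)
  calc ∫⁻ ξ, (∫⁻ η, F η * G (ξ - η)) ^ 2
      ≤ ∫⁻ ξ, (∫⁻ η, F η) * ∫⁻ η, F η * G (ξ - η) ^ 2 := lintegral_mono h1
    _ = (∫⁻ η, F η) * ∫⁻ ξ, ∫⁻ η, F η * G (ξ - η) ^ 2 := by
        rw [lintegral_const_mul'' _ hjoint.lintegral_prod_right']
    _ = (∫⁻ η, F η) * ∫⁻ η, ∫⁻ ξ, F η * G (ξ - η) ^ 2 := by
        rw [lintegral_lintegral_swap hjoint]
    _ = (∫⁻ η, F η) * ∫⁻ η, F η * ∫⁻ ξ, G ξ ^ 2 := by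
        congr 1
        refine lintegral_congr fun η => ?_
        rw [lintegral_const_mul'']
        · congr 1
          exact lintegral_sub_right_eq_self (fun ξ => G ξ ^ 2) η
        · exact (hG.comp_quasiMeasurePreserving
            (measurePreserving_sub_right volume η).quasiMeasurePreserving).pow_const 2
    _ = (∫⁻ η, F η) ^ 2 * ∫⁻ ξ, G ξ ^ 2 := by
        rw [lintegral_mul_const'' _ hF]; ring

/-- Young's inequality `‖F * G‖_{L²} ≤ ‖F‖_{L¹} ‖G‖_{L²}`. -/
theorem eLpNorm_two_le_young {f g h : Plane → ℂ} (hf : AEStronglyMeasurable f volume)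
    (hg : AEStronglyMeasurable g volume)
    (hh : ∀ᵐ ξ, ‖h ξ‖ₑ ≤ ∫⁻ η, ‖f η‖ₑ * ‖g (ξ - η)‖ₑ) :
    eLpNorm h 2 volume ≤ (∫⁻ η, ‖f η‖ₑ) * eLpNorm g 2 volume := by
  rw [← ENNReal.pow_le_pow_left_iff two_ne_zero, mul_pow, eLpNorm_two_sq, eLpNorm_two_sq]
  refine le_trans (lintegral_mono_ae ?_) (lintegral_young hf.enorm hg.enorm)
  filter_upwards [hh] with ξ h
  gcongr

/-! ### Integrals over triples p + q + r = 0. -/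

theorem measurePreserving_rot :
    MeasurePreserving (fun z : Plane × Plane => (-z.1 - z.2, z.2)) volume volume := by
  -- On each fibre this is a reflection followed by a translation; conjugating with the swap moves
  -- it to the first coordinate.
  have h1 : MeasurePreserving (fun z : Plane × Plane => (z.1, -z.2 - z.1))
      (volume.prod volume) (volume.prod volume) := by
    refine (MeasurePreserving.id volume).skew_product (g := fun a c => -c - a) ?_ ?_
    · fun_prop
    · refine Filter.Eventually.of_forall fun a => ?_
      exact ((measurePreserving_sub_right volume a).comp (Measure.measurePreserving_neg volume)).map_eq
  have h2 : MeasurePreserving (Prod.swap : Plane × Plane → Plane × Plane)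
      (volume.prod volume) (volume.prod volume) := Measure.measurePreserving_swap
  exact h2.comp (h1.comp h2)

/-- The measurable involution `(p, q) ↦ (-p - q, q)` of the plane `p + q + r = 0`. -/
def rotEquiv : (Plane × Plane) ≃ᵐ (Plane × Plane) where
  toFun z := (-z.1 - z.2, z.2)
  invFun z := (-z.1 - z.2, z.2)
  left_inv z := by simp
  right_inv z := by simp
  measurable_toFun := by
    change Measurable fun z : Plane × Plane => (-z.1 - z.2, z.2)
    fun_prop
  measurable_invFun := by
    change Measurable fun z : Plane × Plane => (-z.1 - z.2, z.2)
    fun_prop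

/-- Together with `lintegral_swap` it generates all permutations of (p, q, r), so any of the three
factors can take the role of the L¹ factor. -/
theorem lintegral_rot (Φ : Plane → Plane → Plane → ℝ≥0∞) :
    ∫⁻ z : Plane × Plane, Φ z.1 z.2 (-z.1 - z.2) =
      ∫⁻ z : Plane × Plane, Φ (-z.1 - z.2) z.2 z.1 := by
  have := MeasurePreserving.lintegral_comp_emb measurePreserving_rot
    rotEquiv.measurableEmbedding (fun z => Φ z.1 z.2 (-z.1 - z.2))
  rw [← this]
  simp

theorem lintegral_swap (Φ : Plane → Plane → Plane → ℝ≥0∞) :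
    ∫⁻ z : Plane × Plane, Φ z.1 z.2 (-z.1 - z.2) =
      ∫⁻ z : Plane × Plane, Φ z.2 z.1 (-z.1 - z.2) := by
  have := MeasurePreserving.lintegral_comp_emb
    (Measure.measurePreserving_swap (μ := volume) (ν := volume))
    MeasurableEquiv.prodComm.measurableEmbedding
    (fun z : Plane × Plane => Φ z.1 z.2 (-z.1 - z.2))
  refine this.symm.trans (lintegral_congr fun z => ?_)
  change Φ z.2 z.1 (-z.2 - z.1) = _
  rw [show -z.2 - z.1 = -z.1 - z.2 by abel]

/-- The integral over triples `(p, q, r)` with `p + q + r = 0`. -/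
def tri (Φ : Plane → Plane → Plane → ℂ) : ℂ := ∫ z : Plane × Plane, Φ z.1 z.2 (-z.1 - z.2)

theorem tri_rot (Φ : Plane → Plane → Plane → ℂ) : tri Φ = tri fun p q r => Φ r q p := by
  have := MeasurePreserving.integral_comp (f := rotEquiv) measurePreserving_rot
    rotEquiv.measurableEmbedding (fun z => Φ z.1 z.2 (-z.1 - z.2))
  rw [tri, ← this]
  simp [rotEquiv, tri]

theorem tri_swap (Φ : Plane → Plane → Plane → ℂ) : tri Φ = tri fun p q r => Φ q p r := by
  have := MeasurePreserving.integral_comp (f := (MeasurableEquiv.prodComm : Plane × Plane ≃ᵐ _))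
    (Measure.measurePreserving_swap (μ := volume) (ν := volume))
    MeasurableEquiv.prodComm.measurableEmbedding
    (fun z : Plane × Plane => Φ z.1 z.2 (-z.1 - z.2))
  refine this.symm.trans (integral_congr_ae (Filter.Eventually.of_forall fun z => ?_))
  change Φ z.2 z.1 (-z.2 - z.1) = Φ z.2 z.1 (-z.1 - z.2)
  rw [show -z.2 - z.1 = -z.1 - z.2 by abel]

/-- Cauchy–Schwarz in p, then Young's inequality for the convolution of G and H; the reflection of p
turns H(-p - q) into H(p - q). -/
theorem lintegral_tri_two {F G H : Plane → ℝ≥0∞} (hF : AEMeasurable F) (hG : AEMeasurable G)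
    (hH : AEMeasurable H) :
    ∫⁻ z : Plane × Plane, F z.1 * G z.2 * H (-z.1 - z.2) ≤
      (∫⁻ ξ, F ξ ^ 2) ^ (1 / 2 : ℝ) * (∫⁻ ξ, G ξ) * (∫⁻ ξ, H ξ ^ 2) ^ (1 / 2 : ℝ) := by
  have hm : AEMeasurable (fun z : Plane × Plane => G z.2 * H (-z.1 - z.2))
      (volume.prod volume) := by
    refine (hG.comp_snd).mul (hH.comp_quasiMeasurePreserving ?_)
    exact (Measure.quasiMeasurePreserving_fst).comp measurePreserving_rot.quasiMeasurePreserving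
  have hm' : AEMeasurable (fun z : Plane × Plane => F z.1 * (G z.2 * H (-z.1 - z.2)))
      (volume.prod volume) := (hF.comp_fst).mul hm
  have e1 : ∫⁻ z : Plane × Plane, F z.1 * G z.2 * H (-z.1 - z.2) =
      ∫⁻ p, F p * ∫⁻ q, G q * H (-p - q) := by
    simp_rw [mul_assoc]
    rw [Measure.volume_eq_prod, lintegral_prod _ hm']
    refine lintegral_congr_ae ?_
    filter_upwards [hm.aestronglyMeasurable.prodMk_left] with p hp
    exact lintegral_const_mul'' _ hp.aemeasurable
  have e2 : (∫⁻ p, F p * ∫⁻ q, G q * H (-p - q)) ^ 2 ≤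
      (∫⁻ ξ, F ξ ^ 2) * ((∫⁻ ξ, G ξ) ^ 2 * (∫⁻ ξ, H ξ ^ 2)) := by
    refine (lintegral_mul_le_sqrt hF hm.lintegral_prod_right').trans ?_
    gcongr
    refine le_trans (le_of_eq ?_) (lintegral_young hG hH)
    exact lintegral_neg_eq_self (fun p => (∫⁻ q, G q * H (p - q)) ^ 2)
  rw [e1]
  have e3 : ∀ a b : ℝ≥0∞, a ^ 2 ≤ b → a ≤ b ^ (1 / 2 : ℝ) := by
    intro a b h
    rw [one_div, ENNReal.le_rpow_inv_iff (by norm_num)]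
    simpa using h
  refine (e3 _ _ e2).trans (le_of_eq ?_)
  rw [ENNReal.mul_rpow_of_nonneg _ _ (by norm_num), ENNReal.mul_rpow_of_nonneg _ _ (by norm_num),
    ← ENNReal.rpow_natCast, ← ENNReal.rpow_mul]
  norm_num
  ring

theorem eLpNorm_two_eq (f : Plane → ℂ) :
    eLpNorm f 2 volume = (∫⁻ ξ, ‖f ξ‖ₑ ^ 2) ^ (1 / 2 : ℝ) := by
  rw [← eLpNorm_two_sq, ← ENNReal.rpow_natCast, ← ENNReal.rpow_mul]; norm_num

section TrilinearBounds

variable {f g h : Plane → ℂ} (hf : AEStronglyMeasurable f volume)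
  (hg : AEStronglyMeasurable g volume) (hh : AEStronglyMeasurable h volume)
include hf hg hh

theorem lintegral_tri_le_mid : ∫⁻ z : Plane × Plane, ‖f z.1‖ₑ * ‖g z.2‖ₑ * ‖h (-z.1 - z.2)‖ₑ ≤
    eLpNorm f 2 volume * (∫⁻ ξ, ‖g ξ‖ₑ) * eLpNorm h 2 volume := by
  rw [eLpNorm_two_eq, eLpNorm_two_eq]
  exact lintegral_tri_two hf.enorm hg.enorm hh.enorm

theorem lintegral_tri_le_left : ∫⁻ z : Plane × Plane, ‖f z.1‖ₑ * ‖g z.2‖ₑ * ‖h (-z.1 - z.2)‖ₑ ≤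
    (∫⁻ ξ, ‖f ξ‖ₑ) * eLpNorm g 2 volume * eLpNorm h 2 volume := by
  rw [lintegral_swap (fun p q r => ‖f p‖ₑ * ‖g q‖ₑ * ‖h r‖ₑ)]
  simp_rw [mul_comm ‖f _‖ₑ ‖g _‖ₑ]
  rw [mul_comm (∫⁻ ξ, ‖f ξ‖ₑ)]
  exact lintegral_tri_le_mid hg hf hh

theorem lintegral_tri_le_right : ∫⁻ z : Plane × Plane, ‖f z.1‖ₑ * ‖g z.2‖ₑ * ‖h (-z.1 - z.2)‖ₑ ≤
    eLpNorm f 2 volume * eLpNorm g 2 volume * ∫⁻ ξ, ‖h ξ‖ₑ := by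
  rw [lintegral_rot (fun p q r => ‖f p‖ₑ * ‖g q‖ₑ * ‖h r‖ₑ)]
  have := lintegral_tri_le_left hh hg hf
  refine le_trans (le_of_eq ?_) (this.trans (le_of_eq (by ring)))
  refine lintegral_congr fun z => ?_
  ring

end TrilinearBounds

/-- Cauchy–Schwarz against ⟨ξ⟩^{-σ}, which is square integrable on the plane because 2σ > 2. It is
applied with σ = s − 1, one of the places where s > 2 is needed. -/
theorem N1_le_N2 {σ : ℝ} (hσ : 1 < σ) : ∃ C : ℝ≥0, ∀ {f : Plane → ℂ} (_ : AEStronglyMeasurable f volume)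
    (a : ℝ), N1 (fun x => x ^ a) f ≤ C * N2 (fun x => x ^ (a + σ)) f := by
  have hint : Integrable (fun ξ : Plane => (1 + ‖ξ‖ ^ 2) ^ (-(2 * σ) / 2)) volume :=
    integrable_rpow_neg_one_add_norm_sq (by simp; linarith)
  set I : ℝ≥0∞ := ∫⁻ ξ, ‖((jb ξ ^ (-σ) : ℝ) : ℂ)‖ₑ ^ 2 with hI
  have hIfin : I ≠ ⊤ := by
    have := hint.2
    rw [hasFiniteIntegral_iff_enorm] at this
    refine ne_of_lt (lt_of_le_of_lt (lintegral_mono fun ξ => ?_) this)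
    rw [← enorm_pow]
    have : ((jb ξ ^ (-σ) : ℝ) : ℂ) ^ 2 = (((1 + ‖ξ‖ ^ 2) ^ (-(2 * σ) / 2) : ℝ) : ℂ) := by
      norm_cast
      rw [jb_rpow, ← Real.rpow_natCast, ← Real.rpow_mul (by positivity)]
      congr 1; push_cast; ring
    rw [this, ← ofReal_norm, ← ofReal_norm, Complex.norm_real]
  refine ⟨(I ^ (1 / 2 : ℝ)).toNNReal, fun {f} hf a => ?_⟩
  rw [ENNReal.coe_toNNReal (ENNReal.rpow_ne_top_of_nonneg (by norm_num) hIfin), N2,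
    eLpNorm_two_eq, ← ENNReal.mul_rpow_of_nonneg _ _ (by norm_num), one_div,
    ENNReal.le_rpow_inv_iff (by norm_num)]
  have h1 : N1 (fun x => x ^ a) f = ∫⁻ ξ, ‖((jb ξ ^ (-σ) : ℝ) : ℂ)‖ₑ *
      ‖wt (fun x => x ^ (a + σ)) f ξ‖ₑ := by
    refine lintegral_congr fun ξ => ?_
    rw [wt, wt, ← enorm_mul, ← mul_assoc]
    congr 2
    norm_cast
    rw [← Real.rpow_add (jb_pos ξ)]
    congr 1; ring
  rw [h1]
  have m1 : AEMeasurable fun ξ => ‖((jb ξ ^ (-σ) : ℝ) : ℂ)‖ₑ :=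
    (Complex.measurable_ofReal.comp (measurable_comp_jb (w := fun x => x ^ (-σ))
      (by fun_prop))).aestronglyMeasurable.enorm
  have := lintegral_mul_le_sqrt m1 (aesm_wt (w := fun x => x ^ (a + σ)) (by fun_prop) hf).enorm
  simpa using this

/-! ### The Fourier transform of real functions. -/

/-- Complex-valued square integrable functions on the plane. -/
abbrev C2 : Type := Lp ℂ 2 (volume : Measure Plane)

/-- The Fourier transform of real-valued square integrable functions. -/
def FT : L2 →ₗᵢ[ℝ] C2 where
  toLinearMap := ((Lp.fourierTransformₗᵢ Plane ℂ).toLinearIsometry.toLinearMap.restrictScalars ℝ) ∘ₗ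
    (Complex.ofRealCLM.compLpL 2 (volume : Measure Plane)).toLinearMap
  norm_map' f := by
    change ‖Lp.fourierTransformₗᵢ Plane ℂ (toComplex f)‖ = ‖f‖
    rw [LinearIsometryEquiv.norm_map, Lp.norm_def, Lp.norm_def]
    congr 1
    refine eLpNorm_congr_norm_ae ?_
    filter_upwards [Complex.ofRealCLM.coeFn_compLp f] with x hx
    rw [toComplex, hx]; simp

theorem FT_apply (f : L2) : FT f = 𝓕 (toComplex f) := rfl

/-- The Fourier transform of `f` as a function. -/
def hat (f : L2) : Plane → ℂ := ⇑(FT f)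

theorem aesm_hat (f : L2) : AEStronglyMeasurable (hat f) volume := Lp.aestronglyMeasurable _

theorem memLp_hat (f : L2) : MemLp (hat f) 2 volume := Lp.memLp _

theorem hat_add (f g : L2) : hat (f + g) =ᵐ[volume] fun ξ => hat f ξ + hat g ξ := by
  unfold hat; rw [map_add]; exact Lp.coeFn_add _ _

theorem hat_sub (f g : L2) : hat (f - g) =ᵐ[volume] fun ξ => hat f ξ - hat g ξ := by
  unfold hat; rw [map_sub]; exact Lp.coeFn_sub _ _

theorem hat_smul (c : ℝ) (f : L2) : hat (c • f) =ᵐ[volume] fun ξ => (c : ℂ) * hat f ξ := by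
  unfold hat; rw [map_smul]
  filter_upwards [Lp.coeFn_smul c (FT f)] with ξ h
  rw [h]; simp

theorem hat_injective {f g : L2} (h : hat f =ᵐ[volume] hat g) : f = g :=
  FT.injective (Lp.ext h)

theorem eLpNorm_hat (f : L2) : eLpNorm (hat f) 2 volume = ‖f‖ₑ := by
  rw [← FT.enorm_map, Lp.enorm_def]; rfl

theorem sobolevNorm_eq (σ : ℝ) (f : L2) : sobolevNorm σ f = N2 (fun x => x ^ σ) (hat f) := by
  rw [sobolevNorm, N2]
  refine congrArg (eLpNorm · 2 volume) (funext fun ξ => ?_)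
  rw [wt, jb_rpow]; rfl

theorem coeFn_toComplex (f : L2) : ∀ᵐ x, toComplex f x = (f x : ℂ) := by
  filter_upwards [Complex.ofRealCLM.coeFn_compLp f] with x hx
  rw [toComplex, hx]; rfl

/-- A complex `L²` function with vanishing imaginary part comes from a real one. -/
theorem exists_toComplex_eq {F : C2} (h : ∀ᵐ x, (F x).im = 0) : ∃ f : L2, toComplex f = F := by
  refine ⟨Complex.reCLM.compLp F, ?_⟩
  ext1
  filter_upwards [coeFn_toComplex (Complex.reCLM.compLp F), Complex.reCLM.coeFn_compLp F, h]
    with x h1 h2 h3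
  rw [h1, h2]
  exact Complex.ext (by simp) (by simp [h3])

theorem integral_smul_fourier (f : C2) (φ : 𝓢(Plane, ℂ)) :
    ∫ x, φ x * (𝓕 f : C2) x = ∫ x, 𝓕 φ x * f x := by
  have := congrArg (fun T : 𝓢'(Plane, ℂ) => T φ) (Lp.fourier_toTemperedDistribution_eq f)
  simp only [Lp.toTemperedDistribution_apply, TemperedDistribution.fourier_apply, smul_eq_mul] at this
  exact this.symm

/-- Two functions agree a.e. if they agree when tested against Schwartz functions. -/
theorem ae_eq_of_schwartz {f g : Plane → ℂ} (hf : LocallyIntegrable f volume)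
    (hg : LocallyIntegrable g volume)
    (h : ∀ φ : 𝓢(Plane, ℂ), ∫ x, φ x * f x = ∫ x, φ x * g x) : f =ᵐ[volume] g := by
  refine ae_eq_of_integral_contDiff_smul_eq hf hg fun u hu hc => ?_
  have hg₁ : HasCompactSupport (Complex.ofRealCLM ∘ u) := hc.comp_left rfl
  have hg₂ : ContDiff ℝ ((⊤ : ℕ∞) : WithTop ℕ∞) (Complex.ofRealCLM ∘ u) := by fun_prop
  simpa using h (hg₁.toSchwartzMap hg₂)

theorem locallyIntegrable_of_memLp {f : Plane → ℂ} (hf : MemLp f 2 volume) :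
    LocallyIntegrable f volume := hf.locallyIntegrable (by norm_num)

/-- Complex conjugation of a Schwartz function. -/
def conjS (φ : 𝓢(Plane, ℂ)) : 𝓢(Plane, ℂ) :=
  SchwartzMap.postcompCLM (𝕜 := ℝ) (Complex.conjCLE : ℂ →L[ℝ] ℂ) φ

theorem conjS_apply (φ : 𝓢(Plane, ℂ)) (x : Plane) : conjS φ x = (starRingEnd ℂ) (φ x) := rfl

theorem fourier_conjS (φ : 𝓢(Plane, ℂ)) (x : Plane) :
    𝓕 (conjS φ) x = (starRingEnd ℂ) (𝓕 φ (-x)) := by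
  rw [SchwartzMap.fourier_coe, SchwartzMap.fourier_coe, Real.fourier_eq, Real.fourier_eq,
    ← integral_conj]
  refine integral_congr_ae (Filter.Eventually.of_forall fun v => ?_)
  simp [Circle.smul_def, conjS_apply]

theorem measurePreserving_neg' : MeasurePreserving (fun x : Plane => -x) volume volume :=
  Measure.measurePreserving_neg volume

/-- By duality: the pairing is moved onto a Schwartz function, and the identity for f is tested with
the conjugate of the reflected test function, where `fourier_conjS` is an explicit integral. -/
theorem fourier_conj_neg (f g : C2) (h : ∀ᵐ x, g x = (starRingEnd ℂ) (f x)) :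
    ∀ᵐ ξ, (𝓕 g : C2) ξ = (starRingEnd ℂ) ((𝓕 f : C2) (-ξ)) := by
  have hm : MemLp (fun ξ => (starRingEnd ℂ) ((𝓕 f : C2) (-ξ))) 2 volume := by
    have := (Lp.memLp (𝓕 f : C2)).comp_measurePreserving measurePreserving_neg'
    exact this.star
  refine ae_eq_of_schwartz (locallyIntegrable_of_memLp (Lp.memLp _))
    (locallyIntegrable_of_memLp hm) fun φ => ?_
  rw [integral_smul_fourier]
  have e1 : ∫ x, φ x * (starRingEnd ℂ) ((𝓕 f : C2) (-x)) =
      ∫ x, φ (-x) * (starRingEnd ℂ) ((𝓕 f : C2) x) := by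
    rw [← integral_neg_eq_self]; simp
  have e2 := integral_smul_fourier f (conjS (SchwartzMap.compCLMOfContinuousLinearEquiv ℝ
    (ContinuousLinearEquiv.neg ℝ) φ))
  have e3 := congrArg (starRingEnd ℂ) e2
  rw [← integral_conj, ← integral_conj] at e3
  rw [e1]
  simp only [map_mul, conjS_apply, SchwartzMap.compCLMOfContinuousLinearEquiv_apply,
    Function.comp, ContinuousLinearEquiv.neg_apply, Complex.conj_conj, fourier_conjS] at e3
  rw [e3]
  refine integral_congr_ae ?_
  filter_upwards [h] with x hx
  rw [hx]
  congr 1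
  rw [SchwartzMap.fourier_coe, SchwartzMap.fourier_coe, Real.fourier_eq, Real.fourier_eq,
    ← integral_neg_eq_self]
  simp

/-- Fourier transforms of real functions are Hermitian. -/
theorem hat_neg (f : L2) : ∀ᵐ ξ, hat f (-ξ) = (starRingEnd ℂ) (hat f ξ) := by
  have h1 : ∀ᵐ x, toComplex f x = (starRingEnd ℂ) (toComplex f x) := by
    filter_upwards [coeFn_toComplex f] with x hx
    rw [hx, Complex.conj_ofReal]
  have h2 := fourier_conj_neg _ _ h1
  filter_upwards [measurePreserving_neg'.quasiMeasurePreserving.ae h2] with ξ h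
  rw [neg_neg] at h
  exact h

/-- Hermitian `L²` functions are Fourier transforms of real functions. -/
theorem exists_hat_eq {F : Plane → ℂ} (hF : MemLp F 2 volume)
    (hs : ∀ᵐ ξ, F (-ξ) = (starRingEnd ℂ) (F ξ)) : ∃ f : L2, hat f =ᵐ[volume] F := by
  set G : C2 := 𝓕⁻ hF.toLp with hG
  set H : C2 := Complex.conjCLE.toContinuousLinearMap.compLp G with hH
  have hHG : ∀ᵐ x, H x = (starRingEnd ℂ) (G x) :=
    Complex.conjCLE.toContinuousLinearMap.coeFn_compLp G
  have h1 := fourier_conj_neg G H hHG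
  have h2 : 𝓕 H = 𝓕 G := by
    ext1
    have hFG : (𝓕 G : C2) = hF.toLp := FourierTransform.fourier_fourierInv_eq _
    filter_upwards [h1, hs, hF.coeFn_toLp,
      measurePreserving_neg'.quasiMeasurePreserving.ae hF.coeFn_toLp] with ξ h1 h2 h3 h4
    rw [h1, hFG, h4, h3, h2, Complex.conj_conj]
  -- The inverse transform G of F and its conjugate H have the same Fourier transform, so G is real.
  have h3 : H = G := (Lp.fourierTransformₗᵢ Plane ℂ).injective h2
  obtain ⟨f, hf⟩ := exists_toComplex_eq (F := G) (by
    filter_upwards [hHG] with x hx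
    rw [h3] at hx
    exact Complex.conj_eq_iff_im.mp hx.symm)
  refine ⟨f, ?_⟩
  have : FT f = hF.toLp := by
    rw [FT_apply, hf]; exact FourierTransform.fourier_fourierInv_eq _
  rw [hat, this]
  exact hF.coeFn_toLp

/-- Real Fourier multipliers. -/
theorem exists_multiplier {m : Plane → ℂ} {f : L2}
    (hm : ∀ ξ, m (-ξ) = (starRingEnd ℂ) (m ξ)) (hF : MemLp (fun ξ => m ξ * hat f ξ) 2 volume) :
    ∃ g : L2, hat g =ᵐ[volume] fun ξ => m ξ * hat f ξ := by
  refine exists_hat_eq hF ?_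
  filter_upwards [hat_neg f] with ξ h
  rw [hm, h, map_mul]

/-- `f ∈ H¹` has weak derivatives, with the expected Fourier transform. -/
theorem isWeakDeriv_of_hat {i : Fin 2} {f g : L2}
    (h : hat g =ᵐ[volume] fun ξ => 2 * Real.pi * Complex.I * (ξ i : ℂ) * hat f ξ) :
    IsWeakDeriv i f g := by
  -- The derivative can be identified after a Fourier transform of tempered distributions, where it
  -- is a multiplication.
  have hinj : Function.Injective (𝓕 : 𝓢'(Plane, ℂ) → 𝓢'(Plane, ℂ)) :=
    Function.LeftInverse.injective (g := 𝓕⁻) FourierTransform.fourierInv_fourier_eq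
  apply hinj
  rw [TemperedDistribution.fourier_lineDerivOp_eq, Lp.fourier_toTemperedDistribution_eq,
    Lp.fourier_toTemperedDistribution_eq]
  ext φ
  have hg : (fun x : Plane => ((inner ℝ x (EuclideanSpace.single i (1 : ℝ)) : ℝ) : ℂ)).HasTemperateGrowth := by
    fun_prop
  change (2 * Real.pi * Complex.I) • (smulLeftCLM ℂ _ (Lp.toTemperedDistribution _) φ) = _
  rw [TemperedDistribution.smulLeftCLM_apply_apply,
    Lp.toTemperedDistribution_apply, Lp.toTemperedDistribution_apply, smul_eq_mul,
    ← integral_const_mul]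
  refine integral_congr_ae ?_
  filter_upwards [h] with ξ hξ
  rw [SchwartzMap.smulLeftCLM_apply_apply hg]
  change _ = φ ξ • hat g ξ
  rw [hξ]
  change _ * ((_ • _) • hat f ξ) = _
  simp [EuclideanSpace.inner_single_right]
  ring

/-! ### Convolutions and the transform of a product. -/

/-- The character `exp (2πi η·x)`. -/
def chr (η x : Plane) : ℂ := ((Real.fourierChar (inner ℝ η x) : Circle) : ℂ)

@[simp] theorem norm_chr (η x : Plane) : ‖chr η x‖ = 1 := Circle.norm_coe _

theorem continuous_chr : Continuous fun z : Plane × Plane => chr z.2 z.1 :=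
  continuous_subtype_val.comp (Real.continuous_fourierChar.comp (by fun_prop))

/-- Convolution `∫ f(η) g(ξ - η) dη`. -/
def conv (f g : Plane → ℂ) (ξ : Plane) : ℂ := ∫ η, f η * g (ξ - η)

theorem aesm_sub {g : Plane → ℂ} (hg : AEStronglyMeasurable g volume) :
    AEStronglyMeasurable (fun z : Plane × Plane => g (z.1 - z.2)) (volume.prod volume) :=
  hg.comp_quasiMeasurePreserving (quasiMeasurePreserving_sub volume volume)

theorem memLp_conv {f g : Plane → ℂ} (hf : Integrable f volume) (hg : MemLp g 2 volume) :
    MemLp (conv f g) 2 volume := by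
  have hm : AEStronglyMeasurable (fun z : Plane × Plane => f z.2 * g (z.1 - z.2))
      (volume.prod volume) := (hf.1.comp_snd).mul (aesm_sub hg.1)
  refine ⟨hm.integral_prod_right', lt_of_le_of_lt (eLpNorm_two_le_young hf.1 hg.1
    (Filter.Eventually.of_forall fun ξ => ?_)) (ENNReal.mul_lt_top hf.2 hg.2)⟩
  refine (enorm_integral_le_lintegral_enorm _).trans (le_of_eq ?_)
  simp_rw [enorm_mul]

/-- Cauchy–Schwarz in the outer variable and Young's inequality for the convolution; this justifies
the exchange of integrals in `fourier_mul`. -/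
theorem integrable_mul_conv {f g h : Plane → ℂ} (hf : MemLp f 2 volume)
    (hg : Integrable g volume) (hh : MemLp h 2 volume) :
    Integrable (fun z : Plane × Plane => f z.1 * (g z.2 * h (z.1 - z.2)))
      (volume.prod volume) := by
  have hm : AEStronglyMeasurable (fun z : Plane × Plane => g z.2 * h (z.1 - z.2))
      (volume.prod volume) := (hg.1.comp_snd).mul (aesm_sub hh.1)
  have hm' : AEStronglyMeasurable (fun z : Plane × Plane => f z.1 * (g z.2 * h (z.1 - z.2)))
      (volume.prod volume) := (hf.1.comp_fst).mul hm
  refine ⟨hm', ?_⟩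
  rw [hasFiniteIntegral_iff_enorm, lintegral_prod _ hm'.enorm]
  have e : ∀ᵐ ξ, ∫⁻ η, ‖f ξ * (g η * h (ξ - η))‖ₑ = ‖f ξ‖ₑ * ∫⁻ η, ‖g η‖ₑ * ‖h (ξ - η)‖ₑ := by
    filter_upwards [hm.prodMk_left] with ξ hξ
    simp_rw [enorm_mul]
    rw [lintegral_const_mul'']
    simpa only [enorm_mul] using hξ.enorm
  rw [lintegral_congr_ae e]
  have h2 : AEMeasurable (fun ξ => ∫⁻ η, ‖g η‖ₑ * ‖h (ξ - η)‖ₑ) volume := by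
    have := hm.enorm.lintegral_prod_right'
    simpa only [enorm_mul] using this
  have h1 := lintegral_mul_le_sqrt hf.1.enorm h2
  have h3 : (∫⁻ ξ, ‖f ξ‖ₑ ^ 2) * ∫⁻ ξ, (∫⁻ η, ‖g η‖ₑ * ‖h (ξ - η)‖ₑ) ^ 2 < ⊤ := by
    refine ENNReal.mul_lt_top ?_ (lt_of_le_of_lt (lintegral_young hg.1.enorm hh.1.enorm) ?_)
    · rw [← eLpNorm_two_sq]; exact ENNReal.pow_lt_top hf.2
    · refine ENNReal.mul_lt_top (ENNReal.pow_lt_top hg.2) ?_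
      rw [← eLpNorm_two_sq]; exact ENNReal.pow_lt_top hh.2
  have h4 := lt_of_le_of_lt h1 h3
  by_contra hcon
  rw [not_lt, top_le_iff] at hcon
  rw [hcon] at h4
  simp at h4

theorem integral_char_swap {u F : Plane → ℂ} (hu : Integrable u volume)
    (hF : Integrable F volume) :
    ∫ x, u x * ∫ η, chr η x * F η =
      ∫ η, F η * ∫ x, chr η x * u x := by
  have hint : Integrable (fun z : Plane × Plane =>
      chr z.2 z.1 * (u z.1 * F z.2)) (volume.prod volume) := by
    refine (hu.mul_prod hF).bdd_mul (c := 1) ?_ (Filter.Eventually.of_forall fun z => by simp)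
    exact continuous_chr.aestronglyMeasurable
  calc ∫ x, u x * ∫ η, chr η x * F η
      = ∫ x, ∫ η, chr η x * (u x * F η) := by
        refine integral_congr_ae (Filter.Eventually.of_forall fun x => ?_)
        dsimp only
        rw [← integral_const_mul]
        refine integral_congr_ae (Filter.Eventually.of_forall fun η => ?_)
        dsimp only; ring
    _ = ∫ η, ∫ x, chr η x * (u x * F η) :=
        integral_integral_swap hint
    _ = _ := by
        refine integral_congr_ae (Filter.Eventually.of_forall fun η => ?_)
        dsimp only
        rw [← integral_const_mul]
        refine integral_congr_ae (Filter.Eventually.of_forall fun η => ?_)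
        dsimp only; ring

/-- Fourier inversion for `f ∈ L²` with integrable Fourier transform. -/
theorem ae_eq_inversion (f : C2) (hF : Integrable (𝓕 f : C2) volume) :
    f =ᵐ[volume] fun x => ∫ η, chr η x * (𝓕 f : C2) η := by
  have hbd : ∀ x, ‖∫ η, chr η x * (𝓕 f : C2) η‖ ≤
      ∫ η, ‖(𝓕 f : C2) η‖ := fun x => by
    refine (norm_integral_le_integral_norm _).trans (le_of_eq ?_)
    simp
  have hm : AEStronglyMeasurable
      (fun x => ∫ η, chr η x * (𝓕 f : C2) η) volume := by
    have : AEStronglyMeasurable (fun z : Plane × Plane =>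
      chr z.2 z.1 * (𝓕 f : C2) z.2) (volume.prod volume) := by
      refine AEStronglyMeasurable.mul continuous_chr.aestronglyMeasurable hF.1.comp_snd
    exact this.integral_prod_right'
  refine ae_eq_of_schwartz (locallyIntegrable_of_memLp (Lp.memLp _))
    ((memLp_top_of_bound hm _ (Filter.Eventually.of_forall hbd)).locallyIntegrable le_top)
    fun φ => ?_
  rw [integral_char_swap φ.integrable hF]
  have := integral_smul_fourier f (𝓕⁻ φ)
  rw [FourierTransform.fourier_fourierInv_eq] at this
  rw [← this]
  refine integral_congr_ae (Filter.Eventually.of_forall fun ξ => ?_)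
  dsimp only
  rw [mul_comm]
  congr 1
  rw [SchwartzMap.fourierInv_coe, Real.fourierInv_eq]
  refine integral_congr_ae (Filter.Eventually.of_forall fun x => ?_)
  dsimp only
  rw [Circle.smul_def, smul_eq_mul, real_inner_comm]; rfl

/-- A character produced by the inversion formula becomes a shift of the test function, which is how
the convolution in `fourier_mul` arises. -/
theorem fourier_translate (φ : 𝓢(Plane, ℂ)) (η x : Plane) :
    𝓕 (SchwartzMap.compSubConstCLM ℝ (-η) φ) x =
      chr η x * 𝓕 φ x := by
  rw [SchwartzMap.fourier_coe, SchwartzMap.fourier_coe, Real.fourier_eq, Real.fourier_eq,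
    ← integral_add_right_eq_self (fun v => Real.fourierChar (-inner ℝ v x) • φ v) η,
    ← integral_const_mul]
  refine integral_congr_ae (Filter.Eventually.of_forall fun v => ?_)
  simp only [Circle.smul_def, smul_eq_mul, inner_add_left, neg_add, AddChar.map_add_eq_mul,
    Circle.coe_mul, SchwartzMap.compSubConstCLM_apply, sub_neg_eq_add]
  rw [AddChar.map_neg_eq_inv _ (inner ℝ η x)]
  rw [Circle.coe_inv]
  change _ = chr η x * _
  have : ((Real.fourierChar (inner ℝ η x) : Circle) : ℂ) ≠ 0 := Circle.coe_ne_zero _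
  field_simp
  rfl

/-- The Fourier transform of a product is the convolution of the Fourier transforms. -/
theorem fourier_mul (f g h : C2) (hF : Integrable (𝓕 f : C2) volume)
    (hh : ∀ᵐ x, h x = f x * g x) : (𝓕 h : C2) =ᵐ[volume] conv (𝓕 f : C2) (𝓕 g : C2) := by
  refine ae_eq_of_schwartz (locallyIntegrable_of_memLp (Lp.memLp _))
    (locallyIntegrable_of_memLp (memLp_conv hF (Lp.memLp _))) fun φ => ?_
  have hu : Integrable (fun x => 𝓕 φ x * g x) volume :=
    MemLp.integrable_mul (p := 2) (q := 2) ((𝓕 φ).memLp 2) (Lp.memLp g)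
  rw [integral_smul_fourier]
  -- Only f is expanded by Fourier inversion, since only its transform is assumed integrable; g is
  -- handled by duality for each fixed η.
  calc ∫ x, 𝓕 φ x * h x
      = ∫ x, (𝓕 φ x * g x) * ∫ η, chr η x * (𝓕 f : C2) η := by
        refine integral_congr_ae ?_
        filter_upwards [hh, ae_eq_inversion f hF] with x h1 h2
        rw [h1, ← h2]; ring
    _ = ∫ η, (𝓕 f : C2) η * ∫ x, chr η x * (𝓕 φ x * g x) :=
        integral_char_swap hu hF
    _ = ∫ η, ∫ ξ, φ ξ * ((𝓕 f : C2) η * (𝓕 g : C2) (ξ - η)) := by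
        refine integral_congr_ae (Filter.Eventually.of_forall fun η => ?_)
        dsimp only
        have := integral_smul_fourier g (SchwartzMap.compSubConstCLM ℝ (-η) φ)
        simp only [fourier_translate, mul_assoc] at this
        rw [← this, ← integral_sub_right_eq_self _ η, ← integral_const_mul]
        refine integral_congr_ae (Filter.Eventually.of_forall fun ξ => ?_)
        simp only [SchwartzMap.compSubConstCLM_apply, sub_neg_eq_add, sub_add_cancel]
        ring
    _ = ∫ ξ, ∫ η, φ ξ * ((𝓕 f : C2) η * (𝓕 g : C2) (ξ - η)) :=
        (integral_integral_swap (integrable_mul_conv (φ.memLp 2) hF (Lp.memLp _))).symm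
    _ = _ := by
        refine integral_congr_ae (Filter.Eventually.of_forall fun ξ => ?_)
        dsimp only
        rw [integral_const_mul]; rfl

/-- Products of real functions, one of which has integrable Fourier transform. -/
theorem exists_mul_eq (f g : L2) (hf : Integrable (hat f) volume) :
    ∃ h : L2, (∀ᵐ x, h x = f x * g x) ∧ hat h =ᵐ[volume] conv (hat f) (hat g) := by
  have hinv := ae_eq_inversion (toComplex f) hf
  have hbd : ∀ᵐ x, ‖f x‖ ≤ ∫ η, ‖hat f η‖ := by
    filter_upwards [hinv, coeFn_toComplex f] with x h1 h2
    rw [← Complex.norm_real, ← h2, h1]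
    refine (norm_integral_le_integral_norm _).trans (le_of_eq ?_)
    simp; rfl
  have hL : MemLp (fun x => f x * g x) 2 volume :=
    (Lp.memLp g).mul (p := ⊤) (memLp_top_of_bound (Lp.aestronglyMeasurable f) _ hbd)
  refine ⟨hL.toLp, hL.coeFn_toLp, ?_⟩
  refine fourier_mul (toComplex f) (toComplex g) (toComplex hL.toLp) hf ?_
  filter_upwards [coeFn_toComplex f, coeFn_toComplex g, coeFn_toComplex hL.toLp, hL.coeFn_toLp]
    with x h1 h2 h3 h4
  rw [h1, h2, h3, h4]; push_cast; rfl

/-! ### Comparison of weights; derivatives as Fourier multipliers. -/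

section WeightedNorms

variable {w v : ℝ → ℝ} {f g : Plane → ℂ}

theorem N2_congr (h : f =ᵐ[volume] g) : N2 w f = N2 w g :=
  eLpNorm_congr_ae (by filter_upwards [h] with ξ h; rw [wt, wt, h])

theorem N2_le_of_le {C : ℝ≥0} (h : ∀ᵐ ξ, |w (jb ξ)| * ‖f ξ‖ ≤ C * (|v (jb ξ)| * ‖g ξ‖)) :
    N2 w f ≤ C * N2 v g := by
  have := eLpNorm_le_nnreal_smul_eLpNorm_of_ae_le_mul (μ := volume) (f := wt w f) (g := wt v g)
    (c := C) (by
      filter_upwards [h] with ξ h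
      rw [← NNReal.coe_le_coe]
      simpa [wt] using h) 2
  simpa [N2, ENNReal.smul_def] using this

theorem N2_mono (h : ∀ x, 1 ≤ x → |w x| ≤ |v x|) (f : Plane → ℂ) : N2 w f ≤ N2 v f := by
  have := N2_le_of_le (w := w) (v := v) (f := f) (g := f) (C := 1)
    (Filter.Eventually.of_forall fun ξ => by
      have := h _ (one_le_jb ξ)
      rw [NNReal.coe_one, one_mul]; gcongr)
  simpa using this

theorem N2_rpow_mono {α β : ℝ} (h : α ≤ β) (f : Plane → ℂ) :
    N2 (fun x => x ^ α) f ≤ N2 (fun x => x ^ β) f := by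
  refine N2_mono (fun x hx => ?_) f
  rw [abs_of_nonneg (by positivity), abs_of_nonneg (by positivity)]
  exact Real.rpow_le_rpow_of_exponent_le hx h

theorem memLp_wt (hw : Measurable w) (hf : AEStronglyMeasurable f volume) (h : N2 w f < ⊤) :
    MemLp (wt w f) 2 volume := ⟨aesm_wt hw hf, h⟩

theorem eLpNorm_eq_N2 (f : Plane → ℂ) : eLpNorm f 2 volume = N2 (fun _ => 1) f := by
  rw [N2]; congr 1; funext ξ; simp [wt]

theorem eLpNorm_le_N2 {k : ℝ} (hk : 0 ≤ k) (f : Plane → ℂ) :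
    eLpNorm f 2 volume ≤ N2 (fun x => x ^ k) f := by
  rw [eLpNorm_eq_N2]
  refine N2_mono (fun x hx => ?_) f
  rw [abs_one, abs_of_nonneg (by positivity)]
  exact Real.one_le_rpow hx hk

theorem N2_sub_le (hw : Measurable w) (hf : AEStronglyMeasurable f volume)
    (hg : AEStronglyMeasurable g volume) : N2 w (fun ξ => f ξ - g ξ) ≤ N2 w f + N2 w g := by
  refine le_trans (le_of_eq ?_) (eLpNorm_sub_le (aesm_wt hw hf) (aesm_wt hw hg) (by norm_num))
  rw [N2]; congr 1; funext ξ; simp [wt]; ring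

end WeightedNorms

theorem measurable_rpow_const (σ : ℝ) : Measurable fun x : ℝ => x ^ σ := by fun_prop

theorem hat_weakDeriv {f : L2} (h : N2 (fun x => x ^ (1 : ℝ)) (hat f) < ⊤) (i : Fin 2) :
    hat (weakDeriv i f) =ᵐ[volume] fun ξ => 2 * Real.pi * Complex.I * (ξ i : ℂ) * hat f ξ := by
  have hm : MemLp (fun ξ : Plane => 2 * Real.pi * Complex.I * (ξ i : ℂ) * hat f ξ) 2 volume := by
    refine MemLp.of_le_mul (c := 2 * Real.pi)
      (memLp_wt (measurable_rpow_const 1) (aesm_hat f) h) ?_ ?_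
    · refine AEStronglyMeasurable.mul (Continuous.aestronglyMeasurable ?_) (aesm_hat f)
      fun_prop
    · refine Filter.Eventually.of_forall fun ξ => ?_
      have h1 : |ξ i| ≤ jb ξ := (PiLp.norm_apply_le ξ i).trans (norm_le_jb ξ)
      simp only [wt, norm_mul, Complex.norm_real, Real.rpow_one, Real.norm_eq_abs, Complex.norm_I,
        abs_of_pos (jb_pos ξ), abs_of_pos Real.pi_pos, Complex.norm_ofNat, mul_one]
      rw [mul_assoc]
      gcongr
  obtain ⟨g, hg⟩ := exists_multiplier (m := fun ξ : Plane => 2 * Real.pi * Complex.I * (ξ i : ℂ))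
    (fun ξ => by
      simp only [map_mul, Complex.conj_I, Complex.conj_ofReal, map_ofNat, PiLp.neg_apply]
      push_cast; ring) hm
  rwa [(isWeakDeriv_of_hat hg).weakDeriv_eq]

theorem N2_hat_weakDeriv_le {f : L2} (h : N2 (fun x => x ^ (1 : ℝ)) (hat f) < ⊤) (i : Fin 2)
    (k : ℝ) : N2 (fun x => x ^ k) (hat (weakDeriv i f)) ≤
      (Real.toNNReal (2 * Real.pi)) * N2 (fun x => x ^ (k + 1)) (hat f) := by
  refine N2_le_of_le ?_
  filter_upwards [hat_weakDeriv h i] with ξ hξ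
  have h1 : |ξ i| ≤ jb ξ := (PiLp.norm_apply_le ξ i).trans (norm_le_jb ξ)
  have h0 := jb_pos ξ
  rw [hξ, Real.rpow_add_one h0.ne']
  simp only [norm_mul, Complex.norm_real, Real.norm_eq_abs, Complex.norm_I, abs_mul,
        abs_of_pos (jb_pos ξ), abs_of_pos Real.pi_pos, Complex.norm_ofNat, mul_one,
        Real.coe_toNNReal (2 * Real.pi) (by positivity)]
  calc |jb ξ ^ k| * (2 * Real.pi * |ξ i| * ‖hat f ξ‖)
      = 2 * Real.pi * (|jb ξ ^ k| * |ξ i| * ‖hat f ξ‖) := by ring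
    _ ≤ _ := by gcongr

/-- The constant `4π²`. -/
def kap : ℝ := 4 * Real.pi ^ 2

theorem kap_pos : 0 < kap := by unfold kap; positivity

theorem hat_lap {f : L2} (h : N2 (fun x => x ^ (2 : ℝ)) (hat f) < ⊤) :
    hat (lap f) =ᵐ[volume] fun ξ => -((kap * ‖ξ‖ ^ 2 : ℝ) : ℂ) * hat f ξ := by
  have h1 : N2 (fun x => x ^ (1 : ℝ)) (hat f) < ⊤ :=
    lt_of_le_of_lt (N2_rpow_mono (by norm_num) _) h
  have h2 : ∀ i, N2 (fun x => x ^ (1 : ℝ)) (hat (weakDeriv i f)) < ⊤ := fun i => by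
    refine lt_of_le_of_lt (N2_hat_weakDeriv_le h1 i 1) (ENNReal.mul_lt_top ENNReal.coe_lt_top ?_)
    rwa [one_add_one_eq_two]
  filter_upwards [hat_add (dx (dx f)) (dy (dy f)), hat_weakDeriv h1 0, hat_weakDeriv h1 1,
    hat_weakDeriv (h2 0) 0, hat_weakDeriv (h2 1) 1] with ξ e1 e2 e3 e4 e5
  rw [lap, e1, e4, e5, e2, e3]
  have : ‖ξ‖ ^ 2 = ξ 0 ^ 2 + ξ 1 ^ 2 := by
    rw [EuclideanSpace.norm_sq_eq]; simp
  rw [this, kap]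
  push_cast
  linear_combination (4 * Real.pi ^ 2 * (ξ 0 ^ 2 + ξ 1 ^ 2) * hat f ξ : ℂ) * Complex.I_sq

/-! ### The Jacobian and the system on the Fourier side. -/

/-- The two-dimensional cross product. -/
def cross (p q : Plane) : ℝ := p 0 * q 1 - p 1 * q 0

theorem abs_cross_le (p q : Plane) : |cross p q| ≤ ‖p‖ * ‖q‖ := by
  have h1 : ‖p‖ ^ 2 = p 0 ^ 2 + p 1 ^ 2 := by rw [EuclideanSpace.norm_sq_eq]; simp
  have h2 : ‖q‖ ^ 2 = q 0 ^ 2 + q 1 ^ 2 := by rw [EuclideanSpace.norm_sq_eq]; simp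
  refine abs_le_of_sq_le_sq ?_ (by positivity)
  rw [mul_pow, h1, h2, cross]
  nlinarith [sq_nonneg (p 0 * q 0 + p 1 * q 1)]

/-- The Jacobian `f_x g_y - f_y g_x` on the Fourier side, divided by `-4π²`. -/
def Jc (f g : Plane → ℂ) (ξ : Plane) : ℂ := ∫ η, (cross η (ξ - η) : ℂ) * (f η * g (ξ - η))

/-- Multiplication by `|ξ|²`. -/
def sqm (f : Plane → ℂ) (ξ : Plane) : ℂ := ((‖ξ‖ ^ 2 : ℝ) : ℂ) * f ξ

theorem aesm_sqm {f : Plane → ℂ} (hf : AEStronglyMeasurable f volume) :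
    AEStronglyMeasurable (sqm f) volume :=
  (Continuous.aestronglyMeasurable (by fun_prop)).mul hf

theorem N2_sqm_le (k : ℝ) (f : Plane → ℂ) :
    N2 (fun x => x ^ k) (sqm f) ≤ N2 (fun x => x ^ (k + 2)) f := by
  have := N2_le_of_le (w := fun x => x ^ k) (v := fun x => x ^ (k + 2)) (f := sqm f) (g := f)
    (C := 1) (Filter.Eventually.of_forall fun ξ => ?_)
  · simpa using this
  have h0 := jb_pos ξ
  have h1 := norm_le_jb ξ
  rw [sqm, norm_mul, Complex.norm_real, Real.rpow_add h0, NNReal.coe_one, one_mul, abs_mul]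
  norm_num
  rw [mul_assoc]
  gcongr

theorem ae_integrable_conv {f g : Plane → ℂ} (hf : Integrable f volume) (hg : MemLp g 2 volume) :
    ∀ᵐ ξ, Integrable (fun η => f η * g (ξ - η)) volume := by
  have hm : AEStronglyMeasurable (fun z : Plane × Plane => f z.2 * g (z.1 - z.2))
      (volume.prod volume) := (hf.1.comp_snd).mul (aesm_sub hg.1)
  have h2 : AEMeasurable (fun ξ => ∫⁻ η, ‖f η‖ₑ * ‖g (ξ - η)‖ₑ) volume := by
    have := hm.enorm.lintegral_prod_right'
    simpa only [enorm_mul] using this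
  have h1 : ∀ᵐ ξ, (∫⁻ η, ‖f η‖ₑ * ‖g (ξ - η)‖ₑ) ^ 2 < ⊤ := by
    refine ae_lt_top' (h2.pow_const 2) (ne_of_lt
      (lt_of_le_of_lt (lintegral_young hf.1.enorm hg.1.enorm) ?_))
    refine ENNReal.mul_lt_top (ENNReal.pow_lt_top hf.2) ?_
    rw [← eLpNorm_two_sq]; exact ENNReal.pow_lt_top hg.2
  filter_upwards [h1, hm.prodMk_left] with ξ h3 h4
  refine ⟨h4, ?_⟩
  rw [hasFiniteIntegral_iff_enorm]
  simp_rw [enorm_mul]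
  by_contra hcon
  rw [not_lt, top_le_iff] at hcon
  rw [hcon] at h3
  simp at h3

theorem integrable_wt {w : ℝ → ℝ} (hw : Measurable w) {f : Plane → ℂ}
    (hf : AEStronglyMeasurable f volume) (h : N1 w f < ⊤) : Integrable (wt w f) volume :=
  ⟨aesm_wt hw hf, h⟩

/-- The integrand of `Jc f g` is integrable when `⟨ξ⟩ f ∈ L¹` and `⟨ξ⟩ g ∈ L²`. -/
theorem ae_integrable_Jc {f g : Plane → ℂ} (hf : AEStronglyMeasurable f volume)
    (hg : AEStronglyMeasurable g volume) (h1 : N1 (fun x => x ^ (1 : ℝ)) f < ⊤)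
    (h2 : N2 (fun x => x ^ (1 : ℝ)) g < ⊤) :
    ∀ᵐ ξ, Integrable (fun η => (cross η (ξ - η) : ℂ) * (f η * g (ξ - η))) volume := by
  have hm : AEStronglyMeasurable (fun z : Plane × Plane =>
      (cross z.2 (z.1 - z.2) : ℂ) * (f z.2 * g (z.1 - z.2))) (volume.prod volume) := by
    refine AEStronglyMeasurable.mul (Continuous.aestronglyMeasurable ?_)
      ((hf.comp_snd).mul (aesm_sub hg))
    unfold cross; fun_prop
  filter_upwards [ae_integrable_conv (integrable_wt (measurable_rpow_const 1) hf h1)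
    (memLp_wt (measurable_rpow_const 1) hg h2), hm.prodMk_left] with ξ h3 h4
  refine h3.mono h4 (Filter.Eventually.of_forall fun η => ?_)
  simp only [norm_mul, wt, Complex.norm_real, Real.rpow_one, Real.norm_eq_abs,
    abs_of_pos (jb_pos _)]
  have e : |cross η (ξ - η)| ≤ jb η * jb (ξ - η) :=
    (abs_cross_le _ _).trans (mul_le_mul (norm_le_jb _) (norm_le_jb _) (norm_nonneg _)
      (jb_pos _).le)
  calc _ ≤ jb η * jb (ξ - η) * (‖f η‖ * ‖g (ξ - η)‖) := by gcongr
    _ = _ := by ring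

theorem N1_finite {s : ℝ} (hs : 2 < s) {f : Plane → ℂ} (hf : AEStronglyMeasurable f volume)
    (h : N2 (fun x => x ^ s) f < ⊤) : N1 (fun x => x ^ (1 : ℝ)) f < ⊤ := by
  obtain ⟨C, hC⟩ := N1_le_N2 (σ := s - 1) (by linarith)
  refine lt_of_le_of_lt (hC hf 1) (ENNReal.mul_lt_top ENNReal.coe_lt_top ?_)
  rwa [show 1 + (s - 1) = s by ring]

/-- Right-hand side of the equation for `a` on the Fourier side. -/
def rhsA (μ : ℝ) (f g : Plane → ℂ) (ξ : Plane) : ℂ :=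
  -(kap : ℂ) * Jc f g ξ - ((μ * kap * ‖ξ‖ ^ 2 : ℝ) : ℂ) * f ξ

/-- Right-hand side of the equation for `b` on the Fourier side. -/
def rhsB (ν : ℝ) (f g : Plane → ℂ) (ξ : Plane) : ℂ :=
  -((kap ^ 2 : ℝ) : ℂ) * Jc f (sqm f) ξ - ((ν * kap * ‖ξ‖ ^ 2 : ℝ) : ℂ) * g ξ

/-- The Jacobian of two real functions and its Fourier transform. -/
theorem exists_jacobian {s : ℝ} (hs : 2 < s) {f g : L2} (hf : N2 (fun x => x ^ s) (hat f) < ⊤)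
    (hg : N2 (fun x => x ^ (1 : ℝ)) (hat g) < ⊤) :
    ∃ h : L2, (∀ᵐ p, h p = dx f p * dy g p - dy f p * dx g p) ∧
      hat h =ᵐ[volume] fun ξ => -(kap : ℂ) * Jc (hat f) (hat g) ξ := by
  have hf1 : N2 (fun x => x ^ (1 : ℝ)) (hat f) < ⊤ :=
    lt_of_le_of_lt (N2_rpow_mono (by linarith) _) hf
  -- A derivative of f lies in H^{s-1}, and s − 1 > 1 makes its transform integrable, as
  -- `exists_mul_eq` requires of the first factor.
  have hd : ∀ i, Integrable (hat (weakDeriv i f)) volume := fun i => by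
    have h1 : N2 (fun x => x ^ (s - 1)) (hat (weakDeriv i f)) < ⊤ := by
      refine lt_of_le_of_lt (N2_hat_weakDeriv_le hf1 i (s - 1)) (ENNReal.mul_lt_top ENNReal.coe_lt_top ?_)
      simpa using hf
    obtain ⟨C, hC⟩ := N1_le_N2 (σ := s - 1) (by linarith)
    have h2 := lt_of_le_of_lt (hC (aesm_hat (weakDeriv i f)) 0)
      (ENNReal.mul_lt_top ENNReal.coe_lt_top (by simpa using h1))
    have := integrable_wt (measurable_rpow_const 0) (aesm_hat (weakDeriv i f)) h2
    refine this.congr (Filter.Eventually.of_forall fun ξ => ?_)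
    simp [wt]
  obtain ⟨h1, hp1, hc1⟩ := exists_mul_eq (dx f) (dy g) (hd 0)
  obtain ⟨h2, hp2, hc2⟩ := exists_mul_eq (dy f) (dx g) (hd 1)
  refine ⟨h1 - h2, ?_, ?_⟩
  · filter_upwards [Lp.coeFn_sub h1 h2, hp1, hp2] with p e1 e2 e3
    rw [e1, Pi.sub_apply, e2, e3]
  · have q : ∀ ξ : Plane, Filter.Tendsto (fun η => ξ - η) (ae volume) (ae volume) :=
      fun ξ => (quasiMeasurePreserving_sub_left volume ξ).tendsto_ae
    filter_upwards [hat_sub h1 h2, hc1, hc2, ae_integrable_conv (hd 0) (memLp_hat (dy g)),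
      ae_integrable_conv (hd 1) (memLp_hat (dx g))] with ξ e1 e2 e3 i1 i2
    rw [e1, e2, e3, conv, conv, ← integral_sub i1 i2, Jc, ← integral_const_mul]
    refine integral_congr_ae ?_
    filter_upwards [hat_weakDeriv hf1 0, hat_weakDeriv hf1 1, (q ξ).eventually (hat_weakDeriv hg 0),
      (q ξ).eventually (hat_weakDeriv hg 1)] with η d1 d2 d3 d4
    rw [d1, d2, d3, d4, cross, kap]
    push_cast
    linear_combination (4 * Real.pi ^ 2 * (η 0 * (ξ - η) 1 - η 1 * (ξ - η) 0) * hat f η *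
      hat g (ξ - η) : ℂ) * Complex.I_sq

/-- The same G satisfies the equation pointwise and has the Fourier transform `rhsA`; with
`exists_rhsB` this is the passage from the differential equations to the Fourier side. -/
theorem exists_rhsA {s : ℝ} (hs : 2 < s) (μ : ℝ) {a b : L2} (ha : MemH (s + 1) a)
    (hb : MemH s b) : ∃ G : L2,
      (∀ᵐ p, G p + dy a p * dx b p - dx a p * dy b p = μ * lap a p) ∧
      hat G =ᵐ[volume] rhsA μ (hat a) (hat b) := by
  rw [MemH, sobolevNorm_eq] at ha hb
  have ha2 := lt_of_le_of_lt (N2_rpow_mono (show (2 : ℝ) ≤ s + 1 by linarith) _) ha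
  obtain ⟨h, hp, hh⟩ := exists_jacobian hs
    (lt_of_le_of_lt (N2_rpow_mono (by linarith) _) ha)
    (lt_of_le_of_lt (N2_rpow_mono (by linarith) _) hb)
  refine ⟨h + μ • lap a, ?_, ?_⟩
  · filter_upwards [hp, Lp.coeFn_add h (μ • lap a), Lp.coeFn_smul μ (lap a)] with p e1 e2 e3
    rw [e2, Pi.add_apply, e3, e1, Pi.smul_apply, smul_eq_mul]; ring
  · filter_upwards [hh, hat_add h (μ • lap a), hat_smul μ (lap a), hat_lap ha2] with ξ e1 e2 e3 e4
    rw [e2, e3, e4, e1, rhsA]; push_cast; ring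

theorem exists_rhsB {s : ℝ} (hs : 2 < s) (ν : ℝ) {a b : L2} (ha : MemH (s + 1) a)
    (hb : MemH s b) : ∃ G : L2,
      (∀ᵐ p, G p - dy a p * dx (lap a) p + dx a p * dy (lap a) p = ν * lap b p) ∧
      hat G =ᵐ[volume] rhsB ν (hat a) (hat b) := by
  rw [MemH, sobolevNorm_eq] at ha hb
  have ha2 := lt_of_le_of_lt (N2_rpow_mono (show (2 : ℝ) ≤ s + 1 by linarith) _) ha
  have hb2 := lt_of_le_of_lt (N2_rpow_mono (show (2 : ℝ) ≤ s by linarith) _) hb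
  -- The Laplacian of a still has one derivative in L², because s + 1 > 3.
  have hl : N2 (fun x => x ^ (1 : ℝ)) (hat (lap a)) < ⊤ := by
    refine lt_of_le_of_lt (b := (Real.toNNReal kap) * N2 (fun x => x ^ (3 : ℝ)) (hat a)) ?_
      (ENNReal.mul_lt_top ENNReal.coe_lt_top (lt_of_le_of_lt (N2_rpow_mono (by linarith) _) ha))
    refine N2_le_of_le ?_
    filter_upwards [hat_lap ha2] with ξ h
    have h0 := jb_pos ξ
    have h1 := norm_le_jb ξ
    have h3 : jb ξ ^ (3 : ℝ) = jb ξ * jb ξ ^ 2 := by norm_cast; ring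
    rw [h, norm_mul, norm_neg, Complex.norm_real, Real.norm_eq_abs, Real.coe_toNNReal _ kap_pos.le,
      abs_of_nonneg (mul_nonneg kap_pos.le (sq_nonneg _)), Real.rpow_one, h3,
      abs_of_pos h0, abs_of_pos (by positivity)]
    calc jb ξ * (kap * ‖ξ‖ ^ 2 * ‖hat a ξ‖) = kap * (jb ξ * ‖ξ‖ ^ 2 * ‖hat a ξ‖) := by ring
      _ ≤ _ := by have := kap_pos; gcongr
  obtain ⟨h, hp, hh⟩ := exists_jacobian hs
    (lt_of_le_of_lt (N2_rpow_mono (by linarith) _) ha) hl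
  refine ⟨ν • lap b - h, ?_, ?_⟩
  · filter_upwards [hp, Lp.coeFn_sub (ν • lap b) h, Lp.coeFn_smul ν (lap b)] with p e1 e2 e3
    rw [e2, Pi.sub_apply, e3, e1, Pi.smul_apply, smul_eq_mul]; ring
  · have q : ∀ ξ : Plane, Filter.Tendsto (fun η => ξ - η) (ae volume) (ae volume) :=
      fun ξ => (quasiMeasurePreserving_sub_left volume ξ).tendsto_ae
    filter_upwards [hh, hat_sub (ν • lap b) h, hat_smul ν (lap b), hat_lap hb2]
      with ξ e1 e2 e3 e4
    rw [e2, e3, e4, e1, rhsB]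
    have : Jc (hat a) (hat (lap a)) ξ = -(kap : ℂ) * Jc (hat a) (sqm (hat a)) ξ := by
      rw [Jc, Jc, ← integral_const_mul]
      refine integral_congr_ae ?_
      filter_upwards [(q ξ).eventually (hat_lap ha2)] with η hη
      rw [hη, sqm]; push_cast; ring
    rw [this]; push_cast; ring

/-! ### Admissible weights and the symbol of the energy identity. -/

/-- Admissible weights: positive, nondecreasing, and growing at most like `x ^ k` in the sense
that `w x / x ^ k` is nonincreasing. -/
structure IsWt (k : ℝ) (w : ℝ → ℝ) : Prop where
  meas : Measurable w
  pos : ∀ x, 1 ≤ x → 0 < w x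
  mono : ∀ x y, 1 ≤ x → x ≤ y → w x ≤ w y
  growth : ∀ x y, 1 ≤ x → x ≤ y → w y * x ^ k ≤ w x * y ^ k

namespace IsWt

variable {k : ℝ} {w : ℝ → ℝ} (h : IsWt k w)
include h

theorem le_two_rpow (hk : 0 ≤ k) {x y : ℝ} (hx : 1 ≤ x) (hxy : x ≤ y) (hy : y ≤ 2 * x) :
    w y ≤ 2 ^ k * w x := by
  have h1 := h.growth x y hx hxy
  have h2 : y ^ k ≤ 2 ^ k * x ^ k := by
    rw [← Real.mul_rpow (by norm_num) (by linarith)]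
    exact Real.rpow_le_rpow (by linarith) hy hk
  have h3 : 0 < x ^ k := by positivity
  have h4 := h.pos x hx
  have : w y * x ^ k ≤ (2 ^ k * w x) * x ^ k := by nlinarith
  exact le_of_mul_le_mul_right this h3

/-- Slow variation, an integrated form of x w′ ≤ k w. Bernoulli's inequality (x/y)^{2k} ≥ 1 + 2k(x/y
− 1), multiplied by w(y)², turns the growth condition into a bound on a difference. -/
theorem sq_sub_le (hk : 1 ≤ k) {x y : ℝ} (hx : 1 ≤ x) (hxy : x ≤ y) :
    y * (w y ^ 2 - w x ^ 2) ≤ 2 * k * w y ^ 2 * (y - x) := by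
  have hy : 0 < y := by linarith
  have h1 := h.growth x y hx hxy
  have h2 : w y * (x / y) ^ k ≤ w x := by
    rw [Real.div_rpow (by linarith) hy.le, mul_div_assoc', div_le_iff₀ (by positivity)]
    exact h1
  have h3 : 1 + (2 * k) * (x / y - 1) ≤ (1 + (x / y - 1)) ^ (2 * k) :=
    one_add_mul_self_le_rpow_one_add (by
      have : 0 ≤ x / y := by positivity
      linarith) (by linarith)
  have h4 : (1 + (x / y - 1)) ^ (2 * k) = ((x / y) ^ k) ^ 2 := by
    rw [add_sub_cancel, ← Real.rpow_natCast, ← Real.rpow_mul (by positivity)]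
    congr 1; push_cast; ring
  have h5 : (w y * (x / y) ^ k) ^ 2 ≤ w x ^ 2 := by
    have : 0 ≤ w y * (x / y) ^ k := mul_nonneg (h.pos y (by linarith)).le (by positivity)
    gcongr
  rw [h4] at h3
  have h6 : w y ^ 2 * (1 + 2 * k * (x / y - 1)) ≤ w x ^ 2 := by
    refine le_trans ?_ h5
    rw [mul_pow]
    exact mul_le_mul_of_nonneg_left h3 (sq_nonneg _)
  have h7 : y * (w y ^ 2 * (1 + 2 * k * (x / y - 1))) =
      y * w y ^ 2 + 2 * k * w y ^ 2 * (x - y) := by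
    field_simp
  nlinarith [mul_le_mul_of_nonneg_left h6 hy.le]

end IsWt

/-- The constant in the symbol estimate. -/
def symC (k : ℝ) : ℝ := (4 + 2 * k) * (2 ^ k * 2 ^ k)

theorem symC_pos {k : ℝ} (hk : 1 ≤ k) : 0 < symC k := by unfold symC; positivity

/-- Here z is the lowest frequency, y − x ≤ z and y ≤ 2x. The bracket is x²(w(x)² − w(y)²) − (y² −
x²)(w(y)² − w(z)²), and both terms gain a factor y − x ≤ z, the first by slow variation. The second
factor z comes from c ≤ x z. -/
theorem symbol_le_of_low {k : ℝ} {w : ℝ → ℝ} (h : IsWt k w) (hk : 1 ≤ k) {x y z c : ℝ}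
    (hz : 1 ≤ z) (hzx : z ≤ x) (hxy : x ≤ y) (hyz : y ≤ x + z) (hc : c ≤ x * z) :
    c * |x ^ 2 * (w x ^ 2 - w z ^ 2) - y ^ 2 * (w y ^ 2 - w z ^ 2)| ≤
      symC k * (z ^ 2 * (x * w x) * (y * w y)) := by
  have hx : 1 ≤ x := by linarith
  have hy0 : 0 < y := by linarith
  have hz0 : 0 < z := by linarith
  have wx := h.pos x hx
  have wy := h.pos y (by linarith)
  have wz := h.pos z hz
  have m1 := h.mono z x hz hzx
  have m2 := h.mono x y hx hxy
  have d1 := h.sq_sub_le hk hx hxy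
  have d2 := h.le_two_rpow (by linarith) hx hxy (by linarith)
  have p2 : (1 : ℝ) ≤ 2 ^ k := Real.one_le_rpow (by norm_num) (by linarith)
  have e1 : |x ^ 2 * (w x ^ 2 - w z ^ 2) - y ^ 2 * (w y ^ 2 - w z ^ 2)| ≤
      (4 + 2 * k) * (z * y * w y ^ 2) := by
    have a1 : x ^ 2 * (w y ^ 2 - w x ^ 2) ≤ 2 * k * (z * y * w y ^ 2) := by
      calc x ^ 2 * (w y ^ 2 - w x ^ 2) ≤ y * (y * (w y ^ 2 - w x ^ 2)) := by
            have : 0 ≤ w y ^ 2 - w x ^ 2 := by nlinarith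
            rw [← mul_assoc]
            exact mul_le_mul_of_nonneg_right (by nlinarith) this
        _ ≤ y * (2 * k * w y ^ 2 * (y - x)) := by gcongr
        _ ≤ y * (2 * k * w y ^ 2 * z) := by gcongr; linarith
        _ = _ := by ring
    have a2 : (y ^ 2 - x ^ 2) ≤ 2 * (z * y) := by nlinarith
    have a3 : 0 ≤ y ^ 2 - x ^ 2 := by nlinarith
    have a4 : w z ^ 2 ≤ w y ^ 2 := by gcongr; linarith
    have a5 : 0 ≤ x ^ 2 * (w y ^ 2 - w x ^ 2) := by
      have : 0 ≤ w y ^ 2 - w x ^ 2 := by nlinarith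
      positivity
    have a6 : (y ^ 2 - x ^ 2) * w y ^ 2 ≤ 2 * (z * y) * w y ^ 2 := by gcongr
    have a7 : (y ^ 2 - x ^ 2) * w z ^ 2 ≤ (y ^ 2 - x ^ 2) * w y ^ 2 := by gcongr
    have a8 : 0 ≤ (y ^ 2 - x ^ 2) * w z ^ 2 := by positivity
    have a9 : 0 ≤ (y ^ 2 - x ^ 2) * w y ^ 2 := by positivity
    rw [abs_le]
    constructor <;> nlinarith
  have e2 : w y ^ 2 ≤ (2 ^ k * 2 ^ k) * (w x * w y) := by
    have : w y ≤ (2 ^ k * 2 ^ k) * w x := d2.trans (by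
      have : 0 ≤ 2 ^ k * w x := by positivity
      nlinarith)
    nlinarith
  calc c * |x ^ 2 * (w x ^ 2 - w z ^ 2) - y ^ 2 * (w y ^ 2 - w z ^ 2)|
      ≤ (x * z) * ((4 + 2 * k) * (z * y * ((2 ^ k * 2 ^ k) * (w x * w y)))) := by
        gcongr
        exact e1.trans (by gcongr)
    _ = _ := by rw [symC]; ring

/-- Now x is the lowest frequency, y and z are comparable and |y − z| ≤ x. The first term of the
bracket has the factor x² outright; in the second, slow variation of w between y and z gains |y − z|
≤ x. The other factor x comes from c ≤ x z. -/
theorem symbol_le_of_high {k : ℝ} {w : ℝ → ℝ} (h : IsWt k w) (hk : 1 ≤ k) {x y z c : ℝ}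
    (hx : 1 ≤ x) (hxz : x ≤ z) (hxy : x ≤ y) (hyz : y ≤ x + z) (hzy : z ≤ x + y)
    (hc : c ≤ x * z) :
    c * |x ^ 2 * (w x ^ 2 - w z ^ 2) - y ^ 2 * (w y ^ 2 - w z ^ 2)| ≤
      symC k * (x ^ 2 * (y * w y) * (z * w z)) := by
  have hy : 1 ≤ y := by linarith
  have hz : 1 ≤ z := by linarith
  have wx := h.pos x hx
  have wy := h.pos y hy
  have wz := h.pos z hz
  have m1 := h.mono x z hx hxz
  have p2 : (1 : ℝ) ≤ 2 ^ k := Real.one_le_rpow (by norm_num) (by linarith)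
  have b1 : w z ≤ 2 ^ k * w y := by
    rcases le_total y z with hh | hh
    · exact h.le_two_rpow (by linarith) hy hh (by linarith)
    · have := h.mono z y hz hh; nlinarith
  have b2 : w y ≤ 2 ^ k * w z := by
    rcases le_total z y with hh | hh
    · exact h.le_two_rpow (by linarith) hz hh (by linarith)
    · have := h.mono y z hy hh; nlinarith
  have q1 : w z ^ 2 ≤ (2 ^ k * 2 ^ k) * (w y * w z) := by
    have : w z ≤ (2 ^ k * 2 ^ k) * w y := b1.trans (by
      have : 0 ≤ 2 ^ k * w y := by positivity
      nlinarith)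
    nlinarith
  have q2 : w y ^ 2 ≤ (2 ^ k * 2 ^ k) * (w y * w z) := by
    have : w y ≤ (2 ^ k * 2 ^ k) * w z := b2.trans (by
      have : 0 ≤ 2 ^ k * w z := by positivity
      nlinarith)
    nlinarith
  set Q := (2 ^ k * 2 ^ k) * (w y * w z) with hQ
  have hQ0 : 0 < Q := by positivity
  have e0 : y * |w y ^ 2 - w z ^ 2| ≤ 2 * k * x * Q := by
    rcases le_total z y with hh | hh
    · have d := h.sq_sub_le hk hz hh
      have : 0 ≤ w y ^ 2 - w z ^ 2 := by have := h.mono z y hz hh; nlinarith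
      rw [abs_of_nonneg this]
      calc _ ≤ 2 * k * w y ^ 2 * (y - z) := d
        _ ≤ 2 * k * Q * x := by gcongr; linarith
        _ = _ := by ring
    · have d := h.sq_sub_le hk hy hh
      have : 0 ≤ w z ^ 2 - w y ^ 2 := by have := h.mono y z hy hh; nlinarith
      rw [abs_sub_comm, abs_of_nonneg this]
      calc y * (w z ^ 2 - w y ^ 2) ≤ z * (w z ^ 2 - w y ^ 2) := by gcongr
        _ ≤ 2 * k * w z ^ 2 * (z - y) := d
        _ ≤ 2 * k * Q * x := by gcongr; linarith
        _ = _ := by ring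
  have e1 : |x ^ 2 * (w x ^ 2 - w z ^ 2) - y ^ 2 * (w y ^ 2 - w z ^ 2)| ≤
      (4 + 2 * k) * (x * y * Q) := by
    have a1 : |x ^ 2 * (w x ^ 2 - w z ^ 2)| ≤ x * y * Q := by
      rw [abs_mul, abs_of_nonneg (sq_nonneg x), abs_sub_comm, abs_of_nonneg (by nlinarith)]
      calc x ^ 2 * (w z ^ 2 - w x ^ 2) ≤ x ^ 2 * Q := by gcongr; nlinarith
        _ ≤ _ := by rw [pow_two]; gcongr
    have a2 : |y ^ 2 * (w y ^ 2 - w z ^ 2)| ≤ 2 * k * (x * y * Q) := by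
      rw [abs_mul, abs_of_nonneg (sq_nonneg y)]
      calc y ^ 2 * |w y ^ 2 - w z ^ 2| = y * (y * |w y ^ 2 - w z ^ 2|) := by ring
        _ ≤ y * (2 * k * x * Q) := by gcongr
        _ = _ := by ring
    have a3 : 0 ≤ x * y * Q := by positivity
    have := abs_sub (x ^ 2 * (w x ^ 2 - w z ^ 2)) (y ^ 2 * (w y ^ 2 - w z ^ 2))
    linarith
  calc c * |x ^ 2 * (w x ^ 2 - w z ^ 2) - y ^ 2 * (w y ^ 2 - w z ^ 2)|
      ≤ (x * z) * ((4 + 2 * k) * (x * y * Q)) := by gcongr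
    _ = _ := by rw [symC, hQ]; ring

/-- The commutator structure of the system: the symmetrized energy symbol loses at most two
derivatives on the lowest frequency. -/
theorem symbol_cases {k : ℝ} {w : ℝ → ℝ} (h : IsWt k w) (hk : 1 ≤ k) {x y z c : ℝ}
    (hx : 1 ≤ x) (hy : 1 ≤ y) (hz : 1 ≤ z) (hxyz : x ≤ y + z) (hyxz : y ≤ x + z)
    (hzxy : z ≤ x + y) (hcxz : c ≤ x * z) (hcyz : c ≤ y * z) :
    let S := c * |x ^ 2 * (w x ^ 2 - w z ^ 2) - y ^ 2 * (w y ^ 2 - w z ^ 2)|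
    (z ≤ x ∧ z ≤ y ∧ S ≤ symC k * (z ^ 2 * (x * w x) * (y * w y))) ∨
    (x ≤ y ∧ x ≤ z ∧ S ≤ symC k * (x ^ 2 * (y * w y) * (z * w z))) ∨
    (y ≤ x ∧ y ≤ z ∧ S ≤ symC k * (y ^ 2 * (x * w x) * (z * w z))) := by
  intro S
  have hS : S = c * |y ^ 2 * (w y ^ 2 - w z ^ 2) - x ^ 2 * (w x ^ 2 - w z ^ 2)| := by
    rw [abs_sub_comm]
  rcases le_total x y with hxy | hxy
  · rcases le_total z x with hzx | hzx
    · exact Or.inl ⟨hzx, hzx.trans hxy, symbol_le_of_low h hk hz hzx hxy hyxz hcxz⟩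
    · exact Or.inr (Or.inl ⟨hxy, hzx, symbol_le_of_high h hk hx hzx hxy hyxz hzxy hcxz⟩)
  · rcases le_total z y with hzx | hzx
    · refine Or.inl ⟨hzx.trans hxy, hzx, ?_⟩
      rw [hS]
      exact (symbol_le_of_low h hk hz hzx hxy hxyz hcyz).trans (le_of_eq (by ring))
    · refine Or.inr (Or.inr ⟨hxy, hzx, ?_⟩)
      rw [hS]
      exact symbol_le_of_high h hk hy hzx hxy hxyz (by linarith) hcyz

/-- One summand for each choice of the lowest frequency; its square will be measured in L¹. For use
when b is dissipated: the slot z may carry z w(z). -/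
theorem symbol_bound_b {k : ℝ} {w : ℝ → ℝ} (h : IsWt k w) (hk : 1 ≤ k) {x y z c : ℝ}
    (hx : 1 ≤ x) (hy : 1 ≤ y) (hz : 1 ≤ z) (hxyz : x ≤ y + z) (hyxz : y ≤ x + z)
    (hzxy : z ≤ x + y) (hcxz : c ≤ x * z) (hcyz : c ≤ y * z) :
    c * |x ^ 2 * (w x ^ 2 - w z ^ 2) - y ^ 2 * (w y ^ 2 - w z ^ 2)| ≤
      symC k * ((x * w x) * (y * w y) * z ^ 2 + x ^ 2 * (y * w y) * (z * w z) +
        (x * w x) * y ^ 2 * (z * w z)) := by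
  have wx := h.pos x hx
  have wy := h.pos y hy
  have wz := h.pos z hz
  have hC := symC_pos hk
  have t1 : 0 ≤ (x * w x) * (y * w y) * z ^ 2 := by positivity
  have t2 : 0 ≤ x ^ 2 * (y * w y) * (z * w z) := by positivity
  have t3 : 0 ≤ (x * w x) * y ^ 2 * (z * w z) := by positivity
  rcases symbol_cases h hk hx hy hz hxyz hyxz hzxy hcxz hcyz with ⟨-, -, h1⟩ | ⟨-, -, h1⟩ |
    ⟨-, -, h1⟩
  all_goals
    refine h1.trans (mul_le_mul_of_nonneg_left ?_ hC.le)
    nlinarith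

/-- For use when a is dissipated: one power of z is traded for a power of x or y, by z ≤ y if z is
lowest and by z ≤ 2y or z ≤ 2x otherwise. The slot z then carries only z or w(z), and a slot of a
carries the dissipated weight x² w(x). -/
theorem symbol_bound_a {k : ℝ} {w : ℝ → ℝ} (h : IsWt k w) (hk : 1 ≤ k) {x y z c : ℝ}
    (hx : 1 ≤ x) (hy : 1 ≤ y) (hz : 1 ≤ z) (hxyz : x ≤ y + z) (hyxz : y ≤ x + z)
    (hzxy : z ≤ x + y) (hcxz : c ≤ x * z) (hcyz : c ≤ y * z) :
    c * |x ^ 2 * (w x ^ 2 - w z ^ 2) - y ^ 2 * (w y ^ 2 - w z ^ 2)| ≤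
      2 * symC k * ((x * w x) * (y ^ 2 * w y) * z + x ^ 2 * (y ^ 2 * w y) * w z +
        (x ^ 2 * w x) * y ^ 2 * w z) := by
  have wx := h.pos x hx
  have wy := h.pos y hy
  have wz := h.pos z hz
  have hC := symC_pos hk
  have t1 : 0 ≤ (x * w x) * (y ^ 2 * w y) * z := by positivity
  have t2 : 0 ≤ x ^ 2 * (y ^ 2 * w y) * w z := by positivity
  have t3 : 0 ≤ (x ^ 2 * w x) * y ^ 2 * w z := by positivity
  rw [mul_comm 2 (symC k), mul_assoc]
  rcases symbol_cases h hk hx hy hz hxyz hyxz hzxy hcxz hcyz with ⟨_, g2, h1⟩ | ⟨g1, _, h1⟩ |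
    ⟨g1, _, h1⟩
  · refine h1.trans (mul_le_mul_of_nonneg_left ?_ hC.le)
    have : z ^ 2 * (x * w x) * (y * w y) ≤ (x * w x) * (y ^ 2 * w y) * z := by
      calc z ^ 2 * (x * w x) * (y * w y) = (x * w x) * (z * y * w y) * z := by ring
        _ ≤ (x * w x) * (y * y * w y) * z := by gcongr
        _ = _ := by ring
    linarith
  · refine h1.trans (mul_le_mul_of_nonneg_left ?_ hC.le)
    have : x ^ 2 * (y * w y) * (z * w z) ≤ 2 * (x ^ 2 * (y ^ 2 * w y) * w z) := by
      calc x ^ 2 * (y * w y) * (z * w z) ≤ x ^ 2 * (y * w y) * ((2 * y) * w z) := by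
            gcongr; linarith
        _ = _ := by ring
    linarith
  · refine h1.trans (mul_le_mul_of_nonneg_left ?_ hC.le)
    have : y ^ 2 * (x * w x) * (z * w z) ≤ 2 * ((x ^ 2 * w x) * y ^ 2 * w z) := by
      calc y ^ 2 * (x * w x) * (z * w z) ≤ y ^ 2 * (x * w x) * ((2 * x) * w z) := by
            gcongr; linarith
        _ = _ := by ring
    linarith

theorem isWt_rpow {k s : ℝ} (hs : 0 ≤ s) (hk : s ≤ k) : IsWt k fun x => x ^ s where
  meas := measurable_rpow_const s
  pos x hx := by positivity
  mono x y hx hxy := Real.rpow_le_rpow (by linarith) hxy hs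
  growth x y hx hxy := by
    have hy : 0 < y := by linarith
    have hx0 : 0 < x := by linarith
    have e : ∀ t : ℝ, 0 < t → t ^ k = t ^ s * t ^ (k - s) := fun t ht => by
      rw [← Real.rpow_add ht]; congr 1; ring
    rw [e x hx0, e y hy]
    have : x ^ (k - s) ≤ y ^ (k - s) := Real.rpow_le_rpow hx0.le hxy (by linarith)
    calc y ^ s * (x ^ s * x ^ (k - s)) ≤ y ^ s * (x ^ s * y ^ (k - s)) := by gcongr
      _ = _ := by ring

/-- The weight `x ^ s min (1, x / N)`, which is small at frequencies below `N`. -/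
def tailW (s N : ℝ) (x : ℝ) : ℝ := x ^ s * min 1 (x / N)

/-- The growth exponent does not depend on `N`, so neither do the constants in the energy estimates
for these weights. -/
theorem isWt_tailW {s N : ℝ} (hs : 0 ≤ s) (hN : 0 < N) : IsWt (s + 1) (tailW s N) where
  meas := by unfold tailW; fun_prop
  pos x hx := by unfold tailW; positivity
  mono x y hx hxy := by
    unfold tailW
    have : x ^ s ≤ y ^ s := Real.rpow_le_rpow (by linarith) hxy hs
    have : 0 < y ^ s := Real.rpow_pos_of_pos (by linarith) s
    gcongr
  growth x y hx hxy := by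
    have hy : 0 < y := by linarith
    have hx0 : 0 < x := by linarith
    unfold tailW
    rw [Real.rpow_add_one hx0.ne', Real.rpow_add_one hy.ne']
    have : min 1 (y / N) * x ≤ min 1 (x / N) * y := by
      rcases le_total 1 (x / N) with h1 | h1
      · rw [min_eq_left h1]
        exact mul_le_mul (min_le_left _ _) hxy hx0.le zero_le_one
      · rw [min_eq_right h1]
        calc min 1 (y / N) * x ≤ y / N * x := by gcongr; exact min_le_right _ _
          _ = _ := by ring
    calc y ^ s * min 1 (y / N) * (x ^ s * x) = x ^ s * y ^ s * (min 1 (y / N) * x) := by ring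
      _ ≤ x ^ s * y ^ s * (min 1 (x / N) * y) := by gcongr
      _ = _ := by ring

/-! ### Trilinear forms: symmetrization and bounds. -/

/-- Integrability over triples `(p, q, r)` with `p + q + r = 0`. -/
def TriInt (Φ : Plane → Plane → Plane → ℂ) : Prop :=
  Integrable (fun z : Plane × Plane => Φ z.1 z.2 (-z.1 - z.2)) (volume.prod volume)

theorem TriInt.rot {Φ : Plane → Plane → Plane → ℂ} (h : TriInt Φ) :
    TriInt fun p q r => Φ r q p := by
  have := (measurePreserving_rot.integrable_comp_emb rotEquiv.measurableEmbedding
    (g := fun z : Plane × Plane => Φ z.1 z.2 (-z.1 - z.2))).2 h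
  refine this.congr (Filter.Eventually.of_forall fun z => ?_)
  simp

theorem TriInt.swap {Φ : Plane → Plane → Plane → ℂ} (h : TriInt Φ) :
    TriInt fun p q r => Φ q p r := by
  refine (Integrable.swap h).congr (Filter.Eventually.of_forall fun z => ?_)
  simp only [Function.comp, Prod.fst_swap, Prod.snd_swap]
  rw [show -z.2 - z.1 = -z.1 - z.2 by abel]

theorem tri_add {Φ Ψ : Plane → Plane → Plane → ℂ} (hΦ : TriInt Φ) (hΨ : TriInt Ψ) :
    tri (fun p q r => Φ p q r + Ψ p q r) = tri Φ + tri Ψ := integral_add hΦ hΨ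

theorem TriInt.add {Φ Ψ : Plane → Plane → Plane → ℂ} (hΦ : TriInt Φ) (hΨ : TriInt Ψ) :
    TriInt (fun p q r => Φ p q r + Ψ p q r) := Integrable.add hΦ hΨ

theorem tri_congr {Φ Ψ : Plane → Plane → Plane → ℂ}
    (h : ∀ p q, Φ p q (-p - q) = Ψ p q (-p - q)) : tri Φ = tri Ψ :=
  integral_congr_ae (Filter.Eventually.of_forall fun z => h z.1 z.2)

/-- Antisymmetrization of a trilinear form. -/
theorem two_mul_tri {Φ : Plane → Plane → Plane → ℂ} (h : TriInt Φ) :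
    2 * tri Φ = tri fun p q r => Φ p q r + Φ q p r := by
  rw [tri_add h h.swap, ← tri_swap]; ring

theorem aesm_third {g : Plane → ℂ} (hg : AEStronglyMeasurable g volume) :
    AEStronglyMeasurable (fun z : Plane × Plane => g (-z.1 - z.2)) (volume.prod volume) :=
  hg.comp_quasiMeasurePreserving
    ((Measure.quasiMeasurePreserving_fst).comp measurePreserving_rot.quasiMeasurePreserving)

/-- Hermitian functions, i.e. Fourier transforms of real ones. -/
def Herm (f : Plane → ℂ) : Prop := ∀ᵐ ξ, f (-ξ) = (starRingEnd ℂ) (f ξ)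

theorem herm_hat (f : L2) : Herm (hat f) := hat_neg f

theorem Herm.wt {f : Plane → ℂ} (hf : Herm f) (w : ℝ → ℝ) : Herm (wt w f) := by
  filter_upwards [hf] with ξ h
  simp [EMHD.wt, h]

section Pairing

variable {A f g : Plane → ℂ} (hA : AEStronglyMeasurable A volume)
  (hf : AEStronglyMeasurable f volume) (hg : AEStronglyMeasurable g volume)
  (hA2 : eLpNorm A 2 volume < ⊤) (hf1 : N1 (fun x => x ^ (1 : ℝ)) f < ⊤)
  (hg2 : N2 (fun x => x ^ (1 : ℝ)) g < ⊤)
include hA hf hg hA2 hf1 hg2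

theorem triInt_cross : TriInt fun p q r => A p * ((cross q r : ℂ) * (f q * g r)) := by
  have hc : AEStronglyMeasurable (fun z : Plane × Plane => (cross z.2 (-z.1 - z.2) : ℂ))
      (volume.prod volume) :=
    Continuous.aestronglyMeasurable (by unfold cross; fun_prop)
  refine ⟨(hA.comp_fst).mul (hc.mul ((hf.comp_snd).mul (aesm_third hg))), ?_⟩
  rw [hasFiniteIntegral_iff_enorm]
  refine lt_of_le_of_lt (lintegral_mono fun z => ?_) (lt_of_le_of_lt
    (lintegral_tri_le_mid hA (aesm_wt (measurable_rpow_const 1) hf)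
      (aesm_wt (measurable_rpow_const 1) hg))
    (ENNReal.mul_lt_top (ENNReal.mul_lt_top hA2 hf1) hg2))
  rw [← enorm_mul, ← enorm_mul, enorm_le_iff_norm_le]
  simp only [norm_mul, EMHD.wt, Complex.norm_real, Real.rpow_one, Real.norm_eq_abs,
    abs_of_pos (jb_pos _)]
  have e : |cross z.2 (-z.1 - z.2)| ≤ jb z.2 * jb (-z.1 - z.2) :=
    (abs_cross_le _ _).trans (mul_le_mul (norm_le_jb _) (norm_le_jb _) (norm_nonneg _)
      (jb_pos _).le)
  calc _ ≤ ‖A z.1‖ * (jb z.2 * jb (-z.1 - z.2) * (‖f z.2‖ * ‖g (-z.1 - z.2)‖)) := by gcongr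
    _ = _ := by ring

/-- Hermitian symmetry replaces the conjugate of A(ξ) by A(−ξ); with p = −ξ the three arguments sum
to zero. -/
theorem integral_conj_mul_Jc (hH : Herm A) : ∫ ξ, (starRingEnd ℂ) (A ξ) * Jc f g ξ =
    tri fun p q r => A p * ((cross q r : ℂ) * (f q * g r)) := by
  have h1 : ∫ ξ, (starRingEnd ℂ) (A ξ) * Jc f g ξ = ∫ ξ, A (-ξ) * Jc f g ξ :=
    integral_congr_ae (by filter_upwards [hH] with ξ h; rw [h])
  have h2 : ∫ ξ, A (-ξ) * Jc f g ξ = ∫ ξ, A ξ * Jc f g (-ξ) := by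
    rw [← integral_neg_eq_self]; simp
  rw [h1, h2, tri, Measure.volume_eq_prod,
    integral_prod _ (triInt_cross hA hf hg hA2 hf1 hg2)]
  refine integral_congr_ae (Filter.Eventually.of_forall fun p => ?_)
  dsimp only
  rw [Jc, ← integral_const_mul]

end Pairing

/-- The trilinear `L¹` norm with weights. -/
def TN (u v w : ℝ → ℝ) (f g h : Plane → ℂ) : ℝ≥0∞ :=
  ∫⁻ z : Plane × Plane, ‖wt u f z.1‖ₑ * ‖wt v g z.2‖ₑ * ‖wt w h (-z.1 - z.2)‖ₑ

/-- Converts a pointwise bound on triples into trilinear norms `TN`; `TN_le` then lets the L¹ factor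
be chosen separately in each term. -/
theorem enorm_tri_le {f g h : Plane → ℂ} (hf : AEStronglyMeasurable f volume)
    (hg : AEStronglyMeasurable g volume) (hh : AEStronglyMeasurable h volume)
    {u₁ u₂ u₃ v₁ v₂ v₃ : ℝ → ℝ} {w₁ w₂ w₃ : ℝ → ℝ}
    (hu₁ : Measurable u₁) (hu₂ : Measurable u₂)
    (hv₁ : Measurable v₁) (hv₂ : Measurable v₂)
    (hw₁ : Measurable w₁) (hw₂ : Measurable w₂)
    {Φ : Plane → Plane → Plane → ℂ} {C : ℝ} (hC : 0 ≤ C)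
    (hΦ : ∀ p q r, p + q + r = 0 → ‖Φ p q r‖ ≤
      C * (|u₁ (jb p)| * |v₁ (jb q)| * |w₁ (jb r)| + |u₂ (jb p)| * |v₂ (jb q)| * |w₂ (jb r)| +
        |u₃ (jb p)| * |v₃ (jb q)| * |w₃ (jb r)|) * (‖f p‖ * ‖g q‖ * ‖h r‖)) :
    ‖tri Φ‖ₑ ≤ C.toNNReal * (TN u₁ v₁ w₁ f g h + TN u₂ v₂ w₂ f g h + TN u₃ v₃ w₃ f g h) := by
  have hm : ∀ {u v w : ℝ → ℝ}, Measurable u → Measurable v → Measurable w →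
      AEMeasurable (fun z : Plane × Plane =>
        ‖wt u f z.1‖ₑ * ‖wt v g z.2‖ₑ * ‖wt w h (-z.1 - z.2)‖ₑ) volume := by
    intro u v w hu hv hw
    exact (((aesm_wt hu hf).comp_fst).enorm.mul ((aesm_wt hv hg).comp_snd).enorm).mul
      (aesm_third (aesm_wt hw hh)).enorm
  have hm' : AEMeasurable (fun z : Plane × Plane =>
      ‖wt u₁ f z.1‖ₑ * ‖wt v₁ g z.2‖ₑ * ‖wt w₁ h (-z.1 - z.2)‖ₑ +
        ‖wt u₂ f z.1‖ₑ * ‖wt v₂ g z.2‖ₑ * ‖wt w₂ h (-z.1 - z.2)‖ₑ) volume :=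
    (hm hu₁ hv₁ hw₁).add (hm hu₂ hv₂ hw₂)
  rw [TN, TN, TN, ← lintegral_add_left' (hm hu₁ hv₁ hw₁), ← lintegral_add_left' hm', ← lintegral_const_mul' _ _ ENNReal.coe_ne_top]
  refine (enorm_integral_le_lintegral_enorm _).trans (lintegral_mono fun z => ?_)
  have h1 := hΦ z.1 z.2 (-z.1 - z.2) (by abel)
  have hn : ∀ (u : ℝ → ℝ) (f : Plane → ℂ) ξ, ‖wt u f ξ‖ = |u (jb ξ)| * ‖f ξ‖ := by
    intro u f ξ; simp [wt]
  have key : ‖Φ z.1 z.2 (-z.1 - z.2)‖ ≤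
      C * (‖wt u₁ f z.1‖ * ‖wt v₁ g z.2‖ * ‖wt w₁ h (-z.1 - z.2)‖ +
      ‖wt u₂ f z.1‖ * ‖wt v₂ g z.2‖ * ‖wt w₂ h (-z.1 - z.2)‖ +
      ‖wt u₃ f z.1‖ * ‖wt v₃ g z.2‖ * ‖wt w₃ h (-z.1 - z.2)‖) := by
    simp only [hn]
    exact h1.trans (le_of_eq (by ring))
  simp only [← ofReal_norm]
  change _ ≤ ENNReal.ofReal C * _
  rw [← ENNReal.ofReal_mul (by positivity), ← ENNReal.ofReal_mul (by positivity),
    ← ENNReal.ofReal_mul (by positivity), ← ENNReal.ofReal_mul (by positivity),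
    ← ENNReal.ofReal_mul (by positivity), ← ENNReal.ofReal_mul (by positivity),
    ← ENNReal.ofReal_add (by positivity) (by positivity),
    ← ENNReal.ofReal_add (by positivity) (by positivity), ← ENNReal.ofReal_mul hC]
  exact ENNReal.ofReal_le_ofReal key

theorem TN_le {f g h : Plane → ℂ} (hf : AEStronglyMeasurable f volume)
    (hg : AEStronglyMeasurable g volume) (hh : AEStronglyMeasurable h volume)
    {u v w : ℝ → ℝ} (hu : Measurable u) (hv : Measurable v) (hw : Measurable w) :
    TN u v w f g h ≤ N1 u f * N2 v g * N2 w h ∧ TN u v w f g h ≤ N2 u f * N1 v g * N2 w h ∧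
      TN u v w f g h ≤ N2 u f * N2 v g * N1 w h :=
  ⟨lintegral_tri_le_left (aesm_wt hu hf) (aesm_wt hv hg) (aesm_wt hw hh),
    lintegral_tri_le_mid (aesm_wt hu hf) (aesm_wt hv hg) (aesm_wt hw hh),
    lintegral_tri_le_right (aesm_wt hu hf) (aesm_wt hv hg) (aesm_wt hw hh)⟩

theorem cross_eq {p q r : Plane} (h : p + q + r = 0) :
    cross q r = cross p q ∧ cross q p = - cross p q ∧ cross r p = cross p q := by
  have : r = -p - q := by
    have h2 : r = -(p + q) := eq_neg_of_add_eq_zero_right h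
    rw [h2]; abel
  subst this
  simp only [cross, PiLp.sub_apply, PiLp.neg_apply]
  refine ⟨?_, ?_, ?_⟩ <;> ring

theorem abs_cross_le_jb (p q : Plane) : |cross p q| ≤ jb p * jb q :=
  (abs_cross_le _ _).trans (mul_le_mul (norm_le_jb _) (norm_le_jb _) (norm_nonneg _) (jb_pos _).le)

/-- All bounds on the brackets and the cross product for a triple with sum zero. -/
theorem triple_facts {p q r : Plane} (h : p + q + r = 0) :
    jb p ≤ jb q + jb r ∧ jb q ≤ jb p + jb r ∧ jb r ≤ jb p + jb q ∧
      |cross p q| ≤ jb p * jb q ∧ |cross p q| ≤ jb p * jb r ∧ |cross p q| ≤ jb q * jb r := by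
  obtain ⟨c1, -, c3⟩ := cross_eq h
  have n1 : ‖p + q‖ = ‖r‖ := by rw [eq_neg_of_add_eq_zero_left h, norm_neg]
  have n2 : ‖p + r‖ = ‖q‖ := by
    rw [eq_neg_of_add_eq_zero_left (show (p + r) + q = 0 by rw [← h]; abel), norm_neg]
  refine ⟨?_, ?_, ?_, abs_cross_le_jb p q, ?_, ?_⟩
  · have := jb_le_add p q
    rw [n1] at this
    linarith [norm_le_jb r]
  · have := jb_le_add q p
    rw [add_comm q p, n1] at this
    linarith [norm_le_jb r]
  · have := jb_le_add r p
    rw [add_comm r p, n2] at this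
    linarith [norm_le_jb q]
  · rw [← c3, mul_comm]; exact abs_cross_le_jb r p
  · rw [← c1]; exact abs_cross_le_jb q r

/-! ### The nonlinear part of the energy identity. -/

/-- The nonlinear part of the energy identity. -/
def nlForm (w : ℝ → ℝ) (f g : Plane → ℂ) : ℂ :=
  (∫ ξ, (starRingEnd ℂ) (wt (fun x => x ^ 2 * w x ^ 2) f ξ) * Jc f g ξ) +
    ∫ ξ, (starRingEnd ℂ) (wt (fun x => w x ^ 2) g ξ) * Jc f (sqm f) ξ

theorem norm_sq_eq_jb (p : Plane) : ‖p‖ ^ 2 = jb p ^ 2 - 1 := by rw [jb_sq]; ring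

/-- Exchanging p and r in the second integral puts g in the slot r of both. The symbols are then
⟨p⟩²w(p)² and −|p|²w(r)² = −⟨p⟩²w(r)² + w(r)², each times cross(p,q). The remainder w(r)² drops out
because it is symmetric in p and q while the cross product is antisymmetric. -/
theorem two_mul_nlForm {w : ℝ → ℝ} (hw : Measurable w) {f g : Plane → ℂ}
    (hf : AEStronglyMeasurable f volume) (hg : AEStronglyMeasurable g volume)
    (Hf : Herm f) (Hg : Herm g)
    (h1 : N2 (fun x => x ^ 2 * w x ^ 2) f < ⊤) (h2 : N2 (fun x => w x ^ 2) g < ⊤)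
    (h3 : N1 (fun x => x ^ (1 : ℝ)) f < ⊤) (h4 : N2 (fun x => x ^ (1 : ℝ)) g < ⊤)
    (h5 : N2 (fun x => x ^ (3 : ℝ)) f < ⊤) :
    2 * nlForm w f g = tri fun p q r => (cross p q : ℂ) *
      ((jb p ^ 2 * (w (jb p) ^ 2 - w (jb r) ^ 2) - jb q ^ 2 * (w (jb q) ^ 2 - w (jb r) ^ 2) : ℝ) : ℂ)
      * (f p * f q * g r) := by
  have m1 : Measurable fun x => x ^ 2 * w x ^ 2 := by fun_prop
  have m2 : Measurable fun x => w x ^ 2 := by fun_prop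
  have h5' : N2 (fun x => x ^ (1 : ℝ)) (sqm f) < ⊤ := by
    refine lt_of_le_of_lt (N2_sqm_le 1 f) ?_
    rwa [show (1 : ℝ) + 2 = 3 by norm_num]
  have i1 := triInt_cross (aesm_wt m1 hf) hf hg h1 h3 h4
  have i2 := triInt_cross (aesm_wt m2 hg) hf (aesm_sqm hf) h2 h3 h5'
  rw [nlForm, integral_conj_mul_Jc (aesm_wt m1 hf) hf hg h1 h3 h4 (Hf.wt _),
    integral_conj_mul_Jc (aesm_wt m2 hg) hf (aesm_sqm hf) h2 h3 h5' (Hg.wt _), tri_rot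
    (fun p q r => wt (fun x => w x ^ 2) g p * ((cross q r : ℂ) * (f q * sqm f r))),
    ← tri_add i1 i2.rot, two_mul_tri (i1.add i2.rot)]
  refine tri_congr fun p q => ?_
  obtain ⟨c1, c2, c3⟩ := cross_eq (show p + q + (-p - q) = 0 by abel)
  obtain ⟨d1, d2, d3⟩ := cross_eq (show q + p + (-p - q) = 0 by abel)
  simp only [wt, sqm]
  rw [c1, d1, c2, norm_sq_eq_jb, norm_sq_eq_jb]
  push_cast
  ring

theorem le_two_mul_self (a : ℝ≥0∞) : a ≤ 2 * a := by rw [two_mul]; exact le_self_add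

section EnergyBounds

variable {s k : ℝ} (hs : 2 < s) (hk : 1 ≤ k)
include hs hk

/-- For the case ν > 0, where `N2 (fun x => x * w x) g` is the dissipated norm. The H^{s+1} norm of
g comes from the region where g has the lowest frequency; it is not bounded by the energy, only by
the dissipation. -/
theorem norm_nlForm_le_b : ∃ C : ℝ≥0, ∀ w, IsWt k w → ∀ f g : Plane → ℂ,
    AEStronglyMeasurable f volume → AEStronglyMeasurable g volume → Herm f → Herm g →
    N2 (fun x => x ^ 2 * w x ^ 2) f < ⊤ → N2 (fun x => w x ^ 2) g < ⊤ →
    N2 (fun x => x ^ (s + 1)) f < ⊤ → N2 (fun x => x ^ s) g < ⊤ →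
    ‖nlForm w f g‖ₑ ≤ C * (N2 (fun x => x ^ (s + 1)) g * N2 (fun x => x * w x) f ^ 2 +
      N2 (fun x => x ^ (s + 1)) f * N2 (fun x => x * w x) f * N2 (fun x => x * w x) g) := by
  obtain ⟨C, hC⟩ := N1_le_N2 (σ := s - 1) (by linarith)
  refine ⟨2 * (symC k).toNNReal * C, fun w hw f g hf hg Hf Hg h1 h2 h3 h4 => ?_⟩
  have hw0 := hw.meas
  have e := two_mul_nlForm hw0 hf hg Hf Hg h1 h2
    (N1_finite hs hf (lt_of_le_of_lt (N2_rpow_mono (by linarith) _) h3))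
    (lt_of_le_of_lt (N2_rpow_mono (by linarith) _) h4)
    (lt_of_le_of_lt (N2_rpow_mono (by linarith) _) h3)
  have mx : Measurable fun x => x * w x := by fun_prop
  have m2 : Measurable fun x : ℝ => x ^ (2 : ℝ) := by fun_prop
  have hb := enorm_tri_le hf hf hg (u₁ := fun x => x * w x) (v₁ := fun x => x * w x)
    (w₁ := fun x => x ^ (2 : ℝ)) (u₂ := fun x => x ^ (2 : ℝ)) (v₂ := fun x => x * w x)
    (w₂ := fun x => x * w x) (u₃ := fun x => x * w x) (v₃ := fun x => x ^ (2 : ℝ))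
    (w₃ := fun x => x * w x) mx m2 mx mx m2 mx (symC_pos hk).le
    (Φ := fun p q r => (cross p q : ℂ) * ((jb p ^ 2 * (w (jb p) ^ 2 - w (jb r) ^ 2) -
      jb q ^ 2 * (w (jb q) ^ 2 - w (jb r) ^ 2) : ℝ) : ℂ) * (f p * f q * g r)) (by
    intro p q r hpqr
    obtain ⟨t1, t2, t3, -, t5, t6⟩ := triple_facts hpqr
    have := symbol_bound_b hw hk (one_le_jb p) (one_le_jb q) (one_le_jb r) t1 t2 t3 t5 t6
    have a : ∀ p, 0 < w (jb p) := fun p => hw.pos _ (one_le_jb p)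
    simp only [norm_mul, Complex.norm_real, Real.norm_eq_abs, abs_mul, abs_of_pos (jb_pos _),
      abs_of_pos (a _), Real.rpow_two, abs_pow]
    gcongr)
  rw [← e, enorm_mul] at hb
  have hle : ‖nlForm w f g‖ₑ ≤ ‖(2 : ℂ)‖ₑ * ‖nlForm w f g‖ₑ := by
    conv_lhs => rw [← one_mul ‖nlForm w f g‖ₑ]
    gcongr
    rw [← ofReal_norm]; norm_num
  refine (hle.trans hb).trans ?_
  have b1 := (TN_le hf hf hg mx mx m2).2.2
  have b2 := (TN_le hf hf hg m2 mx mx).1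
  have b3 := (TN_le hf hf hg mx m2 mx).2.1
  have n1 := hC hf 2
  have n2 := hC hg 2
  rw [show (2 : ℝ) + (s - 1) = s + 1 by ring] at n1 n2
  push_cast
  calc _ ≤ ((symC k).toNNReal : ℝ≥0∞) * (N2 (fun x => x * w x) f * N2 (fun x => x * w x) f *
        (C * N2 (fun x => x ^ (s + 1)) g) + (C * N2 (fun x => x ^ (s + 1)) f) *
        N2 (fun x => x * w x) f * N2 (fun x => x * w x) g + N2 (fun x => x * w x) f *
        (C * N2 (fun x => x ^ (s + 1)) f) * N2 (fun x => x * w x) g) := by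
        gcongr
        · exact b1.trans (by gcongr)
        · exact b2.trans (by gcongr)
        · exact b3.trans (by gcongr)
    _ = (symC k).toNNReal * C * (N2 (fun x => x ^ (s + 1)) g * N2 (fun x => x * w x) f ^ 2 +
      2 * (N2 (fun x => x ^ (s + 1)) f * N2 (fun x => x * w x) f * N2 (fun x => x * w x) g)) := by
        ring
    _ ≤ (symC k).toNNReal * C * (2 * (N2 (fun x => x ^ (s + 1)) g * N2 (fun x => x * w x) f ^ 2) +
      2 * (N2 (fun x => x ^ (s + 1)) f * N2 (fun x => x * w x) f * N2 (fun x => x * w x) g)) := by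
        exact mul_le_mul' le_rfl (add_le_add (le_two_mul_self _) le_rfl)
    _ = _ := by ring

/-- For the case μ > 0: g enters only through energy norms, and the lost derivative sits in the
dissipated norm `N2 (fun x => x ^ 2 * w x) f`. -/
theorem norm_nlForm_le_a : ∃ C : ℝ≥0, ∀ w, IsWt k w → ∀ f g : Plane → ℂ,
    AEStronglyMeasurable f volume → AEStronglyMeasurable g volume → Herm f → Herm g →
    N2 (fun x => x ^ 2 * w x ^ 2) f < ⊤ → N2 (fun x => w x ^ 2) g < ⊤ →
    N2 (fun x => x ^ (s + 1)) f < ⊤ → N2 (fun x => x ^ s) g < ⊤ →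
    ‖nlForm w f g‖ₑ ≤ C * (N2 (fun x => x ^ s) g * N2 (fun x => x * w x) f *
        N2 (fun x => x ^ 2 * w x) f +
      N2 (fun x => x ^ (s + 1)) f * N2 (fun x => x ^ 2 * w x) f * N2 w g) := by
  obtain ⟨C, hC⟩ := N1_le_N2 (σ := s - 1) (by linarith)
  refine ⟨4 * (symC k).toNNReal * C, fun w hw f g hf hg Hf Hg h1 h2 h3 h4 => ?_⟩
  have hw0 := hw.meas
  have e := two_mul_nlForm hw0 hf hg Hf Hg h1 h2
    (N1_finite hs hf (lt_of_le_of_lt (N2_rpow_mono (by linarith) _) h3))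
    (lt_of_le_of_lt (N2_rpow_mono (by linarith) _) h4)
    (lt_of_le_of_lt (N2_rpow_mono (by linarith) _) h3)
  have mx : Measurable fun x => x * w x := by fun_prop
  have my : Measurable fun x => x ^ 2 * w x := by fun_prop
  have m1 : Measurable fun x : ℝ => x ^ (1 : ℝ) := by fun_prop
  have m2 : Measurable fun x : ℝ => x ^ (2 : ℝ) := by fun_prop
  have hC0 := symC_pos hk
  have hb := enorm_tri_le hf hf hg (u₁ := fun x => x * w x) (v₁ := fun x => x ^ 2 * w x)
    (w₁ := fun x => x ^ (1 : ℝ)) (u₂ := fun x => x ^ (2 : ℝ)) (v₂ := fun x => x ^ 2 * w x)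
    (w₂ := w) (u₃ := fun x => x ^ 2 * w x) (v₃ := fun x => x ^ (2 : ℝ))
    (w₃ := w) mx m2 my my m1 hw0 (C := 2 * symC k) (by positivity)
    (Φ := fun p q r => (cross p q : ℂ) * ((jb p ^ 2 * (w (jb p) ^ 2 - w (jb r) ^ 2) -
      jb q ^ 2 * (w (jb q) ^ 2 - w (jb r) ^ 2) : ℝ) : ℂ) * (f p * f q * g r)) (by
    intro p q r hpqr
    obtain ⟨t1, t2, t3, -, t5, t6⟩ := triple_facts hpqr
    have := symbol_bound_a hw hk (one_le_jb p) (one_le_jb q) (one_le_jb r) t1 t2 t3 t5 t6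
    have a : ∀ p, 0 < w (jb p) := fun p => hw.pos _ (one_le_jb p)
    simp only [norm_mul, Complex.norm_real, Real.norm_eq_abs, abs_mul, abs_of_pos (jb_pos _),
      abs_of_pos (a _), Real.rpow_two, abs_pow, Real.rpow_one]
    gcongr)
  rw [← e, enorm_mul] at hb
  have hle : ‖nlForm w f g‖ₑ ≤ ‖(2 : ℂ)‖ₑ * ‖nlForm w f g‖ₑ := by
    conv_lhs => rw [← one_mul ‖nlForm w f g‖ₑ]
    gcongr
    rw [← ofReal_norm]; norm_num
  refine (hle.trans hb).trans ?_
  have b1 := (TN_le hf hf hg mx my m1).2.2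
  have b2 := (TN_le hf hf hg m2 my hw0).1
  have b3 := (TN_le hf hf hg my m2 hw0).2.1
  have n1 := hC hf 2
  have n2 := hC hg 1
  rw [show (2 : ℝ) + (s - 1) = s + 1 by ring] at n1
  rw [show (1 : ℝ) + (s - 1) = s by ring] at n2
  rw [show (2 * symC k).toNNReal = 2 * (symC k).toNNReal by
    rw [Real.toNNReal_mul (by norm_num)]; norm_num]
  push_cast
  calc _ ≤ (2 * (symC k).toNNReal : ℝ≥0∞) * (N2 (fun x => x * w x) f * N2 (fun x => x ^ 2 * w x) f *
        (C * N2 (fun x => x ^ s) g) + (C * N2 (fun x => x ^ (s + 1)) f) *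
        N2 (fun x => x ^ 2 * w x) f * N2 w g + N2 (fun x => x ^ 2 * w x) f *
        (C * N2 (fun x => x ^ (s + 1)) f) * N2 w g) := by
        gcongr
        · exact b1.trans (by gcongr)
        · exact b2.trans (by gcongr)
        · exact b3.trans (by gcongr)
    _ = 2 * (symC k).toNNReal * C * (N2 (fun x => x ^ s) g * N2 (fun x => x * w x) f *
        N2 (fun x => x ^ 2 * w x) f +
      2 * (N2 (fun x => x ^ (s + 1)) f * N2 (fun x => x ^ 2 * w x) f * N2 w g)) := by
        ring
    _ ≤ 2 * (symC k).toNNReal * C * (2 * (N2 (fun x => x ^ s) g * N2 (fun x => x * w x) f *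
        N2 (fun x => x ^ 2 * w x) f) +
      2 * (N2 (fun x => x ^ (s + 1)) f * N2 (fun x => x ^ 2 * w x) f * N2 w g)) := by
        exact mul_le_mul' le_rfl (add_le_add (le_two_mul_self _) le_rfl)
    _ = _ := by ring

end EnergyBounds

/-! ### The nonlinear part of the energy identity for differences. -/

/-- The nonlinear part of the energy identity for the difference `(f, g)` of two solutions whose
first components are `f₁` and `f₂`, and the second of which has second component `g₂`. -/
def diffForm (f₁ f₂ g₂ f g : Plane → ℂ) : ℂ :=
  ((∫ ξ, (starRingEnd ℂ) (wt (fun x => x ^ (2 : ℝ)) f ξ) * Jc f₁ g ξ) +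
    ∫ ξ, (starRingEnd ℂ) (g ξ) * Jc f₁ (sqm f) ξ) +
  (∫ ξ, (starRingEnd ℂ) (wt (fun x => x ^ (2 : ℝ)) f ξ) * Jc f g₂ ξ) +
    ∫ ξ, (starRingEnd ℂ) (g ξ) * Jc f (sqm f₂) ξ

theorem sq_symbol_bound_b {x y z c : ℝ} (hx : 1 ≤ x) (hy : 1 ≤ y)
    (hxyz : x ≤ y + z) (hyxz : y ≤ x + z) (hcxz : c ≤ x * z) (hcyz : c ≤ y * z) :
    c * |x ^ 2 - y ^ 2| ≤ 2 * (x * y * z ^ 2) := by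
  have e : |x ^ 2 - y ^ 2| = |x - y| * (x + y) := by
    rw [show x ^ 2 - y ^ 2 = (x - y) * (x + y) by ring, abs_mul, abs_of_pos (by linarith : 0 < x + y)]
  have h1 : |x - y| ≤ z := abs_le.mpr ⟨by linarith, by linarith⟩
  have h2 : c * (x + y) ≤ 2 * (x * y * z) := by nlinarith
  rw [e]
  rcases le_total c 0 with hc | hc
  · have : c * (|x - y| * (x + y)) ≤ 0 := mul_nonpos_of_nonpos_of_nonneg hc (by positivity)
    refine this.trans (by positivity)
  calc c * (|x - y| * (x + y)) = |x - y| * (c * (x + y)) := by ring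
    _ ≤ z * (2 * (x * y * z)) := by
      apply mul_le_mul h1 h2 (by positivity) (by linarith)
    _ = _ := by ring

theorem sq_symbol_bound_a {x y z c : ℝ} (hx : 1 ≤ x) (hy : 1 ≤ y)
    (hxyz : x ≤ y + z) (hyxz : y ≤ x + z) (hc : c ≤ x * y) :
    c * |x ^ 2 - y ^ 2| ≤ x ^ 2 * y * z + x * y ^ 2 * z := by
  have e : |x ^ 2 - y ^ 2| = |x - y| * (x + y) := by
    rw [show x ^ 2 - y ^ 2 = (x - y) * (x + y) by ring, abs_mul, abs_of_pos (by linarith : 0 < x + y)]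
  have h1 : |x - y| ≤ z := abs_le.mpr ⟨by linarith, by linarith⟩
  rw [e]
  calc c * (|x - y| * (x + y)) ≤ (x * y) * (z * (x + y)) := by gcongr
    _ = _ := by ring

/-- In the product ⟨p⟩³⟨q⟩ neither factor can go to L¹ as it stands: ⟨p⟩³ asks for more than
H^{s+1}, and ⟨q⟩ asks for H^s of the difference. Where x ≤ y, one power passes to y. Where y ≤ x, s
− 2 powers pass from y to x, and y^{3-s} in L¹ is controlled by y² in L². -/
theorem cube_bound {s x y : ℝ} (hs : 2 < s) (hx : 1 ≤ x) (hy : 1 ≤ y) :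
    x ^ 3 * y ≤ x ^ 2 * y ^ 2 + x ^ (s + 1) * y ^ (3 - s) := by
  have hx0 : 0 < x := by linarith
  have hy0 : 0 < y := by linarith
  rcases le_total x y with h | h
  · have : x ^ 3 * y ≤ x ^ 2 * y ^ 2 := by
      calc x ^ 3 * y = x ^ 2 * y * x := by ring
        _ ≤ x ^ 2 * y * y := by gcongr
        _ = _ := by ring
    have : 0 ≤ x ^ (s + 1) * y ^ (3 - s) := by positivity
    linarith
  · have e1 : x ^ (s + 1) = x ^ 3 * x ^ (s - 2) := by
      rw [← Real.rpow_natCast, ← Real.rpow_add hx0]; congr 1; push_cast; ring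
    have e2 : y = y ^ (3 - s) * y ^ (s - 2) := by
      rw [← Real.rpow_add hy0]; norm_num
    have e3 : y ^ (s - 2) ≤ x ^ (s - 2) := Real.rpow_le_rpow hy0.le h (by linarith)
    have : x ^ 3 * y ≤ x ^ (s + 1) * y ^ (3 - s) := by
      calc x ^ 3 * y = x ^ 3 * (y ^ (3 - s) * y ^ (s - 2)) := by rw [← e2]
        _ ≤ x ^ 3 * (y ^ (3 - s) * x ^ (s - 2)) := by gcongr
        _ = _ := by rw [e1]; ring
    have : 0 ≤ x ^ 2 * y ^ 2 := by positivity
    linarith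

section

variable {s : ℝ} (hs : 2 < s) {f₁ f₂ g₂ f g : Plane → ℂ}
  (mf₁ : AEStronglyMeasurable f₁ volume) (mf₂ : AEStronglyMeasurable f₂ volume)
  (mg₂ : AEStronglyMeasurable g₂ volume) (mf : AEStronglyMeasurable f volume)
  (mg : AEStronglyMeasurable g volume) (Hf : Herm f) (Hg : Herm g)
  (bf₁ : N2 (fun x => x ^ (s + 1)) f₁ < ⊤) (bf₂ : N2 (fun x => x ^ (s + 1)) f₂ < ⊤)
  (bg₂ : N2 (fun x => x ^ s) g₂ < ⊤) (bf : N2 (fun x => x ^ (s + 1)) f < ⊤)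
  (bg : N2 (fun x => x ^ s) g < ⊤)

include hs

omit hs in
theorem N2_lt_of_le {k l : ℝ} {f : Plane → ℂ} (h : k ≤ l) (hf : N2 (fun x => x ^ l) f < ⊤) :
    N2 (fun x => x ^ k) f < ⊤ := lt_of_le_of_lt (N2_rpow_mono h f) hf

theorem N2_sqm_lt {f : Plane → ℂ} (hf : N2 (fun x => x ^ (s + 1)) f < ⊤) :
    N2 (fun x => x ^ (1 : ℝ)) (sqm f) < ⊤ := by
  refine lt_of_le_of_lt (N2_sqm_le 1 f) (N2_lt_of_le (by linarith) hf)

-- Transport by f₁: the top-order terms cancel without any symmetrization, and only ⟨p⟩² − |p|² = 1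
-- is left of the symbol.
include mf₁ mf mg Hf Hg bf₁ bf bg in
theorem diffForm_transport : (∫ ξ, (starRingEnd ℂ) (wt (fun x => x ^ (2 : ℝ)) f ξ) * Jc f₁ g ξ) +
    ∫ ξ, (starRingEnd ℂ) (g ξ) * Jc f₁ (sqm f) ξ =
    tri fun p q r => (cross p q : ℂ) * (f p * f₁ q * g r) := by
  have m2 := measurable_rpow_const 2
  have n1 : N1 (fun x => x ^ (1 : ℝ)) f₁ < ⊤ :=
    N1_finite hs mf₁ (N2_lt_of_le (by linarith) bf₁)
  have a1 : eLpNorm (wt (fun x => x ^ (2 : ℝ)) f) 2 volume < ⊤ := N2_lt_of_le (by linarith) bf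
  have a2 : N2 (fun x => x ^ (1 : ℝ)) g < ⊤ := N2_lt_of_le (by linarith) bg
  have a3 : eLpNorm g 2 volume < ⊤ := lt_of_le_of_lt (eLpNorm_le_N2 (by linarith) g) bg
  have i1 := triInt_cross (aesm_wt m2 mf) mf₁ mg a1 n1 a2
  have i2 := triInt_cross mg mf₁ (aesm_sqm mf) a3 n1 (N2_sqm_lt hs bf)
  rw [integral_conj_mul_Jc (aesm_wt m2 mf) mf₁ mg a1 n1 a2 (Hf.wt _),
    integral_conj_mul_Jc mg mf₁ (aesm_sqm mf) a3 n1 (N2_sqm_lt hs bf) Hg, tri_rot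
    (fun p q r => g p * ((cross q r : ℂ) * (f₁ q * sqm f r))), ← tri_add i1 i2.rot]
  refine tri_congr fun p q => ?_
  obtain ⟨c1, c2, c3⟩ := cross_eq (show p + q + (-p - q) = 0 by abel)
  simp only [wt, sqm]
  rw [c1, c2, norm_sq_eq_jb, Real.rpow_two]
  push_cast
  ring

-- Both a-slots hold f, so antisymmetrization is available and replaces ⟨p⟩² by the difference ⟨p⟩²
-- − ⟨q⟩², which gains a power of the frequency of g₂.
include mg₂ mf Hf bg₂ bf in
theorem two_mul_diffForm_mid :
    2 * (∫ ξ, (starRingEnd ℂ) (wt (fun x => x ^ (2 : ℝ)) f ξ) * Jc f g₂ ξ) =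
    tri fun p q r => (cross p q : ℂ) * ((jb p ^ 2 - jb q ^ 2 : ℝ) : ℂ) * (f p * f q * g₂ r) := by
  have m2 := measurable_rpow_const 2
  have n1 : N1 (fun x => x ^ (1 : ℝ)) f < ⊤ :=
    N1_finite hs mf (N2_lt_of_le (by linarith) bf)
  have a1 : eLpNorm (wt (fun x => x ^ (2 : ℝ)) f) 2 volume < ⊤ := N2_lt_of_le (by linarith) bf
  have a2 : N2 (fun x => x ^ (1 : ℝ)) g₂ < ⊤ := N2_lt_of_le (by linarith) bg₂
  have i1 := triInt_cross (aesm_wt m2 mf) mf mg₂ a1 n1 a2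
  rw [integral_conj_mul_Jc (aesm_wt m2 mf) mf mg₂ a1 n1 a2 (Hf.wt _), two_mul_tri i1]
  refine tri_congr fun p q => ?_
  obtain ⟨c1, c2, c3⟩ := cross_eq (show p + q + (-p - q) = 0 by abel)
  obtain ⟨d1, d2, d3⟩ := cross_eq (show q + p + (-p - q) = 0 by abel)
  simp only [wt]
  rw [c1, d1, c2, Real.rpow_two, Real.rpow_two]
  push_cast
  ring

include mf₂ mf mg Hg bf₂ bf bg in
theorem diffForm_last : ∫ ξ, (starRingEnd ℂ) (g ξ) * Jc f (sqm f₂) ξ =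
    tri fun p q r => -(cross p q : ℂ) * ((‖p‖ ^ 2 : ℝ) : ℂ) * (f₂ p * f q * g r) := by
  have n1 : N1 (fun x => x ^ (1 : ℝ)) f < ⊤ :=
    N1_finite hs mf (N2_lt_of_le (by linarith) bf)
  have a3 : eLpNorm g 2 volume < ⊤ := lt_of_le_of_lt (eLpNorm_le_N2 (by linarith) g) bg
  rw [integral_conj_mul_Jc mg mf (aesm_sqm mf₂) a3 n1 (N2_sqm_lt hs bf₂) Hg, tri_rot]
  refine tri_congr fun p q => ?_
  obtain ⟨c1, c2, c3⟩ := cross_eq (show p + q + (-p - q) = 0 by abel)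
  simp only [sqm]
  rw [c2]
  push_cast
  ring

end

theorem enorm_le_of_two_mul {a b : ℂ} {B : ℝ≥0∞} (h : 2 * a = b) (hb : ‖b‖ₑ ≤ B) : ‖a‖ₑ ≤ B := by
  refine le_trans ?_ hb
  rw [← h, enorm_mul]
  conv_lhs => rw [← one_mul ‖a‖ₑ]
  gcongr
  rw [← ofReal_norm]; norm_num

/-- A one-term version of `enorm_tri_le`. -/
theorem enorm_tri_le_one {f g h : Plane → ℂ} (hf : AEStronglyMeasurable f volume)
    (hg : AEStronglyMeasurable g volume) (hh : AEStronglyMeasurable h volume)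
    {u v w : ℝ → ℝ} (hu : Measurable u) (hv : Measurable v) (hw : Measurable w)
    {Φ : Plane → Plane → Plane → ℂ} {C : ℝ} (hC : 0 ≤ C)
    (hΦ : ∀ p q r, p + q + r = 0 → ‖Φ p q r‖ ≤
      C * (|u (jb p)| * |v (jb q)| * |w (jb r)|) * (‖f p‖ * ‖g q‖ * ‖h r‖)) :
    ‖tri Φ‖ₑ ≤ C.toNNReal * TN u v w f g h := by
  have := enorm_tri_le hf hg hh (u₁ := u) (v₁ := v) (w₁ := w) (u₂ := 0) (v₂ := 0) (w₂ := 0)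
    (u₃ := 0) (v₃ := 0) (w₃ := 0) hu (by fun_prop) hv (by fun_prop) hw (by fun_prop)
    (Φ := Φ) hC (fun p q r hpqr => by simpa using hΦ p q r hpqr)
  have z : TN 0 0 0 f g h = 0 := by simp [TN, wt]
  simpa [z] using this

/-- A two-term version of `enorm_tri_le`. -/
theorem enorm_tri_le_two {f g h : Plane → ℂ} (hf : AEStronglyMeasurable f volume)
    (hg : AEStronglyMeasurable g volume) (hh : AEStronglyMeasurable h volume)
    {u₁ u₂ v₁ v₂ w₁ w₂ : ℝ → ℝ} (hu₁ : Measurable u₁) (hu₂ : Measurable u₂)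
    (hv₁ : Measurable v₁) (hv₂ : Measurable v₂) (hw₁ : Measurable w₁) (hw₂ : Measurable w₂)
    {Φ : Plane → Plane → Plane → ℂ} {C : ℝ} (hC : 0 ≤ C)
    (hΦ : ∀ p q r, p + q + r = 0 → ‖Φ p q r‖ ≤
      C * (|u₁ (jb p)| * |v₁ (jb q)| * |w₁ (jb r)| + |u₂ (jb p)| * |v₂ (jb q)| * |w₂ (jb r)|)
        * (‖f p‖ * ‖g q‖ * ‖h r‖)) :
    ‖tri Φ‖ₑ ≤ C.toNNReal * (TN u₁ v₁ w₁ f g h + TN u₂ v₂ w₂ f g h) := by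
  have := enorm_tri_le hf hg hh (u₁ := u₁) (v₁ := v₁) (w₁ := w₁) (u₂ := u₂) (v₂ := v₂) (w₂ := w₂)
    (u₃ := 0) (v₃ := 0) (w₃ := 0) hu₁ hu₂ hv₁ hv₂ hw₁ hw₂
    (Φ := Φ) hC (fun p q r hpqr => by simpa using hΦ p q r hpqr)
  have z : TN 0 0 0 f g h = 0 := by simp [TN, wt]
  simpa [z] using this

section

variable {s : ℝ} (hs : 2 < s)
include hs

/-- For ν > 0. In the last term the cross product is bounded by ⟨q⟩⟨r⟩, so one derivative falls on
g, in its dissipated norm, and f₂ carries only two derivatives in L¹. -/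
theorem enorm_diffForm_le_b : ∃ C : ℝ≥0, ∀ f₁ f₂ g₂ f g : Plane → ℂ,
    AEStronglyMeasurable f₁ volume → AEStronglyMeasurable f₂ volume →
    AEStronglyMeasurable g₂ volume → AEStronglyMeasurable f volume →
    AEStronglyMeasurable g volume → Herm f → Herm g →
    N2 (fun x => x ^ (s + 1)) f₁ < ⊤ → N2 (fun x => x ^ (s + 1)) f₂ < ⊤ →
    N2 (fun x => x ^ s) g₂ < ⊤ → N2 (fun x => x ^ (s + 1)) f < ⊤ → N2 (fun x => x ^ s) g < ⊤ →
    ‖diffForm f₁ f₂ g₂ f g‖ₑ ≤ C * (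
      N2 (fun x => x ^ (s + 1)) f₁ * N2 (fun x => x ^ (1 : ℝ)) f * N2 (fun x => x ^ (0 : ℝ)) g +
      N2 (fun x => x ^ (s + 1)) g₂ * N2 (fun x => x ^ (1 : ℝ)) f ^ 2 +
      N2 (fun x => x ^ (s + 1)) f₂ * N2 (fun x => x ^ (1 : ℝ)) f *
        N2 (fun x => x ^ (1 : ℝ)) g) := by
  obtain ⟨C, hC⟩ := N1_le_N2 (σ := s - 1) (by linarith)
  refine ⟨2 * C, fun f₁ f₂ g₂ f g mf₁ mf₂ mg₂ mf mg Hf Hg bf₁ bf₂ bg₂ bf bg => ?_⟩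
  have m0 := measurable_rpow_const 0
  have m1 := measurable_rpow_const 1
  have m2 := measurable_rpow_const 2
  have hB1 : ‖(∫ ξ, (starRingEnd ℂ) (wt (fun x => x ^ (2 : ℝ)) f ξ) * Jc f₁ g ξ) +
      ∫ ξ, (starRingEnd ℂ) (g ξ) * Jc f₁ (sqm f) ξ‖ₑ ≤ C * (N2 (fun x => x ^ (s + 1)) f₁ *
      N2 (fun x => x ^ (1 : ℝ)) f * N2 (fun x => x ^ (0 : ℝ)) g) := by
    rw [diffForm_transport hs mf₁ mf mg Hf Hg bf₁ bf bg]
    have := enorm_tri_le_one mf mf₁ mg m1 m1 m0 (C := 1) zero_le_one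
      (Φ := fun p q r => (cross p q : ℂ) * (f p * f₁ q * g r)) (by
      intro p q r hpqr
      obtain ⟨-, -, -, t4, -, -⟩ := triple_facts hpqr
      simp only [norm_mul, Complex.norm_real, Real.norm_eq_abs, abs_of_pos (jb_pos _),
        Real.rpow_one, Real.rpow_zero, abs_one, one_mul, mul_one]
      gcongr)
    rw [Real.toNNReal_one, ENNReal.coe_one, one_mul] at this
    have n := (hC mf₁ 1).trans (mul_le_mul' le_rfl (N2_rpow_mono (show 1 + (s - 1) ≤ s + 1 by linarith) f₁))
    calc _ ≤ N2 (fun x => x ^ (1 : ℝ)) f * N1 (fun x => x ^ (1 : ℝ)) f₁ *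
          N2 (fun x => x ^ (0 : ℝ)) g := this.trans (TN_le mf mf₁ mg m1 m1 m0).2.1
      _ ≤ N2 (fun x => x ^ (1 : ℝ)) f * (C * N2 (fun x => x ^ (s + 1)) f₁) *
          N2 (fun x => x ^ (0 : ℝ)) g := by gcongr
      _ = _ := by ring
  have hB2 : ‖∫ ξ, (starRingEnd ℂ) (wt (fun x => x ^ (2 : ℝ)) f ξ) * Jc f g₂ ξ‖ₑ ≤
      2 * C * (N2 (fun x => x ^ (s + 1)) g₂ * N2 (fun x => x ^ (1 : ℝ)) f ^ 2) := by
    refine enorm_le_of_two_mul (two_mul_diffForm_mid hs mg₂ mf Hf bg₂ bf) ?_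
    have := enorm_tri_le_one mf mf mg₂ m1 m1 m2 (C := 2) zero_le_two
      (Φ := fun p q r => (cross p q : ℂ) * ((jb p ^ 2 - jb q ^ 2 : ℝ) : ℂ) *
        (f p * f q * g₂ r)) (by
      intro p q r hpqr
      obtain ⟨t1, t2, -, -, t5, t6⟩ := triple_facts hpqr
      have := sq_symbol_bound_b (one_le_jb p) (one_le_jb q) t1 t2 t5 t6
      simp only [norm_mul, Complex.norm_real, Real.norm_eq_abs, abs_of_pos (jb_pos _),
        Real.rpow_one, Real.rpow_two, abs_pow]
      gcongr)
    have n := hC mg₂ 2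
    rw [show (2 : ℝ) + (s - 1) = s + 1 by ring] at n
    calc _ ≤ ((2 : ℝ).toNNReal : ℝ≥0∞) * (N2 (fun x => x ^ (1 : ℝ)) f *
          N2 (fun x => x ^ (1 : ℝ)) f * N1 (fun x => x ^ (2 : ℝ)) g₂) :=
          this.trans (mul_le_mul' le_rfl (TN_le mf mf mg₂ m1 m1 m2).2.2)
      _ ≤ ((2 : ℝ).toNNReal : ℝ≥0∞) * (N2 (fun x => x ^ (1 : ℝ)) f *
          N2 (fun x => x ^ (1 : ℝ)) f * (C * N2 (fun x => x ^ (s + 1)) g₂)) := by gcongr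
      _ = _ := by rw [Real.toNNReal_ofNat]; push_cast; ring
  have hB3 : ‖∫ ξ, (starRingEnd ℂ) (g ξ) * Jc f (sqm f₂) ξ‖ₑ ≤
      C * (N2 (fun x => x ^ (s + 1)) f₂ * N2 (fun x => x ^ (1 : ℝ)) f *
        N2 (fun x => x ^ (1 : ℝ)) g) := by
    rw [diffForm_last hs mf₂ mf mg Hg bf₂ bf bg]
    have := enorm_tri_le_one mf₂ mf mg m2 m1 m1 (C := 1) zero_le_one
      (Φ := fun p q r => -(cross p q : ℂ) * ((‖p‖ ^ 2 : ℝ) : ℂ) * (f₂ p * f q * g r)) (by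
      intro p q r hpqr
      obtain ⟨-, -, -, -, -, t6⟩ := triple_facts hpqr
      have := norm_le_jb p
      have := jb_pos q
      have := jb_pos r
      simp only [norm_mul, norm_neg, Complex.norm_real, Real.norm_eq_abs, abs_of_pos (jb_pos _),
        Real.rpow_one, Real.rpow_two, abs_pow, abs_norm, one_mul]
      rw [mul_assoc (jb p ^ 2), mul_comm (jb p ^ 2)]
      gcongr)
    rw [Real.toNNReal_one, ENNReal.coe_one, one_mul] at this
    have n := hC mf₂ 2
    rw [show (2 : ℝ) + (s - 1) = s + 1 by ring] at n
    calc _ ≤ N1 (fun x => x ^ (2 : ℝ)) f₂ * N2 (fun x => x ^ (1 : ℝ)) f *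
          N2 (fun x => x ^ (1 : ℝ)) g := this.trans (TN_le mf₂ mf mg m2 m1 m1).1
      _ ≤ (C * N2 (fun x => x ^ (s + 1)) f₂) * N2 (fun x => x ^ (1 : ℝ)) f *
          N2 (fun x => x ^ (1 : ℝ)) g := by gcongr
      _ = _ := by ring
  rw [diffForm]
  refine (enorm_add_le _ _).trans ((add_le_add ((enorm_add_le _ _).trans
    (add_le_add hB1 hB2)) hB3).trans ?_)
  push_cast
  rw [mul_add, mul_add]
  refine add_le_add (add_le_add ?_ le_rfl) ?_ <;>
  · rw [mul_assoc 2]; exact le_two_mul_self _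

/-- For μ > 0 no derivative may fall on g. In the last term the cross product is bounded by ⟨p⟩⟨q⟩,
and `cube_bound` distributes the powers between f₂ and f, whose ⟨ξ⟩² norm is dissipated. -/
theorem enorm_diffForm_le_a : ∃ C : ℝ≥0, ∀ f₁ f₂ g₂ f g : Plane → ℂ,
    AEStronglyMeasurable f₁ volume → AEStronglyMeasurable f₂ volume →
    AEStronglyMeasurable g₂ volume → AEStronglyMeasurable f volume →
    AEStronglyMeasurable g volume → Herm f → Herm g →
    N2 (fun x => x ^ (s + 1)) f₁ < ⊤ → N2 (fun x => x ^ (s + 1)) f₂ < ⊤ →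
    N2 (fun x => x ^ s) g₂ < ⊤ → N2 (fun x => x ^ (s + 1)) f < ⊤ → N2 (fun x => x ^ s) g < ⊤ →
    ‖diffForm f₁ f₂ g₂ f g‖ₑ ≤ C * (
      N2 (fun x => x ^ (s + 1)) f₁ * N2 (fun x => x ^ (1 : ℝ)) f * N2 (fun x => x ^ (0 : ℝ)) g +
      N2 (fun x => x ^ s) g₂ * N2 (fun x => x ^ (1 : ℝ)) f * N2 (fun x => x ^ (2 : ℝ)) f +
      N2 (fun x => x ^ (s + 1)) f₂ * N2 (fun x => x ^ (2 : ℝ)) f *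
        N2 (fun x => x ^ (0 : ℝ)) g) := by
  obtain ⟨C, hC⟩ := N1_le_N2 (σ := s - 1) (by linarith)
  refine ⟨2 * C, fun f₁ f₂ g₂ f g mf₁ mf₂ mg₂ mf mg Hf Hg bf₁ bf₂ bg₂ bf bg => ?_⟩
  have m0 := measurable_rpow_const 0
  have m1 := measurable_rpow_const 1
  have m2 := measurable_rpow_const 2
  have ms := measurable_rpow_const (s + 1)
  have ms' := measurable_rpow_const (3 - s)
  have hB1 : ‖(∫ ξ, (starRingEnd ℂ) (wt (fun x => x ^ (2 : ℝ)) f ξ) * Jc f₁ g ξ) +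
      ∫ ξ, (starRingEnd ℂ) (g ξ) * Jc f₁ (sqm f) ξ‖ₑ ≤ C * (N2 (fun x => x ^ (s + 1)) f₁ *
      N2 (fun x => x ^ (1 : ℝ)) f * N2 (fun x => x ^ (0 : ℝ)) g) := by
    rw [diffForm_transport hs mf₁ mf mg Hf Hg bf₁ bf bg]
    have := enorm_tri_le_one mf mf₁ mg m1 m1 m0 (C := 1) zero_le_one
      (Φ := fun p q r => (cross p q : ℂ) * (f p * f₁ q * g r)) (by
      intro p q r hpqr
      obtain ⟨-, -, -, t4, -, -⟩ := triple_facts hpqr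
      simp only [norm_mul, Complex.norm_real, Real.norm_eq_abs, abs_of_pos (jb_pos _),
        Real.rpow_one, Real.rpow_zero, abs_one, one_mul, mul_one]
      gcongr)
    rw [Real.toNNReal_one, ENNReal.coe_one, one_mul] at this
    have n := (hC mf₁ 1).trans (mul_le_mul' le_rfl (N2_rpow_mono (show 1 + (s - 1) ≤ s + 1 by linarith) f₁))
    calc _ ≤ N2 (fun x => x ^ (1 : ℝ)) f * N1 (fun x => x ^ (1 : ℝ)) f₁ *
          N2 (fun x => x ^ (0 : ℝ)) g := this.trans (TN_le mf mf₁ mg m1 m1 m0).2.1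
      _ ≤ N2 (fun x => x ^ (1 : ℝ)) f * (C * N2 (fun x => x ^ (s + 1)) f₁) *
          N2 (fun x => x ^ (0 : ℝ)) g := by gcongr
      _ = _ := by ring
  have hB2 : ‖∫ ξ, (starRingEnd ℂ) (wt (fun x => x ^ (2 : ℝ)) f ξ) * Jc f g₂ ξ‖ₑ ≤
      2 * C * (N2 (fun x => x ^ s) g₂ * N2 (fun x => x ^ (1 : ℝ)) f *
        N2 (fun x => x ^ (2 : ℝ)) f) := by
    refine enorm_le_of_two_mul (two_mul_diffForm_mid hs mg₂ mf Hf bg₂ bf) ?_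
    have := enorm_tri_le_two mf mf mg₂ m2 m1 m1 m2 m1 m1 (C := 1) zero_le_one
      (Φ := fun p q r => (cross p q : ℂ) * ((jb p ^ 2 - jb q ^ 2 : ℝ) : ℂ) *
        (f p * f q * g₂ r)) (by
      intro p q r hpqr
      obtain ⟨t1, t2, -, t4, -, -⟩ := triple_facts hpqr
      have := sq_symbol_bound_a (one_le_jb p) (one_le_jb q) t1 t2 t4
      simp only [norm_mul, Complex.norm_real, Real.norm_eq_abs, abs_of_pos (jb_pos _),
        Real.rpow_one, Real.rpow_two, abs_pow, one_mul]
      gcongr)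
    rw [Real.toNNReal_one, ENNReal.coe_one, one_mul] at this
    have n := hC mg₂ 1
    rw [show (1 : ℝ) + (s - 1) = s by ring] at n
    calc _ ≤ N2 (fun x => x ^ (2 : ℝ)) f * N2 (fun x => x ^ (1 : ℝ)) f *
          N1 (fun x => x ^ (1 : ℝ)) g₂ + N2 (fun x => x ^ (1 : ℝ)) f *
          N2 (fun x => x ^ (2 : ℝ)) f * N1 (fun x => x ^ (1 : ℝ)) g₂ :=
          this.trans (add_le_add (TN_le mf mf mg₂ m2 m1 m1).2.2 (TN_le mf mf mg₂ m1 m2 m1).2.2)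
      _ = 2 * (N2 (fun x => x ^ (1 : ℝ)) f * N2 (fun x => x ^ (2 : ℝ)) f) *
          N1 (fun x => x ^ (1 : ℝ)) g₂ := by ring
      _ ≤ 2 * (N2 (fun x => x ^ (1 : ℝ)) f * N2 (fun x => x ^ (2 : ℝ)) f) *
          (C * N2 (fun x => x ^ s) g₂) := by gcongr
      _ = _ := by ring
  have hB3 : ‖∫ ξ, (starRingEnd ℂ) (g ξ) * Jc f (sqm f₂) ξ‖ₑ ≤
      2 * C * (N2 (fun x => x ^ (s + 1)) f₂ * N2 (fun x => x ^ (2 : ℝ)) f *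
        N2 (fun x => x ^ (0 : ℝ)) g) := by
    rw [diffForm_last hs mf₂ mf mg Hg bf₂ bf bg]
    have := enorm_tri_le_two mf₂ mf mg m2 ms m2 ms' m0 m0 (C := 1) zero_le_one
      (Φ := fun p q r => -(cross p q : ℂ) * ((‖p‖ ^ 2 : ℝ) : ℂ) * (f₂ p * f q * g r)) (by
      intro p q r hpqr
      obtain ⟨-, -, -, t4, -, -⟩ := triple_facts hpqr
      have h1 := norm_le_jb p
      have := jb_pos p
      have := jb_pos q
      have h2 := cube_bound hs (one_le_jb p) (one_le_jb q)
      have h3 : |cross p q| * ‖p‖ ^ 2 ≤ jb p ^ 2 * jb q ^ 2 + jb p ^ (s + 1) * jb q ^ (3 - s) := by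
        refine le_trans ?_ h2
        calc |cross p q| * ‖p‖ ^ 2 ≤ (jb p * jb q) * jb p ^ 2 := by gcongr
          _ = _ := by ring
      have ep : ∀ k : ℝ, |jb p ^ k| = jb p ^ k := fun k =>
        abs_of_pos (Real.rpow_pos_of_pos (jb_pos _) _)
      have eq : ∀ k : ℝ, |jb q ^ k| = jb q ^ k := fun k =>
        abs_of_pos (Real.rpow_pos_of_pos (jb_pos _) _)
      simp only [norm_mul, norm_neg, Complex.norm_real, Real.norm_eq_abs, ep, eq,
        Real.rpow_zero, abs_one, Real.rpow_two, abs_pow, abs_norm, one_mul, mul_one, sq_abs]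
      gcongr)
    rw [Real.toNNReal_one, ENNReal.coe_one, one_mul] at this
    have n := hC mf₂ 2
    rw [show (2 : ℝ) + (s - 1) = s + 1 by ring] at n
    have n' := hC mf (3 - s)
    rw [show (3 - s) + (s - 1) = 2 by ring] at n'
    calc _ ≤ N1 (fun x => x ^ (2 : ℝ)) f₂ * N2 (fun x => x ^ (2 : ℝ)) f *
          N2 (fun x => x ^ (0 : ℝ)) g + N2 (fun x => x ^ (s + 1)) f₂ *
          N1 (fun x => x ^ (3 - s)) f * N2 (fun x => x ^ (0 : ℝ)) g :=
          this.trans (add_le_add (TN_le mf₂ mf mg m2 m2 m0).1 (TN_le mf₂ mf mg ms ms' m0).2.1)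
      _ ≤ (C * N2 (fun x => x ^ (s + 1)) f₂) * N2 (fun x => x ^ (2 : ℝ)) f *
          N2 (fun x => x ^ (0 : ℝ)) g + N2 (fun x => x ^ (s + 1)) f₂ *
          (C * N2 (fun x => x ^ (2 : ℝ)) f) * N2 (fun x => x ^ (0 : ℝ)) g := by gcongr
      _ = _ := by ring
  rw [diffForm]
  refine (enorm_add_le _ _).trans ((add_le_add ((enorm_add_le _ _).trans
    (add_le_add hB1 hB2)) hB3).trans ?_)
  push_cast
  rw [mul_add, mul_add]
  refine add_le_add (add_le_add ?_ le_rfl) le_rfl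
  rw [mul_assoc 2]; exact le_two_mul_self _

end

/-! ### Mapping properties of the Jacobian. -/

theorem aesm_Jc {f g : Plane → ℂ} (hf : AEStronglyMeasurable f volume)
    (hg : AEStronglyMeasurable g volume) : AEStronglyMeasurable (Jc f g) volume := by
  have hm : AEStronglyMeasurable (fun z : Plane × Plane =>
      (cross z.2 (z.1 - z.2) : ℂ) * (f z.2 * g (z.1 - z.2))) (volume.prod volume) := by
    refine AEStronglyMeasurable.mul (Continuous.aestronglyMeasurable ?_)
      ((hf.comp_snd).mul (aesm_sub hg))
    unfold cross; fun_prop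
  exact hm.integral_prod_right'

theorem lintegral_young_swap {F G : Plane → ℝ≥0∞} (hF : AEMeasurable F) (hG : AEMeasurable G) :
    ∫⁻ ξ, (∫⁻ η, F η * G (ξ - η)) ^ 2 ≤ (∫⁻ η, F η ^ 2) * (∫⁻ ξ, G ξ) ^ 2 := by
  refine le_trans (le_of_eq ?_) ((lintegral_young hG hF).trans (le_of_eq (mul_comm _ _)))
  refine lintegral_congr fun ξ => ?_
  rw [← lintegral_sub_left_eq_self (fun η => F η * G (ξ - η)) ξ]
  simp_rw [sub_sub_cancel, mul_comm]

section

variable {s : ℝ} (hs : 2 < s)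
include hs

/-- Young's inequality in both orders: in each term the factor with weight ⟨ξ⟩ goes to L¹, at the
cost of H^s. The factor 2 in the constant is the square root of the 4 in (a + b)² ≤ 4(a² + b²). -/
theorem eLpNorm_bilin_le : ∃ C₀ : ℝ≥0, ∀ (α β : ℝ) (f g h : Plane → ℂ) (D : ℝ≥0),
    AEStronglyMeasurable f volume → AEStronglyMeasurable g volume →
    (∀ ξ, ‖h ξ‖ₑ ≤ D * ∫⁻ η, (‖wt (fun x => x ^ α) f η‖ₑ * ‖wt (fun x => x ^ (1 : ℝ)) g (ξ - η)‖ₑ +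
      ‖wt (fun x => x ^ (1 : ℝ)) f η‖ₑ * ‖wt (fun x => x ^ β) g (ξ - η)‖ₑ)) →
    eLpNorm h 2 volume ≤ C₀ * D * (N2 (fun x => x ^ α) f * N2 (fun x => x ^ s) g +
      N2 (fun x => x ^ s) f * N2 (fun x => x ^ β) g) := by
  obtain ⟨C, hC⟩ := N1_le_N2 (σ := s - 1) (by linarith)
  refine ⟨2 * C, fun α β f g h D hf hg hh => ?_⟩
  have ma := (aesm_wt (measurable_rpow_const α) hf).enorm
  have mb := (aesm_wt (measurable_rpow_const β) hg).enorm
  have mf := (aesm_wt (measurable_rpow_const 1) hf).enorm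
  have mg := (aesm_wt (measurable_rpow_const 1) hg).enorm
  have nf := hC hf 1
  have ng := hC hg 1
  rw [show (1 : ℝ) + (s - 1) = s by ring] at nf ng
  set Ff : Plane → ℝ≥0∞ := fun η => ‖wt (fun x => x ^ α) f η‖ₑ
  set Gg : Plane → ℝ≥0∞ := fun η => ‖wt (fun x => x ^ (1 : ℝ)) g η‖ₑ
  set Fb : Plane → ℝ≥0∞ := fun η => ‖wt (fun x => x ^ (1 : ℝ)) f η‖ₑ
  set Gb : Plane → ℝ≥0∞ := fun η => ‖wt (fun x => x ^ β) g η‖ₑ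
  have m1 : AEMeasurable (fun z : Plane × Plane => Ff z.2 * Gg (z.1 - z.2))
      (volume.prod volume) := (ma.comp_snd).mul
    (mg.comp_quasiMeasurePreserving (quasiMeasurePreserving_sub volume volume))
  have e : ∀ᵐ ξ, ∫⁻ η, (Ff η * Gg (ξ - η) + Fb η * Gb (ξ - η)) =
      (∫⁻ η, Ff η * Gg (ξ - η)) + ∫⁻ η, Fb η * Gb (ξ - η) := by
    filter_upwards [m1.aestronglyMeasurable.prodMk_left] with ξ hξ
    exact lintegral_add_left' hξ.aemeasurable _
  have key : eLpNorm h 2 volume ^ 2 ≤ (2 * C * D * (N2 (fun x => x ^ α) f * N2 (fun x => x ^ s) g +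
      N2 (fun x => x ^ s) f * N2 (fun x => x ^ β) g)) ^ 2 := by
    rw [eLpNorm_two_sq]
    have sq2 : ∀ a b : ℝ≥0∞, (a + b) ^ 2 ≤ 4 * (a ^ 2 + b ^ 2) := by
      intro a b
      rcases le_total a b with hab | hab
      · calc (a + b) ^ 2 ≤ (b + b) ^ 2 := by gcongr
          _ = 4 * b ^ 2 := by ring
          _ ≤ _ := by gcongr; exact le_add_self
      · calc (a + b) ^ 2 ≤ (a + a) ^ 2 := by gcongr
          _ = 4 * a ^ 2 := by ring
          _ ≤ _ := by gcongr; exact le_self_add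
    have y1 : ∫⁻ ξ, (∫⁻ η, Ff η * Gg (ξ - η)) ^ 2 ≤
        (N2 (fun x => x ^ α) f * (C * N2 (fun x => x ^ s) g)) ^ 2 := by
      refine (lintegral_young_swap ma mg).trans ?_
      rw [mul_pow]
      refine mul_le_mul' (le_of_eq eLpNorm_two_sq.symm) (pow_le_pow_left' ng 2)
    have y2 : ∫⁻ ξ, (∫⁻ η, Fb η * Gb (ξ - η)) ^ 2 ≤
        ((C * N2 (fun x => x ^ s) f) * N2 (fun x => x ^ β) g) ^ 2 := by
      refine (lintegral_young mf mb).trans ?_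
      rw [mul_pow]
      exact mul_le_mul' (pow_le_pow_left' nf 2) (le_of_eq eLpNorm_two_sq.symm)
    have m1' : AEMeasurable (fun ξ => (∫⁻ η, Ff η * Gg (ξ - η)) ^ 2) volume :=
      m1.lintegral_prod_right'.pow_const 2
    calc ∫⁻ ξ, ‖h ξ‖ₑ ^ 2
        ≤ ∫⁻ ξ, (D : ℝ≥0∞) ^ 2 * (4 * ((∫⁻ η, Ff η * Gg (ξ - η)) ^ 2 +
            (∫⁻ η, Fb η * Gb (ξ - η)) ^ 2)) := by
          refine lintegral_mono_ae ?_
          filter_upwards [e] with ξ hξ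
          have := hh ξ
          rw [hξ] at this
          refine (pow_le_pow_left' this 2).trans ?_
          rw [mul_pow]
          exact mul_le_mul' le_rfl (sq2 _ _)
      _ = (D : ℝ≥0∞) ^ 2 * (4 * ((∫⁻ ξ, (∫⁻ η, Ff η * Gg (ξ - η)) ^ 2) +
            ∫⁻ ξ, (∫⁻ η, Fb η * Gb (ξ - η)) ^ 2)) := by
          rw [lintegral_const_mul' _ _ (by finiteness), lintegral_const_mul' _ _ (by finiteness),
            lintegral_add_left' m1']
      _ ≤ (D : ℝ≥0∞) ^ 2 * (4 * ((N2 (fun x => x ^ α) f * (C * N2 (fun x => x ^ s) g)) ^ 2 +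
            ((C * N2 (fun x => x ^ s) f) * N2 (fun x => x ^ β) g) ^ 2)) := by gcongr
      _ = (2 * C * D) ^ 2 * ((N2 (fun x => x ^ α) f * N2 (fun x => x ^ s) g) ^ 2 +
            (N2 (fun x => x ^ s) f * N2 (fun x => x ^ β) g) ^ 2) := by ring
      _ ≤ (2 * C * D) ^ 2 * (N2 (fun x => x ^ α) f * N2 (fun x => x ^ s) g +
            N2 (fun x => x ^ s) f * N2 (fun x => x ^ β) g) ^ 2 := by
          gcongr
          rw [add_sq]
          refine add_le_add ?_ le_rfl
          exact le_self_add
      _ = _ := by ring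
  push_cast
  exact (ENNReal.pow_le_pow_left_iff two_ne_zero).1 key

/-- The output weight falls on the larger of the two input frequencies. The regularities s − 1 here
and s − 2 in `N2_Jc_sqm_le` exceed those of the difference energy, 1 and 0, by s − 2; this surplus
is the convergence rate of the Galerkin scheme. -/
theorem N2_Jc_le : ∃ C : ℝ≥0, ∀ f g : Plane → ℂ, AEStronglyMeasurable f volume →
    AEStronglyMeasurable g volume →
    N2 (fun x => x ^ (s - 1)) (Jc f g) ≤ C * (N2 (fun x => x ^ s) f * N2 (fun x => x ^ s) g) := by
  obtain ⟨C₀, h₀⟩ := eLpNorm_bilin_le hs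
  refine ⟨C₀ * (2 ^ (s - 1) : ℝ).toNNReal * 2, fun f g hf hg => ?_⟩
  have := h₀ s s f g (wt (fun x => x ^ (s - 1)) (Jc f g)) (2 ^ (s - 1) : ℝ).toNNReal hf hg
    fun ξ => ?_
  · refine (show N2 _ _ ≤ _ from this).trans (le_of_eq ?_)
    push_cast; ring
  rw [wt, Jc, ← integral_const_mul, ← lintegral_const_mul' _ _ ENNReal.coe_ne_top]
  refine (enorm_integral_le_lintegral_enorm _).trans (lintegral_mono fun η => ?_)
  set x := jb ξ
  set y := jb η with hy
  set z := jb (ξ - η) with hz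
  have hx0 : 0 < x := jb_pos _
  have hy0 : 0 < y := jb_pos _
  have hz0 : 0 < z := jb_pos _
  have hxyz : x ≤ y + z := by
    have := jb_le_add ξ (-η)
    rw [jb_neg, ← sub_eq_add_neg] at this
    linarith [norm_le_jb (ξ - η)]
  have hsym : x ^ (s - 1) * (y * z) ≤ 2 ^ (s - 1) * (y ^ s * z + y * z ^ s) := by
    have p : ∀ t : ℝ, 0 < t → t ^ s = t ^ (s - 1) * t := fun t ht => by
      rw [← Real.rpow_add_one ht.ne']; congr 1; ring
    rw [p y hy0, p z hz0]
    have hb : x ^ (s - 1) ≤ 2 ^ (s - 1) * (y ^ (s - 1) + z ^ (s - 1)) := by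
      rcases le_total y z with h | h
      · calc x ^ (s - 1) ≤ (2 * z) ^ (s - 1) := Real.rpow_le_rpow hx0.le (by linarith) (by linarith)
          _ = 2 ^ (s - 1) * z ^ (s - 1) := Real.mul_rpow (by norm_num) hz0.le
          _ ≤ _ := by gcongr; linarith [Real.rpow_pos_of_pos hy0 (s - 1)]
      · calc x ^ (s - 1) ≤ (2 * y) ^ (s - 1) := Real.rpow_le_rpow hx0.le (by linarith) (by linarith)
          _ = 2 ^ (s - 1) * y ^ (s - 1) := Real.mul_rpow (by norm_num) hy0.le
          _ ≤ _ := by gcongr; linarith [Real.rpow_pos_of_pos hz0 (s - 1)]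
    calc x ^ (s - 1) * (y * z) ≤ 2 ^ (s - 1) * (y ^ (s - 1) + z ^ (s - 1)) * (y * z) := by gcongr
      _ = _ := by ring
  have hc := abs_cross_le_jb η (ξ - η)
  rw [← hy, ← hz] at hc
  have key : ‖((x ^ (s - 1) : ℝ) : ℂ) * ((cross η (ξ - η) : ℂ) * (f η * g (ξ - η)))‖ ≤
      2 ^ (s - 1) * (‖wt (fun x => x ^ s) f η‖ * ‖wt (fun x => x ^ (1 : ℝ)) g (ξ - η)‖ +
        ‖wt (fun x => x ^ (1 : ℝ)) f η‖ * ‖wt (fun x => x ^ s) g (ξ - η)‖) := by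
    simp only [norm_mul, wt, Complex.norm_real, Real.norm_eq_abs, Real.rpow_one, ← hy, ← hz,
      abs_of_pos hy0, abs_of_pos hz0, abs_of_pos (Real.rpow_pos_of_pos hx0 _),
      abs_of_pos (Real.rpow_pos_of_pos hy0 _), abs_of_pos (Real.rpow_pos_of_pos hz0 _)]
    calc _ ≤ x ^ (s - 1) * ((y * z) * (‖f η‖ * ‖g (ξ - η)‖)) := by gcongr
      _ = x ^ (s - 1) * (y * z) * (‖f η‖ * ‖g (ξ - η)‖) := by ring
      _ ≤ 2 ^ (s - 1) * (y ^ s * z + y * z ^ s) * (‖f η‖ * ‖g (ξ - η)‖) := by gcongr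
      _ = _ := by ring
  simp only [← ofReal_norm]
  change _ ≤ ENNReal.ofReal _ * _
  rw [← ENNReal.ofReal_mul (by positivity), ← ENNReal.ofReal_mul (by positivity),
    ← ENNReal.ofReal_add (by positivity) (by positivity), ← ENNReal.ofReal_mul (by positivity)]
  exact ENNReal.ofReal_le_ofReal key

theorem N2_Jc_sqm_le : ∃ C : ℝ≥0, ∀ f g : Plane → ℂ, AEStronglyMeasurable f volume →
    AEStronglyMeasurable g volume →
    N2 (fun x => x ^ (s - 2)) (Jc f (sqm g)) ≤
      C * (N2 (fun x => x ^ (s + 1)) f * N2 (fun x => x ^ (s + 1)) g) := by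
  obtain ⟨C₀, h₀⟩ := eLpNorm_bilin_le hs
  refine ⟨C₀ * (2 ^ (s - 2) : ℝ).toNNReal * 2, fun f g hf hg => ?_⟩
  have := h₀ (s + 1) (s + 1) f g (wt (fun x => x ^ (s - 2)) (Jc f (sqm g)))
    (2 ^ (s - 2) : ℝ).toNNReal hf hg fun ξ => ?_
  · refine (show N2 _ _ ≤ _ from this).trans ?_
    have hf' := N2_rpow_mono (show s ≤ s + 1 by linarith) f
    have hg' := N2_rpow_mono (show s ≤ s + 1 by linarith) g
    calc _ ≤ (C₀ : ℝ≥0∞) * (2 ^ (s - 2) : ℝ).toNNReal *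
          (N2 (fun x => x ^ (s + 1)) f * N2 (fun x => x ^ (s + 1)) g +
          N2 (fun x => x ^ (s + 1)) f * N2 (fun x => x ^ (s + 1)) g) := by gcongr
      _ = _ := by push_cast; ring
  rw [wt, Jc, ← integral_const_mul, ← lintegral_const_mul' _ _ ENNReal.coe_ne_top]
  refine (enorm_integral_le_lintegral_enorm _).trans (lintegral_mono fun η => ?_)
  set x := jb ξ
  set y := jb η with hy
  set z := jb (ξ - η) with hz
  have hx0 : 0 < x := jb_pos _
  have hy0 : 0 < y := jb_pos _
  have hz0 : 0 < z := jb_pos _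
  have hxyz : x ≤ y + z := by
    have := jb_le_add ξ (-η)
    rw [jb_neg, ← sub_eq_add_neg] at this
    linarith [norm_le_jb (ξ - η)]
  have hsym : x ^ (s - 2) * (y * z * z ^ 2) ≤
      2 ^ (s - 2) * (y ^ (s + 1) * z + y * z ^ (s + 1)) := by
    have p : ∀ t : ℝ, 0 < t → t ^ (s + 1) = t ^ (s - 2) * t ^ 3 := fun t ht => by
      rw [← Real.rpow_natCast, ← Real.rpow_add ht]; congr 1; push_cast; ring
    rcases le_total y z with h | h
    · calc x ^ (s - 2) * (y * z * z ^ 2) ≤ (2 * z) ^ (s - 2) * (y * z * z ^ 2) := by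
            gcongr
            linarith
        _ = 2 ^ (s - 2) * (y * z ^ (s + 1)) := by
            rw [p z hz0, Real.mul_rpow (by norm_num) hz0.le]; ring
        _ ≤ _ := by
            gcongr
            have : 0 < y ^ (s + 1) * z := by positivity
            linarith
    · calc x ^ (s - 2) * (y * z * z ^ 2) ≤ (2 * y) ^ (s - 2) * (y * z * y ^ 2) := by
            gcongr
            linarith
        _ = 2 ^ (s - 2) * (y ^ (s + 1) * z) := by
            rw [p y hy0, Real.mul_rpow (by norm_num) hy0.le]; ring
        _ ≤ _ := by
            gcongr
            have : 0 < y * z ^ (s + 1) := by positivity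
            linarith
  have hc := abs_cross_le_jb η (ξ - η)
  rw [← hy, ← hz] at hc
  have hn := norm_le_jb (ξ - η)
  rw [← hz] at hn
  have key : ‖((x ^ (s - 2) : ℝ) : ℂ) * ((cross η (ξ - η) : ℂ) * (f η * sqm g (ξ - η)))‖ ≤
      2 ^ (s - 2) * (‖wt (fun x => x ^ (s + 1)) f η‖ * ‖wt (fun x => x ^ (1 : ℝ)) g (ξ - η)‖ +
        ‖wt (fun x => x ^ (1 : ℝ)) f η‖ * ‖wt (fun x => x ^ (s + 1)) g (ξ - η)‖) := by
    simp only [norm_mul, wt, sqm, Complex.norm_real, Real.norm_eq_abs, Real.rpow_one, ← hy, ← hz,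
      abs_of_pos hy0, abs_of_pos hz0, abs_of_pos (Real.rpow_pos_of_pos hx0 _),
      abs_of_pos (Real.rpow_pos_of_pos hy0 _), abs_of_pos (Real.rpow_pos_of_pos hz0 _), abs_pow,
      abs_norm]
    calc _ ≤ x ^ (s - 2) * ((y * z) * (‖f η‖ * (z ^ 2 * ‖g (ξ - η)‖))) := by gcongr
      _ = x ^ (s - 2) * (y * z * z ^ 2) * (‖f η‖ * ‖g (ξ - η)‖) := by ring
      _ ≤ 2 ^ (s - 2) * (y ^ (s + 1) * z + y * z ^ (s + 1)) * (‖f η‖ * ‖g (ξ - η)‖) := by gcongr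
      _ = _ := by ring
  simp only [← ofReal_norm]
  change _ ≤ ENNReal.ofReal _ * _
  rw [← ENNReal.ofReal_mul (by positivity), ← ENNReal.ofReal_mul (by positivity),
    ← ENNReal.ofReal_add (by positivity) (by positivity), ← ENNReal.ofReal_mul (by positivity)]
  exact ENNReal.ofReal_le_ofReal key

end

/-- `Jc` is bilinear, up to null sets. -/
theorem Jc_sub_Jc {f g f' g' : Plane → ℂ} (hf : AEStronglyMeasurable f volume)
    (hg : AEStronglyMeasurable g volume) (hf' : AEStronglyMeasurable f' volume)
    (hg' : AEStronglyMeasurable g' volume) (h1 : N1 (fun x => x ^ (1 : ℝ)) f < ⊤)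
    (h2 : N2 (fun x => x ^ (1 : ℝ)) g < ⊤) (h1' : N1 (fun x => x ^ (1 : ℝ)) f' < ⊤)
    (h2' : N2 (fun x => x ^ (1 : ℝ)) g' < ⊤) :
    (fun ξ => Jc f g ξ - Jc f' g' ξ) =ᵐ[volume]
      fun ξ => Jc (fun η => f η - f' η) g ξ + Jc f' (fun η => g η - g' η) ξ := by
  filter_upwards [ae_integrable_Jc hf hg h1 h2, ae_integrable_Jc hf' hg h1' h2,
    ae_integrable_Jc hf' hg' h1' h2'] with ξ i1 i2 i3
  simp only [Jc]
  have e1 : ∫ η, (cross η (ξ - η) : ℂ) * ((f η - f' η) * g (ξ - η)) =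
      (∫ η, (cross η (ξ - η) : ℂ) * (f η * g (ξ - η))) -
        ∫ η, (cross η (ξ - η) : ℂ) * (f' η * g (ξ - η)) := by
    rw [← integral_sub i1 i2]
    refine integral_congr_ae (Filter.Eventually.of_forall fun η => ?_)
    dsimp only; ring
  have e2 : ∫ η, (cross η (ξ - η) : ℂ) * (f' η * (g (ξ - η) - g' (ξ - η))) =
      (∫ η, (cross η (ξ - η) : ℂ) * (f' η * g (ξ - η))) -
        ∫ η, (cross η (ξ - η) : ℂ) * (f' η * g' (ξ - η)) := by
    rw [← integral_sub i2 i3]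
    refine integral_congr_ae (Filter.Eventually.of_forall fun η => ?_)
    dsimp only; ring
  rw [e1, e2]; ring

/-! ### Energy, dissipation and absorption of the nonlinear terms. -/

/-- The weighted `L²` norm as a real number. -/
def nr (w : ℝ → ℝ) (f : Plane → ℂ) : ℝ := (N2 w f).toReal

theorem nr_nonneg (w : ℝ → ℝ) (f : Plane → ℂ) : 0 ≤ nr w f := ENNReal.toReal_nonneg

theorem N2_weight_congr {w v : ℝ → ℝ} (h : ∀ x, 1 ≤ x → w x = v x) (f : Plane → ℂ) :
    N2 w f = N2 v f :=
  le_antisymm (N2_mono (fun x hx => by rw [h x hx]) f) (N2_mono (fun x hx => by rw [h x hx]) f)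

theorem nr_weight_congr {w v : ℝ → ℝ} (h : ∀ x, 1 ≤ x → w x = v x) (f : Plane → ℂ) :
    nr w f = nr v f := by rw [nr, N2_weight_congr h, nr]

theorem mul_rpow_weight (s : ℝ) : ∀ x : ℝ, 1 ≤ x → x * x ^ s = x ^ (s + 1) := fun x hx => by
  rw [Real.rpow_add (by linarith), Real.rpow_one, mul_comm]

theorem nr_sq {w : ℝ → ℝ} (hw : Measurable w) {f : Plane → ℂ} (hf : AEStronglyMeasurable f volume) :
    nr w f ^ 2 = ∫ ξ, ‖wt w f ξ‖ ^ 2 := by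
  have hm : AEStronglyMeasurable (fun ξ => ‖wt w f ξ‖ ^ 2) volume := (aesm_wt hw hf).norm.pow 2
  rw [integral_eq_lintegral_of_nonneg_ae (Filter.Eventually.of_forall fun ξ => by positivity)
    hm, nr, ← ENNReal.toReal_pow, N2, eLpNorm_two_sq]
  congr 1
  refine lintegral_congr fun ξ => ?_
  rw [ENNReal.ofReal_pow (norm_nonneg _), ofReal_norm]

theorem integrable_conj_mul {f g : Plane → ℂ} (hf : MemLp f 2 volume) (hg : MemLp g 2 volume) :
    Integrable (fun ξ => (starRingEnd ℂ) (f ξ) * g ξ) volume := by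
  have h := hf.star
  exact h.integrable_mul hg

theorem norm_integral_conj_mul_le {f g : Plane → ℂ} (hf : MemLp f 2 volume)
    (hg : MemLp g 2 volume) :
    ‖∫ ξ, (starRingEnd ℂ) (f ξ) * g ξ‖ ≤
      (eLpNorm f 2 volume).toReal * (eLpNorm g 2 volume).toReal := by
  have h : ‖∫ ξ, (starRingEnd ℂ) (f ξ) * g ξ‖ₑ ≤ eLpNorm f 2 volume * eLpNorm g 2 volume := by
    refine (enorm_integral_le_lintegral_enorm _).trans ?_
    rw [← ENNReal.pow_le_pow_left_iff two_ne_zero, mul_pow, eLpNorm_two_sq, eLpNorm_two_sq]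
    simp only [enorm_mul, RCLike.enorm_conj]
    exact lintegral_mul_le_sqrt hf.1.enorm hg.1.enorm
  rw [← toReal_enorm, ← ENNReal.toReal_mul]
  exact ENNReal.toReal_mono (ENNReal.mul_ne_top hf.2.ne hg.2.ne) h

theorem memLp_sqm {f : Plane → ℂ} (hf : AEStronglyMeasurable f volume)
    (h : N2 (fun x => x ^ (2 : ℝ)) f < ⊤) : MemLp (sqm f) 2 volume := by
  refine ⟨aesm_sqm hf, ?_⟩
  refine lt_of_le_of_lt (eLpNorm_le_N2 le_rfl _) (lt_of_le_of_lt (N2_sqm_le 0 f) ?_)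
  rwa [zero_add]

/-- The subtracted `nr v f ^ 2` comes from |ξ|² = ⟨ξ⟩² − 1: the viscosity does not see the lowest
frequencies, which costs a multiple of the energy. -/
theorem re_pairing {v : ℝ → ℝ} (hv : Measurable v) {f J : Plane → ℂ}
    (hf : AEStronglyMeasurable f volume) (hJ : MemLp J 2 volume)
    (h0 : N2 (fun x => v x ^ 2) f < ⊤) (h1 : N2 v f < ⊤) (h2 : N2 (fun x => x * v x) f < ⊤)
    (hq : N2 (fun x => x ^ (2 : ℝ)) f < ⊤) (c d : ℝ) :
    (∫ ξ, (starRingEnd ℂ) (wt (fun x => v x ^ 2) f ξ) *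
      (-(c : ℂ) * J ξ - ((d * ‖ξ‖ ^ 2 : ℝ) : ℂ) * f ξ)).re =
    -c * (∫ ξ, (starRingEnd ℂ) (wt (fun x => v x ^ 2) f ξ) * J ξ).re -
      d * (nr (fun x => x * v x) f ^ 2 - nr v f ^ 2) := by
  have hA := memLp_wt (hv.pow_const 2) hf h0
  have iJ := integrable_conj_mul hA hJ
  have iq := integrable_conj_mul hA (memLp_sqm hf hq)
  have mx : Measurable fun x => x * v x := by fun_prop
  have i1 := (memLp_wt hv hf h1).integrable_norm_pow (by norm_num)
  have i2 := (memLp_wt mx hf h2).integrable_norm_pow (by norm_num)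
  have e : ∀ ξ, (starRingEnd ℂ) (wt (fun x => v x ^ 2) f ξ) *
      (-(c : ℂ) * J ξ - ((d * ‖ξ‖ ^ 2 : ℝ) : ℂ) * f ξ) =
      -(c : ℂ) * ((starRingEnd ℂ) (wt (fun x => v x ^ 2) f ξ) * J ξ) -
      (d : ℂ) * ((starRingEnd ℂ) (wt (fun x => v x ^ 2) f ξ) * sqm f ξ) := fun ξ => by
    simp only [sqm]; push_cast; ring
  have e2 : ∫ ξ, (starRingEnd ℂ) (wt (fun x => v x ^ 2) f ξ) * sqm f ξ =
      ((nr (fun x => x * v x) f ^ 2 - nr v f ^ 2 : ℝ) : ℂ) := by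
    rw [nr_sq mx hf, nr_sq hv hf, ← integral_sub i2 i1, ← integral_complex_ofReal]
    refine integral_congr_ae (Filter.Eventually.of_forall fun ξ => ?_)
    simp only [wt, sqm, norm_mul, Complex.norm_real, Real.norm_eq_abs, mul_pow, sq_abs,
      norm_sq_eq_jb, map_mul, Complex.conj_ofReal]
    have := Complex.conj_mul' (f ξ)
    push_cast
    linear_combination (v (jb ξ) ^ 2 * (jb ξ ^ 2 - 1) : ℂ) * this
  simp_rw [e]
  rw [integral_sub (iJ.const_mul _) (iq.const_mul _), integral_const_mul, integral_const_mul, e2,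
    ← Complex.ofReal_neg, Complex.sub_re, Complex.re_ofReal_mul, Complex.re_ofReal_mul,
    Complex.ofReal_re]

/-- The energy with weight `w`. -/
def en (w : ℝ → ℝ) (f g : Plane → ℂ) : ℝ := kap * nr (fun x => x * w x) f ^ 2 + nr w g ^ 2

/-- The dissipation with weight `w`. -/
def ds (μ ν : ℝ) (w : ℝ → ℝ) (f g : Plane → ℂ) : ℝ :=
  μ * nr (fun x => x ^ 2 * w x) f ^ 2 + ν * nr (fun x => x * w x) g ^ 2

theorem en_nonneg (w : ℝ → ℝ) (f g : Plane → ℂ) : 0 ≤ en w f g := by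
  have := kap_pos; unfold en; positivity

theorem ds_nonneg {μ ν : ℝ} (hμ : 0 ≤ μ) (hν : 0 ≤ ν) (w : ℝ → ℝ) (f g : Plane → ℂ) :
    0 ≤ ds μ ν w f g := by unfold ds; positivity

theorem one_le_kap : 1 ≤ kap := by
  unfold kap; nlinarith [Real.pi_gt_three]

theorem nr_le_sqrt_en_left (w : ℝ → ℝ) (f g : Plane → ℂ) :
    nr (fun x => x * w x) f ^ 2 ≤ en w f g := by
  have := one_le_kap
  unfold en
  nlinarith [sq_nonneg (nr (fun x => x * w x) f), sq_nonneg (nr w g)]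

theorem nr_le_sqrt_en_right (w : ℝ → ℝ) (f g : Plane → ℂ) : nr w g ^ 2 ≤ en w f g := by
  have := kap_pos
  unfold en
  have : 0 ≤ kap * nr (fun x => x * w x) f ^ 2 := by positivity
  linarith

/-- Absorption when the second component is dissipated. -/
theorem absorb_b {ν C : ℝ} (hν : 0 < ν) (hC : 0 ≤ C) : ∃ K : ℝ, 0 ≤ K ∧
    ∀ (F₁ F G X Y W nl es es' dss : ℝ), 0 ≤ F₁ → 0 ≤ F → 0 ≤ G → 0 ≤ X → 0 ≤ Y → 0 ≤ W →
    F₁ ^ 2 ≤ es' → F ^ 2 ≤ es → ν * G ^ 2 ≤ dss →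
    |nl| ≤ C * (F₁ * X * W + G * X ^ 2 + F * X * Y) →
    -kap ^ 2 * nl - kap * ν * (Y ^ 2 - W ^ 2) ≤
      -(1 / 2) * (ν * Y ^ 2) + K * (1 + √dss + es + es') * (kap * X ^ 2 + W ^ 2) := by
  have hk := one_le_kap
  have hk0 := kap_pos
  have hsν : 0 < √ν := Real.sqrt_pos.mpr hν
  -- One summand each for the transport term, the term with G ≤ √dss / √ν, Young's inequality for F
  -- X Y, and the low-frequency defect W².
  refine ⟨kap ^ 2 * C + kap ^ 2 * C / √ν + kap ^ 3 * C ^ 2 / (2 * ν) + kap * ν, by positivity, ?_⟩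
  intro F₁ F G X Y W nl es es' dss h1 h2 h3 hX hY hW hF1 hF hG hnl
  have hes : 0 ≤ es := (sq_nonneg _).trans hF
  have hes' : 0 ≤ es' := (sq_nonneg _).trans hF1
  have hds : 0 ≤ √dss := Real.sqrt_nonneg _
  have hG' : G ≤ √dss / √ν := by
    rw [le_div_iff₀ hsν, mul_comm, ← Real.sqrt_sq h3, ← Real.sqrt_mul hν.le]
    exact Real.sqrt_le_sqrt hG
  set e := kap * X ^ 2 + W ^ 2 with he
  have hXe : X ^ 2 ≤ e := by nlinarith [sq_nonneg X, sq_nonneg W]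
  have hWe : W ^ 2 ≤ e := by nlinarith [sq_nonneg X, sq_nonneg W]
  have he0 : 0 ≤ e := (sq_nonneg X).trans hXe
  have hF1' : F₁ ≤ 1 + es' := by nlinarith [sq_nonneg (F₁ - 1)]
  have hXW : X * W ≤ e := by nlinarith [sq_nonneg (X - W)]
  have hF1'' : F₁ * X * W ≤ (1 + es') * e := by
    rw [mul_assoc]; exact mul_le_mul hF1' hXW (by positivity) (by positivity)
  have t2 : G * X ^ 2 ≤ √dss / √ν * e := mul_le_mul hG' hXe (by positivity) (by positivity)
  have t3 : kap ^ 2 * C * (F * X * Y) ≤ kap * ν / 2 * Y ^ 2 + kap ^ 3 * C ^ 2 / (2 * ν) * (es * e) := by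
    have a : kap ^ 3 * C ^ 2 / (2 * ν) * (F ^ 2 * X ^ 2) ≤ kap ^ 3 * C ^ 2 / (2 * ν) * (es * e) := by
      gcongr
    have b : kap * ν / 2 * Y ^ 2 + kap ^ 3 * C ^ 2 / (2 * ν) * (F ^ 2 * X ^ 2) -
        kap ^ 2 * C * (F * X * Y) = kap / (2 * ν) * (ν * Y - kap * C * F * X) ^ 2 := by
      field_simp; ring
    have c : 0 ≤ kap / (2 * ν) * (ν * Y - kap * C * F * X) ^ 2 := by positivity
    linarith
  have t0 : -kap ^ 2 * nl ≤ kap ^ 2 * (C * (F₁ * X * W + G * X ^ 2 + F * X * Y)) := by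
    have : -nl ≤ C * (F₁ * X * W + G * X ^ 2 + F * X * Y) := (neg_le_abs nl).trans hnl
    nlinarith [sq_nonneg kap]
  have t1' := mul_le_mul_of_nonneg_left hF1'' (show 0 ≤ kap ^ 2 * C by positivity)
  have t2' := mul_le_mul_of_nonneg_left t2 (show 0 ≤ kap ^ 2 * C by positivity)
  have t4 : kap * ν * W ^ 2 ≤ kap * ν * e := by gcongr
  have t5 : 1 / 2 * (ν * Y ^ 2) ≤ kap * ν / 2 * Y ^ 2 := by
    nlinarith [show 0 ≤ ν * Y ^ 2 by positivity]
  have p1 : 0 ≤ kap ^ 2 * C * e := by positivity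
  have p2 : 0 ≤ kap ^ 2 * C / √ν * e := by positivity
  have p3 : 0 ≤ kap ^ 3 * C ^ 2 / (2 * ν) * e := by positivity
  have p4 : 0 ≤ kap * ν * e := by positivity
  have q : kap ^ 2 * C * (√dss / √ν * e) = kap ^ 2 * C / √ν * e * √dss := by ring
  have expand : (kap ^ 2 * C + kap ^ 2 * C / √ν + kap ^ 3 * C ^ 2 / (2 * ν) + kap * ν) *
      (1 + √dss + es + es') * e =
      kap ^ 2 * C * e * (1 + es') + kap ^ 2 * C * e * (√dss + es) +
      (kap ^ 2 * C / √ν * e * √dss + kap ^ 2 * C / √ν * e * (1 + es + es')) +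
      (kap ^ 3 * C ^ 2 / (2 * ν) * e * es + kap ^ 3 * C ^ 2 / (2 * ν) * e * (1 + √dss + es')) +
      (kap * ν * e + kap * ν * e * (√dss + es + es')) := by ring
  have r1 : 0 ≤ kap ^ 2 * C * e * (√dss + es) := by positivity
  have r2 : 0 ≤ kap ^ 2 * C / √ν * e * (1 + es + es') := by positivity
  have r3 : 0 ≤ kap ^ 3 * C ^ 2 / (2 * ν) * e * (1 + √dss + es') := by positivity
  have r4 : 0 ≤ kap * ν * e * (√dss + es + es') := by positivity
  rw [expand]
  rw [q] at t2'
  linarith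

/-- Absorption when the first component is dissipated. -/
theorem absorb_a {μ C : ℝ} (hμ : 0 < μ) (hC : 0 ≤ C) : ∃ K : ℝ, 0 ≤ K ∧
    ∀ (F₁ F G X Z W nl es es' : ℝ), 0 ≤ F₁ → 0 ≤ F → 0 ≤ G → 0 ≤ X → 0 ≤ Z → 0 ≤ W →
    F₁ ^ 2 ≤ es' → F ^ 2 ≤ es → G ^ 2 ≤ es →
    |nl| ≤ C * (F₁ * X * W + G * X * Z + F * Z * W) →
    -kap ^ 2 * nl - kap ^ 2 * μ * (Z ^ 2 - X ^ 2) ≤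
      -(1 / 2) * (μ * Z ^ 2) + K * (1 + es + es') * (kap * X ^ 2 + W ^ 2) := by
  have hk := one_le_kap
  have hk0 := kap_pos
  -- Two terms contain Z, and Young's inequality spends a quarter of the dissipation on each; the
  -- remaining half suffices because `kap` is at least 1.
  refine ⟨kap ^ 2 * C + 2 * (kap ^ 2 * C ^ 2 / μ) + kap ^ 2 * μ, by positivity, ?_⟩
  intro F₁ F G X Z W nl es es' h1 h2 h3 hX hZ hW hF1 hF hG hnl
  have hes : 0 ≤ es := (sq_nonneg _).trans hF
  have hes' : 0 ≤ es' := (sq_nonneg _).trans hF1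
  set e := kap * X ^ 2 + W ^ 2 with he
  have hXe : X ^ 2 ≤ e := by nlinarith [sq_nonneg X, sq_nonneg W]
  have hWe : W ^ 2 ≤ e := by nlinarith [sq_nonneg X, sq_nonneg W]
  have he0 : 0 ≤ e := (sq_nonneg X).trans hXe
  have hF1' : F₁ ≤ 1 + es' := by nlinarith [sq_nonneg (F₁ - 1)]
  have hXW : X * W ≤ e := by nlinarith [sq_nonneg (X - W)]
  have hF1'' : F₁ * X * W ≤ (1 + es') * e := by
    rw [mul_assoc]; exact mul_le_mul hF1' hXW (by positivity) (by positivity)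
  have young : ∀ P Q : ℝ, P ^ 2 ≤ es → Q ^ 2 ≤ e →
      kap ^ 2 * C * (P * Q * Z) ≤ kap ^ 2 * μ / 4 * Z ^ 2 + kap ^ 2 * C ^ 2 / μ * (es * e) := by
    intro P Q hP hQ
    have a : kap ^ 2 * C ^ 2 / μ * (P ^ 2 * Q ^ 2) ≤ kap ^ 2 * C ^ 2 / μ * (es * e) := by
      gcongr
    have b : kap ^ 2 * μ / 4 * Z ^ 2 + kap ^ 2 * C ^ 2 / μ * (P ^ 2 * Q ^ 2) -
        kap ^ 2 * C * (P * Q * Z) = kap ^ 2 / μ * (μ / 2 * Z - C * P * Q) ^ 2 := by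
      field_simp; ring
    have c : 0 ≤ kap ^ 2 / μ * (μ / 2 * Z - C * P * Q) ^ 2 := by positivity
    linarith
  have t2 := young G X hG hXe
  have t3 := young F W hF hWe
  have t0 : -kap ^ 2 * nl ≤ kap ^ 2 * (C * (F₁ * X * W + G * X * Z + F * Z * W)) := by
    have : -nl ≤ C * (F₁ * X * W + G * X * Z + F * Z * W) := (neg_le_abs nl).trans hnl
    nlinarith [sq_nonneg kap]
  have t1' := mul_le_mul_of_nonneg_left hF1'' (show 0 ≤ kap ^ 2 * C by positivity)
  have t4 : kap ^ 2 * μ * X ^ 2 ≤ kap ^ 2 * μ * e := by gcongr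
  have t5 : 1 / 2 * (μ * Z ^ 2) ≤ kap ^ 2 * μ / 2 * Z ^ 2 := by
    have : 1 ≤ kap ^ 2 := by nlinarith
    nlinarith [show 0 ≤ μ * Z ^ 2 by positivity]
  have expand : (kap ^ 2 * C + 2 * (kap ^ 2 * C ^ 2 / μ) + kap ^ 2 * μ) * (1 + es + es') * e =
      kap ^ 2 * C * ((1 + es') * e) + kap ^ 2 * C * e * es +
      2 * (kap ^ 2 * C ^ 2 / μ * (es * e) + kap ^ 2 * C ^ 2 / μ * e * (1 + es')) +
      (kap ^ 2 * μ * e + kap ^ 2 * μ * e * (es + es')) := by ring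
  have r1 : 0 ≤ kap ^ 2 * C * e * es := by positivity
  have r3 : 0 ≤ kap ^ 2 * C ^ 2 / μ * e * (1 + es') := by positivity
  have r4 : 0 ≤ kap ^ 2 * μ * e * (es + es') := by positivity
  rw [expand]
  linarith

/-! ### Energy estimates for solutions and for differences. -/

/-- Hermitian functions all of whose weighted `L²` norms are finite. -/
structure Rapid (f : Plane → ℂ) : Prop where
  aesm : AEStronglyMeasurable f volume
  herm : Herm f
  fin : ∀ k : ℝ, N2 (fun x => x ^ k) f < ⊤

theorem Rapid.lt_top {f : Plane → ℂ} (h : Rapid f) {w : ℝ → ℝ} {C : ℝ} (k : ℝ)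
    (hw : ∀ x, 1 ≤ x → |w x| ≤ C * x ^ k) : N2 w f < ⊤ := by
  have hC : 0 ≤ C := by
    have := (abs_nonneg _).trans (hw 1 le_rfl)
    simpa using this
  refine lt_of_le_of_lt (N2_le_of_le (v := fun x => x ^ k) (g := f) (C := C.toNNReal) ?_)
    (ENNReal.mul_lt_top ENNReal.coe_lt_top (h.fin k))
  refine Filter.Eventually.of_forall fun ξ => ?_
  have := hw (jb ξ) (one_le_jb ξ)
  rw [Real.coe_toNNReal _ hC, ← mul_assoc, abs_of_nonneg (Real.rpow_nonneg (jb_pos ξ).le k)]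
  gcongr

theorem IsWt.le_const_mul {k : ℝ} {w : ℝ → ℝ} (hw : IsWt k w) {x : ℝ} (hx : 1 ≤ x) :
    w x ≤ w 1 * x ^ k := by
  have := hw.growth 1 x le_rfl hx
  simpa using this

theorem Rapid.lt_top_wt {f : Plane → ℂ} (h : Rapid f) {k : ℝ} {w : ℝ → ℝ} (hw : IsWt k w)
    (i j : ℕ) : N2 (fun x => x ^ i * w x ^ j) f < ⊤ := by
  refine h.lt_top (C := w 1 ^ j) (i + k * j) fun x hx => ?_
  have h0 := hw.pos x hx
  have hx0 : 0 < x := by linarith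
  rw [abs_of_pos (by positivity), Real.rpow_add hx0, Real.rpow_natCast, Real.rpow_mul hx0.le,
    Real.rpow_natCast]
  calc x ^ i * w x ^ j ≤ x ^ i * (w 1 * x ^ k) ^ j := by gcongr; exact hw.le_const_mul hx
    _ = _ := by rw [mul_pow]; ring

theorem abs_re_le_toReal {z : ℂ} {B : ℝ≥0∞} (h : ‖z‖ₑ ≤ B) (hB : B ≠ ⊤) : |z.re| ≤ B.toReal := by
  refine (Complex.abs_re_le_norm z).trans ?_
  rw [← toReal_enorm]
  exact ENNReal.toReal_mono hB h

section

variable {s : ℝ} (hs : 2 < s)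
include hs

theorem memLp_Jc {f g : Plane → ℂ} (hf : AEStronglyMeasurable f volume)
    (hg : AEStronglyMeasurable g volume) (bf : N2 (fun x => x ^ s) f < ⊤)
    (bg : N2 (fun x => x ^ s) g < ⊤) : MemLp (Jc f g) 2 volume := by
  obtain ⟨C, hC⟩ := N2_Jc_le hs
  exact ⟨aesm_Jc hf hg, ((eLpNorm_le_N2 (by linarith) _).trans (hC f g hf hg)).trans_lt
    (ENNReal.mul_lt_top ENNReal.coe_lt_top (ENNReal.mul_lt_top bf bg))⟩

theorem memLp_Jc_sqm {f g : Plane → ℂ} (hf : AEStronglyMeasurable f volume)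
    (hg : AEStronglyMeasurable g volume) (bf : N2 (fun x => x ^ (s + 1)) f < ⊤)
    (bg : N2 (fun x => x ^ (s + 1)) g < ⊤) : MemLp (Jc f (sqm g)) 2 volume := by
  obtain ⟨C, hC⟩ := N2_Jc_sqm_le hs
  exact ⟨aesm_Jc hf (aesm_sqm hg), ((eLpNorm_le_N2 (by linarith) _).trans (hC f g hf hg)).trans_lt
    (ENNReal.mul_lt_top ENNReal.coe_lt_top (ENNReal.mul_lt_top bf bg))⟩

variable {μ ν : ℝ} (hμν : (0 < μ ∧ ν = 0) ∨ (μ = 0 ∧ 0 < ν))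
include hμν

omit hs in
/-- The real-variable content of the energy estimates. -/
theorem absorb (C : ℝ≥0) : ∃ K : ℝ, 0 ≤ K ∧
    ∀ (F₁ F G G' X Y Z W nl es es' dss : ℝ), 0 ≤ F₁ → 0 ≤ F → 0 ≤ G → 0 ≤ G' → 0 ≤ X → 0 ≤ Y →
    0 ≤ Z → 0 ≤ W → F₁ ^ 2 ≤ es' → F ^ 2 ≤ es → G ^ 2 ≤ es → ν * G' ^ 2 ≤ dss →
    (0 < ν → |nl| ≤ C * (F₁ * X * W + G' * X ^ 2 + F * X * Y)) →
    (0 < μ → |nl| ≤ C * (F₁ * X * W + G * X * Z + F * Z * W)) →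
    -kap ^ 2 * nl - kap ^ 2 * μ * (Z ^ 2 - X ^ 2) - kap * ν * (Y ^ 2 - W ^ 2) ≤
      -(1 / 2) * (μ * Z ^ 2 + ν * Y ^ 2) + K * (1 + √dss + es + es') * (kap * X ^ 2 + W ^ 2) := by
  rcases hμν with ⟨hμ, rfl⟩ | ⟨rfl, hν⟩
  · obtain ⟨K, hK, h⟩ := absorb_a hμ C.2
    refine ⟨K, hK, ?_⟩
    intro F₁ F G G' X Y Z W nl es es' dss h1 h2 h3 h3' hX hY hZ hW hF1 hF hG hG' hb ha
    have := h F₁ F G X Z W nl es es' h1 h2 h3 hX hZ hW hF1 hF hG (ha hμ)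
    have hk := kap_pos
    have : K * (1 + es + es') * (kap * X ^ 2 + W ^ 2) ≤
        K * (1 + √dss + es + es') * (kap * X ^ 2 + W ^ 2) := by
      gcongr
      have := Real.sqrt_nonneg dss
      linarith
    linarith
  · obtain ⟨K, hK, h⟩ := absorb_b hν C.2
    refine ⟨K, hK, ?_⟩
    intro F₁ F G G' X Y Z W nl es es' dss h1 h2 h3 h3' hX hY hZ hW hF1 hF hG hG' hb ha
    have := h F₁ F G' X Y W nl es es' dss h1 h2 h3' hX hY hW hF1 hF hG' (hb hν)
    linarith

/-- The energy estimate: the weighted energy of a solution. -/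
theorem energy_estimate {k : ℝ} (hk : 1 ≤ k) : ∃ K : ℝ, 0 ≤ K ∧ ∀ w, IsWt k w →
    ∀ f g : Plane → ℂ, Rapid f → Rapid g →
    kap * (∫ ξ, (starRingEnd ℂ) (wt (fun x => (x * w x) ^ 2) f ξ) * rhsA μ f g ξ).re +
      (∫ ξ, (starRingEnd ℂ) (wt (fun x => w x ^ 2) g ξ) * rhsB ν f g ξ).re ≤
    -(1 / 2) * ds μ ν w f g + K * (1 + √(ds μ ν (fun x => x ^ s) f g) + en (fun x => x ^ s) f g) *
      en w f g := by
  obtain ⟨Ca, ha⟩ := norm_nlForm_le_a hs hk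
  obtain ⟨Cb, hb⟩ := norm_nlForm_le_b hs hk
  have hμ : 0 ≤ μ := by rcases hμν with h | h <;> linarith [h.1, h.2]
  obtain ⟨K, hK, h⟩ := absorb hμν (max Ca Cb)
  refine ⟨K, hK, fun w hw f g hf hg => ?_⟩
  have hw0 := hw.meas
  have mx : Measurable fun x => x * w x := by fun_prop
  have e1 : (fun x => (x * w x) ^ 2) = fun x => x ^ 2 * w x ^ 2 := by funext x; ring
  have e2 : (fun x => x * (x * w x)) = fun x => x ^ 2 * w x := by funext x; ring
  have fi : ∀ {f}, Rapid f → ∀ i j : ℕ, N2 (fun x => x ^ i * w x ^ j) f < ⊤ :=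
    fun hf => hf.lt_top_wt hw
  have f22 := fi hf 2 2
  have f11 : N2 (fun x => x * w x) f < ⊤ := by simpa using fi hf 1 1
  have f21 : N2 (fun x => x ^ 2 * w x) f < ⊤ := by simpa using fi hf 2 1
  have g02 : N2 (fun x => w x ^ 2) g < ⊤ := by simpa using fi hg 0 2
  have g01 : N2 w g < ⊤ := by simpa using fi hg 0 1
  have g11 : N2 (fun x => x * w x) g < ⊤ := by simpa using fi hg 1 1
  have pA := re_pairing mx hf.aesm (memLp_Jc hs hf.aesm hg.aesm (hf.fin s) (hg.fin s))
    (by rwa [e1]) f11 (by rwa [e2]) (hf.fin 2) kap (μ * kap)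
  have pB := re_pairing hw0 hg.aesm (memLp_Jc_sqm hs hf.aesm hf.aesm (hf.fin _) (hf.fin _))
    g02 g01 g11 (hg.fin 2) (kap ^ 2) (ν * kap)
  simp only [rhsA, rhsB]
  rw [pA, pB, e1, e2]
  have hE : (nlForm w f g).re = (∫ ξ, (starRingEnd ℂ) (wt (fun x => x ^ 2 * w x ^ 2) f ξ) *
      Jc f g ξ).re + (∫ ξ, (starRingEnd ℂ) (wt (fun x => w x ^ 2) g ξ) * Jc f (sqm f) ξ).re :=
    Complex.add_re _ _
  -- F₁ and es' are zero here; they are needed only for the transport by a second solution in the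
  -- difference estimate.
  have main := h 0 (nr (fun x => x ^ (s + 1)) f) (nr (fun x => x ^ s) g)
    (nr (fun x => x ^ (s + 1)) g) (nr (fun x => x * w x) f) (nr (fun x => x * w x) g)
    (nr (fun x => x ^ 2 * w x) f) (nr w g) (nlForm w f g).re (en (fun x => x ^ s) f g) 0
    (ds μ ν (fun x => x ^ s) f g) le_rfl (nr_nonneg _ _) (nr_nonneg _ _) (nr_nonneg _ _)
    (nr_nonneg _ _) (nr_nonneg _ _) (nr_nonneg _ _) (nr_nonneg _ _) (by norm_num)
    (by rw [← nr_weight_congr (mul_rpow_weight s)]; exact nr_le_sqrt_en_left _ _ _)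
    (nr_le_sqrt_en_right _ _ _)
    (by
      rw [← nr_weight_congr (mul_rpow_weight s), ds]
      have : 0 ≤ μ * nr (fun x => x ^ 2 * x ^ s) f ^ 2 := by positivity
      linarith)
    (fun _ => by
      have b := hb w hw f g hf.aesm hg.aesm hf.herm hg.herm f22 g02 (hf.fin _) (hg.fin _)
      have t1 := ENNReal.mul_ne_top (hg.fin (s + 1)).ne (ENNReal.pow_ne_top f11.ne (n := 2))
      have t2 := ENNReal.mul_ne_top (ENNReal.mul_ne_top (hf.fin (s + 1)).ne f11.ne) g11.ne
      have r := abs_re_le_toReal b (ENNReal.mul_ne_top ENNReal.coe_ne_top (ENNReal.add_ne_top.2 ⟨t1, t2⟩))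
      rw [ENNReal.toReal_mul, ENNReal.toReal_add t1 t2, ENNReal.toReal_mul, ENNReal.toReal_mul,
        ENNReal.toReal_mul, ENNReal.toReal_pow, ENNReal.coe_toReal] at r
      refine r.trans ?_
      simp only [zero_mul, zero_add]
      refine mul_le_mul (NNReal.coe_le_coe.2 (le_max_right _ _)) le_rfl (by positivity) (by positivity))
    (fun _ => by
      have b := ha w hw f g hf.aesm hg.aesm hf.herm hg.herm f22 g02 (hf.fin _) (hg.fin _)
      have t1 := ENNReal.mul_ne_top (ENNReal.mul_ne_top (hg.fin s).ne f11.ne) f21.ne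
      have t2 := ENNReal.mul_ne_top (ENNReal.mul_ne_top (hf.fin (s + 1)).ne f21.ne) g01.ne
      have r := abs_re_le_toReal b (ENNReal.mul_ne_top ENNReal.coe_ne_top (ENNReal.add_ne_top.2 ⟨t1, t2⟩))
      rw [ENNReal.toReal_mul, ENNReal.toReal_add t1 t2, ENNReal.toReal_mul, ENNReal.toReal_mul,
        ENNReal.toReal_mul, ENNReal.toReal_mul, ENNReal.coe_toReal] at r
      refine r.trans ?_
      simp only [zero_mul, zero_add]
      refine mul_le_mul (NNReal.coe_le_coe.2 (le_max_left _ _)) le_rfl (by positivity) (by positivity))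
  rw [hE, add_zero] at main
  refine le_trans (le_of_eq ?_) main
  ring

omit hμν hs in
theorem herm_sub {f g : Plane → ℂ} (hf : Herm f) (hg : Herm g) : Herm fun ξ => f ξ - g ξ := by
  filter_upwards [hf, hg] with ξ h1 h2
  rw [h1, h2, map_sub]

-- The bilinear differences are split so that f and g of the first pair multiply the difference,
-- while of the second pair only f' occurs, and only as the transporting coefficient. This is what
-- later frees the second solution from any dissipation bound.
omit hμν in
theorem rhs_sub (μ ν : ℝ) {f g f' g' : Plane → ℂ} (hf : AEStronglyMeasurable f volume)
    (hg : AEStronglyMeasurable g volume) (hf' : AEStronglyMeasurable f' volume)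
    (hg' : AEStronglyMeasurable g' volume) (b1 : N2 (fun x => x ^ (s + 1)) f < ⊤)
    (b2 : N2 (fun x => x ^ s) g < ⊤) (b1' : N2 (fun x => x ^ (s + 1)) f' < ⊤)
    (b2' : N2 (fun x => x ^ s) g' < ⊤) :
    ((fun ξ => rhsA μ f g ξ - rhsA μ f' g' ξ) =ᵐ[volume] fun ξ =>
      -(kap : ℂ) * (Jc (fun η => f η - f' η) g ξ + Jc f' (fun η => g η - g' η) ξ) -
        ((μ * kap * ‖ξ‖ ^ 2 : ℝ) : ℂ) * (f ξ - f' ξ)) ∧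
    ((fun ξ => rhsB ν f g ξ - rhsB ν f' g' ξ) =ᵐ[volume] fun ξ =>
      -((kap ^ 2 : ℝ) : ℂ) * (Jc (fun η => f η - f' η) (sqm f) ξ +
        Jc f' (sqm fun η => f η - f' η) ξ) - ((ν * kap * ‖ξ‖ ^ 2 : ℝ) : ℂ) * (g ξ - g' ξ)) := by
  have n1 := N1_finite hs hf (N2_lt_of_le (by linarith) b1)
  have n1' := N1_finite hs hf' (N2_lt_of_le (by linarith) b1')
  constructor
  · filter_upwards [Jc_sub_Jc hf hg hf' hg' n1 (N2_lt_of_le (by linarith) b2) n1'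
      (N2_lt_of_le (by linarith) b2')] with ξ h
    rw [← h]; simp only [rhsA]; ring
  · have e : (sqm fun η => f η - f' η) = fun η => sqm f η - sqm f' η := by
      funext η; simp only [sqm]; ring
    filter_upwards [Jc_sub_Jc hf (aesm_sqm hf) hf' (aesm_sqm hf') n1 (N2_sqm_lt hs b1) n1'
      (N2_sqm_lt hs b1')] with ξ h
    rw [e, ← h]; simp only [rhsB]; ring

/-- The energy estimate for the difference of two solutions, the first of which is smooth. -/
theorem difference_estimate : ∃ K : ℝ, 0 ≤ K ∧ ∀ f g f' g' : Plane → ℂ, Rapid f → Rapid g →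
    AEStronglyMeasurable f' volume → AEStronglyMeasurable g' volume → Herm f' → Herm g' →
    N2 (fun x => x ^ (s + 1)) f' < ⊤ → N2 (fun x => x ^ s) g' < ⊤ →
    kap * (∫ ξ, (starRingEnd ℂ) (wt (fun x => x ^ 2) (fun η => f η - f' η) ξ) *
        (rhsA μ f g ξ - rhsA μ f' g' ξ)).re +
      (∫ ξ, (starRingEnd ℂ) (g ξ - g' ξ) * (rhsB ν f g ξ - rhsB ν f' g' ξ)).re ≤
    K * (1 + √(ds μ ν (fun x => x ^ s) f g) + en (fun x => x ^ s) f g +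
      en (fun x => x ^ s) f' g') * en (fun _ => 1) (fun η => f η - f' η) (fun η => g η - g' η) := by
  obtain ⟨Ca, ha⟩ := enorm_diffForm_le_a hs
  obtain ⟨Cb, hb⟩ := enorm_diffForm_le_b hs
  have hμ : 0 ≤ μ := by rcases hμν with h | h <;> linarith [h.1, h.2]
  have hν : 0 ≤ ν := by rcases hμν with h | h <;> linarith [h.1, h.2]
  obtain ⟨K, hK, h⟩ := absorb hμν (max Ca Cb)
  refine ⟨K, hK, fun f g f' g' hf hg mf' mg' Hf' Hg' bf' bg' => ?_⟩
  obtain ⟨eA, eB⟩ := rhs_sub hs μ ν hf.aesm hg.aesm mf' mg' (hf.fin _) (hg.fin _) bf' bg'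
  have mF : AEStronglyMeasurable (fun η => f η - f' η) volume := hf.aesm.sub mf'
  have mG : AEStronglyMeasurable (fun η => g η - g' η) volume := hg.aesm.sub mg'
  have bF : N2 (fun x => x ^ (s + 1)) (fun η => f η - f' η) < ⊤ :=
    (N2_sub_le (measurable_rpow_const _) hf.aesm mf').trans_lt (ENNReal.add_lt_top.2 ⟨hf.fin _, bf'⟩)
  have bG : N2 (fun x => x ^ s) (fun η => g η - g' η) < ⊤ :=
    (N2_sub_le (measurable_rpow_const _) hg.aesm mg').trans_lt (ENNReal.add_lt_top.2 ⟨hg.fin _, bg'⟩)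
  have HF := herm_sub hf.herm Hf'
  have HG := herm_sub hg.herm Hg'
  rw [integral_congr_ae (g := fun ξ => (starRingEnd ℂ) (wt (fun x => x ^ 2)
    (fun η => f η - f' η) ξ) * (-(kap : ℂ) * (Jc (fun η => f η - f' η) g ξ +
      Jc f' (fun η => g η - g' η) ξ) - ((μ * kap * ‖ξ‖ ^ 2 : ℝ) : ℂ) * (f ξ - f' ξ))) (by
      filter_upwards [eA] with ξ hξ
      rw [hξ])]
  have w1 : ∀ g : Plane → ℂ, wt (fun _ => (1 : ℝ) ^ 2) g = g := fun g => by
    funext ξ; simp [wt]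
  rw [integral_congr_ae (f := fun ξ => (starRingEnd ℂ) (g ξ - g' ξ) * _)
    (g := fun ξ => (starRingEnd ℂ) (wt (fun _ => (1 : ℝ) ^ 2) (fun η => g η - g' η) ξ) *
      (-((kap ^ 2 : ℝ) : ℂ) * (Jc (fun η => f η - f' η) (sqm f) ξ +
        Jc f' (sqm fun η => f η - f' η) ξ) - ((ν * kap * ‖ξ‖ ^ 2 : ℝ) : ℂ) * (g ξ - g' ξ))) (by
      filter_upwards [eB] with ξ hξ
      rw [hξ, w1])]
  set F : Plane → ℂ := fun η => f η - f' η with hF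
  set G : Plane → ℂ := fun η => g η - g' η with hG
  have F2 : N2 (fun x => x ^ (2 : ℝ)) F < ⊤ := N2_lt_of_le (by linarith) bF
  have F1 : N2 (fun x => x ^ (1 : ℝ)) F < ⊤ := N2_lt_of_le (by linarith) bF
  have G2 : N2 (fun x => x ^ (2 : ℝ)) G < ⊤ := N2_lt_of_le (by linarith) bG
  have G1 : N2 (fun x => x ^ (1 : ℝ)) G < ⊤ := N2_lt_of_le (by linarith) bG
  have G0 : N2 (fun x => x ^ (0 : ℝ)) G < ⊤ := N2_lt_of_le (by linarith) bG
  have q2 : (fun x : ℝ => x ^ 2) = fun x => x ^ (2 : ℝ) := by funext x; norm_cast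
  have q2' : (fun x : ℝ => x * x) = fun x => x ^ (2 : ℝ) := by funext x; norm_cast; ring
  have q1 : (fun x : ℝ => x) = fun x => x ^ (1 : ℝ) := by funext x; simp
  have q1' : (fun x : ℝ => x * 1) = fun x => x ^ (1 : ℝ) := by funext x; simp
  have q0 : (fun _ : ℝ => (1 : ℝ)) = fun x => x ^ (0 : ℝ) := by funext x; simp
  have q0' : (fun _ : ℝ => (1 : ℝ) ^ 2) = fun x => x ^ (0 : ℝ) := by funext x; simp
  have j1 := memLp_Jc hs mF hg.aesm (N2_lt_of_le (by linarith) bF) (hg.fin s)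
  have j2 := memLp_Jc hs mf' mG (N2_lt_of_le (by linarith) bf') bG
  have j3 := memLp_Jc_sqm hs mF hf.aesm bF (hf.fin _)
  have j4 := memLp_Jc_sqm hs mf' mF bf' bF
  have pA := re_pairing (v := fun x => x) measurable_id mF (j1.add j2)
    (by rwa [q2]) (by rwa [q1]) (by rwa [q2']) F2 kap (μ * kap)
  have pB := re_pairing (v := fun _ => 1) measurable_const mG (j3.add j4)
    (by rwa [q0']) (by rwa [q0]) (by rwa [q1']) G2 (kap ^ 2) (ν * kap)
  simp only [Pi.add_apply] at pA pB
  rw [pA, pB]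
  have hA2 := memLp_wt (measurable_rpow_const 2) mF F2
  have hG0 : MemLp G 2 volume := ⟨mG, (eLpNorm_le_N2 (by linarith) _).trans_lt bG⟩
  have hE : (diffForm f' f g F G).re = (∫ ξ, (starRingEnd ℂ) (wt (fun x => x ^ 2) F ξ) *
      (Jc F g ξ + Jc f' G ξ)).re + (∫ ξ, (starRingEnd ℂ) (wt (fun _ => 1 ^ 2) G ξ) *
      (Jc F (sqm f) ξ + Jc f' (sqm F) ξ)).re := by
    rw [w1, q2]
    simp_rw [mul_add]
    rw [integral_add (integrable_conj_mul hA2 j1) (integrable_conj_mul hA2 j2),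
      integral_add (integrable_conj_mul hG0 j3) (integrable_conj_mul hG0 j4), diffForm]
    simp only [Complex.add_re]
    ring
  -- The H^{s+1} norm of g, which only dissipation controls, is that of the smooth pair; the rough
  -- pair enters through the H^{s+1} norm of f' alone.
  have main := h (nr (fun x => x ^ (s + 1)) f') (nr (fun x => x ^ (s + 1)) f) (nr (fun x => x ^ s) g)
    (nr (fun x => x ^ (s + 1)) g) (nr (fun x => x ^ (1 : ℝ)) F) (nr (fun x => x ^ (1 : ℝ)) G)
    (nr (fun x => x ^ (2 : ℝ)) F) (nr (fun x => x ^ (0 : ℝ)) G) (diffForm f' f g F G).re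
    (en (fun x => x ^ s) f g) (en (fun x => x ^ s) f' g')
    (ds μ ν (fun x => x ^ s) f g) (nr_nonneg _ _) (nr_nonneg _ _) (nr_nonneg _ _) (nr_nonneg _ _)
    (nr_nonneg _ _) (nr_nonneg _ _) (nr_nonneg _ _) (nr_nonneg _ _)
    (by rw [← nr_weight_congr (mul_rpow_weight s)]; exact nr_le_sqrt_en_left _ _ _)
    (by rw [← nr_weight_congr (mul_rpow_weight s)]; exact nr_le_sqrt_en_left _ _ _)
    (nr_le_sqrt_en_right _ _ _)
    (by
      rw [← nr_weight_congr (mul_rpow_weight s), ds]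
      have : 0 ≤ μ * nr (fun x => x ^ 2 * x ^ s) f ^ 2 := by positivity
      linarith)
    (fun _ => by
      have b := hb f' f g F G mf' hf.aesm hg.aesm mF mG HF HG bf' (hf.fin _) (hg.fin _) bF bG
      have t0 := ENNReal.mul_ne_top (ENNReal.mul_ne_top bf'.ne F1.ne) G0.ne
      have t1 := ENNReal.mul_ne_top (hg.fin (s + 1)).ne (ENNReal.pow_ne_top F1.ne (n := 2))
      have t2 := ENNReal.mul_ne_top (ENNReal.mul_ne_top (hf.fin (s + 1)).ne F1.ne) G1.ne
      have t01 := ENNReal.add_ne_top.2 ⟨t0, t1⟩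
      have r := abs_re_le_toReal b (ENNReal.mul_ne_top ENNReal.coe_ne_top
        (ENNReal.add_ne_top.2 ⟨t01, t2⟩))
      rw [ENNReal.toReal_mul, ENNReal.toReal_add t01 t2, ENNReal.toReal_add t0 t1,
        ENNReal.coe_toReal] at r
      simp only [ENNReal.toReal_mul, ENNReal.toReal_pow] at r
      refine r.trans ?_
      refine mul_le_mul (NNReal.coe_le_coe.2 (le_max_right _ _)) le_rfl (by positivity) (by positivity))
    (fun _ => by
      have b := ha f' f g F G mf' hf.aesm hg.aesm mF mG HF HG bf' (hf.fin _) (hg.fin _) bF bG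
      have t0 := ENNReal.mul_ne_top (ENNReal.mul_ne_top bf'.ne F1.ne) G0.ne
      have t1 := ENNReal.mul_ne_top (ENNReal.mul_ne_top (hg.fin s).ne F1.ne) F2.ne
      have t2 := ENNReal.mul_ne_top (ENNReal.mul_ne_top (hf.fin (s + 1)).ne F2.ne) G0.ne
      have t01 := ENNReal.add_ne_top.2 ⟨t0, t1⟩
      have r := abs_re_le_toReal b (ENNReal.mul_ne_top ENNReal.coe_ne_top
        (ENNReal.add_ne_top.2 ⟨t01, t2⟩))
      rw [ENNReal.toReal_mul, ENNReal.toReal_add t01 t2, ENNReal.toReal_add t0 t1,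
        ENNReal.coe_toReal] at r
      simp only [ENNReal.toReal_mul] at r
      refine r.trans ?_
      refine mul_le_mul (NNReal.coe_le_coe.2 (le_max_left _ _)) le_rfl (by positivity) (by positivity))
  rw [hE] at main
  have e1 : en (fun _ => 1) F G = kap * nr (fun x => x ^ (1 : ℝ)) F ^ 2 +
      nr (fun x => x ^ (0 : ℝ)) G ^ 2 := by rw [en, q1', q0]
  rw [e1, q1', q2', q1, q0]
  have : 0 ≤ μ * nr (fun x => x ^ (2 : ℝ)) F ^ 2 + ν * nr (fun x => x ^ (1 : ℝ)) G ^ 2 := by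
    positivity
  refine le_trans (le_of_eq ?_) (main.trans (by linarith))
  ring

end

/-! ### Radial multipliers, frequency truncation and interpolation. -/

/-- Compares the expansions of ‖u − v‖² on both sides of the isometry `FT`, which is only
real-linear into a complex space. -/
theorem inner_hat (u v : L2) :
    inner ℝ u v = (∫ ξ, (starRingEnd ℂ) (hat u ξ) * hat v ξ).re := by
  have h1 := norm_sub_sq (𝕜 := ℂ) (FT u) (FT v)
  have h2 := norm_sub_sq (𝕜 := ℝ) u v
  have h3 : (inner ℂ (FT u) (FT v) : ℂ) = ∫ ξ, (starRingEnd ℂ) (hat u ξ) * hat v ξ := by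
    rw [MeasureTheory.L2.inner_def]
    refine integral_congr_ae (Filter.Eventually.of_forall fun ξ => ?_)
    change inner ℂ (hat u ξ) (hat v ξ) = (starRingEnd ℂ) (hat u ξ) * hat v ξ
    rw [RCLike.inner_apply, mul_comm]
  rw [← map_sub, FT.norm_map, FT.norm_map, FT.norm_map, h3] at h1
  simp only [RCLike.re_to_real, RCLike.re_to_complex] at h1 h2
  linarith

theorem exists_hat_eq_wt {w : ℝ → ℝ} (hw : Measurable w) {f : L2} (h : N2 w (hat f) < ⊤) :
    ∃ g : L2, hat g =ᵐ[volume] wt w (hat f) :=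
  exists_multiplier (m := fun ξ => (w (jb ξ) : ℂ)) (fun ξ => by rw [jb_neg, Complex.conj_ofReal])
    (memLp_wt hw (aesm_hat f) h)

theorem N2_le_of_bound {w : ℝ → ℝ} {C : ℝ≥0} (hC : ∀ x, 1 ≤ x → |w x| ≤ C) (f : Plane → ℂ) :
    N2 w f ≤ C * eLpNorm f 2 volume := by
  rw [eLpNorm_eq_N2]
  refine N2_le_of_le (Filter.Eventually.of_forall fun ξ => ?_)
  have := hC _ (one_le_jb ξ)
  rw [abs_one, one_mul]
  gcongr

/-- Bounded radial Fourier multipliers. -/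
theorem exists_mulOp {w : ℝ → ℝ} (hw : Measurable w) (C : ℝ≥0) (hC : ∀ x, 1 ≤ x → |w x| ≤ C) :
    ∃ M : L2 →L[ℝ] L2, ∀ f, hat (M f) =ᵐ[volume] wt w (hat f) := by
  have hb : ∀ f : L2, N2 w (hat f) ≤ C * ‖f‖ₑ := fun f => by
    rw [← eLpNorm_hat]; exact N2_le_of_bound hC _
  choose M hM using fun f : L2 => exists_hat_eq_wt hw
    ((hb f).trans_lt (ENNReal.mul_lt_top ENNReal.coe_lt_top enorm_lt_top))
  refine ⟨LinearMap.mkContinuous { toFun := M, map_add' := ?_, map_smul' := ?_ } C ?_, hM⟩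
  · intro f g
    apply hat_injective
    filter_upwards [hM (f + g), hM f, hM g, hat_add f g, hat_add (M f) (M g)] with ξ h1 h2 h3 h4 h5
    rw [h1, h5, h2, h3, wt, wt, wt, h4]; ring
  · intro c f
    apply hat_injective
    filter_upwards [hM (c • f), hM f, hat_smul c f, hat_smul c (M f)] with ξ h1 h2 h3 h4
    rw [h1, RingHom.id_apply, h4, h2, wt, wt, h3]; ring
  · intro f
    have h1 : ‖M f‖ₑ ≤ C * ‖f‖ₑ := by
      rw [← eLpNorm_hat, eLpNorm_congr_ae (hM f)]; exact hb f
    have h2 := ENNReal.toReal_mono (ENNReal.mul_ne_top ENNReal.coe_ne_top enorm_ne_top) h1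
    rwa [ENNReal.toReal_mul, toReal_enorm, toReal_enorm, ENNReal.coe_toReal] at h2

/-- The sharp frequency cutoff. -/
def cut (n : ℝ) (x : ℝ) : ℝ := if x ≤ n then 1 else 0

theorem measurable_cut (n : ℝ) : Measurable (cut n) :=
  Measurable.ite measurableSet_Iic measurable_const measurable_const

theorem abs_cut_le (n x : ℝ) : |cut n x| ≤ 1 := by unfold cut; split_ifs <;> simp

theorem cut_mul_self (n x : ℝ) : cut n x * cut n x = cut n x := by unfold cut; split_ifs <;> simp

/-- The Fourier truncation to frequencies `⟨ξ⟩ ≤ n`. -/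
def trunc (n : ℝ) : L2 →L[ℝ] L2 :=
  (exists_mulOp (measurable_cut n) 1 (fun x _ => by simpa using abs_cut_le n x)).choose

theorem hat_trunc (n : ℝ) (f : L2) : hat (trunc n f) =ᵐ[volume] wt (cut n) (hat f) :=
  (exists_mulOp (measurable_cut n) 1 (fun x _ => by simpa using abs_cut_le n x)).choose_spec f

theorem trunc_trunc (n : ℝ) (f : L2) : trunc n (trunc n f) = trunc n f := by
  apply hat_injective
  filter_upwards [hat_trunc n (trunc n f), hat_trunc n f] with ξ h1 h2
  rw [h1, wt, h2, wt, ← mul_assoc, ← Complex.ofReal_mul, cut_mul_self]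

theorem N2_trunc_le (n : ℝ) (w : ℝ → ℝ) (f : L2) : N2 w (hat (trunc n f)) ≤ N2 w (hat f) := by
  rw [N2_congr (hat_trunc n f)]
  have := N2_le_of_le (w := w) (v := w) (f := wt (cut n) (hat f)) (g := hat f) (C := 1)
    (Filter.Eventually.of_forall fun ξ => by
      rw [wt, norm_mul, Complex.norm_real, Real.norm_eq_abs, NNReal.coe_one, one_mul]
      gcongr
      exact mul_le_of_le_one_left (norm_nonneg _) (abs_cut_le _ _))
  simpa using this

/-- Truncated functions: weights are bounded by their supremum over `[1, n]`. -/
theorem N2_trunc_le_of_bound {n : ℝ} {w : ℝ → ℝ} {C : ℝ≥0} (hC : ∀ x, 1 ≤ x → x ≤ n → |w x| ≤ C)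
    {f : L2} (hf : trunc n f = f) : N2 w (hat f) ≤ C * ‖f‖ₑ := by
  rw [← eLpNorm_hat, eLpNorm_eq_N2, ← hf]
  refine N2_le_of_le ?_
  filter_upwards [hat_trunc n f, hat_trunc n (trunc n f)] with ξ h1 h2
  rw [trunc_trunc] at h2
  rw [abs_one, one_mul]
  by_cases h : jb ξ ≤ n
  · gcongr
    exact hC _ (one_le_jb ξ) h
  · rw [h1, wt, cut, if_neg h]; simp

theorem rapid_of_trunc {n : ℝ} {f : L2} (hf : trunc n f = f) : Rapid (hat f) := by
  refine ⟨aesm_hat f, herm_hat f, fun k => ?_⟩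
  refine (N2_trunc_le_of_bound (n := n) (C := (max 1 n ^ |k|).toNNReal) (fun x hx hn => ?_) hf).trans_lt
    (ENNReal.mul_lt_top ENNReal.coe_lt_top enorm_lt_top)
  have h1 : (1 : ℝ) ≤ max 1 n := le_max_left _ _
  rw [Real.coe_toNNReal _ (by positivity), abs_of_nonneg (by positivity)]
  exact (Real.rpow_le_rpow_of_exponent_le hx (le_abs_self k)).trans
    (Real.rpow_le_rpow (by linarith) (hn.trans (le_max_right _ _)) (abs_nonneg k))

theorem N2_weight_add_le {u v w : ℝ → ℝ} (hu : Measurable u) (hv : Measurable v) {f : Plane → ℂ}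
    (hf : AEStronglyMeasurable f volume) (h : ∀ x, 1 ≤ x → |w x| ≤ u x + v x) :
    N2 w f ≤ N2 u f + N2 v f := by
  have h1 : N2 w f ≤ N2 (fun x => u x + v x) f :=
    N2_mono (fun x hx => (h x hx).trans (le_abs_self _)) f
  refine h1.trans (le_trans (le_of_eq ?_)
    (eLpNorm_add_le (aesm_wt hu hf) (aesm_wt hv hf) (by norm_num)))
  rw [N2]; congr 1; funext ξ; simp [wt]; ring

theorem N2_const (C : ℝ≥0) (f : Plane → ℂ) : N2 (fun _ => (C : ℝ)) f ≤ C * eLpNorm f 2 volume :=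
  N2_le_of_bound (fun x _ => by simp) f

/-- Interpolation with a tail. -/
theorem N2_le_tail {w v : ℝ → ℝ} (hv : Measurable v) {f : L2} {C : ℝ≥0}
    (h : ∀ x, 1 ≤ x → |w x| ≤ C + v x) : N2 w (hat f) ≤ C * ‖f‖ₑ + N2 v (hat f) := by
  refine (N2_weight_add_le (u := fun _ => (C : ℝ)) measurable_const hv (aesm_hat f) h).trans ?_
  gcongr
  rw [← eLpNorm_hat]; exact N2_const C _

/-- Frequencies below R are controlled by the L² norm and those above by R^{α−β} times the norm of
order β; R is fixed before the limit is taken. -/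
theorem tendsto_N2_of_tendsto {ι : Type*} {l : Filter ι} {u : ι → L2} {α β : ℝ} (hα : 0 ≤ α)
    (hαβ : α < β) (h : Filter.Tendsto u l (𝓝 0)) {B : ℝ≥0}
    (hB : ∀ᶠ i in l, N2 (fun x => x ^ β) (hat (u i)) ≤ B) :
    Filter.Tendsto (fun i => N2 (fun x => x ^ α) (hat (u i))) l (𝓝 0) := by
  rw [ENNReal.tendsto_nhds_zero]
  intro ε hε
  have key : ∀ R : ℝ≥0, 1 ≤ R → ∀ f : L2, N2 (fun x => x ^ α) (hat f) ≤
      ((R ^ α : ℝ≥0) : ℝ≥0∞) * ‖f‖ₑ + ((R ^ (α - β) : ℝ≥0) : ℝ≥0∞) * N2 (fun x => x ^ β) (hat f) := by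
    intro R hR f
    have hR' : (1 : ℝ) ≤ R := by exact_mod_cast hR
    refine (N2_le_tail (v := fun x => (R : ℝ) ^ (α - β) * x ^ β) (C := R ^ α) (by fun_prop) ?_).trans ?_
    · intro x hx
      have hx0 : 0 < x := by linarith
      have hR0 : (0 : ℝ) < R := by linarith
      rw [abs_of_nonneg (by positivity), NNReal.coe_rpow]
      rcases le_total x R with hxR | hxR
      · have : x ^ α ≤ (R : ℝ) ^ α := Real.rpow_le_rpow hx0.le hxR hα
        have : 0 ≤ (R : ℝ) ^ (α - β) * x ^ β := by positivity
        linarith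
      · have h1 : x ^ (α - β) ≤ (R : ℝ) ^ (α - β) :=
          Real.rpow_le_rpow_of_nonpos hR0 hxR (by linarith)
        have h2 : x ^ α = x ^ (α - β) * x ^ β := by rw [← Real.rpow_add hx0]; congr 1; ring
        have h3 : 0 ≤ (R : ℝ) ^ α := by positivity
        rw [h2]
        have := mul_le_mul_of_nonneg_right h1 (Real.rpow_nonneg hx0.le β)
        linarith
    · gcongr
      refine N2_le_of_le (Filter.Eventually.of_forall fun ξ => le_of_eq ?_)
      rw [abs_mul, NNReal.coe_rpow, abs_of_nonneg (by positivity)]; ring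
  have t : Filter.Tendsto (fun R : ℝ≥0 => ((R ^ (α - β) * B : ℝ≥0) : ℝ≥0∞)) Filter.atTop (𝓝 0) := by
    rw [← ENNReal.coe_zero, ENNReal.tendsto_coe, ← NNReal.tendsto_coe]
    have := (tendsto_rpow_neg_atTop (y := β - α) (by linarith)).mul_const (B : ℝ)
    rw [zero_mul] at this
    have h2 := this.comp (NNReal.tendsto_coe_atTop.2 Filter.tendsto_id)
    refine h2.congr fun R => ?_
    simp
  have hε2 : 0 < ε / 2 := ENNReal.half_pos hε.ne'
  obtain ⟨R, hR, hR1⟩ := ((ENNReal.tendsto_nhds_zero.1 t _ hε2).and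
    (Filter.eventually_ge_atTop 1)).exists
  have hu : Filter.Tendsto (fun i => ((R ^ α : ℝ≥0) : ℝ≥0∞) * ‖u i‖ₑ) l (𝓝 0) := by
    have h1 : Filter.Tendsto (fun i => ‖u i‖ₑ) l (𝓝 0) := by
      simpa using h.enorm
    simpa using ENNReal.Tendsto.const_mul h1 (Or.inr ENNReal.coe_ne_top)
  filter_upwards [hB, ENNReal.tendsto_nhds_zero.1 hu _ hε2] with i h1 h2
  calc N2 (fun x => x ^ α) (hat (u i)) ≤ _ := key R hR1 (u i)
    _ ≤ ε / 2 + ((R ^ (α - β) : ℝ≥0) : ℝ≥0∞) * B := by gcongr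
    _ ≤ ε / 2 + ε / 2 := by gcongr; rw [← ENNReal.coe_mul]; exact hR
    _ = ε := ENNReal.add_halves ε

/-! ### Derivatives of weighted norms and Grönwall inequalities. -/

/-- By the symmetry, the difference quotient is the inner product of v τ + v t with the slope of u,
so v need only be continuous. It is meant for v = w²u, where u is differentiable in L² but w²u need
not be. -/
theorem hasDerivWithinAt_inner_symm {E : Type*} [NormedAddCommGroup E] [InnerProductSpace ℝ E]
    {u v : ℝ → E} {u' : E} {S : Set ℝ} {t : ℝ} (hu : HasDerivWithinAt u u' S t)
    (hv : ContinuousWithinAt v S t)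
    (hs : ∀ τ ∈ S, (inner ℝ (v τ) (u t) : ℝ) = inner ℝ (v t) (u τ)) :
    HasDerivWithinAt (fun τ => (inner ℝ (v τ) (u τ) : ℝ)) (2 * inner ℝ (v t) u') S t := by
  rw [hasDerivWithinAt_iff_tendsto_slope] at hu ⊢
  have h1 : Filter.Tendsto (fun τ => v τ + v t) (𝓝[S \ {t}] t) (𝓝 (v t + v t)) :=
    (hv.mono_left (nhdsWithin_mono _ Set.sdiff_subset)).add_const _
  have h2 := h1.inner (𝕜 := ℝ) hu
  have e : (inner ℝ (v t + v t) u' : ℝ) = 2 * inner ℝ (v t) u' := by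
    rw [inner_add_left]; ring
  rw [e] at h2
  refine h2.congr' ?_
  filter_upwards [self_mem_nhdsWithin] with τ hτ
  have := hs τ hτ.1
  rw [slope_def_module, slope_def_module, inner_smul_right, smul_eq_mul, inner_sub_right,
    inner_add_left, inner_add_left, this]
  ring

theorem integral_conj_wt_sq {w : ℝ → ℝ} (hw : Measurable w) {f : Plane → ℂ}
    (hf : AEStronglyMeasurable f volume) :
    (∫ ξ, (starRingEnd ℂ) (wt (fun x => w x ^ 2) f ξ) * f ξ).re = nr w f ^ 2 := by
  rw [nr_sq hw hf, ← Complex.ofReal_re (∫ ξ, ‖wt w f ξ‖ ^ 2), ← integral_complex_ofReal]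
  congr 1
  refine integral_congr_ae (Filter.Eventually.of_forall fun ξ => ?_)
  have := Complex.conj_mul' (f ξ)
  simp only [wt, norm_mul, Complex.norm_real, Real.norm_eq_abs, mul_pow, sq_abs, map_mul,
    Complex.conj_ofReal]
  push_cast
  linear_combination (w (jb ξ) ^ 2 : ℂ) * this

/-- The squared norm is the pairing of w²u with u, and `hc` says that w²u is continuous in L², so a
derivative of u in L² is enough. -/
theorem hasDerivWithinAt_nr_sq {w : ℝ → ℝ} (hw : Measurable w) {u : ℝ → L2} {u' : L2} {S : Set ℝ}
    {t : ℝ} (ht : t ∈ S) (hfin : ∀ τ ∈ S, N2 (fun x => w x ^ 2) (hat (u τ)) < ⊤)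
    (hc : Filter.Tendsto (fun τ => N2 (fun x => w x ^ 2) (hat (u τ - u t))) (𝓝[S] t) (𝓝 0))
    (hd : HasDerivWithinAt u u' S t) :
    HasDerivWithinAt (fun τ => nr w (hat (u τ)) ^ 2)
      (2 * (∫ ξ, (starRingEnd ℂ) (wt (fun x => w x ^ 2) (hat (u t)) ξ) * hat u' ξ).re) S t := by
  have hex : ∀ τ, ∃ g : L2, τ ∈ S → hat g =ᵐ[volume] wt (fun x => w x ^ 2) (hat (u τ)) := by
    intro τ
    by_cases h : τ ∈ S
    · obtain ⟨g, hg⟩ := exists_hat_eq_wt (hw.pow_const 2) (hfin τ h)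
      exact ⟨g, fun _ => hg⟩
    · exact ⟨0, fun h' => absurd h' h⟩
  choose v hv using hex
  have hin : ∀ τ ∈ S, ∀ g : L2, (inner ℝ (v τ) g : ℝ) =
      (∫ ξ, (starRingEnd ℂ) (wt (fun x => w x ^ 2) (hat (u τ)) ξ) * hat g ξ).re := by
    intro τ hτ g
    rw [inner_hat]
    congr 1
    refine integral_congr_ae ?_
    filter_upwards [hv τ hτ] with ξ h
    rw [h]
  have hcv : ContinuousWithinAt v S t := by
    rw [ContinuousWithinAt, tendsto_iff_edist_tendsto_0]
    refine hc.congr' ?_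
    filter_upwards [self_mem_nhdsWithin] with τ hτ
    rw [edist_eq_enorm_sub, ← eLpNorm_hat, N2]
    refine eLpNorm_congr_ae ?_
    filter_upwards [hat_sub (v τ) (v t), hat_sub (u τ) (u t), hv τ hτ, hv t ht] with ξ h1 h2 h3 h4
    rw [h1, wt, h2, h3, h4, wt, wt]; ring
  have key := hasDerivWithinAt_inner_symm hd hcv (fun τ hτ => by
    rw [hin τ hτ, hin t ht]
    have hsym : ∫ ξ, (starRingEnd ℂ) (wt (fun x => w x ^ 2) (hat (u t)) ξ) * hat (u τ) ξ =
        (starRingEnd ℂ) (∫ ξ, (starRingEnd ℂ) (wt (fun x => w x ^ 2) (hat (u τ)) ξ) * hat (u t) ξ) := by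
      rw [← integral_conj]
      refine integral_congr_ae (Filter.Eventually.of_forall fun ξ => ?_)
      simp only [wt, map_mul, Complex.conj_ofReal, Complex.conj_conj]
      ring
    rw [hsym, Complex.conj_re])
  rw [hin t ht] at key
  refine key.congr (fun τ hτ => ?_) ?_
  · rw [hin τ hτ, integral_conj_wt_sq hw (aesm_hat _)]
  · rw [hin t ht, integral_conj_wt_sq hw (aesm_hat _)]

theorem hasDerivWithinAt_Ici_of_Icc {E : Type*} [NormedAddCommGroup E] [NormedSpace ℝ E]
    {f : ℝ → E} {f' : E} {T t : ℝ} (ht : t ∈ Set.Ico 0 T)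
    (h : HasDerivWithinAt f f' (Set.Icc 0 T) t) : HasDerivWithinAt f f' (Set.Ici t) t := by
  have h1 : HasDerivWithinAt f f' (Set.Icc t T) t := h.mono (Set.Icc_subset_Icc_left ht.1)
  exact h1.mono_of_mem_nhdsWithin (Icc_mem_nhdsGE ht.2)

theorem le_exp_of_deriv_le {f f' : ℝ → ℝ} {T K : ℝ}
    (hf : ∀ t ∈ Set.Icc 0 T, HasDerivWithinAt f (f' t) (Set.Icc 0 T) t)
    (h : ∀ t ∈ Set.Icc 0 T, f' t ≤ K * f t) :
    ∀ t ∈ Set.Icc 0 T, f t ≤ Real.exp (K * t) * f 0 := by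
  have hg : ∀ t ∈ Set.Icc 0 T, HasDerivWithinAt (fun t => Real.exp (-(K * t)) * f t)
      (Real.exp (-(K * t)) * (f' t - K * f t)) (Set.Icc 0 T) t := fun t ht => by
    have h1 : HasDerivAt (fun t : ℝ => Real.exp (-(K * t))) (Real.exp (-(K * t)) * -(K * 1)) t :=
      (((hasDerivAt_id t).const_mul K).neg).exp
    exact (h1.hasDerivWithinAt.mul (hf t ht)).congr_deriv (by ring)
  intro t ht
  have := image_le_of_deriv_right_le_deriv_boundary (f := fun t => Real.exp (-(K * t)) * f t)
    (f' := fun t => Real.exp (-(K * t)) * (f' t - K * f t)) (a := 0) (b := T)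
    (fun t ht => (hg t ht).continuousWithinAt)
    (fun t ht => hasDerivWithinAt_Ici_of_Icc ht (hg t (Set.Ico_subset_Icc_self ht)))
    (B := fun _ => f 0) (B' := fun _ => 0) (by simp) continuousOn_const
    (fun t _ => hasDerivWithinAt_const _ _ _)
    (fun t ht => mul_nonpos_of_nonneg_of_nonpos (Real.exp_pos _).le
      (by linarith [h t (Set.Ico_subset_Icc_self ht)])) ht
  have h2 : f t = Real.exp (K * t) * (Real.exp (-(K * t)) * f t) := by
    rw [← mul_assoc, ← Real.exp_add]; simp
  rw [h2]
  gcongr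

/-- A Grönwall inequality whose rate is controlled by the dissipation of another quantity. -/
theorem gronwall_weighted {E E' S S' d : ℝ → ℝ} {T L c K M : ℝ} (hc : 0 < c) (hL : 0 ≤ L)
    (hK : 0 ≤ K)
    (hE : ∀ t ∈ Set.Icc 0 T, HasDerivWithinAt E (E' t) (Set.Icc 0 T) t)
    (hS : ∀ t ∈ Set.Icc 0 T, HasDerivWithinAt S (S' t) (Set.Icc 0 T) t)
    (hE0 : ∀ t ∈ Set.Icc 0 T, 0 ≤ E t) (hS0 : ∀ t ∈ Set.Icc 0 T, 0 ≤ S t ∧ S t ≤ M)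
    (hd : ∀ t ∈ Set.Icc 0 T, 0 ≤ d t)
    (hS' : ∀ t ∈ Set.Icc 0 T, S' t ≤ -c * d t + K)
    (hE' : ∀ t ∈ Set.Icc 0 T, E' t ≤ L * (1 + √(d t)) * E t) :
    ∀ t ∈ Set.Icc 0 T, E t ≤ Real.exp ((L + L ^ 2 / (4 * c) + K) * T + M) * E 0 := by
  intro t ht
  have hT : 0 ≤ T := ht.1.trans ht.2
  -- With the integrating factor exp S, the dissipation in S' pays for the rate: L√d ≤ c d +
  -- L²/(4c). No pointwise bound on d is needed.
  have hF : ∀ t ∈ Set.Icc 0 T, HasDerivWithinAt (fun t => Real.exp (S t) * E t)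
      (Real.exp (S t) * (S' t * E t + E' t)) (Set.Icc 0 T) t := fun t ht => by
    exact ((hS t ht).exp.mul (hE t ht)).congr_deriv (by ring)
  have hF' : ∀ t ∈ Set.Icc 0 T, Real.exp (S t) * (S' t * E t + E' t) ≤
      (L + L ^ 2 / (4 * c) + K) * (Real.exp (S t) * E t) := fun t ht => by
    have h0 := hE0 t ht
    have h1 := mul_le_mul_of_nonneg_right (hS' t ht) h0
    have h2 : L * √(d t) ≤ c * d t + L ^ 2 / (4 * c) := by
      have e : c * d t + L ^ 2 / (4 * c) - L * √(d t) = (2 * c * √(d t) - L) ^ 2 / (4 * c) := by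
        have := Real.sq_sqrt (hd t ht)
        field_simp
        linear_combination (-4 * c ^ 2) * this
      have : 0 ≤ (2 * c * √(d t) - L) ^ 2 / (4 * c) := by positivity
      linarith
    have h3 := mul_le_mul_of_nonneg_right h2 h0
    have h4 := hE' t ht
    have h5 : S' t * E t + E' t ≤ (L + L ^ 2 / (4 * c) + K) * E t := by linarith
    have := mul_le_mul_of_nonneg_left h5 (Real.exp_pos (S t)).le
    linarith
  have key := le_exp_of_deriv_le hF hF' t ht
  have h00 : (0 : ℝ) ∈ Set.Icc 0 T := ⟨le_rfl, hT⟩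
  have hK1 : 0 ≤ L + L ^ 2 / (4 * c) + K := by positivity
  calc E t = 1 * E t := (one_mul _).symm
    _ ≤ Real.exp (S t) * E t := by
        gcongr
        · exact hE0 t ht
        · exact Real.one_le_exp (hS0 t ht).1
    _ ≤ _ := key
    _ ≤ Real.exp ((L + L ^ 2 / (4 * c) + K) * T) * (Real.exp M * E 0) := by
        have := hE0 0 h00
        gcongr
        · exact ht.2
        · exact (hS0 0 h00).2
    _ = _ := by rw [Real.exp_add]; ring

/-! ### A cut-off ordinary differential equation. -/

section ODE

variable {E : Type*} [NormedAddCommGroup E] [NormedSpace ℝ E]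

/-- A Lipschitz cutoff, `1` on the ball of radius `R` and `0` outside of the ball of radius `2R`. -/
def ballCut (R r : ℝ) : ℝ := max 0 (min 1 (2 - r / R))

theorem ballCut_nonneg (R r : ℝ) : 0 ≤ ballCut R r := le_max_left _ _

theorem ballCut_le_one (R r : ℝ) : ballCut R r ≤ 1 := max_le zero_le_one (min_le_left _ _)

theorem ballCut_eq_one {R r : ℝ} (hR : 0 < R) (h : r ≤ R) : ballCut R r = 1 := by
  have : r / R ≤ 1 := (div_le_one hR).2 h
  rw [ballCut, min_eq_left (by linarith), max_eq_right zero_le_one]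

theorem ballCut_eq_zero {R r : ℝ} (hR : 0 < R) (h : 2 * R ≤ r) : ballCut R r = 0 := by
  have : 2 ≤ r / R := (le_div_iff₀ hR).2 h
  rw [ballCut, max_eq_left]
  exact (min_le_right _ _).trans (by linarith)

theorem abs_ballCut_sub_le {R : ℝ} (hR : 0 < R) (r r' : ℝ) :
    |ballCut R r - ballCut R r'| ≤ R⁻¹ * |r - r'| := by
  unfold ballCut
  refine (abs_max_sub_max_le_max _ _ _ _).trans ?_
  rw [sub_self, abs_zero, max_eq_right (abs_nonneg _)]
  refine (abs_min_sub_min_le_max _ _ _ _).trans ?_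
  rw [sub_self, abs_zero, max_eq_right (abs_nonneg _),
    show 2 - r / R - (2 - r' / R) = R⁻¹ * (r' - r) by field_simp; ring, abs_mul,
    abs_of_pos (inv_pos.2 hR), abs_sub_comm]

/-- The cutoff makes the field bounded by some L, so Picard–Lindelöf on the ball of radius L T
reaches the prescribed time T although V is only locally Lipschitz. The number θ is the value of the
cutoff; an a priori bound by R makes it 1. -/
theorem exists_cutoff_solution [CompleteSpace E] (V : E → E) (P : E →L[ℝ] E)
    (hV : ∀ ρ : ℝ, ∃ K : ℝ≥0, LipschitzOnWith K V (Metric.closedBall 0 ρ))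
    (hVP : ∀ u, V (P u) = V u) (hPV : ∀ u, P (V u) = V u) (hPP : ∀ u, P (P u) = P u)
    {R T : ℝ} (hR : 0 < R) (hT : 0 ≤ T) (u₀ : E) : ∃ w : ℝ → E, w 0 = P u₀ ∧
      ∀ t ∈ Set.Icc 0 T, P (w t) = w t ∧ ∃ θ ∈ Set.Icc (0 : ℝ) 1, (‖w t‖ ≤ R → θ = 1) ∧
        HasDerivWithinAt w (θ • V (w t)) (Set.Icc 0 T) t := by
  have bound : ∀ ρ : ℝ, ∃ B : ℝ≥0, ∀ u, ‖u‖ ≤ ρ → ‖V u‖ ≤ B := by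
    intro ρ
    obtain ⟨K, hK⟩ := hV ρ
    refine ⟨‖V 0‖₊ + K * ρ.toNNReal, fun u hu => ?_⟩
    have hρ := (norm_nonneg u).trans hu
    have h := hK.dist_le_mul u (by simpa using hu) 0 (by simpa using hρ)
    rw [dist_eq_norm, dist_zero_right] at h
    have h1 : ‖V u‖ ≤ ‖V 0‖ + ‖V u - V 0‖ := by
      simpa using norm_add_le (V 0) (V u - V 0)
    push_cast
    rw [Real.coe_toNNReal _ hρ]
    have : (K : ℝ) * ‖u‖ ≤ K * ρ := by gcongr
    linarith
  -- The cutoff is taken in ‖P u‖, so that W depends on P u only. The projection of a solution then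
  -- satisfies the same equation, with the cutoff evaluated at its own norm.
  set W : E → E := fun u => ballCut R ‖P u‖ • V u with hW
  obtain ⟨L, hL⟩ := bound (2 * R)
  have hWL : ∀ u, ‖W u‖ ≤ L := by
    intro u
    rw [hW]
    dsimp only
    rw [norm_smul, Real.norm_eq_abs, abs_of_nonneg (ballCut_nonneg _ _)]
    rcases le_total (2 * R) ‖P u‖ with h | h
    · rw [ballCut_eq_zero hR h, zero_mul]; exact L.2
    · have := hL (P u) h
      rw [hVP] at this
      calc ballCut R ‖P u‖ * ‖V u‖ ≤ 1 * L := by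
            gcongr
            exact ballCut_le_one _ _
        _ = L := one_mul _
  obtain ⟨K, hK⟩ := hV (‖u₀‖ + L * T)
  obtain ⟨B, hB⟩ := bound (‖u₀‖ + L * T)
  have hball : ∀ u ∈ Metric.closedBall u₀ (L * T.toNNReal : ℝ≥0), ‖u‖ ≤ ‖u₀‖ + L * T := by
    intro u hu
    rw [mem_closedBall_iff_norm] at hu
    push_cast at hu
    rw [Real.coe_toNNReal _ hT] at hu
    have := norm_add_le u₀ (u - u₀)
    rw [add_sub_cancel] at this
    linarith
  have hlip : LipschitzOnWith (K + Real.toNNReal R⁻¹ * ‖P‖₊ * B) W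
      (Metric.closedBall u₀ (L * T.toNNReal : ℝ≥0)) := by
    refine LipschitzOnWith.of_dist_le_mul fun u hu v hv => ?_
    have hu' := hball u hu
    have hv' := hball v hv
    have h1 := hK.dist_le_mul u (by simpa using hu') v (by simpa using hv')
    have h2 := hB v hv'
    have h3 := abs_ballCut_sub_le hR ‖P u‖ ‖P v‖
    have h4 : |‖P u‖ - ‖P v‖| ≤ ‖P‖ * ‖u - v‖ := by
      refine (abs_norm_sub_norm_le _ _).trans ?_
      rw [← map_sub]; exact P.le_opNorm _
    rw [dist_eq_norm, dist_eq_norm] at h1 ⊢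
    have e : W u - W v = ballCut R ‖P u‖ • (V u - V v) + (ballCut R ‖P u‖ - ballCut R ‖P v‖) • V v := by
      simp only [hW, smul_sub, sub_smul]; abel
    rw [e]
    refine (norm_add_le _ _).trans ?_
    rw [norm_smul, norm_smul, Real.norm_eq_abs, Real.norm_eq_abs, abs_of_nonneg (ballCut_nonneg _ _)]
    push_cast
    rw [Real.coe_toNNReal _ (inv_pos.2 hR).le, add_mul]
    have hR' := inv_pos.2 hR
    refine add_le_add ?_ ?_
    · calc ballCut R ‖P u‖ * ‖V u - V v‖ ≤ 1 * (K * ‖u - v‖) := by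
            gcongr
            exact ballCut_le_one _ _
        _ = _ := one_mul _
    · calc |ballCut R ‖P u‖ - ballCut R ‖P v‖| * ‖V v‖ ≤ (R⁻¹ * (‖P‖ * ‖u - v‖)) * B := by
            gcongr
            exact h3.trans (by gcongr)
        _ = _ := by ring
  have hPL : IsPicardLindelof (fun _ => W) (⟨0, le_rfl, hT⟩ : Set.Icc (0 : ℝ) T) u₀
      (L * T.toNNReal) 0 L (K + Real.toNNReal R⁻¹ * ‖P‖₊ * B) := by
    refine IsPicardLindelof.of_time_independent (fun u _ => hWL u) hlip ?_
    simp [hT]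
  obtain ⟨α, hα0, hα⟩ := hPL.exists_eq_forall_mem_Icc_hasDerivWithinAt₀
  refine ⟨fun t => P (α t), by rw [← hα0], fun t ht => ⟨hPP _, ballCut R ‖P (α t)‖,
    ⟨ballCut_nonneg _ _, ballCut_le_one _ _⟩, fun h => ballCut_eq_one hR h, ?_⟩⟩
  have := P.hasFDerivAt.comp_hasDerivWithinAt t (hα t ht)
  refine this.congr_deriv ?_
  simp only [hW, map_smul, hPV, hVP]

end ODE

/-! ### The vector field of the system in L². -/

/-- The size of a pair in `H^{s+1} × H^s`, on the Fourier side. -/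
def sz (s : ℝ) (f g : Plane → ℂ) : ℝ≥0∞ := N2 (fun x => x ^ (s + 1)) f + N2 (fun x => x ^ s) g

theorem sz_lt_top {s : ℝ} {f g : Plane → ℂ} :
    sz s f g < ⊤ ↔ N2 (fun x => x ^ (s + 1)) f < ⊤ ∧ N2 (fun x => x ^ s) g < ⊤ :=
  ENNReal.add_lt_top

theorem sz_hat {s : ℝ} {a b : L2} : sz s (hat a) (hat b) < ⊤ ↔ MemH (s + 1) a ∧ MemH s b := by
  rw [sz_lt_top, MemH, MemH, sobolevNorm_eq, sobolevNorm_eq]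

theorem eLpNorm_quadratic_le {μ : ℝ} {c : ℝ} {J₁ J₂ F : Plane → ℂ}
    (h1 : AEStronglyMeasurable J₁ volume) (h2 : AEStronglyMeasurable J₂ volume)
    (hF : AEStronglyMeasurable F volume) :
    eLpNorm (fun ξ => -(c : ℂ) * (J₁ ξ + J₂ ξ) - ((μ * kap * ‖ξ‖ ^ 2 : ℝ) : ℂ) * F ξ) 2 volume ≤
      ‖c‖ₑ * (eLpNorm J₁ 2 volume + eLpNorm J₂ 2 volume) +
        ‖μ * kap‖ₑ * N2 (fun x => x ^ (2 : ℝ)) F := by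
  have e : (fun ξ => -(c : ℂ) * (J₁ ξ + J₂ ξ) - ((μ * kap * ‖ξ‖ ^ 2 : ℝ) : ℂ) * F ξ) =
      (-(c : ℂ)) • (J₁ + J₂) - ((μ * kap : ℝ) : ℂ) • sqm F := by
    funext ξ
    simp only [sqm, Pi.sub_apply, Pi.smul_apply, Pi.add_apply, smul_eq_mul]
    push_cast; ring
  rw [e]
  refine (eLpNorm_sub_le ((h1.add h2).const_smul _) ((aesm_sqm hF).const_smul _) (by norm_num)).trans ?_
  rw [eLpNorm_const_smul, eLpNorm_const_smul, enorm_neg]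
  have n : ∀ r : ℝ, ‖(r : ℂ)‖ₑ = ‖r‖ₑ := fun r => by
    rw [← ofReal_norm, ← ofReal_norm, Complex.norm_real]
  rw [n, n]
  gcongr
  · exact eLpNorm_add_le h1 h2 (by norm_num)
  · refine (eLpNorm_le_N2 le_rfl _).trans ((N2_sqm_le 0 F).trans (le_of_eq ?_))
    rw [zero_add]

section

variable {s : ℝ} (hs : 2 < s)
include hs

/-- Each Jacobian in `rhs_sub` has one factor from the difference and one bounded by the sizes of
the two pairs. Derivatives are lost, so the target is only L²; this is used to pass to the limit
and, after truncation, to solve the Galerkin system. -/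
theorem rhs_lipschitz (μ ν : ℝ) : ∃ C : ℝ≥0, ∀ f g f' g' : Plane → ℂ,
    AEStronglyMeasurable f volume → AEStronglyMeasurable g volume →
    AEStronglyMeasurable f' volume → AEStronglyMeasurable g' volume →
    sz s f g < ⊤ → sz s f' g' < ⊤ →
    eLpNorm (fun ξ => rhsA μ f g ξ - rhsA μ f' g' ξ) 2 volume ≤
      C * (1 + sz s f g + sz s f' g') * sz s (fun η => f η - f' η) (fun η => g η - g' η) ∧
    eLpNorm (fun ξ => rhsB ν f g ξ - rhsB ν f' g' ξ) 2 volume ≤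
      C * (1 + sz s f g + sz s f' g') * sz s (fun η => f η - f' η) (fun η => g η - g' η) := by
  obtain ⟨C₁, h₁⟩ := N2_Jc_le hs
  obtain ⟨C₂, h₂⟩ := N2_Jc_sqm_le hs
  obtain ⟨k₁, e₁⟩ : ∃ k : ℝ≥0, ‖kap‖ₑ = k := ⟨_, rfl⟩
  obtain ⟨k₂, e₂⟩ : ∃ k : ℝ≥0, ‖μ * kap‖ₑ = k := ⟨_, rfl⟩
  obtain ⟨k₃, e₃⟩ : ∃ k : ℝ≥0, ‖kap ^ 2‖ₑ = k := ⟨_, rfl⟩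
  obtain ⟨k₄, e₄⟩ : ∃ k : ℝ≥0, ‖ν * kap‖ₑ = k := ⟨_, rfl⟩
  refine ⟨k₁ * C₁ + k₂ + (2 * (k₃ * C₂) + k₄), ?_⟩
  intro f g f' g' hf hg hf' hg' b b'
  obtain ⟨b1, b2⟩ := sz_lt_top.1 b
  obtain ⟨b1', b2'⟩ := sz_lt_top.1 b'
  obtain ⟨eA, eB⟩ := rhs_sub hs μ ν hf hg hf' hg' b1 b2 b1' b2'
  have mF : AEStronglyMeasurable (fun η => f η - f' η) volume := hf.sub hf'
  have mG : AEStronglyMeasurable (fun η => g η - g' η) volume := hg.sub hg'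
  rw [eLpNorm_congr_ae eA, eLpNorm_congr_ae eB]
  set F : Plane → ℂ := fun η => f η - f' η
  set G : Plane → ℂ := fun η => g η - g' η
  set m := 1 + sz s f g + sz s f' g' with hm
  have l1 : N2 (fun x => x ^ s) g ≤ m := by
    rw [hm, sz]; exact le_add_right (le_add_left le_add_self)
  have l2 : N2 (fun x => x ^ s) f' ≤ m := by
    rw [hm]; exact (N2_rpow_mono (by linarith) _).trans (le_add_left le_self_add)
  have l3 : N2 (fun x => x ^ (s + 1)) f ≤ m := by
    rw [hm]; exact le_add_right (le_add_left le_self_add)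
  have l4 : N2 (fun x => x ^ (s + 1)) f' ≤ m := by
    rw [hm]; exact (le_add_left le_self_add)
  have l5 : 1 ≤ m := by rw [hm, add_assoc]; exact le_self_add
  have j1 : eLpNorm (Jc F g) 2 volume ≤ C₁ * (N2 (fun x => x ^ (s + 1)) F * m) := by
    refine (eLpNorm_le_N2 (by linarith) _).trans ((h₁ F g mF hg).trans ?_)
    gcongr
    exact N2_rpow_mono (by linarith) _
  have j2 : eLpNorm (Jc f' G) 2 volume ≤ C₁ * (m * N2 (fun x => x ^ s) G) := by
    refine (eLpNorm_le_N2 (by linarith) _).trans ((h₁ f' G hf' mG).trans ?_)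
    gcongr
  have j3 : eLpNorm (Jc F (sqm f)) 2 volume ≤ C₂ * (N2 (fun x => x ^ (s + 1)) F * m) := by
    refine (eLpNorm_le_N2 (by linarith) _).trans ((h₂ F f mF hf).trans ?_)
    gcongr
  have j4 : eLpNorm (Jc f' (sqm F)) 2 volume ≤ C₂ * (m * N2 (fun x => x ^ (s + 1)) F) := by
    refine (eLpNorm_le_N2 (by linarith) _).trans ((h₂ f' F hf' mF).trans ?_)
    gcongr
  have d1 : N2 (fun x => x ^ (2 : ℝ)) F ≤ m * N2 (fun x => x ^ (s + 1)) F :=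
    (N2_rpow_mono (by linarith) _).trans (le_mul_of_one_le_left' l5)
  have d2 : N2 (fun x => x ^ (2 : ℝ)) G ≤ m * N2 (fun x => x ^ s) G :=
    (N2_rpow_mono (by linarith) _).trans (le_mul_of_one_le_left' l5)
  have hF : N2 (fun x => x ^ (s + 1)) F ≤ sz s F G := le_self_add
  have hG : N2 (fun x => x ^ s) G ≤ sz s F G := le_add_self
  have hFG : sz s F G = N2 (fun x => x ^ (s + 1)) F + N2 (fun x => x ^ s) G := rfl
  have qA := eLpNorm_quadratic_le (μ := μ) (c := kap) (aesm_Jc mF hg) (aesm_Jc hf' mG) mF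
  have qB := eLpNorm_quadratic_le (μ := ν) (c := kap ^ 2) (aesm_Jc mF (aesm_sqm hf))
    (aesm_Jc hf' (aesm_sqm mF)) mG
  rw [e₁, e₂] at qA
  rw [e₃, e₄] at qB
  generalize N2 (fun x => x ^ (s + 1)) F = u at *
  generalize N2 (fun x => x ^ s) G = v at *
  generalize sz s F G = z at *
  rw [show ((k₁ * C₁ + k₂ + (2 * (k₃ * C₂) + k₄) : ℝ≥0) : ℝ≥0∞) =
    k₁ * C₁ + k₂ + (2 * (k₃ * C₂) + k₄) by push_cast; ring]
  constructor
  · refine qA.trans ?_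
    calc _ ≤ (k₁ : ℝ≥0∞) * (C₁ * (u * m) + C₁ * (m * v)) + k₂ * (m * u) := by gcongr
      _ ≤ (k₁ : ℝ≥0∞) * (C₁ * (u * m) + C₁ * (m * v)) + k₂ * (m * z) := by gcongr
      _ = (k₁ * C₁ + k₂) * m * z := by rw [hFG]; ring
      _ ≤ _ := mul_le_mul' (mul_le_mul' le_self_add le_rfl) le_rfl
  · refine qB.trans ?_
    calc _ ≤ (k₃ : ℝ≥0∞) * (C₂ * (u * m) + C₂ * (m * u)) + k₄ * (m * v) := by gcongr
      _ ≤ (k₃ : ℝ≥0∞) * (C₂ * (z * m) + C₂ * (m * z)) + k₄ * (m * z) := by gcongr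
      _ = (2 * (k₃ * C₂) + k₄) * m * z := by ring
      _ ≤ _ := mul_le_mul' (mul_le_mul' le_add_self le_rfl) le_rfl

end

open Classical in
/-- The time derivative of `a` prescribed by the system. -/
def fieldA (μ : ℝ) (a b : L2) : L2 :=
  if h : ∃ G : L2, hat G =ᵐ[volume] rhsA μ (hat a) (hat b) then h.choose else 0

open Classical in
/-- The time derivative of `b` prescribed by the system. -/
def fieldB (ν : ℝ) (a b : L2) : L2 :=
  if h : ∃ G : L2, hat G =ᵐ[volume] rhsB ν (hat a) (hat b) then h.choose else 0

theorem fieldA_eq {μ : ℝ} {a b G : L2} (h : hat G =ᵐ[volume] rhsA μ (hat a) (hat b)) :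
    fieldA μ a b = G := by
  have hex : ∃ G : L2, hat G =ᵐ[volume] rhsA μ (hat a) (hat b) := ⟨G, h⟩
  rw [fieldA, dif_pos hex]
  exact hat_injective (hex.choose_spec.trans h.symm)

theorem fieldB_eq {ν : ℝ} {a b G : L2} (h : hat G =ᵐ[volume] rhsB ν (hat a) (hat b)) :
    fieldB ν a b = G := by
  have hex : ∃ G : L2, hat G =ᵐ[volume] rhsB ν (hat a) (hat b) := ⟨G, h⟩
  rw [fieldB, dif_pos hex]
  exact hat_injective (hex.choose_spec.trans h.symm)

theorem sz_sub_hat (s : ℝ) (a b a' b' : L2) : sz s (hat (a - a')) (hat (b - b')) =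
    sz s (fun η => hat a η - hat a' η) (fun η => hat b η - hat b' η) := by
  rw [sz, sz, N2_congr (hat_sub a a'), N2_congr (hat_sub b b')]

section

variable {s : ℝ} (hs : 2 < s)
include hs

theorem hat_fieldA (μ : ℝ) {a b : L2} (h : sz s (hat a) (hat b) < ⊤) :
    hat (fieldA μ a b) =ᵐ[volume] rhsA μ (hat a) (hat b) := by
  obtain ⟨ha, hb⟩ := sz_hat.1 h
  obtain ⟨G, -, hG⟩ := exists_rhsA hs μ ha hb
  rwa [fieldA_eq hG]

theorem hat_fieldB (ν : ℝ) {a b : L2} (h : sz s (hat a) (hat b) < ⊤) :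
    hat (fieldB ν a b) =ᵐ[volume] rhsB ν (hat a) (hat b) := by
  obtain ⟨ha, hb⟩ := sz_hat.1 h
  obtain ⟨G, -, hG⟩ := exists_rhsB hs ν ha hb
  rwa [fieldB_eq hG]

/-- For given a and b the equation determines the time derivative, so it can be traded for an
equality with `fieldA`. -/
theorem fieldA_spec (μ : ℝ) {a b : L2} (h : sz s (hat a) (hat b) < ⊤) (G : L2) :
    (∀ᵐ p, G p + dy a p * dx b p - dx a p * dy b p = μ * lap a p) ↔ G = fieldA μ a b := by
  obtain ⟨ha, hb⟩ := sz_hat.1 h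
  obtain ⟨G', hp, hG⟩ := exists_rhsA hs μ ha hb
  rw [fieldA_eq hG]
  refine ⟨fun h => Lp.ext ?_, fun h => h ▸ hp⟩
  filter_upwards [h, hp] with p h1 h2
  linarith

theorem fieldB_spec (ν : ℝ) {a b : L2} (h : sz s (hat a) (hat b) < ⊤) (G : L2) :
    (∀ᵐ p, G p - dy a p * dx (lap a) p + dx a p * dy (lap a) p = ν * lap b p) ↔
      G = fieldB ν a b := by
  obtain ⟨ha, hb⟩ := sz_hat.1 h
  obtain ⟨G', hp, hG⟩ := exists_rhsB hs ν ha hb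
  rw [fieldB_eq hG]
  refine ⟨fun h => Lp.ext ?_, fun h => h ▸ hp⟩
  filter_upwards [h, hp] with p h1 h2
  linarith

theorem field_lipschitz (μ ν : ℝ) : ∃ C : ℝ≥0, ∀ a b a' b' : L2,
    sz s (hat a) (hat b) < ⊤ → sz s (hat a') (hat b') < ⊤ →
    ‖fieldA μ a b - fieldA μ a' b'‖ₑ ≤ C * (1 + sz s (hat a) (hat b) + sz s (hat a') (hat b')) *
      sz s (hat (a - a')) (hat (b - b')) ∧
    ‖fieldB ν a b - fieldB ν a' b'‖ₑ ≤ C * (1 + sz s (hat a) (hat b) + sz s (hat a') (hat b')) *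
      sz s (hat (a - a')) (hat (b - b')) := by
  obtain ⟨C, hC⟩ := rhs_lipschitz hs μ ν
  refine ⟨C, fun a b a' b' h h' => ?_⟩
  obtain ⟨h1, h2⟩ := hC _ _ _ _ (aesm_hat a) (aesm_hat b) (aesm_hat a') (aesm_hat b') h h'
  rw [sz_sub_hat, ← eLpNorm_hat, ← eLpNorm_hat]
  constructor
  · refine le_trans (le_of_eq (eLpNorm_congr_ae ?_)) h1
    filter_upwards [hat_sub (fieldA μ a b) (fieldA μ a' b'), hat_fieldA hs μ h, hat_fieldA hs μ h']
      with ξ e1 e2 e3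
    rw [e1, e2, e3]
  · refine le_trans (le_of_eq (eLpNorm_congr_ae ?_)) h2
    filter_upwards [hat_sub (fieldB ν a b) (fieldB ν a' b'), hat_fieldB hs ν h, hat_fieldB hs ν h']
      with ξ e1 e2 e3
    rw [e1, e2, e3]

end

theorem enorm_trunc_le (n : ℝ) (f : L2) : ‖trunc n f‖ₑ ≤ ‖f‖ₑ := by
  rw [← eLpNorm_hat, ← eLpNorm_hat, eLpNorm_eq_N2, eLpNorm_eq_N2]
  exact N2_trunc_le n _ f

theorem sz_trunc_lt_top (s n : ℝ) (a b : L2) : sz s (hat (trunc n a)) (hat (trunc n b)) < ⊤ :=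
  sz_lt_top.2 ⟨(rapid_of_trunc (trunc_trunc n a)).fin _, (rapid_of_trunc (trunc_trunc n b)).fin _⟩

/-- On frequencies below n every Sobolev norm is bounded by a multiple of the L² norm, which makes
the truncated field locally Lipschitz on L² × L². -/
theorem exists_sz_trunc_le (s n : ℝ) : ∃ C : ℝ≥0, ∀ a b : L2,
    sz s (hat (trunc n a)) (hat (trunc n b)) ≤ C * (‖a‖ₑ + ‖b‖ₑ) := by
  have key : ∀ k : ℝ, ∃ C : ℝ≥0, ∀ a : L2, N2 (fun x => x ^ k) (hat (trunc n a)) ≤ C * ‖a‖ₑ := by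
    intro k
    refine ⟨(max 1 n ^ |k|).toNNReal, fun a => (N2_trunc_le_of_bound (n := n) (fun x hx hn => ?_)
      (trunc_trunc n a)).trans (mul_le_mul' le_rfl (enorm_trunc_le n a))⟩
    have h1 : (1 : ℝ) ≤ max 1 n := le_max_left _ _
    rw [Real.coe_toNNReal _ (by positivity), abs_of_nonneg (by positivity)]
    exact (Real.rpow_le_rpow_of_exponent_le hx (le_abs_self k)).trans
      (Real.rpow_le_rpow (by linarith) (hn.trans (le_max_right _ _)) (abs_nonneg k))
  obtain ⟨C₁, h₁⟩ := key (s + 1)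
  obtain ⟨C₂, h₂⟩ := key s
  refine ⟨C₁ + C₂, fun a b => (add_le_add (h₁ a) (h₂ b)).trans ?_⟩
  push_cast
  rw [add_mul, mul_add, mul_add]
  exact add_le_add le_self_add le_add_self

/-! ### The Galerkin system and its lifespan. -/

/-- The truncated vector field. -/
def field (μ ν n : ℝ) (u : L2 × L2) : L2 × L2 :=
  (trunc n (fieldA μ (trunc n u.1) (trunc n u.2)), trunc n (fieldB ν (trunc n u.1) (trunc n u.2)))

theorem field_lipschitzOnWith {s : ℝ} (hs : 2 < s) (μ ν n : ℝ) (ρ : ℝ) :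
    ∃ K : ℝ≥0, LipschitzOnWith K (field μ ν n) (Metric.closedBall 0 ρ) := by
  obtain ⟨C, hC⟩ := field_lipschitz hs μ ν
  obtain ⟨D, hD⟩ := exists_sz_trunc_le s n
  refine ⟨C * (1 + D * (2 * ρ.toNNReal) + D * (2 * ρ.toNNReal)) * (D * 2), ?_⟩
  intro u hu v hv
  have hb : ∀ u ∈ Metric.closedBall (0 : L2 × L2) ρ,
      sz s (hat (trunc n u.1)) (hat (trunc n u.2)) ≤ D * (2 * ρ.toNNReal) := by
    intro u hu
    have h : ‖u‖ₑ ≤ ρ.toNNReal := by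
      rw [mem_closedBall_zero_iff] at hu
      rw [← ofReal_norm]
      exact ENNReal.ofReal_le_ofReal hu
    have h1 : ‖u.1‖ₑ ≤ ‖u‖ₑ := by
      rw [enorm_le_iff_norm_le]; exact norm_fst_le u
    have h2 : ‖u.2‖ₑ ≤ ‖u‖ₑ := by
      rw [enorm_le_iff_norm_le]; exact norm_snd_le u
    refine (hD _ _).trans ?_
    rw [two_mul]
    gcongr
    · exact h1.trans h
    · exact h2.trans h
  have hd : sz s (hat (trunc n u.1 - trunc n v.1)) (hat (trunc n u.2 - trunc n v.2)) ≤
      D * 2 * edist u v := by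
    rw [← map_sub, ← map_sub]
    refine (hD _ _).trans ?_
    rw [mul_assoc, two_mul, ← edist_eq_enorm_sub, ← edist_eq_enorm_sub, Prod.edist_eq]
    gcongr
    · exact le_max_left _ _
    · exact le_max_right _ _
  obtain ⟨h1, h2⟩ := hC _ _ _ _ (sz_trunc_lt_top s n u.1 u.2) (sz_trunc_lt_top s n v.1 v.2)
  have main : C * (1 + sz s (hat (trunc n u.1)) (hat (trunc n u.2)) +
      sz s (hat (trunc n v.1)) (hat (trunc n v.2))) *
      sz s (hat (trunc n u.1 - trunc n v.1)) (hat (trunc n u.2 - trunc n v.2)) ≤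
      ((C * (1 + D * (2 * ρ.toNNReal) + D * (2 * ρ.toNNReal)) * (D * 2) : ℝ≥0) : ℝ≥0∞) *
        edist u v := by
    push_cast
    rw [mul_assoc _ (D * 2 : ℝ≥0∞)]
    gcongr
    · exact hb u hu
    · exact hb v hv
  rw [Prod.edist_eq]
  refine max_le ?_ ?_
  · rw [edist_eq_enorm_sub, field, field, ← map_sub]
    exact (enorm_trunc_le n _).trans (h1.trans main)
  · rw [edist_eq_enorm_sub, field, field, ← map_sub]
    exact (enorm_trunc_le n _).trans (h2.trans main)

/-- The derivative of the weighted energy at `(a, b)` in the direction `(a', b')`. -/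
def enDeriv (w : ℝ → ℝ) (f g f' g' : Plane → ℂ) : ℝ :=
  kap * (2 * (∫ ξ, (starRingEnd ℂ) (wt (fun x => (x * w x) ^ 2) f ξ) * f' ξ).re) +
    2 * (∫ ξ, (starRingEnd ℂ) (wt (fun x => w x ^ 2) g ξ) * g' ξ).re

theorem tendsto_N2_trunc {n : ℝ} {v : ℝ → ℝ} {C : ℝ≥0} (hC : ∀ x, 1 ≤ x → x ≤ n → |v x| ≤ C)
    {u : ℝ → L2} {S : Set ℝ} {t : ℝ} (ht : t ∈ S) (hu : ∀ τ ∈ S, trunc n (u τ) = u τ)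
    (hc : ContinuousWithinAt u S t) :
    Filter.Tendsto (fun τ => N2 v (hat (u τ - u t))) (𝓝[S] t) (𝓝 0) := by
  have h1 : Filter.Tendsto (fun τ => (C : ℝ≥0∞) * ‖u τ - u t‖ₑ) (𝓝[S] t) (𝓝 0) := by
    have := (hc.sub_const (u t)).enorm
    simp only [sub_self, enorm_zero] at this
    simpa using ENNReal.Tendsto.const_mul this (Or.inr ENNReal.coe_ne_top)
  refine tendsto_of_tendsto_of_tendsto_of_le_of_le' tendsto_const_nhds h1
    (Filter.Eventually.of_forall fun _ => zero_le) ?_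
  filter_upwards [self_mem_nhdsWithin] with τ hτ
  refine N2_trunc_le_of_bound hC ?_
  rw [map_sub, hu τ hτ, hu t ht]

theorem hasDerivWithinAt_en_trunc {n k : ℝ} {w : ℝ → ℝ} (hw : IsWt k w) {α β : ℝ → L2} {A B : L2}
    {S : Set ℝ} {t : ℝ} (ht : t ∈ S) (hα : ∀ τ ∈ S, trunc n (α τ) = α τ)
    (hβ : ∀ τ ∈ S, trunc n (β τ) = β τ) (dα : HasDerivWithinAt α A S t)
    (dβ : HasDerivWithinAt β B S t) :
    HasDerivWithinAt (fun τ => en w (hat (α τ)) (hat (β τ)))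
      (enDeriv w (hat (α t)) (hat (β t)) (hat A) (hat B)) S t := by
  have hw0 := hw.meas
  have mx : Measurable fun x => x * w x := by fun_prop
  have e1 : (fun x => (x * w x) ^ 2) = fun x => x ^ 2 * w x ^ 2 := by funext x; ring
  have b0 : ∀ x, 1 ≤ x → x ≤ n → |w x ^ 2| ≤ ((w n ^ 2).toNNReal : ℝ) := fun x hx hn => by
    rw [Real.coe_toNNReal _ (by positivity), abs_of_nonneg (by positivity)]
    have := (hw.pos x hx).le
    gcongr
    exact hw.mono x n hx hn
  have b1 : ∀ x, 1 ≤ x → x ≤ n → |(x * w x) ^ 2| ≤ (((n * w n) ^ 2).toNNReal : ℝ) := fun x hx hn => by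
    rw [Real.coe_toNNReal _ (by positivity), abs_of_nonneg (by positivity)]
    have := (hw.pos x hx).le
    have := hw.mono x n hx hn
    have : 0 ≤ n := by linarith
    gcongr
  have d1 := hasDerivWithinAt_nr_sq mx ht (fun τ hτ => by
      rw [e1]; exact (rapid_of_trunc (hα τ hτ)).lt_top_wt hw 2 2)
    (tendsto_N2_trunc b1 ht hα dα.continuousWithinAt) dα
  have d2 := hasDerivWithinAt_nr_sq hw0 ht (fun τ hτ => by
      simpa using (rapid_of_trunc (hβ τ hτ)).lt_top_wt hw 0 2)
    (tendsto_N2_trunc b0 ht hβ dβ.continuousWithinAt) dβ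
  exact (d1.const_mul kap).add d2

/-- The truncation is a multiplier equal to 1 wherever α is nonzero, so it disappears in the
pairing: the truncated field has the same energy derivative as the full one. -/
theorem integral_conj_wt_trunc {n : ℝ} (v : ℝ → ℝ) {α G : L2} (hα : trunc n α = α) {F : Plane → ℂ}
    (hG : hat G =ᵐ[volume] F) :
    ∫ ξ, (starRingEnd ℂ) (wt v (hat α) ξ) * hat (trunc n G) ξ =
      ∫ ξ, (starRingEnd ℂ) (wt v (hat α) ξ) * F ξ := by
  refine integral_congr_ae ?_
  have h := hat_trunc n α
  rw [hα] at h
  filter_upwards [h, hat_trunc n G, hG] with ξ h1 h2 h3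
  rw [h2, wt, wt, h3, h1, wt, map_mul, map_mul, Complex.conj_ofReal, Complex.conj_ofReal]
  have : (cut n (jb ξ) : ℂ) * cut n (jb ξ) = cut n (jb ξ) := by
    rw [← Complex.ofReal_mul, cut_mul_self]
  linear_combination ((v (jb ξ) : ℂ) * (starRingEnd ℂ) (hat α ξ) * F ξ) * this

theorem norm_le_nr (s : ℝ) (hs : 0 ≤ s) {f : L2} (h : N2 (fun x => x ^ s) (hat f) < ⊤) :
    ‖f‖ ≤ nr (fun x => x ^ s) (hat f) := by
  rw [← toReal_enorm, ← eLpNorm_hat]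
  exact ENNReal.toReal_mono h.ne (eLpNorm_le_N2 hs _)

/-- A solution of the truncated system on `[0, T]` with energy at most `M`. -/
structure Galerkin (s μ ν T M n : ℝ) (a₀ b₀ : L2) (α β : ℝ → L2) : Prop where
  init : α 0 = trunc n a₀ ∧ β 0 = trunc n b₀
  tr : ∀ t ∈ Set.Icc 0 T, trunc n (α t) = α t ∧ trunc n (β t) = β t
  bound : ∀ t ∈ Set.Icc 0 T, en (fun x => x ^ s) (hat (α t)) (hat (β t)) ≤ M
  deriv_a : ∀ t ∈ Set.Icc 0 T,
    HasDerivWithinAt α (trunc n (fieldA μ (α t) (β t))) (Set.Icc 0 T) t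
  deriv_b : ∀ t ∈ Set.Icc 0 T,
    HasDerivWithinAt β (trunc n (fieldB ν (α t) (β t))) (Set.Icc 0 T) t

section

variable {s : ℝ} (hs : 2 < s) {μ ν : ℝ} (hμν : (0 < μ ∧ ν = 0) ∨ (μ = 0 ∧ 0 < ν))
include hs hμν

theorem enDeriv_trunc_le : ∃ K : ℝ, 0 ≤ K ∧ ∀ (n : ℝ) (w : ℝ → ℝ), IsWt (s + 1) w →
    ∀ α β : L2, trunc n α = α → trunc n β = β →
    enDeriv w (hat α) (hat β) (hat (trunc n (fieldA μ α β))) (hat (trunc n (fieldB ν α β))) ≤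
    -ds μ ν w (hat α) (hat β) + K * (1 + √(ds μ ν (fun x => x ^ s) (hat α) (hat β)) +
      en (fun x => x ^ s) (hat α) (hat β)) * en w (hat α) (hat β) := by
  obtain ⟨K, hK, h⟩ := energy_estimate hs hμν (k := s + 1) (by linarith)
  refine ⟨2 * K, by positivity, fun n w hw α β hα hβ => ?_⟩
  have hsz : sz s (hat α) (hat β) < ⊤ :=
    sz_lt_top.2 ⟨(rapid_of_trunc hα).fin _, (rapid_of_trunc hβ).fin _⟩
  have := h w hw _ _ (rapid_of_trunc hα) (rapid_of_trunc hβ)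
  rw [enDeriv, integral_conj_wt_trunc _ hα (hat_fieldA hs μ hsz),
    integral_conj_wt_trunc _ hβ (hat_fieldB hs ν hsz)]
  linarith

omit hμν in
theorem norm_le_sqrt_en {α β : L2} (h : sz s (hat α) (hat β) < ⊤) :
    ‖α‖ ^ 2 ≤ en (fun x => x ^ s) (hat α) (hat β) ∧ ‖β‖ ^ 2 ≤ en (fun x => x ^ s) (hat α) (hat β) := by
  obtain ⟨h1, h2⟩ := sz_lt_top.1 h
  constructor
  · refine le_trans ?_ (nr_le_sqrt_en_left _ _ _)
    rw [nr_weight_congr (mul_rpow_weight s)]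
    gcongr
    exact norm_le_nr _ (by linarith) h1
  · refine le_trans ?_ (nr_le_sqrt_en_right _ _ _)
    gcongr
    exact norm_le_nr _ (by linarith) h2

omit hs hμν in
theorem nr_le_of_sobolevNorm_le {σ : ℝ} {f : L2} {A : ℝ≥0} (h : sobolevNorm σ f ≤ A) (n : ℝ) :
    nr (fun x => x ^ σ) (hat (trunc n f)) ≤ A := by
  rw [nr, ← ENNReal.coe_toReal A]
  refine ENNReal.toReal_mono ENNReal.coe_ne_top ((N2_trunc_le n _ f).trans ?_)
  rwa [← sobolevNorm_eq]

/-- The constants of the energy estimate do not depend on n, so one barrier argument gives a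
lifespan and a bound common to all truncations and all data of the given size. -/
theorem exists_galerkin (A B : ℝ≥0) : ∃ T : ℝ, 0 < T ∧ ∃ M : ℝ, ∀ (n : ℝ) (a₀ b₀ : L2),
    sobolevNorm (s + 1) a₀ ≤ A → sobolevNorm s b₀ ≤ B →
    ∃ α β : ℝ → L2, Galerkin s μ ν T M n a₀ b₀ α β := by
  obtain ⟨K, hK, hP⟩ := enDeriv_trunc_le hs hμν
  have hμ : 0 ≤ μ := by rcases hμν with h | h <;> linarith [h.1, h.2]
  have hν : 0 ≤ ν := by rcases hμν with h | h <;> linarith [h.1, h.2]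
  have hk := kap_pos
  set E₀ : ℝ := kap * A ^ 2 + B ^ 2 with hE₀
  have hE₀0 : 0 ≤ E₀ := by positivity
  -- The energy may grow by 1. Since M ≥ 1, a squared norm at most M gives a norm at most M, so M
  -- also serves as the radius of the cutoff.
  set M : ℝ := E₀ + 1 with hM
  have hM0 : 0 < M := by linarith
  -- L − 1 bounds the derivative of the energy while the energy is at most M, the factor √ds being
  -- absorbed by completing a square. The extra 1 gives the strict inequality that the barrier
  -- needs, and time 1/L keeps the growth below 1.
  set L : ℝ := K * (1 + M) * M + K ^ 2 * M ^ 2 / 4 + 1 with hL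
  have hL0 : 0 < L := by positivity
  have hTpos : 0 < 1 / L := by positivity
  have hIs : IsWt (s + 1) fun x => x ^ s := isWt_rpow (by linarith) (by linarith)
  refine ⟨1 / L, hTpos, M, fun n a₀ b₀ ha hb => ?_⟩
  obtain ⟨w, hw0, hw⟩ := exists_cutoff_solution (field μ ν n) ((trunc n).prodMap (trunc n))
    (field_lipschitzOnWith hs μ ν n) (fun u => by simp [field, trunc_trunc])
    (fun u => by simp [field, trunc_trunc]) (fun u => Prod.ext (trunc_trunc n u.1) (trunc_trunc n u.2)) hM0 hTpos.le (a₀, b₀)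
  have htr : ∀ t ∈ Set.Icc 0 (1 / L), trunc n (w t).1 = (w t).1 ∧ trunc n (w t).2 = (w t).2 := by
    intro t ht
    have := (hw t ht).1
    exact ⟨congrArg Prod.fst this, congrArg Prod.snd this⟩
  have hsz : ∀ t ∈ Set.Icc 0 (1 / L), sz s (hat (w t).1) (hat (w t).2) < ⊤ := fun t ht =>
    sz_lt_top.2 ⟨(rapid_of_trunc (htr t ht).1).fin _, (rapid_of_trunc (htr t ht).2).fin _⟩
  have hd : ∀ t ∈ Set.Icc 0 (1 / L), ∃ θ ∈ Set.Icc (0 : ℝ) 1, (‖w t‖ ≤ M → θ = 1) ∧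
      HasDerivWithinAt (fun t => (w t).1) (θ • trunc n (fieldA μ (w t).1 (w t).2))
        (Set.Icc 0 (1 / L)) t ∧
      HasDerivWithinAt (fun t => (w t).2) (θ • trunc n (fieldB ν (w t).1 (w t).2))
        (Set.Icc 0 (1 / L)) t := by
    intro t ht
    obtain ⟨-, θ, hθ, hθ1, hder⟩ := hw t ht
    have e : field μ ν n (w t) = (trunc n (fieldA μ (w t).1 (w t).2),
        trunc n (fieldB ν (w t).1 (w t).2)) := by
      rw [field, (htr t ht).1, (htr t ht).2]
    rw [e] at hder
    exact ⟨θ, hθ, hθ1, (ContinuousLinearMap.fst ℝ L2 L2).hasFDerivAt.comp_hasDerivWithinAt t hder,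
      (ContinuousLinearMap.snd ℝ L2 L2).hasFDerivAt.comp_hasDerivWithinAt t hder⟩
  have hen : ∀ t ∈ Set.Icc 0 (1 / L), ∃ E' : ℝ, HasDerivWithinAt
      (fun t => en (fun x => x ^ s) (hat (w t).1) (hat (w t).2)) E' (Set.Icc 0 (1 / L)) t ∧
      (en (fun x => x ^ s) (hat (w t).1) (hat (w t).2) ≤ M → E' < L) := by
    intro t ht
    obtain ⟨θ, hθ, -, h1, h2⟩ := hd t ht
    refine ⟨_, hasDerivWithinAt_en_trunc hIs ht (fun τ hτ => (htr τ hτ).1)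
      (fun τ hτ => (htr τ hτ).2) h1 h2, fun hle => ?_⟩
    have hp := hP n _ hIs _ _ (htr t ht).1 (htr t ht).2
    have hlin : enDeriv (fun x => x ^ s) (hat (w t).1) (hat (w t).2)
        (hat (θ • trunc n (fieldA μ (w t).1 (w t).2))) (hat (θ • trunc n (fieldB ν (w t).1 (w t).2))) =
        θ * enDeriv (fun x => x ^ s) (hat (w t).1) (hat (w t).2)
        (hat (trunc n (fieldA μ (w t).1 (w t).2))) (hat (trunc n (fieldB ν (w t).1 (w t).2))) := by
      have aux : ∀ (F : Plane → ℂ) (G : L2), (∫ ξ, (starRingEnd ℂ) (F ξ) * hat (θ • G) ξ).re =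
          θ * (∫ ξ, (starRingEnd ℂ) (F ξ) * hat G ξ).re := by
        intro F G
        rw [← Complex.re_ofReal_mul, ← integral_const_mul]
        congr 1
        refine integral_congr_ae ?_
        filter_upwards [hat_smul θ G] with ξ h
        rw [h]; ring
      rw [enDeriv, enDeriv, aux, aux]; ring
    rw [hlin]
    set e := en (fun x => x ^ s) (hat (w t).1) (hat (w t).2)
    set d := ds μ ν (fun x => x ^ s) (hat (w t).1) (hat (w t).2)
    set p := enDeriv (fun x => x ^ s) (hat (w t).1) (hat (w t).2)
        (hat (trunc n (fieldA μ (w t).1 (w t).2))) (hat (trunc n (fieldB ν (w t).1 (w t).2)))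
    have he0 : 0 ≤ e := en_nonneg _ _ _
    have hd0 : 0 ≤ d := ds_nonneg hμ hν _ _ _
    have hsq := Real.sq_sqrt hd0
    have h3 : p ≤ K * (1 + e) * e + K ^ 2 * e ^ 2 / 4 := by
      nlinarith [sq_nonneg (√d - K * e / 2)]
    have h4 : K * (1 + e) * e + K ^ 2 * e ^ 2 / 4 ≤ K * (1 + M) * M + K ^ 2 * M ^ 2 / 4 := by gcongr
    have h5 : p ≤ L - 1 := by rw [hL]; linarith
    have h6 : 0 ≤ L - 1 := by rw [hL]; have : 0 ≤ K * (1 + M) * M + K ^ 2 * M ^ 2 / 4 := by positivity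
                              linarith
    -- The bound holds for every θ in [0, 1], so it does not presuppose that the cutoff is inactive;
    -- that is deduced afterwards from the energy bound.
    calc θ * p ≤ θ * (L - 1) := by gcongr; exact hθ.1
      _ ≤ 1 * (L - 1) := by gcongr; exact hθ.2
      _ < L := by linarith
  choose! E' hE' hEL using hen
  have hbound : ∀ t ∈ Set.Icc 0 (1 / L), en (fun x => x ^ s) (hat (w t).1) (hat (w t).2) ≤ E₀ + L * t := by
    intro t ht
    refine image_le_of_deriv_right_lt_deriv_boundary
      (f := fun t => en (fun x => x ^ s) (hat (w t).1) (hat (w t).2)) (f' := E')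
      (fun t ht => (hE' t ht).continuousWithinAt)
      (fun t ht => hasDerivWithinAt_Ici_of_Icc ht (hE' t (Set.Ico_subset_Icc_self ht)))
      (B := fun t => E₀ + L * t) (B' := fun _ => L) ?_ (fun t => ?_) (fun t ht he => ?_) ht
    · have e1 : (w 0).1 = trunc n a₀ := by rw [hw0]; rfl
      have e2 : (w 0).2 = trunc n b₀ := by rw [hw0]; rfl
      rw [e1, e2, mul_zero, add_zero, en, nr_weight_congr (mul_rpow_weight s), hE₀]
      have h1 := nr_le_of_sobolevNorm_le ha n
      have h2 := nr_le_of_sobolevNorm_le hb n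
      have := nr_nonneg (fun x => x ^ (s + 1)) (hat (trunc n a₀))
      have := nr_nonneg (fun x => x ^ s) (hat (trunc n b₀))
      gcongr
    · simpa using ((hasDerivAt_id t).const_mul L).const_add E₀
    · refine hEL t (Set.Ico_subset_Icc_self ht) ?_
      rw [he, hM]
      have : L * t ≤ L * (1 / L) := by gcongr; exact ht.2.le
      rw [mul_one_div_cancel hL0.ne'] at this
      linarith
  have hboundM : ∀ t ∈ Set.Icc 0 (1 / L), en (fun x => x ^ s) (hat (w t).1) (hat (w t).2) ≤ M := by
    intro t ht
    refine (hbound t ht).trans ?_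
    have : L * t ≤ L * (1 / L) := by gcongr; exact ht.2
    rw [mul_one_div_cancel hL0.ne'] at this
    linarith
  have hθ : ∀ t ∈ Set.Icc 0 (1 / L), ‖w t‖ ≤ M := by
    intro t ht
    obtain ⟨h1, h2⟩ := norm_le_sqrt_en hs (hsz t ht)
    have h3 := hboundM t ht
    have : ∀ r : ℝ, r ^ 2 ≤ M → r ≤ M := fun r hr => by nlinarith
    rw [Prod.norm_def]
    exact max_le (this _ (h1.trans h3)) (this _ (h2.trans h3))
  refine ⟨fun t => (w t).1, fun t => (w t).2, ⟨?_, htr, hboundM, fun t ht => ?_, fun t ht => ?_⟩⟩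
  · rw [hw0]; exact ⟨rfl, rfl⟩
  · obtain ⟨θ, -, h1, h2, -⟩ := hd t ht
    rwa [h1 (hθ t ht), one_smul] at h2
  · obtain ⟨θ, -, h1, -, h2⟩ := hd t ht
    rwa [h1 (hθ t ht), one_smul] at h2

end

/-! ### Bounds for Galerkin solutions and stability of approximate solutions. -/

theorem nr_le_of_N2_le {w : ℝ → ℝ} {f : Plane → ℂ} {M : ℝ≥0} (h : N2 w f ≤ M) : nr w f ≤ M := by
  rw [nr, ← ENNReal.coe_toReal M]
  exact ENNReal.toReal_mono ENNReal.coe_ne_top h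

theorem en_le_of_sz_le {s : ℝ} {f g : Plane → ℂ} {M : ℝ≥0} (h : sz s f g ≤ M) :
    en (fun x => x ^ s) f g ≤ (kap + 1) * M ^ 2 := by
  have h1 := nr_le_of_N2_le (le_self_add.trans h)
  have h2 := nr_le_of_N2_le (le_add_self.trans h)
  rw [en, nr_weight_congr (mul_rpow_weight s), add_mul, one_mul]
  have := nr_nonneg (fun x => x ^ (s + 1)) f
  have := nr_nonneg (fun x => x ^ s) g
  have := kap_pos
  gcongr

theorem sz_le_of_en_le {s : ℝ} {f g : Plane → ℂ} {M : ℝ} (hf : sz s f g < ⊤)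
    (h : en (fun x => x ^ s) f g ≤ M) : sz s f g ≤ ((2 * (1 + M)).toNNReal : ℝ≥0∞) := by
  obtain ⟨h1, h2⟩ := sz_lt_top.1 hf
  have key : ∀ {w : ℝ → ℝ} {f : Plane → ℂ}, N2 w f < ⊤ → nr w f ^ 2 ≤ M →
      N2 w f ≤ ENNReal.ofReal (1 + M) := fun {w f} hf hM => by
    rw [← ENNReal.ofReal_toReal hf.ne]
    refine ENNReal.ofReal_le_ofReal ?_
    change nr w f ≤ _
    nlinarith [sq_nonneg (nr w f - 1)]
  have hM : 0 ≤ M := (en_nonneg _ _ _).trans h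
  have e1 := nr_le_sqrt_en_left (fun x => x ^ s) f g
  rw [nr_weight_congr (mul_rpow_weight s)] at e1
  refine (add_le_add (key h1 (e1.trans h)) (key h2 ((nr_le_sqrt_en_right _ _ _).trans h))).trans ?_
  rw [← ENNReal.ofReal_add (by positivity) (by positivity)]
  exact ENNReal.ofReal_le_ofReal (by linarith)

/-- Solutions of the system on `[0, T]` up to a residual of size `ε` in `H¹ × L²`. -/
structure ApproxSol (s μ ν T : ℝ) (M : ℝ≥0) (ε : ℝ) (a b : ℝ → L2) : Prop where
  bound : ∀ t ∈ Set.Icc 0 T, sz s (hat (a t)) (hat (b t)) ≤ M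
  deriv_a : ∀ t ∈ Set.Icc 0 T, ∃ A : L2, HasDerivWithinAt a A (Set.Icc 0 T) t ∧
    N2 (fun x => x ^ (1 : ℝ)) (hat (A - fieldA μ (a t) (b t))) ≤ ENNReal.ofReal ε
  deriv_b : ∀ t ∈ Set.Icc 0 T, ∃ B : L2, HasDerivWithinAt b B (Set.Icc 0 T) t ∧
    N2 (fun x => x ^ (0 : ℝ)) (hat (B - fieldB ν (a t) (b t))) ≤ ENNReal.ofReal ε

theorem Galerkin.sz_lt {s μ ν T M n : ℝ} {a₀ b₀ : L2} {α β : ℝ → L2}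
    (h : Galerkin s μ ν T M n a₀ b₀ α β) {t : ℝ} (ht : t ∈ Set.Icc 0 T) :
    sz s (hat (α t)) (hat (β t)) < ⊤ :=
  sz_lt_top.2 ⟨(rapid_of_trunc (h.tr t ht).1).fin _, (rapid_of_trunc (h.tr t ht).2).fin _⟩

theorem Galerkin.mono {s μ ν T T' M n : ℝ} {a₀ b₀ : L2} {α β : ℝ → L2}
    (h : Galerkin s μ ν T M n a₀ b₀ α β) (hT : T' ≤ T) : Galerkin s μ ν T' M n a₀ b₀ α β := by
  have hs : Set.Icc 0 T' ⊆ Set.Icc 0 T := Set.Icc_subset_Icc_right hT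
  exact ⟨h.init, fun t ht => h.tr t (hs ht), fun t ht => h.bound t (hs ht),
    fun t ht => (h.deriv_a t (hs ht)).mono hs, fun t ht => (h.deriv_b t (hs ht)).mono hs⟩

section

variable {s : ℝ} (hs : 2 < s) {μ ν : ℝ} (hμν : (0 < μ ∧ ν = 0) ∨ (μ = 0 ∧ 0 < ν))
include hs hμν

theorem Galerkin.energy : ∃ K : ℝ, 0 ≤ K ∧ ∀ {T M n : ℝ} {a₀ b₀ : L2} {α β : ℝ → L2},
    Galerkin s μ ν T M n a₀ b₀ α β → ∀ w, IsWt (s + 1) w → ∃ E' : ℝ → ℝ, ∀ t ∈ Set.Icc 0 T,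
    HasDerivWithinAt (fun t => en w (hat (α t)) (hat (β t))) (E' t) (Set.Icc 0 T) t ∧
    E' t ≤ -ds μ ν w (hat (α t)) (hat (β t)) +
      K * (1 + √(ds μ ν (fun x => x ^ s) (hat (α t)) (hat (β t))) +
        en (fun x => x ^ s) (hat (α t)) (hat (β t))) * en w (hat (α t)) (hat (β t)) := by
  obtain ⟨K, hK, h⟩ := enDeriv_trunc_le hs hμν
  refine ⟨K, hK, fun hG w hw => ⟨_, fun t ht => ⟨hasDerivWithinAt_en_trunc hw ht
    (fun τ hτ => (hG.tr τ hτ).1) (fun τ hτ => (hG.tr τ hτ).2) (hG.deriv_a t ht) (hG.deriv_b t ht), ?_⟩⟩⟩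
  exact h _ w hw _ _ (hG.tr t ht).1 (hG.tr t ht).2

/-- A dissipative bound for the energy of a Galerkin solution. -/
theorem Galerkin.dissipation (M : ℝ) : ∃ K : ℝ, 0 ≤ K ∧ ∀ {T M' n : ℝ} {a₀ b₀ : L2}
    {α β : ℝ → L2}, Galerkin s μ ν T M' n a₀ b₀ α β →
    (∀ t ∈ Set.Icc 0 T, en (fun x => x ^ s) (hat (α t)) (hat (β t)) ≤ M) →
    ∃ S' : ℝ → ℝ, ∀ t ∈ Set.Icc 0 T,
    HasDerivWithinAt (fun t => en (fun x => x ^ s) (hat (α t)) (hat (β t))) (S' t) (Set.Icc 0 T) t ∧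
    S' t ≤ -(1 / 2) * ds μ ν (fun x => x ^ s) (hat (α t)) (hat (β t)) + K := by
  obtain ⟨K, hK, h⟩ := Galerkin.energy hs hμν
  have hμ : 0 ≤ μ := by rcases hμν with h | h <;> linarith [h.1, h.2]
  have hν : 0 ≤ ν := by rcases hμν with h | h <;> linarith [h.1, h.2]
  -- The term K √ds · en is absorbed by half of the dissipation, which leaves K² en² / 2.
  refine ⟨K * (1 + |M|) * |M| + K ^ 2 * |M| ^ 2 / 2, by positivity, fun hG hM => ?_⟩
  obtain ⟨E', hE⟩ := h hG _ (isWt_rpow (by linarith : 0 ≤ s) (by linarith))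
  refine ⟨E', fun t ht => ⟨(hE t ht).1, (hE t ht).2.trans ?_⟩⟩
  set e := en (fun x => x ^ s) (hat _) (hat _)
  set d := ds μ ν (fun x => x ^ s) (hat _) (hat _)
  have he0 : 0 ≤ e := en_nonneg _ _ _
  have heM : e ≤ |M| := (hM t ht).trans (le_abs_self M)
  have hd0 : 0 ≤ d := ds_nonneg hμ hν _ _ _
  have hsq := Real.sq_sqrt hd0
  have h3 : K * (1 + √d + e) * e ≤ K * (1 + e) * e + K ^ 2 * e ^ 2 / 2 + d / 2 := by
    nlinarith [sq_nonneg (√d - K * e)]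
  have h4 : K * (1 + e) * e + K ^ 2 * e ^ 2 / 2 ≤ K * (1 + |M|) * |M| + K ^ 2 * |M| ^ 2 / 2 := by
    gcongr
  linarith

/-- Weighted energies of Galerkin solutions are controlled by their initial values. -/
theorem Galerkin.weighted_bound (T M : ℝ) : ∃ C : ℝ, 0 ≤ C ∧ ∀ (n : ℝ) (a₀ b₀ : L2)
    (α β : ℝ → L2), Galerkin s μ ν T M n a₀ b₀ α β → ∀ w, IsWt (s + 1) w → ∀ t ∈ Set.Icc 0 T,
    en w (hat (α t)) (hat (β t)) ≤ C * en w (hat (trunc n a₀)) (hat (trunc n b₀)) := by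
  obtain ⟨K, hK, h⟩ := Galerkin.energy hs hμν
  obtain ⟨K', hK', h'⟩ := Galerkin.dissipation hs hμν M
  have hμ : 0 ≤ μ := by rcases hμν with h | h <;> linarith [h.1, h.2]
  have hν : 0 ≤ ν := by rcases hμν with h | h <;> linarith [h.1, h.2]
  refine ⟨Real.exp ((K * (1 + |M|) + (K * (1 + |M|)) ^ 2 / (4 * (1 / 2)) + K') * T + M),
    (Real.exp_pos _).le, fun n a₀ b₀ α β hG w hw t ht => ?_⟩
  obtain ⟨E', hE⟩ := h hG w hw
  obtain ⟨S', hS⟩ := h' hG hG.bound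
  have := gronwall_weighted (c := 1 / 2) (L := K * (1 + |M|)) (K := K') (M := M) (by norm_num)
    (by positivity) hK' (fun t ht => (hE t ht).1) (fun t ht => (hS t ht).1)
    (fun t ht => en_nonneg _ _ _) (fun t ht => ⟨en_nonneg _ _ _, hG.bound t ht⟩)
    (fun t ht => ds_nonneg hμ hν _ _ _) (fun t ht => (hS t ht).2) (fun t ht => ?_) t ht
  · rwa [hG.init.1, hG.init.2] at this
  · refine (hE t ht).2.trans ?_
    have h1 := ds_nonneg hμ hν w (hat (α t)) (hat (β t))
    have h2 := en_nonneg w (hat (α t)) (hat (β t))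
    have h3 : en (fun x => x ^ s) (hat (α t)) (hat (β t)) ≤ |M| := (hG.bound t ht).trans (le_abs_self M)
    have h4 := Real.sqrt_nonneg (ds μ ν (fun x => x ^ s) (hat (α t)) (hat (β t)))
    have h5 : 1 + √(ds μ ν (fun x => x ^ s) (hat (α t)) (hat (β t))) +
        en (fun x => x ^ s) (hat (α t)) (hat (β t)) ≤
        (1 + |M|) * (1 + √(ds μ ν (fun x => x ^ s) (hat (α t)) (hat (β t)))) := by
      nlinarith [abs_nonneg M]
    have h6 := mul_le_mul_of_nonneg_right (mul_le_mul_of_nonneg_left h5 hK) h2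
    linarith

omit hs hμν in
theorem ApproxSol.sz_sub_le {T : ℝ} {M : ℝ≥0} {ε : ℝ} {a b a' b' : ℝ → L2}
    (h : ApproxSol s μ ν T M ε a b) (h' : ApproxSol s μ ν T M ε a' b') {t : ℝ}
    (ht : t ∈ Set.Icc 0 T) : sz s (hat (a t - a' t)) (hat (b t - b' t)) ≤ (2 * M : ℝ≥0) := by
  rw [sz_sub_hat]
  refine (add_le_add (N2_sub_le (measurable_rpow_const _) (aesm_hat _) (aesm_hat _))
    (N2_sub_le (measurable_rpow_const _) (aesm_hat _) (aesm_hat _))).trans ?_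
  have h1 := h.bound t ht
  have h2 := h'.bound t ht
  rw [sz] at h1 h2
  push_cast
  calc _ = _ := add_add_add_comm _ _ _ _
    _ ≤ (M : ℝ≥0∞) + M := add_le_add h1 h2
    _ = _ := (two_mul _).symm

-- The time derivatives exist only in L². The weights ⟨ξ⟩² on u and 1 on v are of lower order than s
-- + 1 and s, so continuity in L² and the bound by B give the continuity that
-- `hasDerivWithinAt_nr_sq` requires.
omit hμν in
theorem hasDerivWithinAt_en_one {S : Set ℝ} {t : ℝ} (ht : t ∈ S) {u v : ℝ → L2} {u' v' : L2} {B : ℝ≥0}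
    (hB : ∀ τ ∈ S, sz s (hat (u τ)) (hat (v τ)) ≤ B) (hu : HasDerivWithinAt u u' S t)
    (hv : HasDerivWithinAt v v' S t) :
    HasDerivWithinAt (fun τ => en (fun _ => 1) (hat (u τ)) (hat (v τ)))
      (enDeriv (fun _ => 1) (hat (u t)) (hat (v t)) (hat u') (hat v')) S t := by
  have q2 : (fun x : ℝ => (x * 1) ^ 2) = fun x => x ^ (2 : ℝ) := by funext x; norm_cast; ring
  have q0 : (fun _ : ℝ => (1 : ℝ) ^ 2) = fun x => x ^ (0 : ℝ) := by funext x; simp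
  have hlim : ∀ {u : ℝ → L2} {u' : L2} {p q : ℝ}, 0 ≤ p → p < q → HasDerivWithinAt u u' S t →
      (∀ τ ∈ S, N2 (fun x => x ^ q) (hat (u τ)) ≤ B) →
      Filter.Tendsto (fun τ => N2 (fun x => x ^ p) (hat (u τ - u t))) (𝓝[S] t) (𝓝 0) := by
    intro u u' p q hp hpq hd hb
    refine tendsto_N2_of_tendsto hp hpq (B := B + B) ?_ ?_
    · simpa using (hd.continuousWithinAt.sub_const (u t))
    · filter_upwards [self_mem_nhdsWithin] with τ hτ
      rw [N2_congr (hat_sub _ _)]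
      refine (N2_sub_le (measurable_rpow_const _) (aesm_hat _) (aesm_hat _)).trans ?_
      push_cast
      exact add_le_add (hb τ hτ) (hb t ht)
  have bu : ∀ τ ∈ S, N2 (fun x => x ^ (s + 1)) (hat (u τ)) ≤ B := fun τ hτ => le_self_add.trans (hB τ hτ)
  have bv : ∀ τ ∈ S, N2 (fun x => x ^ s) (hat (v τ)) ≤ B := fun τ hτ => le_add_self.trans (hB τ hτ)
  have d1 := hasDerivWithinAt_nr_sq (w := fun x => x * 1) (by fun_prop) ht
    (fun τ hτ => by
      rw [q2]; exact N2_lt_of_le (by linarith) ((bu τ hτ).trans_lt ENNReal.coe_lt_top))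
    (by rw [q2]; exact hlim (by norm_num) (by linarith) hu bu) hu
  have d2 := hasDerivWithinAt_nr_sq (w := fun _ => 1) measurable_const ht
    (fun τ hτ => by
      rw [q0]; exact N2_lt_of_le (by linarith) ((bv τ hτ).trans_lt ENNReal.coe_lt_top))
    (by rw [q0]; exact hlim le_rfl (by linarith) hv bv) hv
  exact (d1.const_mul kap).add d2

omit hs hμν in
theorem re_pairing_residual_le {v : ℝ → ℝ} (hv : Measurable v) {u r : L2} {ε : ℝ} (hε : 0 ≤ ε)
    (hu : N2 v (hat u) < ⊤) (hr : N2 v (hat r) ≤ ENNReal.ofReal ε) :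
    |(∫ ξ, (starRingEnd ℂ) (wt (fun x => v x ^ 2) (hat u) ξ) * hat r ξ).re| ≤ nr v (hat u) * ε := by
  have e : ∫ ξ, (starRingEnd ℂ) (wt (fun x => v x ^ 2) (hat u) ξ) * hat r ξ =
      ∫ ξ, (starRingEnd ℂ) (wt v (hat u) ξ) * wt v (hat r) ξ := by
    refine integral_congr_ae (Filter.Eventually.of_forall fun ξ => ?_)
    simp only [wt, map_mul, Complex.conj_ofReal]
    push_cast; ring
  rw [e]
  refine (Complex.abs_re_le_norm _).trans ((norm_integral_conj_mul_le
    (memLp_wt hv (aesm_hat u) hu)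
    (memLp_wt hv (aesm_hat r) (hr.trans_lt ENNReal.ofReal_lt_top))).trans ?_)
  refine mul_le_mul le_rfl ?_ ENNReal.toReal_nonneg ENNReal.toReal_nonneg
  exact ENNReal.toReal_le_of_le_ofReal hε hr

omit hs hμν in
theorem integral_conj_split {F : Plane → ℂ} (hF : MemLp F 2 volume) {A A' X X' : L2} :
    (∫ ξ, (starRingEnd ℂ) (F ξ) * hat (A - A') ξ).re =
      (∫ ξ, (starRingEnd ℂ) (F ξ) * hat (X - X') ξ).re +
      (∫ ξ, (starRingEnd ℂ) (F ξ) * hat (A - X) ξ).re -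
      (∫ ξ, (starRingEnd ℂ) (F ξ) * hat (A' - X') ξ).re := by
  have i := fun g : L2 => integrable_conj_mul hF (memLp_hat g)
  have e : ∫ ξ, (starRingEnd ℂ) (F ξ) * hat (A - A') ξ =
      (∫ ξ, (starRingEnd ℂ) (F ξ) * hat (X - X') ξ) + (∫ ξ, (starRingEnd ℂ) (F ξ) * hat (A - X) ξ) -
      ∫ ξ, (starRingEnd ℂ) (F ξ) * hat (A' - X') ξ := by
    rw [← integral_add (i _) (i _)]
    refine Eq.trans ?_ (integral_sub ((i _).add (i _)) (i _))
    refine integral_congr_ae ?_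
    filter_upwards [hat_sub A A', hat_sub X X', hat_sub A X, hat_sub A' X'] with ξ h1 h2 h3 h4
    simp only [h1, h2, h3, h4]
    ring
  rw [e, Complex.sub_re, Complex.add_re]

/-- Stability: the distance of an approximate solution to a Galerkin solution. -/
theorem difference_bound (T : ℝ) (M : ℝ≥0) : ∃ C : ℝ, 0 ≤ C ∧ ∀ (n M' ε : ℝ) (a₀ b₀ : L2)
    (α β a b : ℝ → L2), 0 ≤ ε → Galerkin s μ ν T M' n a₀ b₀ α β →
    ApproxSol s μ ν T M ε α β → ApproxSol s μ ν T M ε a b → ∀ t ∈ Set.Icc 0 T,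
    en (fun _ => 1) (hat (α t - a t)) (hat (β t - b t)) ≤
      C * (en (fun _ => 1) (hat (α 0 - a 0)) (hat (β 0 - b 0)) + (kap + 1) * ε ^ 2) := by
  set M₁ : ℝ := (kap + 1) * M ^ 2 with hM₁
  obtain ⟨K, hK, h⟩ := difference_estimate hs hμν
  obtain ⟨K', hK', h'⟩ := Galerkin.dissipation hs hμν M₁
  have hμ : 0 ≤ μ := by rcases hμν with h | h <;> linarith [h.1, h.2]
  have hν : 0 ≤ ν := by rcases hμν with h | h <;> linarith [h.1, h.2]
  have hk := kap_pos
  have hM₁0 : 0 ≤ M₁ := by positivity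
  -- The constant of `gronwall_weighted` with c = 1/2, taking for S the H^{s+1} × H^s energy of the
  -- Galerkin solution; the summand 2 in the rate accounts for the residuals.
  refine ⟨Real.exp ((2 * K * (1 + 2 * M₁) + 2 + (2 * K * (1 + 2 * M₁) + 2) ^ 2 / (4 * (1 / 2)) + K') *
    T + M₁), (Real.exp_pos _).le, fun n M' ε a₀ b₀ α β a b hε hG hα ha t ht => ?_⟩
  obtain ⟨S', hS⟩ := h' hG (fun t ht => en_le_of_sz_le (hα.bound t ht))
  choose! A hA hA' using hα.deriv_a
  choose! B hB hB' using hα.deriv_b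
  choose! A₂ hA₂ hA₂' using ha.deriv_a
  choose! B₂ hB₂ hB₂' using ha.deriv_b
  -- Adding the constant (kap + 1) ε² to the energy makes the forcing by the residuals proportional
  -- to the quantity itself, so the homogeneous Grönwall inequality applies.
  have hder : ∀ t ∈ Set.Icc 0 T, HasDerivWithinAt
      (fun t => en (fun _ => 1) (hat (α t - a t)) (hat (β t - b t)) + (kap + 1) * ε ^ 2)
      (enDeriv (fun _ => 1) (hat (α t - a t)) (hat (β t - b t)) (hat (A t - A₂ t)) (hat (B t - B₂ t)))
      (Set.Icc 0 T) t := fun t ht =>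
    (hasDerivWithinAt_en_one hs ht (u := fun t => α t - a t) (v := fun t => β t - b t)
      (fun τ hτ => hα.sz_sub_le ha hτ) ((hA t ht).sub (hA₂ t ht))
      ((hB t ht).sub (hB₂ t ht))).add_const _
  have := gronwall_weighted (c := 1 / 2) (L := 2 * K * (1 + 2 * M₁) + 2) (K := K') (M := M₁)
    (by norm_num) (by positivity) hK' hder (fun t ht => (hS t ht).1)
    (fun t ht => add_nonneg (en_nonneg _ _ _) (by positivity))
    (fun t ht => ⟨en_nonneg _ _ _, en_le_of_sz_le (hα.bound t ht)⟩)
    (fun t ht => ds_nonneg hμ hν _ _ _) (fun t ht => (hS t ht).2) (fun t ht => ?_) t ht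
  · refine le_trans ?_ this
    have : 0 ≤ (kap + 1) * ε ^ 2 := by positivity
    linarith
  clear hder hS
  have hsz := hG.sz_lt ht
  have hsz' := (ha.bound t ht).trans_lt ENNReal.coe_lt_top
  obtain ⟨f1, f2⟩ := sz_lt_top.1 hsz'
  obtain ⟨g1, g2⟩ := sz_lt_top.1 ((hα.sz_sub_le ha ht).trans_lt ENNReal.coe_lt_top)
  have main := h _ _ _ _ (rapid_of_trunc (hG.tr t ht).1) (rapid_of_trunc (hG.tr t ht).2)
    (aesm_hat (a t)) (aesm_hat (b t)) (herm_hat _) (herm_hat _) f1 f2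
  have q2 : (fun x : ℝ => (x * 1) ^ 2) = fun x => x ^ 2 := by funext x; ring
  have q2' : (fun x : ℝ => x ^ 2) = fun x => x ^ (2 : ℝ) := by funext x; norm_cast
  have q1 : (fun x : ℝ => x * 1) = fun x => x ^ (1 : ℝ) := by funext x; simp
  have q0 : (fun _ : ℝ => (1 : ℝ)) = fun x => x ^ (0 : ℝ) := by funext x; simp
  have q0' : (fun _ : ℝ => (1 : ℝ) ^ 2) = fun x => x ^ (0 : ℝ) := by funext x; simp
  have hA2 : MemLp (wt (fun x => x ^ 2) (hat (α t - a t))) 2 volume := by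
    rw [q2']
    exact memLp_wt (measurable_rpow_const 2) (aesm_hat _) (N2_lt_of_le (by linarith) g1)
  have hB2 : MemLp (wt (fun _ => 1 ^ 2) (hat (β t - b t))) 2 volume := by
    rw [q0']
    exact memLp_wt (measurable_rpow_const 0) (aesm_hat _) (N2_lt_of_le (by linarith) g2)
  have sA := integral_conj_split hA2 (A := A t) (A' := A₂ t) (X := fieldA μ (α t) (β t))
    (X' := fieldA μ (a t) (b t))
  have sB := integral_conj_split hB2 (A := B t) (A' := B₂ t) (X := fieldB ν (α t) (β t))
    (X' := fieldB ν (a t) (b t))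
  have eA : (∫ ξ, (starRingEnd ℂ) (wt (fun x => x ^ 2) (hat (α t - a t)) ξ) *
      hat (fieldA μ (α t) (β t) - fieldA μ (a t) (b t)) ξ) =
      ∫ ξ, (starRingEnd ℂ) (wt (fun x => x ^ 2) (fun η => hat (α t) η - hat (a t) η) ξ) *
        (rhsA μ (hat (α t)) (hat (β t)) ξ - rhsA μ (hat (a t)) (hat (b t)) ξ) := by
    refine integral_congr_ae ?_
    filter_upwards [hat_sub (α t) (a t), hat_sub (fieldA μ (α t) (β t)) (fieldA μ (a t) (b t)),
      hat_fieldA hs μ hsz, hat_fieldA hs μ hsz'] with ξ h1 h2 h3 h4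
    rw [wt, wt, h1, h2, h3, h4]
  have eB : (∫ ξ, (starRingEnd ℂ) (wt (fun _ => 1 ^ 2) (hat (β t - b t)) ξ) *
      hat (fieldB ν (α t) (β t) - fieldB ν (a t) (b t)) ξ) =
      ∫ ξ, (starRingEnd ℂ) (hat (β t) ξ - hat (b t) ξ) *
        (rhsB ν (hat (α t)) (hat (β t)) ξ - rhsB ν (hat (a t)) (hat (b t)) ξ) := by
    refine integral_congr_ae ?_
    filter_upwards [hat_sub (β t) (b t), hat_sub (fieldB ν (α t) (β t)) (fieldB ν (a t) (b t)),
      hat_fieldB hs ν hsz, hat_fieldB hs ν hsz'] with ξ h1 h2 h3 h4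
    rw [wt, h1, h2, h3, h4]
    simp
  have eE : en (fun _ => 1) (fun η => hat (α t) η - hat (a t) η) (fun η => hat (β t) η - hat (b t) η) =
      en (fun _ => 1) (hat (α t - a t)) (hat (β t - b t)) := by
    simp only [en, nr]
    rw [N2_congr (hat_sub (α t) (a t)), N2_congr (hat_sub (β t) (b t))]
  have r1 := re_pairing_residual_le (v := fun x => x ^ (1 : ℝ)) (measurable_rpow_const 1)
    (u := α t - a t) hε (N2_lt_of_le (by linarith) g1) (hA' t ht)
  have r2 := re_pairing_residual_le (v := fun x => x ^ (1 : ℝ)) (measurable_rpow_const 1)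
    (u := α t - a t) hε (N2_lt_of_le (by linarith) g1) (hA₂' t ht)
  have r3 := re_pairing_residual_le (v := fun x => x ^ (0 : ℝ)) (measurable_rpow_const 0)
    (u := β t - b t) hε (N2_lt_of_le (by linarith) g2) (hB' t ht)
  have r4 := re_pairing_residual_le (v := fun x => x ^ (0 : ℝ)) (measurable_rpow_const 0)
    (u := β t - b t) hε (N2_lt_of_le (by linarith) g2) (hB₂' t ht)
  simp only [Real.rpow_one] at r1 r2
  simp only [Real.rpow_zero] at r3 r4
  rw [eE] at main
  rw [eA] at sA
  rw [eB] at sB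
  rw [enDeriv, q2, sA, sB]
  have hX : nr (fun x : ℝ => x) (hat (α t - a t)) = nr (fun x => x * 1) (hat (α t - a t)) := by
    simp
  rw [hX] at r1 r2
  have hEn : en (fun _ => 1) (hat (α t - a t)) (hat (β t - b t)) =
    kap * nr (fun x => x * 1) (hat (α t - a t)) ^ 2 + nr (fun _ => 1) (hat (β t - b t)) ^ 2 := rfl
  set X := nr (fun x => x * 1) (hat (α t - a t))
  set W := nr (fun _ => 1) (hat (β t - b t))
  set e := en (fun _ => 1) (hat (α t - a t)) (hat (β t - b t))
  set d := ds μ ν (fun x => x ^ s) (hat (α t)) (hat (β t))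
  have he0 : 0 ≤ e := en_nonneg _ _ _
  have hsd : 0 ≤ √d := Real.sqrt_nonneg d
  have hα1 : en (fun x => x ^ s) (hat (α t)) (hat (β t)) ≤ M₁ := en_le_of_sz_le (hα.bound t ht)
  have ha1 : en (fun x => x ^ s) (hat (a t)) (hat (b t)) ≤ M₁ := en_le_of_sz_le (ha.bound t ht)
  have m1 : K * (1 + √d + en (fun x => x ^ s) (hat (α t)) (hat (β t)) +
      en (fun x => x ^ s) (hat (a t)) (hat (b t))) * e ≤ K * ((1 + 2 * M₁) * (1 + √d)) * e := by
    gcongr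
    nlinarith
  have y1 : 4 * (kap * (X * ε)) ≤ 2 * (kap * X ^ 2) + 2 * (kap * ε ^ 2) := by
    nlinarith [mul_nonneg hk.le (sq_nonneg (X - ε))]
  have y2 : 4 * (W * ε) ≤ 2 * W ^ 2 + 2 * ε ^ 2 := by nlinarith [sq_nonneg (W - ε)]
  have hc : 0 ≤ (kap + 1) * ε ^ 2 := by positivity
  have m2 : 0 ≤ (2 * K * (1 + 2 * M₁)) * (1 + √d) * ((kap + 1) * ε ^ 2) := by positivity
  have m3 : 0 ≤ 2 * √d * (e + (kap + 1) * ε ^ 2) := by positivity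
  have z1 := mul_le_mul_of_nonneg_left (le_abs_self _ |>.trans r1) hk.le
  have z2 := mul_le_mul_of_nonneg_left (neg_le_abs _ |>.trans r2) hk.le
  have z3 := le_abs_self _ |>.trans r3
  have z4 := neg_le_abs _ |>.trans r4
  linarith

end

/-! ### Truncation errors and the rate of convergence. -/

/-- Functions supported at high frequencies are small in weaker norms. -/
theorem N2_high_freq_le {p q n c : ℝ} (hq : 0 ≤ q) (hn : 1 ≤ n) (hc : 0 ≤ c) {F J : Plane → ℂ}
    (hl : ∀ᵐ ξ, jb ξ ≤ n → F ξ = 0) (hh : ∀ᵐ ξ, ‖F ξ‖ ≤ c * ‖J ξ‖) :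
    N2 (fun x => x ^ p) F ≤ ENNReal.ofReal (c * n ^ (-q)) * N2 (fun x => x ^ (p + q)) J := by
  have hn0 : 0 < n := by linarith
  refine N2_le_of_le (C := (c * n ^ (-q)).toNNReal) ?_
  filter_upwards [hl, hh] with ξ h1 h2
  have hj := jb_pos ξ
  rw [Real.coe_toNNReal _ (by positivity), abs_of_nonneg (by positivity),
    abs_of_nonneg (by positivity)]
  by_cases h : jb ξ ≤ n
  · rw [h1 h]; simp; positivity
  · have h3 : n ^ q ≤ jb ξ ^ q := Real.rpow_le_rpow hn0.le (not_le.1 h).le hq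
    have h4 : 1 ≤ n ^ (-q) * jb ξ ^ q := by
      rw [Real.rpow_neg hn0.le, inv_mul_eq_div, one_le_div (by positivity)]; exact h3
    have h5 : 0 ≤ jb ξ ^ p * (c * ‖J ξ‖) := by positivity
    calc jb ξ ^ p * ‖F ξ‖ ≤ jb ξ ^ p * (c * ‖J ξ‖) := by gcongr
      _ ≤ (n ^ (-q) * jb ξ ^ q) * (jb ξ ^ p * (c * ‖J ξ‖)) := le_mul_of_one_le_left h5 h4
      _ = _ := by rw [Real.rpow_add hj]; ring

theorem hat_trunc_sub (n : ℝ) (f : L2) :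
    hat (trunc n f - f) =ᵐ[volume] fun ξ => ((cut n (jb ξ) - 1 : ℝ) : ℂ) * hat f ξ := by
  filter_upwards [hat_sub (trunc n f) f, hat_trunc n f] with ξ h1 h2
  rw [h1, h2, wt]; push_cast; ring

theorem abs_cut_sub_one_le (n x : ℝ) : |cut n x - 1| ≤ 1 := by unfold cut; split_ifs <;> simp

theorem N2_trunc_sub_le {p q n : ℝ} (hq : 0 ≤ q) (hn : 1 ≤ n) (f : L2) :
    N2 (fun x => x ^ p) (hat (trunc n f - f)) ≤
      ENNReal.ofReal (n ^ (-q)) * N2 (fun x => x ^ (p + q)) (hat f) := by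
  have := N2_high_freq_le (p := p) (F := hat (trunc n f - f)) (J := hat f) hq hn zero_le_one (by
    filter_upwards [hat_trunc_sub n f] with ξ h hj
    rw [h, cut, if_pos hj]; simp) (by
    filter_upwards [hat_trunc_sub n f] with ξ h
    rw [h, norm_mul, Complex.norm_real, Real.norm_eq_abs]
    gcongr
    exact abs_cut_sub_one_le _ _)
  rwa [one_mul] at this

theorem cut_sub_one_mul_hat {n : ℝ} {α : L2} (hα : trunc n α = α) :
    ∀ᵐ ξ, ((cut n (jb ξ) - 1 : ℝ) : ℂ) * hat α ξ = 0 := by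
  have h := hat_trunc_sub n α
  rw [hα, sub_self] at h
  have h0 : hat (0 : L2) =ᵐ[volume] fun _ => 0 := by
    rw [hat, map_zero]; exact Lp.coeFn_zero ..
  filter_upwards [h, h0] with ξ h1 h2
  rw [← h1, h2]

/-- The complementary cutoff annihilates α and with it the viscous term, so only the Jacobian
contributes to the residual, and only at high frequencies. -/
theorem truncation_residual_le {n c : ℝ} {d : ℝ} (hc : 0 ≤ c) {α : L2} (hα : trunc n α = α) {F : L2} {J : Plane → ℂ}
    (hF : hat F =ᵐ[volume] fun ξ => -(c : ℂ) * J ξ - ((d * ‖ξ‖ ^ 2 : ℝ) : ℂ) * hat α ξ) :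
    (∀ᵐ ξ, jb ξ ≤ n → hat (trunc n F - F) ξ = 0) ∧
      ∀ᵐ ξ, ‖hat (trunc n F - F) ξ‖ ≤ c * ‖J ξ‖ := by
  constructor
  · filter_upwards [hat_trunc_sub n F] with ξ h hj
    rw [h, cut, if_pos hj]; simp
  · filter_upwards [hat_trunc_sub n F, hF, cut_sub_one_mul_hat hα] with ξ h1 h2 h3
    have e : hat (trunc n F - F) ξ = ((-c * (cut n (jb ξ) - 1) : ℝ) : ℂ) * J ξ := by
      rw [h1, h2]
      push_cast at h3 ⊢
      linear_combination (-(d * ‖ξ‖ ^ 2) : ℂ) * h3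
    rw [e, norm_mul, Complex.norm_real, Real.norm_eq_abs, abs_mul, abs_neg, abs_of_nonneg hc]
    have := abs_cut_sub_one_le n (jb ξ)
    gcongr
    exact mul_le_of_le_one_right hc this

theorem ApproxSol.mono {s μ ν T : ℝ} {M M' : ℝ≥0} {ε ε' : ℝ} {a b : ℝ → L2}
    (h : ApproxSol s μ ν T M ε a b) (hM : M ≤ M') (hε : ε ≤ ε') : ApproxSol s μ ν T M' ε' a b := by
  refine ⟨fun t ht => (h.bound t ht).trans (by exact_mod_cast hM), fun t ht => ?_, fun t ht => ?_⟩
  · obtain ⟨A, h1, h2⟩ := h.deriv_a t ht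
    exact ⟨A, h1, h2.trans (ENNReal.ofReal_le_ofReal hε)⟩
  · obtain ⟨A, h1, h2⟩ := h.deriv_b t ht
    exact ⟨A, h1, h2.trans (ENNReal.ofReal_le_ofReal hε)⟩

/-- The rate of convergence of the Galerkin scheme. -/
def rate (s n : ℝ) : ℝ := n ^ (-(s - 2))

theorem rate_nonneg (s : ℝ) {n : ℝ} (hn : 1 ≤ n) : 0 ≤ rate s n := by unfold rate; positivity

section

variable {s : ℝ} (hs : 2 < s)
include hs

theorem rate_antitone {n m : ℝ} (hn : 1 ≤ n) (hnm : n ≤ m) : rate s m ≤ rate s n :=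
  Real.rpow_le_rpow_of_nonpos (by linarith) hnm (by linarith)

/-- The Jacobians have s − 2 more derivatives than the norms of the residuals require, and each of
them gains a factor 1/n beyond frequency n. -/
theorem galerkin_residual (μ ν : ℝ) (M : ℝ≥0) : ∃ C : ℝ, 0 ≤ C ∧ ∀ n : ℝ, 1 ≤ n → ∀ α β : L2,
    trunc n α = α → trunc n β = β → sz s (hat α) (hat β) ≤ M →
    N2 (fun x => x ^ (1 : ℝ)) (hat (trunc n (fieldA μ α β) - fieldA μ α β)) ≤
      ENNReal.ofReal (C * rate s n) ∧
    N2 (fun x => x ^ (0 : ℝ)) (hat (trunc n (fieldB ν α β) - fieldB ν α β)) ≤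
      ENNReal.ofReal (C * rate s n) := by
  obtain ⟨C₁, h₁⟩ := N2_Jc_le hs
  obtain ⟨C₂, h₂⟩ := N2_Jc_sqm_le hs
  have hk := kap_pos
  refine ⟨kap * (C₁ * (M * M)) + kap ^ 2 * (C₂ * (M * M)), by positivity, ?_⟩
  intro n hn α β hα hβ hM
  have hsz := hM.trans_lt ENNReal.coe_lt_top
  have l1 : N2 (fun x => x ^ (s + 1)) (hat α) ≤ M := le_self_add.trans hM
  have l2 : N2 (fun x => x ^ s) (hat β) ≤ M := le_add_self.trans hM
  have l3 : N2 (fun x => x ^ s) (hat α) ≤ M := (N2_rpow_mono (by linarith) _).trans l1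
  have hr := rate_nonneg s hn
  have fin : ∀ (c k : ℝ) (C : ℝ≥0) (N : ℝ≥0∞), 0 ≤ c → c * (C * (M * M)) ≤ k →
      N ≤ C * (M * M) → ENNReal.ofReal (c * rate s n) * N ≤ ENNReal.ofReal (k * rate s n) := by
    intro c k C N hc hk hN
    have e : (C * (M * M) : ℝ≥0∞) = ENNReal.ofReal (C * (M * M)) := by
      rw [← NNReal.coe_mul, ← NNReal.coe_mul, ENNReal.ofReal_coe_nnreal]; push_cast; rfl
    rw [e] at hN
    refine (mul_le_mul' le_rfl hN).trans ?_
    rw [← ENNReal.ofReal_mul (by positivity)]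
    refine ENNReal.ofReal_le_ofReal ?_
    calc c * rate s n * (C * (M * M)) = c * (C * (M * M)) * rate s n := by ring
      _ ≤ _ := by gcongr
  have p1 : 0 ≤ kap * (C₁ * (M * M) : ℝ) := by positivity
  have p2 : 0 ≤ kap ^ 2 * (C₂ * (M * M) : ℝ) := by positivity
  constructor
  · obtain ⟨r1, r2⟩ := truncation_residual_le hk.le hα (hat_fieldA hs μ hsz)
    refine (N2_high_freq_le (q := s - 2) (by linarith) hn hk.le r1 r2).trans ?_
    refine fin kap _ C₁ _ hk.le (by linarith) ?_
    rw [show 1 + (s - 2) = s - 1 by ring]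
    refine (h₁ _ _ (aesm_hat α) (aesm_hat β)).trans ?_
    gcongr
  · obtain ⟨r1, r2⟩ := truncation_residual_le (by positivity) hβ (hat_fieldB hs ν hsz)
    refine (N2_high_freq_le (q := s - 2) (by linarith) hn (by positivity) r1 r2).trans ?_
    refine fin (kap ^ 2) _ C₂ _ (by positivity) (by linarith) ?_
    rw [zero_add]
    refine (h₂ _ _ (aesm_hat α) (aesm_hat α)).trans ?_
    gcongr

theorem Galerkin.approxSol (μ ν M : ℝ) : ∃ (M' : ℝ≥0) (C : ℝ), 0 ≤ C ∧
    ∀ (T n : ℝ) (a₀ b₀ : L2) (α β : ℝ → L2), 1 ≤ n → Galerkin s μ ν T M n a₀ b₀ α β →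
    ApproxSol s μ ν T M' (C * rate s n) α β := by
  obtain ⟨C, hC, h⟩ := galerkin_residual hs μ ν (2 * (1 + M)).toNNReal
  refine ⟨(2 * (1 + M)).toNNReal, C, hC, fun T n a₀ b₀ α β hn hG => ?_⟩
  have hb : ∀ t ∈ Set.Icc 0 T, sz s (hat (α t)) (hat (β t)) ≤ ((2 * (1 + M)).toNNReal : ℝ≥0∞) :=
    fun t ht => sz_le_of_en_le (hG.sz_lt ht) (hG.bound t ht)
  exact ⟨hb, fun t ht => ⟨_, hG.deriv_a t ht, (h n hn _ _ (hG.tr t ht).1 (hG.tr t ht).2 (hb t ht)).1⟩,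
    fun t ht => ⟨_, hG.deriv_b t ht, (h n hn _ _ (hG.tr t ht).1 (hG.tr t ht).2 (hb t ht)).2⟩⟩

omit hs in
theorem en_one_le {f g : L2} {r A B : ℝ} (hr : 0 ≤ r) (hA : 0 ≤ A) (hB : 0 ≤ B)
    (h1 : N2 (fun x => x ^ (1 : ℝ)) (hat f) ≤ ENNReal.ofReal (r * A))
    (h2 : N2 (fun x => x ^ (0 : ℝ)) (hat g) ≤ ENNReal.ofReal (r * B)) :
    en (fun _ => 1) (hat f) (hat g) ≤ (kap * A ^ 2 + B ^ 2) * r ^ 2 := by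
  have q1 : (fun x : ℝ => x * 1) = fun x => x ^ (1 : ℝ) := by funext x; simp
  have q0 : (fun _ : ℝ => (1 : ℝ)) = fun x => x ^ (0 : ℝ) := by funext x; simp
  rw [en, q1, q0]
  have h1' : nr (fun x => x ^ (1 : ℝ)) (hat f) ≤ r * A :=
    ENNReal.toReal_le_of_le_ofReal (by positivity) h1
  have h2' : nr (fun x => x ^ (0 : ℝ)) (hat g) ≤ r * B :=
    ENNReal.toReal_le_of_le_ofReal (by positivity) h2
  have := nr_nonneg (fun x => x ^ (1 : ℝ)) (hat f)
  have := nr_nonneg (fun x => x ^ (0 : ℝ)) (hat g)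
  have := kap_pos
  calc _ ≤ kap * (r * A) ^ 2 + (r * B) ^ 2 := by gcongr
    _ = _ := by ring

/-- Truncation of the initial data. -/
theorem N2_init_le {A B : ℝ≥0} {a₀ b₀ : L2} (ha : sobolevNorm (s + 1) a₀ ≤ A)
    (hb : sobolevNorm s b₀ ≤ B) {n : ℝ} (hn : 1 ≤ n) :
    N2 (fun x => x ^ (1 : ℝ)) (hat (trunc n a₀ - a₀)) ≤ ENNReal.ofReal (rate s n * A) ∧
    N2 (fun x => x ^ (0 : ℝ)) (hat (trunc n b₀ - b₀)) ≤ ENNReal.ofReal (rate s n * B) := by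
  rw [sobolevNorm_eq] at ha hb
  have hr := rate_nonneg s hn
  rw [ENNReal.ofReal_mul hr, ENNReal.ofReal_mul hr, ENNReal.ofReal_coe_nnreal,
    ENNReal.ofReal_coe_nnreal]
  constructor
  · refine (N2_trunc_sub_le (q := s - 2) (by linarith) hn a₀).trans ?_
    rw [rate]
    gcongr
    exact (N2_rpow_mono (by linarith) _).trans ha
  · refine (N2_trunc_sub_le (q := s - 2) (by linarith) hn b₀).trans ?_
    rw [rate]
    gcongr
    exact (N2_rpow_mono (by linarith) _).trans hb

omit hs in
theorem norm_sq_le_en_one {f g : L2} (h : sz 1 (hat f) (hat g) < ⊤) :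
    ‖f‖ ^ 2 ≤ en (fun _ => 1) (hat f) (hat g) ∧ ‖g‖ ^ 2 ≤ en (fun _ => 1) (hat f) (hat g) := by
  have q1 : (fun x : ℝ => x * 1) = fun x => x ^ (1 : ℝ) := by funext x; simp
  have q0 : (fun _ : ℝ => (1 : ℝ)) = fun x => x ^ (0 : ℝ) := by funext x; simp
  obtain ⟨h1, h2⟩ := sz_lt_top.1 h
  constructor
  · refine le_trans ?_ (nr_le_sqrt_en_left _ _ _)
    rw [q1]
    gcongr
    exact norm_le_nr 1 zero_le_one (N2_lt_of_le (by norm_num) h1)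
  · refine le_trans ?_ (nr_le_sqrt_en_right _ _ _)
    rw [q0]
    gcongr
    exact norm_le_nr 0 le_rfl (N2_lt_of_le (by norm_num) h2)

variable {μ ν : ℝ} (hμν : (0 < μ ∧ ν = 0) ∨ (μ = 0 ∧ 0 < ν))
include hμν

/-- A Galerkin solution is close, in `L²`, to any approximate solution. -/
theorem galerkin_close (T : ℝ) (M A B : ℝ≥0) (C' : ℝ) : ∃ C : ℝ, 0 ≤ C ∧
    ∀ (n M' ε : ℝ) (a₀ b₀ : L2) (α β a b : ℝ → L2), 1 ≤ n → 0 ≤ ε → ε ≤ C' * rate s n →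
    Galerkin s μ ν T M' n a₀ b₀ α β →
    ApproxSol s μ ν T M ε α β → ApproxSol s μ ν T M ε a b →
    N2 (fun x => x ^ (1 : ℝ)) (hat (α 0 - a 0)) ≤ ENNReal.ofReal (rate s n * A) →
    N2 (fun x => x ^ (0 : ℝ)) (hat (β 0 - b 0)) ≤ ENNReal.ofReal (rate s n * B) →
    ∀ t ∈ Set.Icc 0 T, ‖α t - a t‖ ≤ C * rate s n ∧ ‖β t - b t‖ ≤ C * rate s n := by
  obtain ⟨C, hC, h⟩ := difference_bound hs hμν T M
  have hk := kap_pos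
  set D : ℝ := C * (kap * A ^ 2 + B ^ 2 + (kap + 1) * C' ^ 2) with hD
  have hD0 : 0 ≤ D := by positivity
  refine ⟨√D, Real.sqrt_nonneg _, ?_⟩
  intro n M' ε a₀ b₀ α β a b hn hε hεr hG hα ha h1 h2 t ht
  have hr := rate_nonneg s hn
  have key := h n M' ε a₀ b₀ α β a b hε hG hα ha t ht
  have hi := en_one_le hr A.2 B.2 h1 h2
  have hle : en (fun _ => 1) (hat (α t - a t)) (hat (β t - b t)) ≤ (√D * rate s n) ^ 2 := by
    rw [mul_pow, Real.sq_sqrt hD0]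
    refine key.trans ?_
    have e2 : ε ^ 2 ≤ (C' * rate s n) ^ 2 := by gcongr
    calc C * (en (fun _ => 1) (hat (α 0 - a 0)) (hat (β 0 - b 0)) + (kap + 1) * ε ^ 2) ≤
        C * ((kap * (A : ℝ) ^ 2 + (B : ℝ) ^ 2) * rate s n ^ 2 + (kap + 1) * (C' * rate s n) ^ 2) := by
          gcongr
          exact hi
      _ = D * rate s n ^ 2 := by rw [hD]; ring
  have hfin : sz 1 (hat (α t - a t)) (hat (β t - b t)) < ⊤ := by
    obtain ⟨g1, g2⟩ := sz_lt_top.1 ((hα.sz_sub_le ha ht).trans_lt ENNReal.coe_lt_top)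
    exact sz_lt_top.2 ⟨N2_lt_of_le (by linarith) g1, N2_lt_of_le (by linarith) g2⟩
  obtain ⟨e1, e2⟩ := norm_sq_le_en_one hfin
  have hR : 0 ≤ √D * rate s n := by positivity
  exact ⟨abs_le_of_sq_le_sq' (e1.trans hle) hR |>.2, abs_le_of_sq_le_sq' (e2.trans hle) hR |>.2⟩

end

/-! ### Uniform smallness of high frequencies. -/

/-- Lower semicontinuity of the weighted norms. -/
theorem N2_le_of_tendsto {w : ℝ → ℝ} (hw : Measurable w) {u : ℕ → L2} {a : L2}
    (h : Filter.Tendsto u Filter.atTop (𝓝 a)) {B : ℝ≥0∞} (hB : ∀ n, N2 w (hat (u n)) ≤ B) :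
    N2 w (hat a) ≤ B := by
  have h1 : Filter.Tendsto (fun n => FT (u n)) Filter.atTop (𝓝 (FT a)) :=
    (FT.continuous.tendsto a).comp h
  -- Convergence in L² gives almost everywhere convergence along a subsequence, and Fatou's lemma
  -- applies there.
  obtain ⟨ns, -, hns⟩ := (tendstoInMeasure_of_tendsto_Lp h1).exists_seq_tendsto_ae
  refine (Lp.eLpNorm_lim_le_liminf_eLpNorm (f := fun i => wt w (hat (u (ns i))))
    (fun i => aesm_wt hw (aesm_hat _)) _ ?_).trans ?_
  · filter_upwards [hns] with ξ hξ
    exact hξ.const_mul _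
  · refine (Filter.liminf_le_liminf (v := fun _ => B)
      (Filter.Eventually.of_forall fun i => hB (ns i))).trans ?_
    rw [Filter.liminf_const]

theorem tendsto_N2_weight {v : ℕ → ℝ → ℝ} {w : ℝ → ℝ} (hv : ∀ N, Measurable (v N))
    (hvw : ∀ N x, 1 ≤ x → |v N x| ≤ |w x|)
    (h0 : ∀ x, 1 ≤ x → Filter.Tendsto (fun N => v N x) Filter.atTop (𝓝 0)) {f : L2}
    (hf : N2 w (hat f) < ⊤) :
    Filter.Tendsto (fun N => N2 (v N) (hat f)) Filter.atTop (𝓝 0) := by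
  have hm : StronglyMeasurable (hat f) := Lp.stronglyMeasurable _
  have hd : Filter.Tendsto (fun N => ∫⁻ ξ, ‖wt (v N) (hat f) ξ‖ₑ ^ 2) Filter.atTop
      (𝓝 (∫⁻ _ : Plane, 0)) := by
    refine tendsto_lintegral_of_dominated_convergence (fun ξ => ‖wt w (hat f) ξ‖ₑ ^ 2) ?_ ?_ ?_ ?_
    · intro N
      exact (((Complex.measurable_ofReal.comp (measurable_comp_jb (hv N))).mul
        hm.measurable).enorm).pow_const 2
    · refine fun N => Filter.Eventually.of_forall fun ξ => ?_
      change ‖wt (v N) (hat f) ξ‖ₑ ^ 2 ≤ ‖wt w (hat f) ξ‖ₑ ^ 2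
      gcongr
      rw [enorm_le_iff_norm_le, wt, wt, norm_mul, norm_mul, Complex.norm_real, Complex.norm_real]
      gcongr
      exact hvw N _ (one_le_jb ξ)
    · rw [← eLpNorm_two_sq]
      exact ENNReal.pow_ne_top hf.ne
    · refine Filter.Eventually.of_forall fun ξ => ?_
      have h1 : Filter.Tendsto (fun N => wt (v N) (hat f) ξ) Filter.atTop (𝓝 0) := by
        have := ((Complex.continuous_ofReal.tendsto 0).comp (h0 _ (one_le_jb ξ))).mul_const (hat f ξ)
        simpa [wt] using this
      have h2 := (ENNReal.continuous_pow 2).tendsto _ |>.comp h1.enorm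
      simpa [Function.comp_def] using h2
  have h2 := (ENNReal.continuous_rpow_const (y := 1 / 2)).tendsto _ |>.comp hd
  simp only [lintegral_zero] at h2
  rw [ENNReal.zero_rpow_of_pos (by norm_num)] at h2
  refine h2.congr fun N => ?_
  rw [N2, eLpNorm_two_eq]
  rfl

theorem tailW_nonneg (s : ℝ) {N x : ℝ} (hN : 0 < N) (hx : 1 ≤ x) : 0 ≤ tailW s N x := by
  have : 0 < x := by linarith
  unfold tailW
  positivity

theorem tailW_le (s : ℝ) {N x : ℝ} (hx : 1 ≤ x) : tailW s N x ≤ x ^ s :=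
  mul_le_of_le_one_right (by positivity) (min_le_left _ _)

theorem measurable_tailW (s N : ℝ) : Measurable (tailW s N) := by
  unfold tailW
  fun_prop

theorem rpow_le_add_tailW {s N x : ℝ} (hs : 0 ≤ s) (hN : 0 < N) (hx : 1 ≤ x) :
    x ^ s ≤ N ^ s + tailW s N x := by
  rcases le_total x N with h | h
  · have := tailW_nonneg s hN hx
    have : x ^ s ≤ N ^ s := by gcongr
    linarith
  · have h1 : 1 ≤ x / N := (one_le_div hN).2 h
    rw [tailW, min_eq_left h1, mul_one]
    have : 0 ≤ N ^ s := by positivity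
    linarith

theorem tendsto_tailW (s x : ℝ) :
    Filter.Tendsto (fun N : ℕ => tailW s (N + 1) x) Filter.atTop (𝓝 0) := by
  have h1 : Filter.Tendsto (fun N : ℕ => x / ((N : ℝ) + 1)) Filter.atTop (𝓝 0) :=
    Filter.Tendsto.div_atTop tendsto_const_nhds
      (Filter.tendsto_atTop_add_const_right _ _ tendsto_natCast_atTop_atTop)
  have h2 := ((tendsto_const_nhds (x := (1 : ℝ))).min h1).const_mul (x ^ s)
  simpa [tailW] using h2

/-- A uniform bound for the high-frequency parts of the pair `(a, b)`. -/
def Tight (s : ℝ) (τ : ℕ → ℝ≥0∞) (a b : L2) : Prop :=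
  ∀ N : ℕ, N2 (fun x => x * tailW s (N + 1) x) (hat a) ≤ τ N ∧ N2 (tailW s (N + 1)) (hat b) ≤ τ N

/-- Frequencies up to N + 1 are controlled by the L² norm, those above by the tails; the 4 counts
two components of two pairs. -/
theorem sz_sub_le_of_tight {s : ℝ} (hs : 0 ≤ s) {τ : ℕ → ℝ≥0∞} {a b a' b' : L2}
    (h : Tight s τ a b) (h' : Tight s τ a' b') (N : ℕ) :
    sz s (hat (a - a')) (hat (b - b')) ≤
      ((((N : ℝ≥0) + 1) ^ (s + 1) : ℝ≥0) : ℝ≥0∞) * (‖a - a'‖ₑ + ‖b - b'‖ₑ) + 4 * τ N := by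
  have hN : (0 : ℝ) < N + 1 := by positivity
  have hN1 : (1 : ℝ) ≤ N + 1 := by linarith [(Nat.cast_nonneg N : (0 : ℝ) ≤ N)]
  have mt := measurable_tailW s (N + 1)
  have mx : Measurable fun x => x * tailW s (N + 1) x := by fun_prop
  have key : ∀ {w : ℝ → ℝ} {f g : L2}, Measurable w → N2 w (hat f) ≤ τ N → N2 w (hat g) ≤ τ N →
      N2 w (hat (f - g)) ≤ 2 * τ N := fun {w f g} hw h1 h2 => by
    rw [N2_congr (hat_sub f g), two_mul]
    exact (N2_sub_le hw (aesm_hat _) (aesm_hat _)).trans (add_le_add h1 h2)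
  have e1 : N2 (fun x => x ^ (s + 1)) (hat (a - a')) ≤
      ((((N : ℝ≥0) + 1) ^ (s + 1) : ℝ≥0) : ℝ≥0∞) * ‖a - a'‖ₑ + 2 * τ N := by
    refine (N2_le_tail mx fun x hx => ?_).trans (add_le_add_right (key mx (h N).1 (h' N).1) _)
    have hx0 : 0 < x := by linarith
    rw [abs_of_nonneg (by positivity)]
    push_cast
    rcases le_total x (N + 1) with hxN | hxN
    · have := mul_nonneg hx0.le (tailW_nonneg s hN hx)
      have : x ^ (s + 1) ≤ ((N : ℝ) + 1) ^ (s + 1) := by gcongr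
      linarith
    · have h1 : 1 ≤ x / (N + 1) := (one_le_div hN).2 hxN
      rw [tailW, min_eq_left h1, mul_one, mul_rpow_weight s x hx]
      have : 0 ≤ ((N : ℝ) + 1) ^ (s + 1) := by positivity
      linarith
  have e2 : N2 (fun x => x ^ s) (hat (b - b')) ≤
      ((((N : ℝ≥0) + 1) ^ (s + 1) : ℝ≥0) : ℝ≥0∞) * ‖b - b'‖ₑ + 2 * τ N := by
    refine (N2_le_tail mt fun x hx => ?_).trans (add_le_add_right (key mt (h N).2 (h' N).2) _)
    rw [abs_of_nonneg (by positivity)]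
    push_cast
    refine (rpow_le_add_tailW hs hN hx).trans (add_le_add_left ?_ _)
    exact Real.rpow_le_rpow_of_exponent_le hN1 (by linarith)
  refine (add_le_add e1 e2).trans (le_of_eq ?_)
  ring

/-- Tightness upgrades L² convergence to the strong norm: N is chosen first to make the tails small.
The filter is arbitrary, so that both continuity in time and convergence uniform in time are
covered. -/
theorem tendsto_sz {s : ℝ} (hs : 0 ≤ s) {ι : Type*} {l : Filter ι} {τ : ℕ → ℝ≥0∞}
    (hτ : Filter.Tendsto τ Filter.atTop (𝓝 0)) {a b a' b' : ι → L2}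
    (h : ∀ᶠ i in l, Tight s τ (a i) (b i)) (h' : ∀ᶠ i in l, Tight s τ (a' i) (b' i))
    (ha : Filter.Tendsto (fun i => a i - a' i) l (𝓝 0))
    (hb : Filter.Tendsto (fun i => b i - b' i) l (𝓝 0)) :
    Filter.Tendsto (fun i => sz s (hat (a i - a' i)) (hat (b i - b' i))) l (𝓝 0) := by
  rw [ENNReal.tendsto_nhds_zero]
  intro ε hε
  have h4 : Filter.Tendsto (fun N => 4 * τ N) Filter.atTop (𝓝 0) := by
    simpa using ENNReal.Tendsto.const_mul hτ (Or.inr (by norm_num : (4 : ℝ≥0∞) ≠ ⊤))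
  have hε2 : 0 < ε / 2 := ENNReal.half_pos hε.ne'
  obtain ⟨N, hN⟩ := (ENNReal.tendsto_nhds_zero.1 h4 (ε / 2) hε2).exists
  have h5 : Filter.Tendsto (fun i => ((((N : ℝ≥0) + 1) ^ (s + 1) : ℝ≥0) : ℝ≥0∞) *
      (‖a i - a' i‖ₑ + ‖b i - b' i‖ₑ)) l (𝓝 0) := by
    have := ENNReal.Tendsto.const_mul (ha.enorm.add hb.enorm)
      (Or.inr (ENNReal.coe_ne_top (r := ((N : ℝ≥0) + 1) ^ (s + 1))))
    simpa using this
  filter_upwards [h, h', ENNReal.tendsto_nhds_zero.1 h5 (ε / 2) hε2] with i h1 h2 h3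
  calc _ ≤ _ := sz_sub_le_of_tight hs h1 h2 N
    _ ≤ ε / 2 + ε / 2 := add_le_add h3 hN
    _ = ε := ENNReal.add_halves ε

theorem Tight.of_tendsto {s : ℝ} {τ : ℕ → ℝ≥0∞} {u v : ℕ → L2} {a b : L2}
    (h : ∀ n, Tight s τ (u n) (v n)) (hu : Filter.Tendsto u Filter.atTop (𝓝 a))
    (hv : Filter.Tendsto v Filter.atTop (𝓝 b)) : Tight s τ a b := by
  intro N
  have mt := measurable_tailW s (N + 1)
  exact ⟨N2_le_of_tendsto (by fun_prop) hu fun n => (h n N).1,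
    N2_le_of_tendsto mt hv fun n => (h n N).2⟩

theorem sz_le_of_tendsto {s : ℝ} {M : ℝ≥0} {u v : ℕ → L2} {a b : L2}
    (h : ∀ n, sz s (hat (u n)) (hat (v n)) ≤ M) (hu : Filter.Tendsto u Filter.atTop (𝓝 a))
    (hv : Filter.Tendsto v Filter.atTop (𝓝 b)) : sz s (hat a) (hat b) ≤ (2 * M : ℝ≥0) := by
  rw [sz]
  push_cast
  rw [two_mul]
  exact add_le_add
    (N2_le_of_tendsto (measurable_rpow_const _) hu fun n => le_self_add.trans (h n))
    (N2_le_of_tendsto (measurable_rpow_const _) hv fun n => le_add_self.trans (h n))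

/-- Differentiating a limit of functions whose derivatives converge uniformly. -/
theorem hasDerivWithinAt_of_tendsto {E : Type*} [NormedAddCommGroup E] [NormedSpace ℝ E]
    {S : Set ℝ} (hS : Convex ℝ S) {u F : ℕ → ℝ → E} {a G : ℝ → E}
    (hu : ∀ n, ∀ t ∈ S, HasDerivWithinAt (u n) (F n t) S t)
    (hF : ∀ ε > 0, ∀ᶠ n in Filter.atTop, ∀ t ∈ S, ‖F n t - G t‖ ≤ ε)
    (ha : ∀ t ∈ S, Filter.Tendsto (fun n => u n t) Filter.atTop (𝓝 (a t))) {t₀ : ℝ} (ht₀ : t₀ ∈ S)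
    (hG : ContinuousWithinAt G S t₀) : HasDerivWithinAt a (G t₀) S t₀ := by
  rw [hasDerivWithinAt_iff_isLittleO, Asymptotics.isLittleO_iff]
  intro ε hε
  obtain ⟨δ, hδ, hδG⟩ := Metric.continuousWithinAt_iff.1 hG (ε / 2) (by positivity)
  have hmem : S ∩ Metric.ball t₀ δ ∈ 𝓝[S] t₀ :=
    Filter.inter_mem self_mem_nhdsWithin (mem_nhdsWithin_of_mem_nhds (Metric.ball_mem_nhds _ hδ))
  filter_upwards [hmem] with t ht
  have hlim : Filter.Tendsto (fun n => u n t - u n t₀ - (t - t₀) • G t₀) Filter.atTop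
      (𝓝 (a t - a t₀ - (t - t₀) • G t₀)) :=
    ((ha t ht.1).sub (ha t₀ ht₀)).sub_const _
  refine le_of_tendsto hlim.norm ?_
  filter_upwards [hF (ε / 2) (by positivity)] with n hn
  -- The mean value inequality on a small convex piece of S is applied before the limit in n; its
  -- bound ε does not depend on n.
  have hd : ∀ x ∈ S ∩ Metric.ball t₀ δ, HasDerivWithinAt (fun x => u n x - x • G t₀)
      (F n x - (1 : ℝ) • G t₀) (S ∩ Metric.ball t₀ δ) x := fun x hx =>
    ((hu n x hx.1).mono Set.inter_subset_left).sub ((hasDerivWithinAt_id x _).smul_const _)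
  have hb : ∀ x ∈ S ∩ Metric.ball t₀ δ, ‖F n x - (1 : ℝ) • G t₀‖ ≤ ε := fun x hx => by
    have h1 := hn x hx.1
    have h2 := (hδG hx.1 hx.2).le
    rw [dist_eq_norm] at h2
    calc ‖F n x - (1 : ℝ) • G t₀‖ = ‖(F n x - G x) + (G x - G t₀)‖ := by rw [one_smul]; congr 1; abel
      _ ≤ ε := (norm_add_le _ _).trans (by linarith)
  have := Convex.norm_image_sub_le_of_norm_hasDerivWithin_le hd hb
    (hS.inter (convex_ball _ _)) ⟨ht₀, Metric.mem_ball_self hδ⟩ ht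
  have e : u n t - u n t₀ - (t - t₀) • G t₀ = u n t - t • G t₀ - (u n t₀ - t₀ • G t₀) := by
    rw [sub_smul]; abel
  rw [e]
  refine this.trans (mul_le_mul_of_nonneg_right ?_ (norm_nonneg _))
  linarith

section

variable {s : ℝ} (hs : 2 < s) {μ ν : ℝ} (hμν : (0 < μ ∧ ν = 0) ∨ (μ = 0 ∧ 0 < ν))
include hs

omit hs in
theorem en_mono {w : ℝ → ℝ} {f g f' g' : Plane → ℂ} (hf : N2 (fun x => x * w x) f' < ⊤)
    (hg : N2 w g' < ⊤) (h1 : N2 (fun x => x * w x) f ≤ N2 (fun x => x * w x) f')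
    (h2 : N2 w g ≤ N2 w g') : en w f g ≤ en w f' g' := by
  have e1 : nr (fun x => x * w x) f ≤ nr (fun x => x * w x) f' := ENNReal.toReal_mono hf.ne h1
  have e2 : nr w g ≤ nr w g' := ENNReal.toReal_mono hg.ne h2
  have := nr_nonneg (fun x => x * w x) f
  have := nr_nonneg w g
  have := kap_pos
  unfold en
  gcongr

omit hs in
theorem N2_tailW_lt {N : ℝ} (hN : 0 < N) {f g : L2} (h : sz s (hat f) (hat g) < ⊤) :
    N2 (fun x => x * tailW s N x) (hat f) < ⊤ ∧ N2 (tailW s N) (hat g) < ⊤ := by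
  obtain ⟨h1, h2⟩ := sz_lt_top.1 h
  refine ⟨(N2_mono (fun x hx => ?_) _).trans_lt h1, (N2_mono (fun x hx => ?_) _).trans_lt h2⟩
  · have hx0 : 0 < x := by linarith
    have h0 := tailW_nonneg s hN hx
    rw [abs_of_nonneg (by positivity), abs_of_nonneg (by positivity), ← mul_rpow_weight s x hx]
    exact mul_le_mul_of_nonneg_left (tailW_le s hx) hx0.le
  · rw [abs_of_nonneg (tailW_nonneg s hN hx), abs_of_nonneg (by positivity)]
    exact tailW_le s hx

include hμν in
/-- The Galerkin solutions have uniformly small high-frequency parts. -/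
theorem Galerkin.tight (T M : ℝ) {a₀ b₀ : L2} (h₀ : sz s (hat a₀) (hat b₀) < ⊤) :
    ∃ τ : ℕ → ℝ≥0∞, Filter.Tendsto τ Filter.atTop (𝓝 0) ∧ ∀ (n : ℝ) (α β : ℝ → L2),
    Galerkin s μ ν T M n a₀ b₀ α β → ∀ t ∈ Set.Icc 0 T, Tight s τ (α t) (β t) := by
  obtain ⟨C, hC, h⟩ := Galerkin.weighted_bound hs hμν T M
  -- The tail energy at time t is at most C times that of the untruncated data, with C independent
  -- of n and N; for fixed data it tends to zero by dominated convergence.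
  refine ⟨fun N => ENNReal.ofReal √(C * en (tailW s (N + 1)) (hat a₀) (hat b₀)), ?_, ?_⟩
  · obtain ⟨ha, hb⟩ := sz_lt_top.1 h₀
    have t1 : Filter.Tendsto (fun N : ℕ => nr (fun x => x * tailW s (N + 1) x) (hat a₀))
        Filter.atTop (𝓝 0) := by
      rw [← ENNReal.toReal_zero]
      refine (ENNReal.tendsto_toReal ENNReal.zero_ne_top).comp
        (tendsto_N2_weight (fun N => ?_) (fun N x hx => ?_) (fun x hx => ?_) ha)
      · have := measurable_tailW s (N + 1)
        fun_prop
      · have hx0 : 0 < x := by linarith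
        have h0 := tailW_nonneg s (N := N + 1) (by positivity) hx
        rw [abs_of_nonneg (by positivity), abs_of_nonneg (by positivity), ← mul_rpow_weight s x hx]
        exact mul_le_mul_of_nonneg_left (tailW_le s hx) hx0.le
      · simpa using (tendsto_tailW s x).const_mul x
    have t2 : Filter.Tendsto (fun N : ℕ => nr (tailW s (N + 1)) (hat b₀)) Filter.atTop (𝓝 0) := by
      rw [← ENNReal.toReal_zero]
      refine (ENNReal.tendsto_toReal ENNReal.zero_ne_top).comp
        (tendsto_N2_weight (fun N => measurable_tailW s _) (fun N x hx => ?_)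
          (fun x hx => tendsto_tailW s x) hb)
      rw [abs_of_nonneg (tailW_nonneg s (by positivity) hx), abs_of_nonneg (by positivity)]
      exact tailW_le s hx
    have t3 : Filter.Tendsto (fun N : ℕ => C * en (tailW s (N + 1)) (hat a₀) (hat b₀))
        Filter.atTop (𝓝 0) := by
      have := (((t1.pow 2).const_mul kap).add (t2.pow 2)).const_mul C
      simpa [en] using this
    have := ENNReal.tendsto_ofReal ((Real.continuous_sqrt.tendsto _).comp t3)
    simpa using this
  · intro n α β hG t ht N
    have hN : (0 : ℝ) < N + 1 := by positivity
    have hb := h n a₀ b₀ α β hG _ (isWt_tailW (by linarith : 0 ≤ s) hN) t ht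
    obtain ⟨f1, f2⟩ := N2_tailW_lt hN h₀
    have hb' : en (tailW s (N + 1)) (hat (α t)) (hat (β t)) ≤
        C * en (tailW s (N + 1)) (hat a₀) (hat b₀) :=
      hb.trans (mul_le_mul_of_nonneg_left (en_mono f1 f2 (N2_trunc_le _ _ _) (N2_trunc_le _ _ _)) hC)
    obtain ⟨g1, g2⟩ := N2_tailW_lt hN (hG.sz_lt ht)
    constructor
    · rw [← ENNReal.ofReal_toReal g1.ne]
      exact ENNReal.ofReal_le_ofReal (Real.le_sqrt_of_sq_le ((nr_le_sqrt_en_left _ _ _).trans hb'))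
    · rw [← ENNReal.ofReal_toReal g2.ne]
      exact ENNReal.ofReal_le_ofReal (Real.le_sqrt_of_sq_le ((nr_le_sqrt_en_right _ _ _).trans hb'))

end

/-! ### Convergence of the Galerkin scheme and the limit equation. -/

theorem enorm_le_N2 {k : ℝ} (hk : 0 ≤ k) (f : L2) : ‖f‖ₑ ≤ N2 (fun x => x ^ k) (hat f) := by
  rw [← eLpNorm_hat]
  exact eLpNorm_le_N2 hk _

theorem N2_hat_zero (w : ℝ → ℝ) : N2 w (hat 0) = 0 := by
  have h : hat 0 =ᵐ[volume] 0 := by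
    rw [hat, map_zero]
    exact Lp.coeFn_zero ..
  rw [N2_congr h, N2]
  have : wt w 0 = 0 := by funext ξ; simp [wt]
  rw [this, eLpNorm_zero]

theorem one_le_natCast_add_one (n : ℕ) : (1 : ℝ) ≤ n + 1 := by
  linarith [(Nat.cast_nonneg n : (0 : ℝ) ≤ n)]

section

variable {s : ℝ} (hs : 2 < s)
include hs

theorem tendsto_rate : Filter.Tendsto (fun n : ℕ => rate s (n + 1)) Filter.atTop (𝓝 0) :=
  (tendsto_rpow_neg_atTop (by linarith : 0 < s - 2)).comp
    (Filter.tendsto_atTop_add_const_right _ _ tendsto_natCast_atTop_atTop)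

theorem tendsto_field (μ ν : ℝ) {ι : Type*} {l : Filter ι} {a b a' b' : ι → L2} {M : ℝ≥0}
    (h : ∀ᶠ i in l, sz s (hat (a i)) (hat (b i)) ≤ M)
    (h' : ∀ᶠ i in l, sz s (hat (a' i)) (hat (b' i)) ≤ M)
    (hd : Filter.Tendsto (fun i => sz s (hat (a i - a' i)) (hat (b i - b' i))) l (𝓝 0)) :
    Filter.Tendsto (fun i => ‖fieldA μ (a i) (b i) - fieldA μ (a' i) (b' i)‖ₑ) l (𝓝 0) ∧
    Filter.Tendsto (fun i => ‖fieldB ν (a i) (b i) - fieldB ν (a' i) (b' i)‖ₑ) l (𝓝 0) := by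
  obtain ⟨C, hC⟩ := field_lipschitz hs μ ν
  have h0 : Filter.Tendsto (fun i => ((C * (1 + M + M) : ℝ≥0) : ℝ≥0∞) *
      sz s (hat (a i - a' i)) (hat (b i - b' i))) l (𝓝 0) := by
    simpa using ENNReal.Tendsto.const_mul hd (Or.inr (ENNReal.coe_ne_top (r := C * (1 + M + M))))
  have key : ∀ᶠ i in l, ((C : ℝ≥0∞) * (1 + sz s (hat (a i)) (hat (b i)) +
      sz s (hat (a' i)) (hat (b' i)))) * sz s (hat (a i - a' i)) (hat (b i - b' i)) ≤
      ((C * (1 + M + M) : ℝ≥0) : ℝ≥0∞) * sz s (hat (a i - a' i)) (hat (b i - b' i)) := by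
    filter_upwards [h, h'] with i h1 h2
    push_cast
    gcongr
  constructor
  · refine tendsto_of_tendsto_of_tendsto_of_le_of_le' tendsto_const_nhds h0
      (Filter.Eventually.of_forall fun _ => zero_le) ?_
    filter_upwards [h, h', key] with i h1 h2 h3
    exact (hC _ _ _ _ (h1.trans_lt ENNReal.coe_lt_top) (h2.trans_lt ENNReal.coe_lt_top)).1.trans h3
  · refine tendsto_of_tendsto_of_tendsto_of_le_of_le' tendsto_const_nhds h0
      (Filter.Eventually.of_forall fun _ => zero_le) ?_
    filter_upwards [h, h', key] with i h1 h2 h3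
    exact (hC _ _ _ _ (h1.trans_lt ENNReal.coe_lt_top) (h2.trans_lt ENNReal.coe_lt_top)).2.trans h3

theorem N2_trunc_sub_trunc_le {A B : ℝ≥0} {a₀ b₀ : L2} (ha : sobolevNorm (s + 1) a₀ ≤ A)
    (hb : sobolevNorm s b₀ ≤ B) {n m : ℝ} (hn : 1 ≤ n) (hnm : n ≤ m) :
    N2 (fun x => x ^ (1 : ℝ)) (hat (trunc n a₀ - trunc m a₀)) ≤
      ENNReal.ofReal (rate s n * (2 * A : ℝ≥0)) ∧
    N2 (fun x => x ^ (0 : ℝ)) (hat (trunc n b₀ - trunc m b₀)) ≤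
      ENNReal.ofReal (rate s n * (2 * B : ℝ≥0)) := by
  obtain ⟨h1, h2⟩ := N2_init_le hs ha hb hn
  obtain ⟨h3, h4⟩ := N2_init_le hs ha hb (hn.trans hnm)
  have hr := rate_antitone hs hn hnm
  have hr0 := rate_nonneg s hn
  have key : ∀ {k : ℝ} {c : L2} {D : ℝ≥0},
      N2 (fun x => x ^ k) (hat (trunc n c - c)) ≤ ENNReal.ofReal (rate s n * D) →
      N2 (fun x => x ^ k) (hat (trunc m c - c)) ≤ ENNReal.ofReal (rate s m * D) →
      N2 (fun x => x ^ k) (hat (trunc n c - trunc m c)) ≤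
        ENNReal.ofReal (rate s n * (2 * D : ℝ≥0)) := fun {k c D} e1 e2 => by
    rw [← sub_sub_sub_cancel_right (trunc n c) (trunc m c) c, N2_congr (hat_sub _ _)]
    refine (N2_sub_le (measurable_rpow_const _) (aesm_hat _) (aesm_hat _)).trans ?_
    refine (add_le_add e1 (e2.trans (ENNReal.ofReal_le_ofReal
      (mul_le_mul_of_nonneg_right hr D.2)))).trans (le_of_eq ?_)
    rw [← ENNReal.ofReal_add (by positivity) (by positivity)]
    congr 1
    push_cast
    ring
  exact ⟨key h1 h3, key h2 h4⟩

variable {μ ν : ℝ} (hμν : (0 < μ ∧ ν = 0) ∨ (μ = 0 ∧ 0 < ν))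
include hμν

/-- The Galerkin solutions converge uniformly in `L²`. -/
theorem exists_galerkin_limit {T M : ℝ} {A B : ℝ≥0} {a₀ b₀ : L2}
    (ha : sobolevNorm (s + 1) a₀ ≤ A) (hb : sobolevNorm s b₀ ≤ B) {α β : ℕ → ℝ → L2}
    (hG : ∀ n : ℕ, Galerkin s μ ν T M (n + 1) a₀ b₀ (α n) (β n)) :
    ∃ (a b : ℝ → L2) (C : ℝ), ∀ n : ℕ, ∀ t ∈ Set.Icc 0 T,
      ‖α n t - a t‖ ≤ C * rate s (n + 1) ∧ ‖β n t - b t‖ ≤ C * rate s (n + 1) := by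
  obtain ⟨M', C₁, hC₁, h₁⟩ := Galerkin.approxSol hs μ ν M
  obtain ⟨C, hC, h⟩ := galerkin_close hs hμν T M' (2 * A) (2 * B) C₁
  -- The coarser solution α n plays the smooth one, and α m is merely an approximate solution; its
  -- smaller residual is weakened to the rate of n.
  have cl : ∀ t ∈ Set.Icc 0 T, ∀ n m : ℕ, n ≤ m → ‖α n t - α m t‖ ≤ C * rate s (n + 1) ∧
      ‖β n t - β m t‖ ≤ C * rate s (n + 1) := by
    intro t ht n m hnm
    have hn := one_le_natCast_add_one n
    have hnm' : (n : ℝ) + 1 ≤ m + 1 := by exact_mod_cast Nat.succ_le_succ hnm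
    have hr := rate_nonneg s hn
    obtain ⟨i1, i2⟩ := N2_trunc_sub_trunc_le hs ha hb hn hnm'
    refine h (n + 1) M (C₁ * rate s (n + 1)) a₀ b₀ _ _ _ _ hn (by positivity) le_rfl (hG n)
      (h₁ _ _ _ _ _ _ hn (hG n)) ((h₁ _ _ _ _ _ _ (hn.trans hnm') (hG m)).mono le_rfl
        (mul_le_mul_of_nonneg_left (rate_antitone hs hn hnm') hC₁)) ?_ ?_ t ht
    · rwa [(hG n).init.1, (hG m).init.1]
    · rwa [(hG n).init.2, (hG m).init.2]
  have hr0 : Filter.Tendsto (fun n : ℕ => C * rate s (n + 1)) Filter.atTop (𝓝 0) := by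
    simpa using (tendsto_rate hs).const_mul C
  have ex : ∀ t, ∃ p : L2 × L2, t ∈ Set.Icc 0 T →
      Filter.Tendsto (fun n => α n t) Filter.atTop (𝓝 p.1) ∧
      Filter.Tendsto (fun n => β n t) Filter.atTop (𝓝 p.2) := by
    intro t
    by_cases ht : t ∈ Set.Icc 0 T
    · obtain ⟨x, hx⟩ := cauchySeq_tendsto_of_complete (cauchySeq_of_le_tendsto_0' (s := fun n => α n t)
        _ (fun n m hnm => by rw [dist_eq_norm]; exact (cl t ht n m hnm).1) hr0)
      obtain ⟨y, hy⟩ := cauchySeq_tendsto_of_complete (cauchySeq_of_le_tendsto_0' (s := fun n => β n t)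
        _ (fun n m hnm => by rw [dist_eq_norm]; exact (cl t ht n m hnm).2) hr0)
      exact ⟨(x, y), fun _ => ⟨hx, hy⟩⟩
    · exact ⟨0, fun h => absurd h ht⟩
  choose p hp using ex
  refine ⟨fun t => (p t).1, fun t => (p t).2, C, fun n t ht => ⟨?_, ?_⟩⟩
  · refine le_of_tendsto ((hp t ht).1.const_sub _).norm ?_
    filter_upwards [Filter.eventually_ge_atTop n] with m hm
    exact (cl t ht n m hm).1
  · refine le_of_tendsto ((hp t ht).2.const_sub _).norm ?_
    filter_upwards [Filter.eventually_ge_atTop n] with m hm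
    exact (cl t ht n m hm).2

omit hμν in
theorem tendsto_of_norm_sub_le_rate {C : ℝ} {u : ℕ → L2} {a : L2}
    (h : ∀ n : ℕ, ‖u n - a‖ ≤ C * rate s (n + 1)) : Filter.Tendsto u Filter.atTop (𝓝 a) := by
  rw [tendsto_iff_norm_sub_tendsto_zero]
  exact squeeze_zero (fun _ => norm_nonneg _) h (by simpa using (tendsto_rate hs).const_mul C)

omit hμν in
theorem tendsto_uniform_of_norm_sub_le_rate {C : ℝ} {S : Set ℝ} {u : ℕ → ℝ → L2} {a : ℝ → L2}
    (h : ∀ n : ℕ, ∀ t ∈ S, ‖u n t - a t‖ ≤ C * rate s (n + 1)) :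
    Filter.Tendsto (fun p : ℕ × ℝ => u p.1 p.2 - a p.2) (Filter.atTop ×ˢ Filter.principal S)
      (𝓝 0) := by
  rw [tendsto_zero_iff_norm_tendsto_zero]
  have h0 : Filter.Tendsto (fun p : ℕ × ℝ => C * rate s (p.1 + 1))
      (Filter.atTop ×ˢ Filter.principal S) (𝓝 0) := by
    have := ((tendsto_rate hs).const_mul C).comp
      (Filter.tendsto_fst (f := Filter.atTop) (g := Filter.principal S))
    simpa [Function.comp_def] using this
  refine tendsto_of_tendsto_of_tendsto_of_le_of_le' tendsto_const_nhds h0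
    (Filter.Eventually.of_forall fun _ => norm_nonneg _) ?_
  rw [Filter.eventually_prod_principal_iff]
  exact Filter.Eventually.of_forall fun n t ht => h n t ht

omit hμν in
theorem continuousOn_of_norm_sub_le_rate {C : ℝ} {S : Set ℝ} {u : ℕ → ℝ → L2} {a : ℝ → L2}
    (h : ∀ n : ℕ, ∀ t ∈ S, ‖u n t - a t‖ ≤ C * rate s (n + 1)) (hu : ∀ n, ContinuousOn (u n) S) :
    ContinuousOn a S := by
  refine TendstoUniformlyOn.continuousOn (F := u) (p := Filter.atTop) ?_
    (Filter.Frequently.of_forall hu)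
  rw [Metric.tendstoUniformlyOn_iff]
  intro ε hε
  have := (tendsto_rate hs).const_mul C
  rw [mul_zero] at this
  filter_upwards [this.eventually_lt_const hε] with n hn t ht
  rw [dist_comm, dist_eq_norm]
  exact (h n t ht).trans_lt hn

omit hμν in
theorem eventually_norm_trunc_sub_le {C : ℝ} {S : Set ℝ} {F : ℕ → ℝ → L2} {G : ℝ → L2}
    (h : ∀ n : ℕ, ∀ t ∈ S,
      ‖trunc (n + 1) (F n t) - F n t‖ₑ ≤ ENNReal.ofReal (C * rate s (n + 1)))
    (hF : Filter.Tendsto (fun p : ℕ × ℝ => ‖F p.1 p.2 - G p.2‖ₑ)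
      (Filter.atTop ×ˢ Filter.principal S) (𝓝 0)) :
    ∀ ε > 0, ∀ᶠ n : ℕ in Filter.atTop, ∀ t ∈ S, ‖trunc (n + 1) (F n t) - G t‖ ≤ ε := by
  intro ε hε
  have h0 : Filter.Tendsto (fun n : ℕ => C * rate s (n + 1)) Filter.atTop (𝓝 0) := by
    simpa using (tendsto_rate hs).const_mul C
  have h3 := ENNReal.tendsto_nhds_zero.1 hF (ENNReal.ofReal (ε / 2))
    (ENNReal.ofReal_pos.2 (by positivity))
  rw [Filter.eventually_prod_principal_iff] at h3
  filter_upwards [h3, h0.eventually_le_const (half_pos hε)] with n h3 h4 t ht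
  have h5 := h3 t ht
  have h6 := (h n t ht).trans (ENNReal.ofReal_le_ofReal h4)
  rw [← ofReal_norm, ENNReal.ofReal_le_ofReal_iff (by positivity)] at h5 h6
  refine (norm_sub_le_norm_sub_add_norm_sub _ (F n t) _).trans ?_
  linarith

/-- The limit of the Galerkin solutions solves the system. -/
theorem galerkin_limit_spec {T M : ℝ} {A B : ℝ≥0} {a₀ b₀ : L2}
    (ha : sobolevNorm (s + 1) a₀ ≤ A) (hb : sobolevNorm s b₀ ≤ B) {α β : ℕ → ℝ → L2}
    (hG : ∀ n : ℕ, Galerkin s μ ν T M (n + 1) a₀ b₀ (α n) (β n)) {a b : ℝ → L2} {C : ℝ}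
    (hC : ∀ n : ℕ, ∀ t ∈ Set.Icc 0 T,
      ‖α n t - a t‖ ≤ C * rate s (n + 1) ∧ ‖β n t - b t‖ ≤ C * rate s (n + 1)) :
    ∃ M' : ℝ≥0, (∀ t ∈ Set.Icc 0 T, sz s (hat (a t)) (hat (b t)) ≤ M') ∧
    ∀ t₀ ∈ Set.Icc 0 T,
      Filter.Tendsto (fun t => sz s (hat (a t - a t₀)) (hat (b t - b t₀))) (𝓝[Set.Icc 0 T] t₀) (𝓝 0) ∧
      HasDerivWithinAt a (fieldA μ (a t₀) (b t₀)) (Set.Icc 0 T) t₀ ∧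
      HasDerivWithinAt b (fieldB ν (a t₀) (b t₀)) (Set.Icc 0 T) t₀ := by
  have hs0 : 0 ≤ s := by linarith
  obtain ⟨M₁, C₁, hC₁, h₁⟩ := Galerkin.approxSol hs μ ν M
  obtain ⟨τ, hτ, hT⟩ := Galerkin.tight hs hμν T M (sz_hat.2
    ⟨ha.trans_lt ENNReal.coe_lt_top, hb.trans_lt ENNReal.coe_lt_top⟩)
  obtain ⟨C₂, hC₂, h₂⟩ := galerkin_residual hs μ ν M₁
  have ta : ∀ t ∈ Set.Icc 0 T, Filter.Tendsto (fun n => α n t) Filter.atTop (𝓝 (a t)) :=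
    fun t ht => tendsto_of_norm_sub_le_rate hs fun n => (hC n t ht).1
  have tb : ∀ t ∈ Set.Icc 0 T, Filter.Tendsto (fun n => β n t) Filter.atTop (𝓝 (b t)) :=
    fun t ht => tendsto_of_norm_sub_le_rate hs fun n => (hC n t ht).2
  have bn : ∀ n, ∀ t ∈ Set.Icc 0 T, sz s (hat (α n t)) (hat (β n t)) ≤ M₁ := fun n =>
    (h₁ _ _ _ _ _ _ (one_le_natCast_add_one n) (hG n)).bound
  have bl : ∀ t ∈ Set.Icc 0 T, sz s (hat (a t)) (hat (b t)) ≤ (2 * M₁ : ℝ≥0) := fun t ht =>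
    sz_le_of_tendsto (fun n => bn n t ht) (ta t ht) (tb t ht)
  have tl : ∀ t ∈ Set.Icc 0 T, Tight s τ (a t) (b t) := fun t ht =>
    Tight.of_tendsto (fun n => hT _ _ _ (hG n) t ht) (ta t ht) (tb t ht)
  have ca : ContinuousOn a (Set.Icc 0 T) := continuousOn_of_norm_sub_le_rate hs
    (fun n t ht => (hC n t ht).1) fun n t ht => ((hG n).deriv_a t ht).continuousWithinAt
  have cb : ContinuousOn b (Set.Icc 0 T) := continuousOn_of_norm_sub_le_rate hs
    (fun n t ht => (hC n t ht).2) fun n t ht => ((hG n).deriv_b t ht).continuousWithinAt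
  have sc : ∀ t₀ ∈ Set.Icc 0 T, Filter.Tendsto (fun t => sz s (hat (a t - a t₀)) (hat (b t - b t₀)))
      (𝓝[Set.Icc 0 T] t₀) (𝓝 0) := fun t₀ ht₀ =>
    tendsto_sz hs0 hτ (by filter_upwards [self_mem_nhdsWithin] with t ht using tl t ht)
      (Filter.Eventually.of_forall fun _ => tl t₀ ht₀)
      (by simpa using (ca t₀ ht₀).tendsto.sub_const (a t₀))
      (by simpa using (cb t₀ ht₀).tendsto.sub_const (b t₀))
  -- Uniform convergence on [0, T] is expressed as convergence along the product with a principal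
  -- filter, so that `tendsto_sz` and `tendsto_field` apply unchanged.
  have un : Filter.Tendsto (fun p : ℕ × ℝ => sz s (hat (α p.1 p.2 - a p.2)) (hat (β p.1 p.2 - b p.2)))
      (Filter.atTop ×ˢ Filter.principal (Set.Icc 0 T)) (𝓝 0) := by
    refine tendsto_sz hs0 hτ ?_ ?_
      (tendsto_uniform_of_norm_sub_le_rate hs fun n t ht => (hC n t ht).1)
      (tendsto_uniform_of_norm_sub_le_rate hs fun n t ht => (hC n t ht).2)
    · rw [Filter.eventually_prod_principal_iff]
      exact Filter.Eventually.of_forall fun n t ht => hT _ _ _ (hG n) t ht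
    · rw [Filter.eventually_prod_principal_iff]
      exact Filter.Eventually.of_forall fun n t ht => tl t ht
  have hle : ((M₁ : ℝ≥0) : ℝ≥0∞) ≤ (2 * M₁ : ℝ≥0) := by
    exact_mod_cast le_mul_of_one_le_left M₁.2 one_le_two
  obtain ⟨fa, fb⟩ := tendsto_field hs μ ν (M := 2 * M₁) (l := Filter.atTop ×ˢ Filter.principal _)
    (a := fun p : ℕ × ℝ => α p.1 p.2) (b := fun p => β p.1 p.2) (a' := fun p => a p.2)
    (b' := fun p => b p.2)
    (by
      rw [Filter.eventually_prod_principal_iff]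
      exact Filter.Eventually.of_forall fun n t ht => (bn n t ht).trans hle)
    (by
      rw [Filter.eventually_prod_principal_iff]
      exact Filter.Eventually.of_forall fun n t ht => bl t ht) un
  have rs := fun (n : ℕ) t ht => h₂ (n + 1 : ℝ) (one_le_natCast_add_one n) _ _ ((hG n).tr t ht).1
    ((hG n).tr t ht).2 (bn n t ht)
  refine ⟨2 * M₁, bl, fun t₀ ht₀ => ⟨sc t₀ ht₀, ?_, ?_⟩⟩
  all_goals
    obtain ⟨ga, gb⟩ := tendsto_field hs μ ν (M := 2 * M₁) (l := 𝓝[Set.Icc 0 T] t₀)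
      (by filter_upwards [self_mem_nhdsWithin] with t ht using bl t ht)
      (Filter.Eventually.of_forall fun _ => bl t₀ ht₀) (sc t₀ ht₀)
  · refine hasDerivWithinAt_of_tendsto (convex_Icc 0 T) (fun n => (hG n).deriv_a)
      (G := fun t => fieldA μ (a t) (b t))
      (eventually_norm_trunc_sub_le hs (fun n t ht => (enorm_le_N2 zero_le_one _).trans (rs n t ht).1) fa) ta ht₀ ?_
    rw [ContinuousWithinAt, tendsto_iff_edist_tendsto_0]
    simpa only [edist_eq_enorm_sub] using ga
  · refine hasDerivWithinAt_of_tendsto (convex_Icc 0 T) (fun n => (hG n).deriv_b)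
      (G := fun t => fieldB ν (a t) (b t))
      (eventually_norm_trunc_sub_le hs (fun n t ht => (enorm_le_N2 le_rfl _).trans (rs n t ht).2) fb) tb ht₀ ?_
    rw [ContinuousWithinAt, tendsto_iff_edist_tendsto_0]
    simpa only [edist_eq_enorm_sub] using gb

/-! ### Uniqueness and conclusion. -/

-- An exact solution has residual zero; all that is used of it is the bound in H^{s+1} × H^s on a
-- compact subinterval, and no dissipation.
omit hμν in
theorem IsSolution.approxSol {T t : ℝ} {a₀ b₀ : L2} {a b : ℝ → L2}
    (h : IsSolution s μ ν T a₀ b₀ a b) (ht : t ∈ Set.Ico 0 T) :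
    ∃ M : ℝ≥0, ApproxSol s μ ν t M 0 a b := by
  obtain ⟨M, hM⟩ := h.locallyBounded t ht
  have hsub : Set.Icc 0 t ⊆ Set.Ico 0 T := fun r hr => ⟨hr.1, hr.2.trans_lt ht.2⟩
  refine ⟨2 * M, fun r hr => ?_, fun r hr => ?_, fun r hr => ?_⟩
  · obtain ⟨h1, h2⟩ := hM r hr
    rw [sobolevNorm_eq] at h1 h2
    rw [sz]
    push_cast
    rw [two_mul]
    exact add_le_add h1 h2
  · obtain ⟨A, hA, hp⟩ := h.eq_a r (hsub hr)
    rw [fieldA_spec hs μ (sz_hat.2 (h.memH r (hsub hr)))] at hp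
    refine ⟨A, hA.mono hsub, ?_⟩
    rw [hp, sub_self, N2_hat_zero]
    exact zero_le
  · obtain ⟨B, hB, hp⟩ := h.eq_b r (hsub hr)
    rw [fieldB_spec hs ν (sz_hat.2 (h.memH r (hsub hr)))] at hp
    refine ⟨B, hB.mono hsub, ?_⟩
    rw [hp, sub_self, N2_hat_zero]
    exact zero_le

/-- A Galerkin sequence converges to any solution with the same initial data. -/
theorem tendsto_galerkin_of_isSolution {T M : ℝ} {A B : ℝ≥0} {a₀ b₀ : L2}
    (ha : sobolevNorm (s + 1) a₀ ≤ A) (hb : sobolevNorm s b₀ ≤ B) {α β : ℕ → ℝ → L2}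
    (hG : ∀ n : ℕ, Galerkin s μ ν T M (n + 1) a₀ b₀ (α n) (β n)) {a b : ℝ → L2}
    (h : IsSolution s μ ν T a₀ b₀ a b) {t : ℝ} (ht : t ∈ Set.Ico 0 T) :
    Filter.Tendsto (fun n => α n t) Filter.atTop (𝓝 (a t)) ∧
    Filter.Tendsto (fun n => β n t) Filter.atTop (𝓝 (b t)) := by
  obtain ⟨M₁, C₁, hC₁, h₁⟩ := Galerkin.approxSol hs μ ν M
  obtain ⟨M₂, h₂⟩ := IsSolution.approxSol hs h ht
  obtain ⟨C, hC, hcl⟩ := galerkin_close hs hμν t (max M₁ M₂) A B C₁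
  have key : ∀ n : ℕ, ‖α n t - a t‖ ≤ C * rate s (n + 1) ∧ ‖β n t - b t‖ ≤ C * rate s (n + 1) := by
    intro n
    have hn := one_le_natCast_add_one n
    have hr := rate_nonneg s hn
    have hGt := (hG n).mono ht.2.le
    obtain ⟨i1, i2⟩ := N2_init_le hs ha hb hn
    refine hcl (n + 1) M (C₁ * rate s (n + 1)) a₀ b₀ _ _ _ _ hn (by positivity) le_rfl hGt
      ((h₁ _ _ _ _ _ _ hn hGt).mono (le_max_left _ _) le_rfl)
      (h₂.mono (le_max_right _ _) (by positivity)) ?_ ?_ t ⟨ht.1, le_rfl⟩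
    · rwa [(hG n).init.1, h.initial.1]
    · rwa [(hG n).init.2, h.initial.2]
  exact ⟨tendsto_of_norm_sub_le_rate hs fun n => (key n).1,
    tendsto_of_norm_sub_le_rate hs fun n => (key n).2⟩

theorem isSolution_of_galerkin {T M : ℝ} (hT : 0 < T) {A B : ℝ≥0} {a₀ b₀ : L2}
    (ha : sobolevNorm (s + 1) a₀ ≤ A) (hb : sobolevNorm s b₀ ≤ B) {α β : ℕ → ℝ → L2}
    (hG : ∀ n : ℕ, Galerkin s μ ν T M (n + 1) a₀ b₀ (α n) (β n)) : ∃ a b : ℝ → L2,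
    IsSolution s μ ν T a₀ b₀ a b ∧ ContinuousInH (s + 1) T a ∧ ContinuousInH s T b := by
  obtain ⟨a, b, C, hC⟩ := exists_galerkin_limit hs hμν ha hb hG
  obtain ⟨M', hM', h⟩ := galerkin_limit_spec hs hμν ha hb hG hC
  have hsub : Set.Ico 0 T ⊆ Set.Icc 0 T := Set.Ico_subset_Icc_self
  have h0 : (0 : ℝ) ∈ Set.Icc 0 T := ⟨le_rfl, hT.le⟩
  have hfin : ∀ t ∈ Set.Ico 0 T, sz s (hat (a t)) (hat (b t)) < ⊤ := fun t ht =>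
    (hM' t (hsub ht)).trans_lt ENNReal.coe_lt_top
  refine ⟨a, b, ⟨fun t ht => sz_hat.1 (hfin t ht), fun T' hT' => ⟨M', fun t ht => ?_⟩, ?_,
    fun t ht => ⟨_, (h t (hsub ht)).2.1.mono hsub, ?_⟩,
    fun t ht => ⟨_, (h t (hsub ht)).2.2.mono hsub, ?_⟩⟩, fun t₀ ht₀ => ?_, fun t₀ ht₀ => ?_⟩
  · have hb := hM' t ⟨ht.1, ht.2.trans hT'.2.le⟩
    rw [sobolevNorm_eq, sobolevNorm_eq]
    exact ⟨le_self_add.trans hb, le_add_self.trans hb⟩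
  -- At time 0 the Galerkin solutions are truncations of the data, which converge both to the limit
  -- and to the data themselves.
  · have key : ∀ {u : ℕ → L2} {x x₀ : L2} {D : ℝ≥0} {k : ℝ}, 0 ≤ k →
        (∀ n : ℕ, ‖u n - x‖ ≤ C * rate s (n + 1)) → (∀ n : ℕ, u n = trunc (n + 1) x₀) →
        (∀ n : ℕ, N2 (fun y => y ^ k) (hat (trunc (n + 1) x₀ - x₀)) ≤
          ENNReal.ofReal (rate s (n + 1) * D)) → x = x₀ := fun {u x x₀ D k} hk e1 e2 e3 => by
      refine tendsto_nhds_unique (tendsto_of_norm_sub_le_rate hs e1)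
        (tendsto_of_norm_sub_le_rate (C := D) hs fun n => ?_)
      have := rate_nonneg s (one_le_natCast_add_one n)
      have h1 := (enorm_le_N2 hk _).trans (e3 n)
      rw [← ofReal_norm, ENNReal.ofReal_le_ofReal_iff (by positivity)] at h1
      rw [e2, mul_comm]
      exact h1
    exact ⟨key zero_le_one (fun n => (hC n 0 h0).1) (fun n => (hG n).init.1)
        fun n => (N2_init_le hs ha hb (one_le_natCast_add_one n)).1,
      key le_rfl (fun n => (hC n 0 h0).2) (fun n => (hG n).init.2)
        fun n => (N2_init_le hs ha hb (one_le_natCast_add_one n)).2⟩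
  · exact (fieldA_spec hs μ (hfin t ht) _).2 rfl
  · exact (fieldB_spec hs ν (hfin t ht) _).2 rfl
  · simp only [sobolevNorm_eq]
    exact tendsto_of_tendsto_of_tendsto_of_le_of_le tendsto_const_nhds
      ((h t₀ (hsub ht₀)).1.mono_left (nhdsWithin_mono _ hsub)) (fun _ => zero_le)
      fun _ => le_self_add
  · simp only [sobolevNorm_eq]
    exact tendsto_of_tendsto_of_tendsto_of_le_of_le tendsto_const_nhds
      ((h t₀ (hsub ht₀)).1.mono_left (nhdsWithin_mono _ hsub)) (fun _ => zero_le)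
      fun _ => le_add_self

end

end EMHD
end

theorem theorem1p1 (s μ ν : ℝ) (hs : 2 < s)
    (hμν : (0 < μ ∧ ν = 0) ∨ (μ = 0 ∧ 0 < ν)) (A B : ℝ≥0) :
    ∃ T : ℝ, 0 < T ∧ ∀ a₀ b₀ : EMHD.L2,
      EMHD.sobolevNorm (s + 1) a₀ ≤ A → EMHD.sobolevNorm s b₀ ≤ B →
      ∃ a b : ℝ → EMHD.L2,
        EMHD.IsSolution s μ ν T a₀ b₀ a b ∧
        EMHD.ContinuousInH (s + 1) T a ∧ EMHD.ContinuousInH s T b ∧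
        ∀ a' b' : ℝ → EMHD.L2, EMHD.IsSolution s μ ν T a₀ b₀ a' b' →
          ∀ t ∈ Set.Ico 0 T, a' t = a t ∧ b' t = b t := by
  obtain ⟨T, hT, M, hG⟩ := EMHD.exists_galerkin hs hμν A B
  refine ⟨T, hT, fun a₀ b₀ ha hb => ?_⟩
  choose α β hαβ using fun n : ℕ => hG (n + 1) a₀ b₀ ha hb
  obtain ⟨a, b, h, ca, cb⟩ := EMHD.isSolution_of_galerkin hs hμν hT ha hb hαβ
  refine ⟨a, b, h, ca, cb, fun a' b' h' t ht => ?_⟩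
  -- Two solutions are never compared directly: each is the limit of the same Galerkin sequence.
  obtain ⟨l1, l2⟩ := EMHD.tendsto_galerkin_of_isSolution hs hμν ha hb hαβ h ht
  obtain ⟨l1', l2'⟩ := EMHD.tendsto_galerkin_of_isSolution hs hμν ha hb hαβ h' ht
  exact ⟨tendsto_nhds_unique l1' l1, tendsto_nhds_unique l2' l2⟩
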